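/- Let $N\ge 2$ and $0\le M\le N$ be integers and let $h$ be a formal parameter. Let $P$ be the permutation operator on $\mathbb C^N\otimes\mathbb C^N$ and $R(u)=1-hPu^{-1}$. Let $g(u)\in 1+u^{-1}\mathbb C[[u^{-1}]]$ be the unique series with $g(u+N)=g(u)(1-u^{-2})$, and $\overline R(u)=g(u/h)R(u)$. For $c\in\mathbb C$, let $\mathrm{DY}_c(\mathfrak{gl}_N)$ (the double Yangian at the level $c$) be the associative $\mathbb C[[h]]$-algebra without $h$-torsion generated by $t_{ij}^{(\pm r)}$, $1\le i,j\le N$, $r\ge 1$, subject to the relations $$R(u-v)T_1(u)T_2(v)=T_2(v)T_1(u)R(u-v),\qquad R(u-v)T_1^+(u)T_2^+(v)=T_2^+(v)T_1^+(u)R(u-v),$$ $$\overline R(u-v+hc/2)\,T_1(u)T_2^+(v)=T_2^+(v)T_1(u)\,\overline R(u-v-hc/2),$$ where $\overline R$ is expanded in negative powers of $u$, $T(u)=(t_{ij}(u))$, $T^+(u)=(t^+_{ij}(u))$, and $$t_{ij}(u)=\delta_{ij}+h\sum_{r\ge1}t_{ij}^{(r)}u^{-r},\qquad t^+_{ij}(u)=\delta_{ij}-h\sum_{r\ge1}t_{ij}^{(-r)}u^{r-1};$$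 the subscript $k$ in $T_k$, $T^+_k$ indicates the tensor factor of $(\operatorname{End}\mathbb C^N)^{\otimes n}$. (That there is no $h$-torsion means that powers of $h$ which divide a consequence of these relations are cancelled.) Let $\widehat{\mathrm{DY}}_c(\mathfrak{gl}_N)$ be its $h$-adic completion, let $I_p$ be the left ideal of $\mathrm{DY}_c(\mathfrak{gl}_N)$ generated by all $t_{ij}^{(r)}$ with $r\ge p$, and let $\widetilde{\mathrm{DY}}_c(\mathfrak{gl}_N)$ be the completion of $\mathrm{DY}_c(\mathfrak{gl}_N)$ in the topology in which the left ideals $I_p+h^m\mathrm{DY}_c(\mathfrak{gl}_N)$, $p,m\ge1$, form a basis of neighbourhoods of $0$. Let $G=\operatorname{diag}(\varepsilon_1,\dots,\varepsilon_N)=(g_{ij})$ with $\varepsilon_1=\dots=\varepsilon_M=1$ and $\varepsilon_{M+1}=\dots=\varepsilon_N=-1$. Put $$B^+(u)=T^+(u)\,G\,T^+(-u)^{-1},\qquad B(u)=T(u+hc)\,G\,T(-u)^{-1},$$ and write their entries as $b^+_{ij}(u)=g_{ij}-h\sum_{r\ge1}b_{ij}^{(-r)}u^{r-1}$ and $b_{ij}(u)=g_{ij}+h\sum_{r\ge1}b_{ij}^{(r)}u^{-r}$.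 Let $\mathrm A'_c(\mathfrak{gl}_N)$ be the subalgebra of $\widehat{\mathrm{DY}}_c(\mathfrak{gl}_N)$ generated by all $b_{ij}^{(\pm r)}$, let $\mathrm A_c(\mathfrak{gl}_N)=\{v\in\widehat{\mathrm{DY}}_c(\mathfrak{gl}_N): h^nv\in \mathrm A'_c(\mathfrak{gl}_N)\text{ for some }n\ge0\}$, and let $\widetilde{\mathrm A}_c(\mathfrak{gl}_N)$ be the completion of $\mathrm A_c(\mathfrak{gl}_N)$ in $\widetilde{\mathrm{DY}}_c(\mathfrak{gl}_N)$, i.e. the closure of its image there. For $n\ge 1$ let $H^{(n)}$ and $A^{(n)}$ be the images of $\frac1{n!}\sum_{s\in\mathfrak S_n}s$ and $\frac1{n!}\sum_{s\in\mathfrak S_n}\operatorname{sgn}(s)\,s$ under the action of $\mathfrak S_n$ on $(\mathbb C^N)^{\otimes n}$ by permutations of the tensor factors. For $w=(w_1,\dots,w_n)$ and a scalar $a$ write $w+a=(w_1+a,\dots,w_n+a)$ and $T_n(w|0)=T_1(w_1)\cdots T_n(w_n)$, $\overleftarrow T_n(w|0)=T_n(w_n)\cdots T_1(w_1)$, and similarly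 $T_n^+(w|0)$, $\overleftarrow T{}_n^+(w|0)$ with $T^+$ in place of $T$. Put $u_\pm=(u,u\pm h,\dots,u\pm(n-1)h)$; all shifted series in $T$ are expanded in powers of $u^{-1}$ and all shifted series in $T^+$ in powers of $u$. For $c=-N/2$ consider the series $$\widetilde{\mathbb B}_{\mu_n^{\mathrm{row}}}(u)=\operatorname{tr}_{1,\dots,n}H^{(n)}\,T_n^+(u_+|0)\,\overleftarrow T{}_n^+(-u_+|0)^{-1}\,\overleftarrow T_n(-u_++hN/4|0)\,T_n(u_+-3hN/4|0)^{-1},$$ $$\widetilde{\mathbb B}_{\mu_n^{\mathrm{col}}}(u)=\operatorname{tr}_{1,\dots,n}A^{(n)}\,T_n^+(u_-|0)\,\overleftarrow T{}_n^+(-u_-|0)^{-1}\,\overleftarrow T_n(-u_-+hN/4|0)\,T_n(u_--3hN/4|0)^{-1}.$$ Suppose that $G=I$ or $G=-I$. Then for every $n\ge1$ and every $k\in\mathbb Z$ the infinite sums which define the coefficients of $u^k$ in $\widetilde{\mathbb B}_{\mu_n^{\mathrm{row}}}(u)$ and $\widetilde{\mathbb B}_{\mu_n^{\mathrm{col}}}(u)$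 converge in $\widetilde{\mathrm{DY}}_{-N/2}(\mathfrak{gl}_N)$, and these coefficients belong to the center of the algebra $\widetilde{\mathrm A}_{-N/2}(\mathfrak{gl}_N)$. -/

import Mathlib

open scoped Pointwise

noncomputable section

namespace Reflection

/-- The ring of scalars `ℂ[[h]]`. -/
abbrev Scal : Type := PowerSeries ℂ

/-- The formal parameter `h`. -/
abbrev hh : Scal := PowerSeries.X

/-! ### Submodules up to powers of `h` -/

/-- `[V] = {v : h ^ n v ∈ V for some n ≥ 0}`. -/
def hSat {E : Type*} [AddCommGroup E] [Module Scal E] (V : Submodule Scal E) :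
    Submodule Scal E where
  carrier := {v | ∃ n : ℕ, hh ^ n • v ∈ V}
  add_mem' := by
    rintro a b ⟨n, hn⟩ ⟨m, hm⟩
    refine ⟨n + m, ?_⟩
    rw [smul_add]
    refine V.add_mem ?_ ?_
    · rw [add_comm, pow_add, mul_smul]; exact V.smul_mem _ hn
    · rw [pow_add, mul_smul]; exact V.smul_mem _ hm
  zero_mem' := ⟨0, by simp⟩
  smul_mem' := by
    rintro c x ⟨n, hn⟩
    exact ⟨n, by rw [smul_comm]; exact V.smul_mem _ hn⟩

/-- `[V] = {v : h ^ n v ∈ V for some n ≥ 0}` for a subalgebra `V`. -/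
def hSatAlg {E : Type*} [Ring E] [Algebra Scal E] (V : Subalgebra Scal E) :
    Subalgebra Scal E where
  carrier := {v | ∃ n : ℕ, hh ^ n • v ∈ V}
  add_mem' := fun ha hb => (hSat (Subalgebra.toSubmodule V)).add_mem ha hb
  mul_mem' := by
    rintro a b ⟨n, hn⟩ ⟨m, hm⟩
    refine ⟨n + m, ?_⟩
    have : hh ^ (n + m) • (a * b) = (hh ^ n • a) * (hh ^ m • b) := by
      rw [smul_mul_smul_comm, pow_add]
    rw [this]
    exact V.mul_mem hn hm
  algebraMap_mem' := fun r => ⟨0, by simp⟩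

/-! ### The normalizing series and `R`-matrices -/

/-- The coefficients of the series `g(u) = 1 + g₁ u⁻¹ + g₂ u⁻² + ⋯` which is determined by
`g(u + N) = g(u) (1 - u⁻²)`; see `gCoeff_spec`. -/
def gCoeff (N : ℕ) : ℕ → ℂ
  | 0 => 1
  | k + 1 =>
    (gCoeff N k + ∑ j : Fin (k + 1),
      ((Ring.choose (-((j : ℕ) : ℤ)) (k + 2 - j) : ℤ) : ℂ) * (N : ℂ) ^ (k + 2 - (j : ℕ)) * gCoeff N j)
      / ((k + 1) * N)

/-- The equation `g(u + N) = g(u) (1 - u⁻²)`, read off at the coefficients of `u⁻ᵐ`, where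
`(u + N)⁻ʲ` is expanded as `∑ i, choose (-j) i * N ^ i * u ^ (-j - i)`. -/
theorem gCoeff_spec (N : ℕ) (hN : N ≠ 0) (m : ℕ) :
    ∑ j ∈ Finset.range (m + 1),
      ((Ring.choose (-(j : ℤ)) (m - j) : ℤ) : ℂ) * (N : ℂ) ^ (m - j) * gCoeff N j
      = gCoeff N m - (if 2 ≤ m then gCoeff N (m - 2) else 0) := by
  have hN' : (N : ℂ) ≠ 0 := by exact_mod_cast hN
  match m with
  | 0 => simp [gCoeff]
  | 1 =>
    rw [Finset.sum_range_succ, Finset.sum_range_succ]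
    simp
  | k + 2 =>
    have hk : ((k : ℂ) + 1) ≠ 0 := by exact_mod_cast Nat.succ_ne_zero k
    rw [Finset.sum_range_succ, Finset.sum_range_succ]
    have e1 : k + 2 - (k + 1) = 1 := by omega
    rw [e1, Nat.sub_self, Ring.choose_one_right, Ring.choose_zero_right]
    have h2 : gCoeff N (k + 1) * (((k : ℂ) + 1) * N) = gCoeff N k + ∑ j ∈ Finset.range (k + 1),
      ((Ring.choose (-(j : ℤ)) (k + 2 - j) : ℤ) : ℂ) * (N : ℂ) ^ (k + 2 - j) * gCoeff N j := by
      rw [Finset.sum_range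
        (fun j => ((Ring.choose (-(j : ℤ)) (k + 2 - j) : ℤ) : ℂ) * (N : ℂ) ^ (k + 2 - j) * gCoeff N j)]
      rw [gCoeff]
      field_simp
    have h3 : ∑ j ∈ Finset.range (k + 1),
      ((Ring.choose (-(j : ℤ)) (k + 2 - j) : ℤ) : ℂ) * (N : ℂ) ^ (k + 2 - j) * gCoeff N j
      = gCoeff N (k + 1) * (((k : ℂ) + 1) * N) - gCoeff N k := by rw [h2]; ring
    rw [h3]
    simp
    ring

/-- The sequence shifted by one place, with `0` in front. -/
def prev {α : Type*} [Zero α] (f : ℕ → α) : ℕ → α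
  | 0 => 0
  | k + 1 => f k

section Tensor

variable {N n : ℕ} {A : Type*} [Ring A]

/-- The action of a permutation of the tensor factors on `(ℂ^N)^{⊗ n}`; the basis of the latter is
indexed by `Fin n → Fin N`, and `σ` moves the factor in place `i` to place `σ i`. -/
def permMat (σ : Equiv.Perm (Fin n)) : Matrix (Fin n → Fin N) (Fin n → Fin N) A :=
  Matrix.of fun a b => if a = b ∘ σ.symm then 1 else 0

/-- The copy `X_k` in `(End ℂ^N)^{⊗ n} ⊗ A` of `X ∈ End ℂ^N ⊗ A`, acting on the factor `k`. -/
def leg (k : Fin n) :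
    Matrix (Fin N) (Fin N) A →+* Matrix (Fin n → Fin N) (Fin n → Fin N) A where
  toFun X := Matrix.of fun a b => if ∀ l, l ≠ k → a l = b l then X (a k) (b k) else 0
  map_one' := by
    ext a b
    simp only [Matrix.of_apply, Matrix.one_apply]
    by_cases h : a = b
    · subst h; simp
    · rw [if_neg h]
      split_ifs with h1 h2
      · exact absurd (funext fun l => by
          by_cases hl : l = k
          · rw [hl]; exact h2
          · exact h1 l hl) h
      · rfl
      · rfl
  map_zero' := by
    ext a b
    simp
  map_add' X Y := by
    ext a b
    simp only [Matrix.of_apply, Matrix.add_apply]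
    split_ifs <;> simp
  map_mul' X Y := by
    classical
    ext a b
    simp only [Matrix.of_apply, Matrix.mul_apply]
    have key : ∀ c : Fin n → Fin N,
        ((if ∀ l, l ≠ k → a l = c l then X (a k) (c k) else 0) *
          (if ∀ l, l ≠ k → c l = b l then Y (c k) (b k) else 0)) =
        ∑ x : Fin N, if c = Function.update a k x then
          (if ∀ l, l ≠ k → a l = b l then X (a k) x * Y x (b k) else 0) else 0 := by
      intro c
      by_cases h : ∀ l, l ≠ k → a l = c l
      · have hc : c = Function.update a k (c k) := by
          funext l
          by_cases hl : l = k
          · subst hl; simp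
          · rw [Function.update_of_ne hl]; exact (h l hl).symm
        rw [Finset.sum_eq_single (c k)]
        · rw [if_pos h, if_pos hc]
          have : (∀ l, l ≠ k → c l = b l) ↔ (∀ l, l ≠ k → a l = b l) :=
            forall₂_congr fun l hl => by rw [h l hl]
          simp only [this]
          split_ifs <;> simp
        · intro x _ hx
          rw [if_neg]
          intro h'
          exact hx (by rw [h']; simp)
        · simp
      · rw [if_neg h, zero_mul]
        symm
        apply Finset.sum_eq_zero
        intro x _
        rw [if_neg]
        rintro rfl
        exact h fun l hl => (Function.update_of_ne hl _ _).symm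
    rw [Finset.sum_congr rfl fun c _ => key c, Finset.sum_comm]
    simp only [Finset.sum_ite_eq', Finset.mem_univ, if_true]
    split_ifs <;> simp

end Tensor

/-- The coefficient of `u^{-p} v^q` in `R̄(u - v + γ h)`, expanded in negative powers of `u`, where
`R̄(x) = g(x / h) (1 - h P x⁻¹) = ∑ k, (g_k - g_{k-1} P) h^k x^{-k}` and
`(u - v + γ h)^{-k} = ∑ p, choose (-k) (p - k) (γ h - v)^{p - k} u^{-p}`. -/
def rbarCoeff (N : ℕ) (A : Type*) [Ring A] [Algebra Scal A] (γ : ℂ) (p q : ℕ) :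
    Matrix (Fin 2 → Fin N) (Fin 2 → Fin N) A :=
  ∑ k ∈ Finset.range (p + 1),
    (hh ^ k * ((Ring.choose (-(k : ℤ)) (p - k) : ℤ) : Scal) *
      ((-1) ^ q * ((p - k).choose q : Scal) * (PowerSeries.C γ * hh) ^ (p - k - q))) •
    (PowerSeries.C (gCoeff N k) • (1 : Matrix (Fin 2 → Fin N) (Fin 2 → Fin N) A)
      - PowerSeries.C (prev (gCoeff N) k) • permMat (Equiv.swap 0 1))

/-! ### The double Yangian at the level `c` -/

/-- Generators: `pos i j r` is `t_ij^{(r+1)}` and `neg i j r` is `t_ij^{(-r-1)}`, for `r ≥ 0`. -/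
inductive Gen (N : ℕ) : Type
  | pos (i j : Fin N) (r : ℕ)
  | neg (i j : Fin N) (r : ℕ)

/-- The coefficient of `u^{-r}` in `T(u)`, for given images `x` of the generators. -/
def tOf {N : ℕ} {A : Type*} [Ring A] [Algebra Scal A] (x : Gen N → A) :
    ℕ → Matrix (Fin N) (Fin N) A
  | 0 => 1
  | r + 1 => Matrix.of fun i j => hh • x (Gen.pos i j r)

/-- The coefficient of `u^r` in `T⁺(u)`, for given images `x` of the generators. -/
def tpOf {N : ℕ} {A : Type*} [Ring A] [Algebra Scal A] (x : Gen N → A) (r : ℕ) :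
    Matrix (Fin N) (Fin N) A :=
  (if r = 0 then 1 else 0) - Matrix.of fun i j => hh • x (Gen.neg i j r)

section Relations

variable {N : ℕ} {A : Type} [Ring A] [Algebra Scal A] (x : Gen N → A)

/-- The coefficient of `u^{-r} v^{-s}` in `(u - v - h P) T₁(u) T₂(v)`. -/
def rttL (r s : ℕ) : Matrix (Fin 2 → Fin N) (Fin 2 → Fin N) A :=
  leg 0 (tOf x (r + 1)) * leg 1 (tOf x s) - leg 0 (tOf x r) * leg 1 (tOf x (s + 1))
    - hh • (permMat (Equiv.swap 0 1) * leg 0 (tOf x r) * leg 1 (tOf x s))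

/-- The coefficient of `u^{-r} v^{-s}` in `T₂(v) T₁(u) (u - v - h P)`. -/
def rttR (r s : ℕ) : Matrix (Fin 2 → Fin N) (Fin 2 → Fin N) A :=
  leg 1 (tOf x s) * leg 0 (tOf x (r + 1)) - leg 1 (tOf x (s + 1)) * leg 0 (tOf x r)
    - hh • (leg 1 (tOf x s) * leg 0 (tOf x r) * permMat (Equiv.swap 0 1))

/-- The coefficient of `u^r v^s` in `(u - v - h P) T₁⁺(u) T₂⁺(v)`. -/
def rttpL (r s : ℕ) : Matrix (Fin 2 → Fin N) (Fin 2 → Fin N) A :=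
  leg 0 (prev (tpOf x) r) * leg 1 (tpOf x s) - leg 0 (tpOf x r) * leg 1 (prev (tpOf x) s)
    - hh • (permMat (Equiv.swap 0 1) * leg 0 (tpOf x r) * leg 1 (tpOf x s))

/-- The coefficient of `u^r v^s` in `T₂⁺(v) T₁⁺(u) (u - v - h P)`. -/
def rttpR (r s : ℕ) : Matrix (Fin 2 → Fin N) (Fin 2 → Fin N) A :=
  leg 1 (tpOf x s) * leg 0 (prev (tpOf x) r) - leg 1 (prev (tpOf x) s) * leg 0 (tpOf x r)
    - hh • (leg 1 (tpOf x s) * leg 0 (tpOf x r) * permMat (Equiv.swap 0 1))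

/-- The coefficient of `u^{-r} v^s` in `R̄(u - v + γ h) T₁(u) T₂⁺(v)`. -/
def rttmL (γ : ℂ) (r s : ℕ) : Matrix (Fin 2 → Fin N) (Fin 2 → Fin N) A :=
  ∑ p ∈ Finset.range (r + 1), ∑ q ∈ Finset.range (s + 1),
    rbarCoeff N A γ p q * leg 0 (tOf x (r - p)) * leg 1 (tpOf x (s - q))

/-- The coefficient of `u^{-r} v^s` in `T₂⁺(v) T₁(u) R̄(u - v + γ h)`. -/
def rttmR (γ : ℂ) (r s : ℕ) : Matrix (Fin 2 → Fin N) (Fin 2 → Fin N) A :=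
  ∑ p ∈ Finset.range (r + 1), ∑ q ∈ Finset.range (s + 1),
    leg 1 (tpOf x (s - q)) * leg 0 (tOf x (r - p)) * rbarCoeff N A γ p q

/-- The defining relations of the double Yangian at the level `c`:
* `(u - v - h P) T₁(u) T₂(v) = T₂(v) T₁(u) (u - v - h P)`;
* `(u - v - h P) T₁⁺(u) T₂⁺(v) = T₂⁺(v) T₁⁺(u) (u - v - h P)`;
* `R̄(u - v + hc/2) T₁(u) T₂⁺(v) = T₂⁺(v) T₁(u) R̄(u - v - hc/2)`. -/
inductive Rel (c : ℂ) : A → A → Prop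
  | rtt (r s : ℕ) (a b : Fin 2 → Fin N) : Rel c (rttL x r s a b) (rttR x r s a b)
  | rttp (r s : ℕ) (a b : Fin 2 → Fin N) : Rel c (rttpL x r s a b) (rttpR x r s a b)
  | rttm (r s : ℕ) (a b : Fin 2 → Fin N) :
    Rel c (rttmL x (c / 2) r s a b) (rttmR x (-(c / 2)) r s a b)

end Relations

/-- The congruence on the free algebra which is generated by the defining relations. -/
def relCon (N : ℕ) (c : ℂ) : RingCon (FreeAlgebra Scal (Gen N)) :=
  ringConGen (Rel (FreeAlgebra.ι Scal) c)

/-- Equality up to `h`-torsion modulo the defining relations. -/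
def dyCon (N : ℕ) (c : ℂ) : RingCon (FreeAlgebra Scal (Gen N)) where
  r x y := ∃ n : ℕ, relCon N c (hh ^ n • x) (hh ^ n • y)
  iseqv :=
    { refl := fun _ => ⟨0, (relCon N c).refl _⟩
      symm := fun ⟨n, hn⟩ => ⟨n, (relCon N c).symm hn⟩
      trans := by
        rintro x y z ⟨n, hn⟩ ⟨m, hm⟩
        refine ⟨n + m, ?_⟩
        have h1 := (relCon N c).smul (hh ^ m) hn
        have h2 := (relCon N c).smul (hh ^ n) hm
        rw [← mul_smul, ← mul_smul, ← pow_add] at h1 h2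
        rw [add_comm m n] at h1
        exact (relCon N c).trans h1 h2 }
  add' := by
    rintro w x y z ⟨n, hn⟩ ⟨m, hm⟩
    refine ⟨n + m, ?_⟩
    have h1 := (relCon N c).smul (hh ^ m) hn
    have h2 := (relCon N c).smul (hh ^ n) hm
    rw [← mul_smul, ← mul_smul, ← pow_add] at h1 h2
    rw [add_comm m n] at h1
    rw [smul_add, smul_add]
    exact (relCon N c).add h1 h2
  mul' := by
    rintro w x y z ⟨n, hn⟩ ⟨m, hm⟩
    refine ⟨n + m, ?_⟩
    have h1 := (relCon N c).mul hn hm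
    rwa [smul_mul_smul_comm, smul_mul_smul_comm, ← pow_add] at h1

/-- The double Yangian `DY_c(gl_N)` at the level `c`. As the series `T(u) - 1` and `T⁺(u) - 1`
carry a factor `h`, the coefficients of the defining relations are multiples of powers of `h`, which
have to be cancelled; that is, the algebra is taken without `h`-torsion. -/
def DY (N : ℕ) (c : ℂ) : Type := (dyCon N c).Quotient

instance (N : ℕ) (c : ℂ) : Ring (DY N c) := inferInstanceAs (Ring (dyCon N c).Quotient)

instance (N : ℕ) (c : ℂ) : Algebra Scal (DY N c) :=
  inferInstanceAs (Algebra Scal (dyCon N c).Quotient)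

namespace DY

variable {N : ℕ} {c : ℂ}

/-- The quotient map from the free algebra. -/
def mk (N : ℕ) (c : ℂ) : FreeAlgebra Scal (Gen N) →ₐ[Scal] DY N c :=
  (dyCon N c).mkₐ Scal

/-- The generators `t_ij^{(±r)}` of `DY_c(gl_N)`. -/
def gen (N : ℕ) (c : ℂ) (x : Gen N) : DY N c :=
  mk N c (FreeAlgebra.ι Scal x)

/-- The left ideal `I_p` generated by all `t_ij^{(r)}` with `r ≥ p`. -/
def leftIdeal (N : ℕ) (c : ℂ) (p : ℕ) : Ideal (DY N c) :=
  Ideal.span {x | ∃ i j r, p ≤ r + 1 ∧ x = gen N c (Gen.pos i j r)}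

/-- `h ^ m DY_c(gl_N)`. -/
def hPow (N : ℕ) (c : ℂ) (m : ℕ) : Submodule Scal (DY N c) := hh ^ m • ⊤

/-- `[I_p] + h ^ m DY_c(gl_N)`. -/
def nbhd (N : ℕ) (c : ℂ) (p m : ℕ) : Submodule Scal (DY N c) :=
  hSat ((leftIdeal N c p).restrictScalars Scal) ⊔ hPow N c m

end DY

/-! ### The completions -/

namespace DY

variable {N : ℕ} {c : ℂ}

theorem mem_hPow {m : ℕ} {x : DY N c} : x ∈ hPow N c m ↔ ∃ y, hh ^ m • y = x := by
  rw [hPow, Submodule.mem_smul_pointwise_iff_exists]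
  simp

theorem mul_mem_hPow {m : ℕ} {x : DY N c} (a : DY N c) (h : x ∈ hPow N c m) :
    a * x ∈ hPow N c m := by
  rw [mem_hPow] at h ⊢
  obtain ⟨y, rfl⟩ := h
  exact ⟨a * y, by rw [mul_smul_comm]⟩

theorem hPow_mul_mem {m : ℕ} {x : DY N c} (a : DY N c) (h : x ∈ hPow N c m) :
    x * a ∈ hPow N c m := by
  rw [mem_hPow] at h ⊢
  obtain ⟨y, rfl⟩ := h
  exact ⟨y * a, by rw [smul_mul_assoc]⟩

theorem hPow_anti {m m' : ℕ} (h : m ≤ m') : hPow N c m' ≤ hPow N c m := by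
  intro x hx
  rw [mem_hPow] at hx ⊢
  obtain ⟨y, rfl⟩ := hx
  exact ⟨hh ^ (m' - m) • y, by rw [← mul_smul, ← pow_add, Nat.add_sub_cancel' h]⟩

theorem mul_mem_nbhd {p m : ℕ} {x : DY N c} (a : DY N c) (h : x ∈ nbhd N c p m) :
    a * x ∈ nbhd N c p m := by
  rw [nbhd, Submodule.mem_sup] at h ⊢
  obtain ⟨y, ⟨n, hn⟩, z, hz, rfl⟩ := h
  refine ⟨a * y, ⟨n, ?_⟩, a * z, mul_mem_hPow a hz, (mul_add _ _ _).symm⟩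
  rw [← mul_smul_comm]
  exact (leftIdeal N c p).mul_mem_left a hn

theorem nbhd_anti {p p' m m' : ℕ} (h : p ≤ p') (h' : m ≤ m') : nbhd N c p' m' ≤ nbhd N c p m := by
  refine sup_le_sup ?_ (hPow_anti h')
  rintro x ⟨n, hn⟩
  have : leftIdeal N c p' ≤ leftIdeal N c p := by
    apply Ideal.span_mono
    rintro x ⟨i, j, r, hr, rfl⟩
    exact ⟨i, j, r, h.trans hr, rfl⟩
  exact ⟨n, this hn⟩

/-- The basic neighbourhoods of `0` for the topology of the completed double Yangian: those `y` with
`y x ∈ [I_p] + h ^ m DY_c` for all `x` from a finite set `X`. -/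
def openIdeal (N : ℕ) (c : ℂ) (i : Finset (DY N c) × ℕ × ℕ) : Submodule Scal (DY N c) where
  carrier := {y | ∀ x ∈ i.1, y * x ∈ nbhd N c i.2.1 i.2.2}
  add_mem' := fun ha hb x hx => by
    rw [add_mul]
    exact Submodule.add_mem _ (ha x hx) (hb x hx)
  zero_mem' := fun x _ => by
    rw [zero_mul]
    exact Submodule.zero_mem _
  smul_mem' := fun s y hy x hx => by
    rw [smul_mul_assoc]
    exact Submodule.smul_mem _ s (hy x hx)

theorem hBasis (N : ℕ) (c : ℂ) :
    RingSubgroupsBasis fun m : ℕ => (hPow N c m).toAddSubgroup where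
  inter i j := ⟨max i j, le_inf (hPow_anti (le_max_left _ _)) (hPow_anti (le_max_right _ _))⟩
  mul i := ⟨i, by
    rintro _ ⟨x, _, y, hy, rfl⟩
    exact mul_mem_hPow x hy⟩
  leftMul x i := ⟨i, fun _ hy => mul_mem_hPow x hy⟩
  rightMul x i := ⟨i, fun _ hy => hPow_mul_mem x hy⟩

open Classical in
theorem iBasis (N : ℕ) (c : ℂ) :
    RingSubgroupsBasis fun i : Finset (DY N c) × ℕ × ℕ => (openIdeal N c i).toAddSubgroup where
  inter i j := ⟨(i.1 ∪ j.1, max i.2.1 j.2.1, max i.2.2 j.2.2), fun _ hy =>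
    ⟨fun x hx => nbhd_anti (le_max_left _ _) (le_max_left _ _)
      (hy x (Finset.mem_union_left _ hx)),
     fun x hx => nbhd_anti (le_max_right _ _) (le_max_right _ _)
      (hy x (Finset.mem_union_right _ hx))⟩⟩
  mul i := ⟨i, by
    rintro _ ⟨x, _, y, hy, rfl⟩
    intro z hz
    change x * y * z ∈ _
    rw [mul_assoc]
    exact mul_mem_nbhd x (hy z hz)⟩
  leftMul x i := ⟨i, fun y hy z hz => by
    rw [mul_assoc]
    exact mul_mem_nbhd x (hy z hz)⟩
  rightMul x i := ⟨(i.1.image (x * ·), i.2), fun y hy z hz => by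
    rw [mul_assoc]
    exact hy _ (Finset.mem_image_of_mem _ hz)⟩

end DY

open UniformSpace (Completion)

/-- `DY_c(gl_N)` with its `h`-adic topology. -/
def HDY (N : ℕ) (c : ℂ) : Type := DY N c

/-- `DY_c(gl_N)` with the coarsest topology which makes it a topological ring, in which the left
ideals form a basis of neighbourhoods of `0` and all the left ideals `[I_p] + h ^ m DY_c(gl_N)` are
open. (By the Poincaré–Birkhoff–Witt theorem `[I_p] = I_p`, and for given `x, p, m` one has
`I_q x ⊆ I_p + h ^ m DY_c(gl_N)` for large `q`; so the left ideals `I_p + h ^ m DY_c(gl_N)` are in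
fact a basis of neighbourhoods of `0`.) -/
def IDY (N : ℕ) (c : ℂ) : Type := DY N c

section Instances

variable (N : ℕ) (c : ℂ)

instance : Ring (HDY N c) := inferInstanceAs (Ring (DY N c))

instance : Algebra Scal (HDY N c) := inferInstanceAs (Algebra Scal (DY N c))

instance : TopologicalSpace (HDY N c) := (DY.hBasis N c).topology

instance : IsTopologicalRing (HDY N c) :=
  (DY.hBasis N c).toRingFilterBasis.isTopologicalRing

instance : NonarchimedeanRing (HDY N c) := (DY.hBasis N c).nonarchimedean

instance : UniformSpace (HDY N c) := IsTopologicalAddGroup.rightUniformSpace (HDY N c)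

instance : IsUniformAddGroup (HDY N c) := isUniformAddGroup_of_addCommGroup

instance : UniformContinuousConstSMul Scal (HDY N c) := ⟨fun s => by
  have : (s • · : HDY N c → HDY N c) = fun x => algebraMap Scal (HDY N c) s * x :=
    funext fun x => Algebra.smul_def s x
  rw [this]
  exact uniformContinuous_addMonoidHom_of_continuous
    (f := AddMonoidHom.mulLeft (algebraMap Scal (HDY N c) s)) (continuous_const_mul _)⟩

instance : Ring (IDY N c) := inferInstanceAs (Ring (DY N c))

instance : Algebra Scal (IDY N c) := inferInstanceAs (Algebra Scal (DY N c))

instance : TopologicalSpace (IDY N c) := (DY.iBasis N c).topology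

instance : IsTopologicalRing (IDY N c) :=
  (DY.iBasis N c).toRingFilterBasis.isTopologicalRing

instance : NonarchimedeanRing (IDY N c) := (DY.iBasis N c).nonarchimedean

instance : UniformSpace (IDY N c) := IsTopologicalAddGroup.rightUniformSpace (IDY N c)

instance : IsUniformAddGroup (IDY N c) := isUniformAddGroup_of_addCommGroup

instance : UniformContinuousConstSMul Scal (IDY N c) := ⟨fun s => by
  have : (s • · : IDY N c → IDY N c) = fun x => algebraMap Scal (IDY N c) s * x :=
    funext fun x => Algebra.smul_def s x
  rw [this]
  exact uniformContinuous_addMonoidHom_of_continuous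
    (f := AddMonoidHom.mulLeft (algebraMap Scal (IDY N c) s)) (continuous_const_mul _)⟩

end Instances

/-- The `h`-adic completion of `DY_c(gl_N)`. -/
abbrev HatDY (N : ℕ) (c : ℂ) : Type := Completion (HDY N c)

/-- The completed double Yangian: the completion of `DY_c(gl_N)` with respect to the left ideals
`[I_p] + h ^ m DY_c(gl_N)`. -/
abbrev TildeDY (N : ℕ) (c : ℂ) : Type := Completion (IDY N c)

/-- The canonical map from `DY_c(gl_N)` to its `h`-adic completion. -/
def toHat (N : ℕ) (c : ℂ) : DY N c →ₐ[Scal] HatDY N c :=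
  { (Completion.coeRingHom : HDY N c →+* HatDY N c) with commutes' := fun _ => rfl }

/-- The canonical map from `DY_c(gl_N)` to the completed double Yangian. -/
def toTilde (N : ℕ) (c : ℂ) : DY N c →ₐ[Scal] TildeDY N c :=
  { (Completion.coeRingHom : IDY N c →+* TildeDY N c) with commutes' := fun _ => rfl }

/-- The identity map from the `h`-adic topology to the coarser topology. -/
def coarsen (N : ℕ) (c : ℂ) : HDY N c →+* IDY N c := RingHom.id (DY N c)

theorem continuous_coarsen (N : ℕ) (c : ℂ) : Continuous (coarsen N c) := by
  apply continuous_of_continuousAt_zero (coarsen N c)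
  rw [ContinuousAt, map_zero]
  refine ((DY.hBasis N c).hasBasis_nhds_zero.tendsto_iff
    (DY.iBasis N c).hasBasis_nhds_zero).2 fun i _ => ⟨i.2.2, trivial, fun y hy x _ => ?_⟩
  exact (le_sup_right : DY.hPow N c i.2.2 ≤ _) (DY.hPow_mul_mem x hy)

/-- The canonical map from the `h`-adic completion to the completed double Yangian. -/
def hatToTilde (N : ℕ) (c : ℂ) : HatDY N c →ₐ[Scal] TildeDY N c :=
  { Completion.mapRingHom (coarsen N c) (continuous_coarsen N c) with
    commutes' := fun s => Completion.mapRingHom_coe (continuous_coarsen N c)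
      (algebraMap Scal (HDY N c) s) }

theorem hatToTilde_toHat (N : ℕ) (c : ℂ) (x : DY N c) :
    hatToTilde N c (toHat N c x) = toTilde N c x :=
  Completion.mapRingHom_coe (continuous_coarsen N c) x

/-! ### Generating series -/

/-- The diagonal matrix `G = diag(1, …, 1, -1, …, -1)` with `M` entries `1`. -/
def gMat (N M : ℕ) (A : Type*) [Ring A] : Matrix (Fin N) (Fin N) A :=
  Matrix.diagonal fun i => if (i : ℕ) < M then 1 else -1

section Series

variable (N : ℕ) (c : ℂ)

/-- The series `T(ε u + α h)`, for `ε = ±1`, as a power series in `u⁻¹`; here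
`(ε u + α h)^{-r} = ∑ a, ε ^ a choose (-r) (a - r) (α h)^{a - r} u^{-a}`. -/
def tSeries (ε : ℤ) (α : ℂ) : PowerSeries (Matrix (Fin N) (Fin N) (DY N c)) :=
  PowerSeries.mk fun a => (ε : Scal) ^ a • ∑ r ∈ Finset.range (a + 1),
    (((Ring.choose (-(r : ℤ)) (a - r) : ℤ) : Scal) * (PowerSeries.C α * hh) ^ (a - r)) •
      tOf (DY.gen N c) r

/-- The series `T⁺(ε u + α h)` as a power series in `u`; the coefficient of `u ^ a` is the
`h`-adically convergent sum of `ε ^ a choose (a + s) a (α h) ^ s T⁺_{a + s}`. -/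
def tpSeries (ε : ℤ) (α : ℂ) : PowerSeries (Matrix (Fin N) (Fin N) (HatDY N c)) :=
  PowerSeries.mk fun a => Matrix.of fun i j => ∑' s : ℕ,
    ((ε : Scal) ^ a * ((a + s).choose a : Scal) * (PowerSeries.C α * hh) ^ s) •
      toHat N c (tpOf (DY.gen N c) (a + s) i j)

/-- `B(u) = T(u + hc) G T(-u)⁻¹`, a power series in `u⁻¹`. -/
def bSeries (M : ℕ) : PowerSeries (Matrix (Fin N) (Fin N) (DY N c)) :=
  tSeries N c 1 c * PowerSeries.C (gMat N M _) * Ring.inverse (tSeries N c (-1) 0)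

/-- `B⁺(u) = T⁺(u) G T⁺(-u)⁻¹`, a power series in `u`. -/
def bpSeries (M : ℕ) : PowerSeries (Matrix (Fin N) (Fin N) (HatDY N c)) :=
  tpSeries N c 1 0 * PowerSeries.C (gMat N M _) * Ring.inverse (tpSeries N c (-1) 0)

/-- The subalgebra of the `h`-adically completed double Yangian which is generated by the elements
`b_ij^{(-r)}` and `b_ij^{(r)}`, `r ≥ 1`, where `b⁺_ij(u) = g_ij - h ∑ r, b_ij^{(-r)} u^{r-1}` and
`b_ij(u) = g_ij + h ∑ r, b_ij^{(r)} u^{-r}`. -/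
def aPrime (M : ℕ) : Subalgebra Scal (HatDY N c) :=
  Algebra.adjoin Scal
    ({b | ∃ i j r, PowerSeries.coeff r (bpSeries N c M) i j =
        (if r = 0 then gMat N M (HatDY N c) i j else 0) - hh • b} ∪
     {b | ∃ i j r, toHat N c (PowerSeries.coeff (r + 1) (bSeries N c M) i j) = hh • b})

/-- The algebra `A_c(gl_N) = [A'_c(gl_N)]`. -/
def aAlg (M : ℕ) : Subalgebra Scal (HatDY N c) := hSatAlg (aPrime N c M)

/-- The completion of `A_c(gl_N)` in the completed double Yangian. -/
def aTilde (M : ℕ) : Subalgebra Scal (TildeDY N c) :=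
  ((aAlg N c M).map (hatToTilde N c)).topologicalClosure

/-- `T⁺_1(w_1) ⋯ T⁺_n(w_n) (T⁺_n(-w_n) ⋯ T⁺_1(-w_1))⁻¹` with `w_k = u + s (k - 1) h`, a power
series in `u`. -/
def plusPart (n : ℕ) (s : ℂ) :
    PowerSeries (Matrix (Fin n → Fin N) (Fin n → Fin N) (HatDY N c)) :=
  (List.ofFn fun k : Fin n => PowerSeries.map (leg k) (tpSeries N c 1 (s * (k : ℕ)))).prod *
  Ring.inverse (List.ofFn fun k : Fin n =>
    PowerSeries.map (leg k) (tpSeries N c (-1) (-(s * (k : ℕ))))).reverse.prod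

/-- `T_n(-w_n + hN/4) ⋯ T_1(-w_1 + hN/4) (T_1(w_1 - 3hN/4) ⋯ T_n(w_n - 3hN/4))⁻¹` with
`w_k = u + s (k - 1) h`, a power series in `u⁻¹`. -/
def minusPart (n : ℕ) (s : ℂ) :
    PowerSeries (Matrix (Fin n → Fin N) (Fin n → Fin N) (DY N c)) :=
  (List.ofFn fun k : Fin n =>
    PowerSeries.map (leg k) (tSeries N c (-1) (-(s * (k : ℕ)) + N / 4))).reverse.prod *
  Ring.inverse (List.ofFn fun k : Fin n =>
    PowerSeries.map (leg k) (tSeries N c 1 (s * (k : ℕ) - 3 * N / 4))).prod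

variable {N} in
/-- The action on `(ℂ^N)^{⊗ n}` of the symmetrizer `(1 / n!) ∑ σ`. -/
def symm (n : ℕ) (A : Type*) [Ring A] [Algebra Scal A] :
    Matrix (Fin n → Fin N) (Fin n → Fin N) A :=
  PowerSeries.C (1 / (n.factorial : ℂ)) • ∑ σ : Equiv.Perm (Fin n), permMat σ

variable {N} in
/-- The action on `(ℂ^N)^{⊗ n}` of the anti-symmetrizer `(1 / n!) ∑ sgn σ · σ`. -/
def antisymm (n : ℕ) (A : Type*) [Ring A] [Algebra Scal A] :
    Matrix (Fin n → Fin N) (Fin n → Fin N) A :=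
  PowerSeries.C (1 / (n.factorial : ℂ)) •
    ∑ σ : Equiv.Perm (Fin n), (Equiv.Perm.sign σ : ℤ) • permMat σ

/-- The contribution of `F_{k+l} u^{k+l}` and `K_l u^{-l}` to the coefficient of `u ^ k` in
`tr_{1,…,n} E F(u) K(u)`, where `F(u)` is `plusPart` and `K(u)` is `minusPart`. -/
def traceTerm (n : ℕ) (E : Matrix (Fin n → Fin N) (Fin n → Fin N) (TildeDY N c)) (s : ℂ)
    (k : ℤ) (l : ℕ) : TildeDY N c :=
  if 0 ≤ k + l then
    Matrix.trace (E * (PowerSeries.coeff (k + l).toNat (plusPart N c n s)).map (hatToTilde N c) *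
      (PowerSeries.coeff l (minusPart N c n s)).map (toTilde N c))
  else 0

/-- `IsCoeffRow N c n k x`: the coefficient of `u ^ k` in `B̃_{row}(u)` (for the row with `n` boxes)
exists, i.e. the infinite sum which defines it converges, and is equal to `x`. -/
def IsCoeffRow (n : ℕ) (k : ℤ) (x : TildeDY N c) : Prop :=
  HasSum (traceTerm N c n (symm n _) 1 k) x

/-- `IsCoeffCol N c n k x`: the coefficient of `u ^ k` in `B̃_{col}(u)` (for the column with `n`
boxes) exists, i.e. the infinite sum which defines it converges, and is equal to `x`. -/
def IsCoeffCol (n : ℕ) (k : ℤ) (x : TildeDY N c) : Prop :=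
  HasSum (traceTerm N c n (antisymm n _) (-1) k) x

end Series

/-! ### The infinite sums and inverses in these definitions exist -/

section WellDefined

variable {N : ℕ} {c : ℂ}

theorem tendsto_hpow_smul (f : ℕ → HatDY N c) :
    Filter.Tendsto (fun k => hh ^ k • f k) Filter.cofinite (nhds 0) := by
  rw [Nat.cofinite_eq_atTop, Filter.tendsto_def]
  intro U hU
  obtain ⟨V, ⟨hV, hVc⟩, hVU⟩ := (closed_nhds_basis (0 : HatDY N c)).mem_iff.1 hU
  have h0 : (fun x : HDY N c => (x : HatDY N c)) ⁻¹' V ∈ nhds (0 : HDY N c) :=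
    (Completion.continuous_coe _).continuousAt.preimage_mem_nhds (by
      rw [Completion.coe_zero]; exact hV)
  obtain ⟨m, -, hm⟩ := (DY.hBasis N c).hasBasis_nhds_zero.mem_iff.1 h0
  filter_upwards [Filter.eventually_ge_atTop m] with k hk
  refine hVU (show hh ^ k • f k ∈ V from ?_)
  refine Completion.induction_on (p := fun z => hh ^ k • z ∈ V) (f k)
    (hVc.preimage (continuous_const_smul _)) fun x => ?_
  rw [← Completion.coe_smul]
  exact hm (DY.hPow_anti hk (DY.mem_hPow.2 ⟨x, rfl⟩))

theorem summable_hpow_smul (f : ℕ → HatDY N c) : Summable fun k => hh ^ k • f k :=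
  NonarchimedeanAddGroup.summable_of_tendsto_cofinite_zero (tendsto_hpow_smul f)

theorem summable_tpSeries (ε : ℤ) (α : ℂ) (a : ℕ) (i j : Fin N) :
    Summable fun s : ℕ =>
      ((ε : Scal) ^ a * ((a + s).choose a : Scal) * (PowerSeries.C α * hh) ^ s) •
        toHat N c (tpOf (DY.gen N c) (a + s) i j) := by
  convert summable_hpow_smul (N := N) (c := c) fun s =>
    ((ε : Scal) ^ a * ((a + s).choose a : Scal) * (PowerSeries.C α) ^ s) •
      toHat N c (tpOf (DY.gen N c) (a + s) i j) using 2 with s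
  rw [← mul_smul]
  congr 1
  ring

theorem isUnit_one_add_smul {ι : Type} [Fintype ι] [DecidableEq ι]
    (Y : Matrix ι ι (HatDY N c)) : IsUnit (1 + hh • Y) := by
  have hs : Summable fun k : ℕ => (-(hh • Y)) ^ k := by
    have e : (fun k : ℕ => (-(hh • Y)) ^ k) = fun k : ℕ => hh ^ k • (-Y) ^ k := by
      funext k
      rw [← smul_neg, smul_pow]
    rw [e]
    refine Pi.summable.2 fun i => Pi.summable.2 fun j => ?_
    exact summable_hpow_smul fun k => ((-Y) ^ k) i j
  have h1 := hs.tsum_pow_mul_one_sub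
  have h2 := hs.one_sub_mul_tsum_pow
  rw [sub_neg_eq_add] at h1 h2
  exact ⟨⟨_, _, h2, h1⟩, rfl⟩

theorem isUnit_tpSeries (ε : ℤ) (α : ℂ) : IsUnit (tpSeries N c ε α) := by
  rw [PowerSeries.isUnit_iff_constantCoeff, ← PowerSeries.coeff_zero_eq_constantCoeff_apply]
  set y : Fin N → Fin N → ℕ → HatDY N c := fun i j s =>
    hh ^ s • (-(PowerSeries.C α ^ s • toHat N c (DY.gen N c (Gen.neg i j s)))) with hy
  have key : PowerSeries.coeff 0 (tpSeries N c ε α) =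
      1 + hh • (Matrix.of fun i j => ∑' s, y i j s) := by
    ext i j
    rw [tpSeries, PowerSeries.coeff_mk, Matrix.of_apply, Matrix.add_apply, Matrix.smul_apply,
      Matrix.of_apply]
    have h1 : HasSum (fun s : ℕ => if s = 0 then (1 : Matrix (Fin N) (Fin N) (HatDY N c)) i j
        else 0) ((1 : Matrix (Fin N) (Fin N) (HatDY N c)) i j) := hasSum_ite_eq 0 _
    have h2 : HasSum (fun s => hh • y i j s) (hh • ∑' s, y i j s) :=
      (summable_hpow_smul _).hasSum.const_smul hh
    refine Eq.trans (tsum_congr fun s => ?_) (h1.add h2).tsum_eq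
    rw [hy, tpOf]
    simp only [pow_zero, one_mul, Nat.choose_zero_right, Nat.cast_one, zero_add, Matrix.sub_apply,
      map_sub, Matrix.of_apply, map_smul, smul_sub, smul_neg]
    rw [sub_eq_add_neg]
    congr 1
    · by_cases hs : s = 0
      · subst hs
        rw [if_pos rfl, if_pos rfl, pow_zero, one_smul, Matrix.one_apply, Matrix.one_apply]
        split_ifs <;> simp
      · rw [if_neg hs, if_neg hs]; simp
    · rw [← mul_smul, ← mul_smul, ← mul_smul]
      congr 2
      ring
  rw [key]
  exact isUnit_one_add_smul _

theorem isUnit_tSeries (ε : ℤ) (α : ℂ) : IsUnit (tSeries N c ε α) := by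
  rw [PowerSeries.isUnit_iff_constantCoeff, ← PowerSeries.coeff_zero_eq_constantCoeff_apply]
  simp [tSeries, tOf]

theorem isUnit_listProd {R : Type*} [Ring R] (l : List R) (h : ∀ x ∈ l, IsUnit x) :
    IsUnit l.prod := by
  induction l with
  | nil => simp
  | cons a l ih =>
    rw [List.prod_cons]
    exact (h a (by simp)).mul (ih fun x hx => h x (by simp [hx]))

/-- The series inverted in `plusPart` is invertible. -/
theorem isUnit_plusPart (n : ℕ) (s : ℂ) : IsUnit (List.ofFn fun k : Fin n =>
    PowerSeries.map (leg k) (tpSeries N c (-1) (-(s * (k : ℕ))))).reverse.prod := by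
  refine isUnit_listProd _ fun x hx => ?_
  rw [List.mem_reverse, List.mem_ofFn] at hx
  obtain ⟨k, rfl⟩ := hx
  exact (isUnit_tpSeries _ _).map _

/-- The series inverted in `minusPart` is invertible. -/
theorem isUnit_minusPart (n : ℕ) (s : ℂ) : IsUnit (List.ofFn fun k : Fin n =>
    PowerSeries.map (leg k) (tSeries N c 1 (s * (k : ℕ) - 3 * N / 4))).prod := by
  refine isUnit_listProd _ fun x hx => ?_
  rw [List.mem_ofFn] at hx
  obtain ⟨k, rfl⟩ := hx
  exact (isUnit_tSeries _ _).map _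

end WellDefined

end Reflection

end

/-!
Let `F(u)` and `K(u)` be the products of series in `u` and in `u⁻¹` under the trace, and let `E` be
the projection of `(ℂ^N)^{⊗ n}` onto the symmetric or the skew-symmetric tensors, so that the series
in question is `tr E F(u) K(u)`. Let `B` be one of the matrices `T⁺(v) T⁺(-v)⁻¹` and
`T(v + hc) T(-v)⁻¹`, acting on an auxiliary factor.

The defining relations imply that `E F(u)` intertwines two conjugates of `B` by products of
`R`-matrices between the tensor factors and the auxiliary one, and so does `E K(u)`
(`exchange_of_relations`, `multi_exchange`). The point is that the `R`-matrices which arise from the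
two halves of `F`, or of `K`, cancel each other; for this they have to commute, and they do so next
to `E` by fusion: on the image of `E` a product of `R`-matrices at points in arithmetic progression
is a multiple of `1 - z (P_1 + ⋯ + P_n)` (`fusion_prod`, `rprod_fused`). The points in `F` and `K`
are such that the conjugate of `B` between the two is the same (`exchange_increasing`,
`exchange_decreasing`, `exchange_combine`). Hence `E F(u) K(u)` intertwines two conjugates of `B`
whose parameters differ by `2 c h = -N h`. They are therefore related by the crossing symmetry of the
normalized `R`-matrix (`rb_crossing`), under which the trace over the tensor factors is invariant
(`trace_crossing`). So the trace commutes with `B` (`scalar_trace_comm`).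

The product `F(u) K(u)` is not defined in a ring of formal series. The argument is carried out on the
quotients of the double Yangian by the left ideals `[I_p] + h^m`, where `[I_p]` is the saturation of
`I_p` with respect to `h`. There `h` is nilpotent, and every vector is annihilated by all but finitely
many generators `t_ij^{(r)}`, as the relations show (`decays`). Hence the series `K(u)` acts on
Laurent polynomials, the series `F(u)` maps these to two-sided formal series, and the sums which
define the coefficients of the trace are finite on every vector. The `R`-matrices have coefficients in
a ring `OpRing` which is compatible with both kinds of action (`trace_coeff_comm`). Convergence in the
completion follows (`summable_hatTerm`), and so does commutation with the coefficients of the two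
matrices `B` (`commute_of_partial_sums`). As `G = ±I`, these are the generators of the reflection
algebra up to division by `h`; since the completion has no `h`-torsion, commutation extends to the
generators, to the saturation and to its closure (`commute_aTilde`).

That the coefficients of the trace lie in the completed reflection algebra follows from
`tr E F K = tr (E F) (E K)`, because the entries of `E F` and `E K` can be expressed by those of the
matrices `B` and by `h`: the halves of `F` are merged factor by factor, where the exchange relations
produce factors `α - ν P_{ik}` which become invertible scalars next to `E`
(`PointRel.proj_fused_mem`, `hatTerm_mem`).
-/

open scoped Pointwise

noncomputable section

namespace Reflection

open scoped PowerSeries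

/-- Matrices of operators on `ℂ^N`. -/
local notation "Mat[" N "]" => Matrix (Fin N) (Fin N)

/-- Matrices of operators on `(ℂ^N)^{⊗ n}`. -/
local notation "Mat[" N ", " n "]" => Matrix (Fin n → Fin N) (Fin n → Fin N)

/-! ### Operators on tensor factors -/

section Legs

variable {N n : ℕ} {A : Type*} [Ring A]

theorem leg_apply (k : Fin n) (X : Mat[N] A) (a b : Fin n → Fin N) :
    leg k X a b = if ∀ l, l ≠ k → a l = b l then X (a k) (b k) else 0 := rfl

theorem agree_off_iff (k : Fin n) (a b : Fin n → Fin N) :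
    (∀ l, l ≠ k → a l = b l) ↔ b = Function.update a k (b k) := by
  constructor
  · intro h
    funext l
    by_cases hl : l = k
    · subst hl; simp
    · rw [Function.update_of_ne hl]; exact (h l hl).symm
  · intro h l hl
    rw [h, Function.update_of_ne hl]

theorem leg_mul_apply (k : Fin n) (X : Mat[N] A)
    (M : Mat[N, n] A) (a b : Fin n → Fin N) :
    (leg k X * M) a b = ∑ x, X (a k) x * M (Function.update a k x) b := by
  rw [Matrix.mul_apply]
  have key : ∀ c : Fin n → Fin N, leg k X a c * M c b =
      ∑ x : Fin N, if c = Function.update a k x then X (a k) x * M c b else 0 := by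
    intro c
    rw [leg_apply]
    simp only [agree_off_iff]
    by_cases h : c = Function.update a k (c k)
    · rw [if_pos h, Finset.sum_eq_single (c k), if_pos h]
      · intro x _ hx
        rw [if_neg]
        intro h'
        exact hx (by rw [h']; simp)
      · simp
    · rw [if_neg h, zero_mul]
      symm
      apply Finset.sum_eq_zero
      intro x _
      rw [if_neg]
      rintro rfl
      exact h (by simp)
  rw [Finset.sum_congr rfl fun c _ => key c, Finset.sum_comm]
  simp

theorem mul_leg_apply (k : Fin n) (X : Mat[N] A)
    (M : Mat[N, n] A) (a b : Fin n → Fin N) :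
    (M * leg k X) a b = ∑ x, M a (Function.update b k x) * X x (b k) := by
  rw [Matrix.mul_apply]
  have key : ∀ c : Fin n → Fin N, M a c * leg k X c b =
      ∑ x : Fin N, if c = Function.update b k x then M a c * X x (b k) else 0 := by
    intro c
    rw [leg_apply]
    have e : (∀ l, l ≠ k → c l = b l) ↔ c = Function.update b k (c k) := by
      rw [← agree_off_iff]
      exact forall₂_congr fun l _ => eq_comm
    simp only [e]
    by_cases h : c = Function.update b k (c k)
    · rw [if_pos h, Finset.sum_eq_single (c k), if_pos h]
      · intro x _ hx
        rw [if_neg]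
        intro h'
        exact hx (by rw [h']; simp)
      · simp
    · rw [if_neg h, mul_zero]
      symm
      apply Finset.sum_eq_zero
      intro x _
      rw [if_neg]
      rintro rfl
      exact h (by simp)
  rw [Finset.sum_congr rfl fun c _ => key c, Finset.sum_comm]
  simp

theorem leg_mul_leg_apply {i j : Fin n} (h : i ≠ j) (X Y : Mat[N] A)
    (a b : Fin n → Fin N) :
    (leg i X * leg j Y) a b =
      if ∀ l, l ≠ i → l ≠ j → a l = b l then X (a i) (b i) * Y (a j) (b j) else 0 := by
  rw [leg_mul_apply, Finset.sum_eq_single (b i)]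
  · rw [leg_apply, Function.update_of_ne h.symm]
    have : (∀ l, l ≠ j → Function.update a i (b i) l = b l) ↔
        ∀ l, l ≠ i → l ≠ j → a l = b l := by
      refine forall_congr' fun l => ?_
      by_cases hl : l = i
      · subst hl; simp
      · rw [Function.update_of_ne hl]; simp [hl]
    simp only [this]
    split_ifs <;> simp
  · intro x _ hx
    rw [leg_apply, if_neg, mul_zero]
    intro h'
    exact hx (by simpa using h' i h)
  · simp

theorem leg_mul_leg_comm {i j : Fin n} (h : i ≠ j) (X Y : Mat[N] A)
    (hc : ∀ a b c d, Commute (X a b) (Y c d)) : Commute (leg i X) (leg j Y) := by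
  ext a b
  rw [leg_mul_leg_apply h, leg_mul_leg_apply h.symm, (hc _ _ _ _).eq]
  exact if_congr (forall_congr' fun l => by tauto) rfl rfl

theorem permMat_mul_apply (σ : Equiv.Perm (Fin n))
    (M : Mat[N, n] A) (a b : Fin n → Fin N) :
    (permMat σ * M : Mat[N, n] A) a b = M (a ∘ σ) b := by
  rw [Matrix.mul_apply, Finset.sum_eq_single (a ∘ σ)]
  · simp [permMat, Function.comp_assoc]
  · intro c _ hc
    rw [permMat, Matrix.of_apply, if_neg, zero_mul]
    rintro rfl
    exact hc (by simp [Function.comp_assoc])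
  · simp

theorem mul_permMat_apply (σ : Equiv.Perm (Fin n))
    (M : Mat[N, n] A) (a b : Fin n → Fin N) :
    (M * permMat σ : Mat[N, n] A) a b = M a (b ∘ σ.symm) := by
  rw [Matrix.mul_apply, Finset.sum_eq_single (b ∘ σ.symm)]
  · simp [permMat]
  · intro c _ hc
    rw [permMat, Matrix.of_apply, if_neg hc, mul_zero]
  · simp

theorem permMat_mul (σ τ : Equiv.Perm (Fin n)) :
    (permMat σ * permMat τ : Mat[N, n] A) = permMat (σ * τ) := by
  ext a b
  rw [permMat_mul_apply]
  simp only [permMat, Matrix.of_apply]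
  congr 1
  rw [eq_iff_iff]
  constructor
  · intro h
    funext l
    have := congrFun h (σ.symm l)
    rw [Function.comp_apply, Equiv.apply_symm_apply] at this
    exact this
  · rintro rfl
    funext l
    change b (τ.symm (σ.symm (σ l))) = _
    rw [Equiv.symm_apply_apply, Function.comp_apply]

theorem permMat_one :
    (permMat 1 : Mat[N, n] A) = 1 := by
  ext a b
  rw [Matrix.one_apply]
  exact if_congr Iff.rfl rfl rfl

theorem permMat_mul_leg (σ : Equiv.Perm (Fin n)) (k : Fin n) (X : Mat[N] A) :
    permMat σ * leg k X = leg (σ k) X * permMat σ := by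
  ext a b
  rw [permMat_mul_apply, mul_permMat_apply, leg_apply, leg_apply]
  simp only [Function.comp_apply, Equiv.symm_apply_apply]
  refine if_congr ⟨fun h l hl => ?_, fun h l hl => ?_⟩ rfl rfl
  · have := h (σ.symm l) (fun e => hl (by rw [← e]; simp))
    simpa using this
  · have := h (σ l) (fun e => hl (σ.injective e))
    simpa using this

theorem permMat_swap_mul_leg (i j : Fin n) (X : Mat[N] A) :
    permMat (Equiv.swap i j) * leg i X = leg j X * permMat (Equiv.swap i j) := by
  rw [permMat_mul_leg, Equiv.swap_apply_left]

theorem permMat_swap_comm_leg {i j k : Fin n} (hi : k ≠ i) (hj : k ≠ j)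
    (X : Mat[N] A) : Commute (permMat (Equiv.swap i j)) (leg k X) := by
  rw [Commute, SemiconjBy, permMat_mul_leg, Equiv.swap_apply_of_ne_of_ne hi hj]

theorem permMat_swap_sq (i j : Fin n) :
    (permMat (Equiv.swap i j) * permMat (Equiv.swap i j) :
      Mat[N, n] A) = 1 := by
  rw [permMat_mul, Equiv.swap_mul_self, permMat_one]

theorem leg_map {B : Type*} [Ring B] (φ : A →+* B) (k : Fin n) (X : Mat[N] A) :
    (leg k X).map φ = leg k (X.map φ) := by
  ext a b
  rw [Matrix.map_apply, leg_apply, leg_apply]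
  split_ifs <;> simp

theorem permMat_map {B : Type*} [Ring B] (φ : A →+* B) (σ : Equiv.Perm (Fin n)) :
    (permMat σ : Mat[N, n] A).map φ = permMat σ := by
  ext a b
  simp only [Matrix.map_apply, permMat, Matrix.of_apply]
  split_ifs <;> simp

theorem leg_scalar (k : Fin n) (x : A) :
    leg k (Matrix.scalar (Fin N) x) = Matrix.scalar (Fin n → Fin N) x := by
  ext a b
  rw [leg_apply, Matrix.scalar_apply, Matrix.scalar_apply, Matrix.diagonal_apply,
    Matrix.diagonal_apply]
  by_cases h : a = b
  · subst h; simp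
  · rw [if_neg h]
    split_ifs with h1 h2
    · exact absurd (funext fun l => by
        by_cases hl : l = k
        · rw [hl]; exact h2
        · exact h1 l hl) h
    · rfl
    · rfl

/-! ### Exchange relations of two matrices -/

/-- The relation `(μ - ν P) X₁ Y₂ = Y₂ X₁ (μ' - ν' P)` in `(End ℂ^N)^{⊗ 2} ⊗ A`, written in terms
of matrix entries. -/
def MRel (μ ν μ' ν' : A) (X Y : Mat[N] A) : Prop :=
  ∀ a b c d, μ * (X a b * Y c d) - ν * (X c b * Y a d) =
    (Y c d * X a b) * μ' - (Y c b * X a d) * ν'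

theorem MRel.map {B : Type*} [Ring B] (φ : A →+* B) {μ ν μ' ν' : A}
    {X Y : Mat[N] A} (h : MRel μ ν μ' ν' X Y) :
    MRel (φ μ) (φ ν) (φ μ') (φ ν') (X.map φ) (Y.map φ) := by
  intro a b c d
  have := congrArg φ (h a b c d)
  simpa using this

/-- The relation `MRel` for two of the tensor factors of `(ℂ^N)^{⊗ n}`. -/
theorem MRel.legs {μ ν μ' ν' : A} {X Y : Mat[N] A} (h : MRel μ ν μ' ν' X Y)
    {i j : Fin n} (hij : i ≠ j) :
    (Matrix.scalar _ μ - Matrix.scalar _ ν * permMat (Equiv.swap i j)) * (leg i X * leg j Y) =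
      (leg j Y * leg i X) * (Matrix.scalar _ μ' - permMat (Equiv.swap i j) * Matrix.scalar _ ν') := by
  have hsw : ∀ (a b : Fin n → Fin N), (∀ l, l ≠ i → l ≠ j → a (Equiv.swap i j l) = b l) ↔
      (∀ l, l ≠ i → l ≠ j → a l = b l) := fun a b =>
    forall_congr' fun l => forall₂_congr fun h1 h2 => by
      rw [Equiv.swap_apply_of_ne_of_ne h1 h2]
  have hsw' : ∀ (a b : Fin n → Fin N), (∀ l, l ≠ j → l ≠ i → a l = b (Equiv.swap i j l)) ↔
      (∀ l, l ≠ i → l ≠ j → a l = b l) := fun a b =>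
    forall_congr' fun l => by
      constructor
      · intro h h1 h2
        have := h h2 h1
        rwa [Equiv.swap_apply_of_ne_of_ne h1 h2] at this
      · intro h h2 h1
        rw [Equiv.swap_apply_of_ne_of_ne h1 h2]
        exact h h1 h2
  ext a b
  rw [sub_mul, mul_sub, Matrix.sub_apply, Matrix.sub_apply, mul_assoc, ← mul_assoc (leg j Y * _),
    Matrix.scalar_apply, Matrix.scalar_apply, Matrix.scalar_apply, Matrix.scalar_apply,
    Matrix.diagonal_mul, Matrix.diagonal_mul, Matrix.mul_diagonal, Matrix.mul_diagonal,
    permMat_mul_apply, mul_permMat_apply, Equiv.symm_swap, leg_mul_leg_apply hij,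
    leg_mul_leg_apply hij, leg_mul_leg_apply hij.symm, leg_mul_leg_apply hij.symm]
  simp only [Function.comp_apply, hsw, hsw', Equiv.swap_apply_left, Equiv.swap_apply_right]
  have e : (∀ l, l ≠ j → l ≠ i → a l = b l) ↔ (∀ l, l ≠ i → l ≠ j → a l = b l) :=
    forall_congr' fun l => by tauto
  simp only [e]
  split_ifs
  · exact h _ _ _ _
  · simp

end Legs

/-! ### The auxiliary tensor factor -/

section Aux

variable {N n : ℕ} {A : Type*} [Ring A]

/-- A matrix over `A`, viewed as a matrix over the ring of matrices over `A`. The inner matrices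
are the operators on an additional tensor factor, called auxiliary, so that operators on `ℂ^N ⊗
ℂ^N` with coefficients in `A` are matrices over the ring `Mat[N] A`. -/
abbrev liftMat {I : Type*} [Fintype I] [DecidableEq I] :
    Matrix I I A →+* Matrix I I (Mat[N] A) :=
  (Matrix.scalar (Fin N) : A →+* Mat[N] A).mapMatrix

/-- The permutation operator on `ℂ^N ⊗ ℂ^N`, as a matrix of matrices. -/
def swapMat (N : ℕ) (A : Type*) [Ring A] : Mat[N] (Mat[N] A) :=
  Matrix.of fun a b => Matrix.single b a 1

/-- A scalar, viewed as an operator on `ℂ^N ⊗ ℂ^N`. -/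
abbrev sc2 (x : A) : Mat[N] (Mat[N] A) :=
  Matrix.scalar _ (Matrix.scalar _ x)

theorem lift_mul_scalar_apply (X Y : Mat[N] A) (a b c d : Fin N) :
    (liftMat X * Matrix.scalar (Fin N) Y : Mat[N] (Mat[N] A)) a b c d = X a b * Y c d := by
  rw [Matrix.scalar_apply, Matrix.mul_diagonal]
  simp [Matrix.scalar_apply]

theorem scalar_mul_lift_apply (X Y : Mat[N] A) (a b c d : Fin N) :
    (Matrix.scalar (Fin N) Y * liftMat X : Mat[N] (Mat[N] A)) a b c d = Y c d * X a b := by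
  rw [Matrix.scalar_apply, Matrix.diagonal_mul]
  simp [Matrix.scalar_apply]

theorem swapMat_mul_apply (M : Mat[N] (Mat[N] A))
    (a b c d : Fin N) : (swapMat N A * M) a b c d = M c b a d := by
  rw [Matrix.mul_apply, Matrix.sum_apply, Finset.sum_eq_single c]
  · simp [swapMat]
  · intro x _ hx
    simp [swapMat, Matrix.single_mul_apply_of_ne _ _ _ _ _ (Ne.symm hx)]
  · simp

theorem mul_swapMat_apply (M : Mat[N] (Mat[N] A))
    (a b c d : Fin N) : (M * swapMat N A) a b c d = M a d c b := by
  rw [Matrix.mul_apply, Matrix.sum_apply, Finset.sum_eq_single d]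
  · simp [swapMat]
  · intro x _ hx
    simp [swapMat, Matrix.mul_single_apply_of_ne _ _ _ _ _ (Ne.symm hx)]
  · simp

/-- The relation `MRel`, with its second factor auxiliary. -/
theorem MRel.aux {μ ν μ' ν' : A} {X Y : Mat[N] A} (h : MRel μ ν μ' ν' X Y) :
    (sc2 μ - sc2 ν * swapMat N A) * (liftMat X * Matrix.scalar _ Y) =
      (Matrix.scalar _ Y * liftMat X) * (sc2 μ' - swapMat N A * sc2 ν') := by
  ext a b c d
  rw [sub_mul, mul_sub, Matrix.sub_apply, Matrix.sub_apply, Matrix.sub_apply, Matrix.sub_apply,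
    mul_assoc, ← mul_assoc (Matrix.scalar _ Y * _)]
  simp only [sc2, Matrix.scalar_apply (α := Mat[N] A), Matrix.diagonal_mul,
    Matrix.mul_diagonal]
  rw [Matrix.scalar_apply, Matrix.scalar_apply, Matrix.scalar_apply, Matrix.scalar_apply,
    Matrix.diagonal_mul, Matrix.diagonal_mul, Matrix.mul_diagonal, Matrix.mul_diagonal,
    swapMat_mul_apply, mul_swapMat_apply]
  have := h a b c d
  rw [← lift_mul_scalar_apply, ← lift_mul_scalar_apply, ← scalar_mul_lift_apply,
    ← scalar_mul_lift_apply] at this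
  simpa [Matrix.scalar_apply] using this

/-- The relation `MRel`, with its first factor auxiliary. -/
theorem MRel.aux_swap {μ ν μ' ν' : A} {X Y : Mat[N] A} (h : MRel μ ν μ' ν' X Y) :
    (sc2 μ - sc2 ν * swapMat N A) * (Matrix.scalar _ X * liftMat Y) =
      (liftMat Y * Matrix.scalar _ X) * (sc2 μ' - swapMat N A * sc2 ν') := by
  ext a b c d
  rw [sub_mul, mul_sub, Matrix.sub_apply, Matrix.sub_apply, Matrix.sub_apply, Matrix.sub_apply,
    mul_assoc, ← mul_assoc (liftMat Y * _)]
  simp only [sc2, Matrix.scalar_apply (α := Mat[N] A), Matrix.diagonal_mul,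
    Matrix.mul_diagonal]
  rw [Matrix.scalar_apply, Matrix.scalar_apply, Matrix.scalar_apply, Matrix.scalar_apply,
    Matrix.diagonal_mul, Matrix.diagonal_mul, Matrix.mul_diagonal, Matrix.mul_diagonal,
    swapMat_mul_apply, mul_swapMat_apply]
  have := h c d a b
  rw [← lift_mul_scalar_apply, ← lift_mul_scalar_apply, ← scalar_mul_lift_apply,
    ← scalar_mul_lift_apply] at this
  simpa [Matrix.scalar_apply] using this

/-- The permutation operators of two factors with the auxiliary one multiply as transpositions. -/
theorem leg_swapMat_mul {i j : Fin n} (h : i ≠ j) :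
    leg i (swapMat N A) * leg j (swapMat N A) =
      permMat (Equiv.swap i j) * leg i (swapMat N A) := by
  ext1 a b
  rw [permMat_mul_apply, leg_mul_leg_apply h, leg_apply]
  simp only [Function.comp_apply, Equiv.swap_apply_left]
  simp only [swapMat, Matrix.of_apply]
  by_cases h1 : ∀ l, l ≠ i → l ≠ j → a l = b l
  · rw [if_pos h1]
    by_cases h2 : a i = b j
    · rw [h2, Matrix.single_mul_single_same, if_pos, mul_one]
      intro l hl
      by_cases hj : l = j
      · subst hj; rw [Equiv.swap_apply_right, h2]
      · rw [Equiv.swap_apply_of_ne_of_ne hl hj, h1 l hl hj]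
    · rw [Matrix.single_mul_single_of_ne _ _ _ _ h2, if_neg]
      intro h3
      exact h2 (by simpa using h3 j h.symm)
  · rw [if_neg h1, if_neg]
    intro h3
    exact h1 fun l hi hj => by simpa [Equiv.swap_apply_of_ne_of_ne hi hj] using h3 l hi

theorem leg_swapMat_mul' {i j : Fin n} (h : i ≠ j) :
    leg i (swapMat N A) * leg j (swapMat N A) =
      leg j (swapMat N A) * permMat (Equiv.swap i j) := by
  rw [leg_swapMat_mul h, permMat_swap_mul_leg]

theorem swapMat_sq : swapMat N A * swapMat N A = 1 := by
  ext a b c d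
  rw [swapMat_mul_apply, swapMat, Matrix.of_apply, Matrix.one_apply]
  by_cases h : a = b
  · subst h
    by_cases h' : c = d
    · subst h'; simp
    · rw [if_pos rfl, Matrix.one_apply_ne h', Matrix.single_apply_of_ne]
      rintro ⟨-, h⟩; exact h' h
  · rw [if_neg h, Matrix.zero_apply, Matrix.single_apply_of_ne]
    rintro ⟨h1, -⟩; exact h h1.symm

theorem swapMat_transpose_sq :
    (swapMat N A).transpose * (swapMat N A).transpose = (N : ℕ) • (swapMat N A).transpose := by
  ext1 a b
  rw [Matrix.mul_apply]
  simp [swapMat, Matrix.single_mul_single_same]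

end Aux

/-! ### Exchange relations in a ring -/

section Abstract

variable {R : Type*} [Ring R]

/-- If `T` and `T'` satisfy exchange relations with `t` and `t'`, then `E T T'⁻¹` intertwines two
conjugates of `t t'⁻¹`. The factors `Y` which arise from moving `t` past `T` cancel those which
arise from moving it past `T'`, since `E` makes them commute and can be inserted next to them. -/
theorem exchange_of_relations {E T t X2 : R} {T' t' X1 X3 X4 Y1 Y2 : Rˣ}
    (r1 : X1 * (T * t) = t * T * Y1) (r2 : X2 * (T * t') = t' * T * Y2)
    (r3 : X3 * (T' * t) = t * T' * (Y2⁻¹ : Rˣ)) (r4 : (X4 : R) * (T' * t') = t' * T' * (Y1⁻¹ : Rˣ))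
    (hX : E * (X1⁻¹ : Rˣ) = E * (X1⁻¹ : Rˣ) * E) (ht : Commute E t) (hT : E * T = E * T * E)
    (hY : E * (Y1 * Y2) = E * (Y2 * Y1)) :
    E * (T * (T'⁻¹ : Rˣ)) * ((X3⁻¹ : Rˣ) * (t * (t'⁻¹ : Rˣ)) * X4) =
      E * ((X1⁻¹ : Rˣ) * (t * (t'⁻¹ : Rˣ)) * X2) * (T * (T'⁻¹ : Rˣ)) := by
  have a : ((T'⁻¹ : Rˣ) : R) * (X3⁻¹ : Rˣ) * t = t * Y2 * (T'⁻¹ : Rˣ) := by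
    rw [Units.eq_mul_inv_iff_mul_eq, mul_assoc, mul_assoc, Units.inv_mul_eq_iff_eq_mul,
      Units.inv_mul_eq_iff_eq_mul]
    rw [Units.eq_mul_inv_iff_mul_eq] at r3
    simpa only [mul_assoc] using r3.symm
  have b : ((T'⁻¹ : Rˣ) : R) * (t'⁻¹ : Rˣ) * X4 = (Y1⁻¹ : Rˣ) * (t'⁻¹ : Rˣ) * (T'⁻¹ : Rˣ) := by
    rw [Units.eq_mul_inv_iff_mul_eq, Units.eq_mul_inv_iff_mul_eq, mul_assoc, mul_assoc, mul_assoc,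
      r4, Units.inv_mul_eq_iff_eq_mul, Units.inv_mul_eq_iff_eq_mul, mul_assoc]
  have d : T * Y2 * (t'⁻¹ : Rˣ) = (t'⁻¹ : Rˣ) * X2 * T := by
    rw [Units.mul_inv_eq_iff_eq_mul, mul_assoc, mul_assoc, Units.eq_inv_mul_iff_mul_eq, r2,
      mul_assoc]
  -- The factor `E` can be inserted to the right of `T`, where `hY` applies.
  have e : E * (X1⁻¹ : Rˣ) * (t * T) = E * (X1⁻¹ : Rˣ) * (t * T) * E := by
    have e1 : E * (t * T) = E * (t * T) * E := by
      calc E * (t * T) = t * (E * T) := by rw [← mul_assoc, ht.eq, mul_assoc]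
        _ = t * E * T * E := by rw [hT]; simp only [mul_assoc]
        _ = _ := by rw [← ht.eq]; simp only [mul_assoc]
    calc E * (X1⁻¹ : Rˣ) * (t * T) = E * (X1⁻¹ : Rˣ) * (E * (t * T)) := by
          rw [← mul_assoc _ E, ← hX]
      _ = E * (X1⁻¹ : Rˣ) * E * (t * T) * E := by rw [e1]; simp only [mul_assoc]
      _ = _ := by rw [← hX]
  have f : T * t = (X1⁻¹ : Rˣ) * (t * T) * Y1 := by
    rw [mul_assoc, Units.eq_inv_mul_iff_mul_eq, r1]
  calc E * (T * (T'⁻¹ : Rˣ)) * ((X3⁻¹ : Rˣ) * (t * (t'⁻¹ : Rˣ)) * X4)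
      = E * T * ((T'⁻¹ : Rˣ) * (X3⁻¹ : Rˣ) * t) * (t'⁻¹ : Rˣ) * X4 := by simp only [mul_assoc]
    _ = E * (T * t) * Y2 * ((T'⁻¹ : Rˣ) * (t'⁻¹ : Rˣ) * X4) := by rw [a]; simp only [mul_assoc]
    _ = E * (X1⁻¹ : Rˣ) * (t * T) * Y1 * Y2 * (Y1⁻¹ : Rˣ) * (t'⁻¹ : Rˣ) * (T'⁻¹ : Rˣ) := by
      rw [b, f]; simp only [mul_assoc]
    _ = E * (X1⁻¹ : Rˣ) * (t * T) * (E * (Y1 * Y2)) * (Y1⁻¹ : Rˣ) * (t'⁻¹ : Rˣ) * (T'⁻¹ : Rˣ) := by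
      rw [← mul_assoc _ E, ← e]; simp only [mul_assoc]
    _ = E * (X1⁻¹ : Rˣ) * (t * T) * E * Y2 * (t'⁻¹ : Rˣ) * (T'⁻¹ : Rˣ) := by
      rw [hY]; simp only [mul_assoc, Units.mul_inv_cancel_left]
    _ = E * (X1⁻¹ : Rˣ) * t * (T * Y2 * (t'⁻¹ : Rˣ)) * (T'⁻¹ : Rˣ) := by
      rw [← e]; simp only [mul_assoc]
    _ = _ := by rw [d]; simp only [mul_assoc]

/-- Exchange relations of the factors `T i` with `t` multiply to one of their product, as the
factors with different indices commute. -/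
theorem list_prod_exchange {ι : Type*} {l : List ι} (hl : l.Nodup) {X T Y : ι → R} {t : R}
    (h : ∀ i ∈ l, X i * (T i * t) = t * T i * Y i)
    (hX : ∀ i ∈ l, ∀ j ∈ l, i ≠ j → Commute (X i) (T j))
    (hY : ∀ i ∈ l, ∀ j ∈ l, i ≠ j → Commute (Y i) (T j)) :
    (l.map X).prod * ((l.map T).prod * t) = t * (l.map T).prod * (l.map Y).prod := by
  induction l with
  | nil => simp
  | cons a l ih =>
    rw [List.nodup_cons] at hl
    have ih := ih hl.2 (fun i hi => h i (List.mem_cons_of_mem _ hi))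
      (fun i hi j hj => hX i (List.mem_cons_of_mem _ hi) j (List.mem_cons_of_mem _ hj))
      (fun i hi j hj => hY i (List.mem_cons_of_mem _ hi) j (List.mem_cons_of_mem _ hj))
    simp only [List.map_cons, List.prod_cons]
    have c1 : Commute (l.map X).prod (T a) := by
      refine Commute.list_prod_left _ _ fun x hx => ?_
      obtain ⟨j, hj, rfl⟩ := List.mem_map.1 hx
      exact hX j (List.mem_cons_of_mem _ hj) a List.mem_cons_self fun e => hl.1 (e ▸ hj)
    have c2 : Commute (Y a) (l.map T).prod := by
      refine Commute.list_prod_right _ _ fun x hx => ?_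
      obtain ⟨j, hj, rfl⟩ := List.mem_map.1 hx
      exact hY a List.mem_cons_self j (List.mem_cons_of_mem _ hj) fun e => hl.1 (e ▸ hj)
    have ha := h a (List.mem_cons_self)
    calc X a * (l.map X).prod * (T a * (l.map T).prod * t)
        = X a * (T a * ((l.map X).prod * ((l.map T).prod * t))) := by
          rw [← mul_assoc (T a) _ _ |>.symm, mul_assoc, ← mul_assoc (l.map X).prod, c1.eq]
          simp only [mul_assoc]
      _ = X a * (T a * t) * (l.map T).prod * (l.map Y).prod := by
          rw [ih]; simp only [mul_assoc]
      _ = t * T a * (Y a * (l.map T).prod) * (l.map Y).prod := by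
          rw [ha]; simp only [mul_assoc]
      _ = _ := by rw [c2.eq]; simp only [mul_assoc]

/-- Fusion of `R`-matrices: in the presence of a (anti-)symmetrizer `E`, a product of the factors
`1 - ξ_i P_i` at points in arithmetic progression depends only on the sum of the `P_i`. -/
theorem fusion_prod {S ι : Type*} [CommRing S] [Algebra S R] {E : R} {s : ℤ} {P : ι → R}
    {ξ : ι → S} (l : List ι) (hl : l.Nodup)
    (hP : ∀ i j, i ≠ j → E * (P i * P j) = s • (E * P i))
    (hP' : ∀ i j, i ≠ j → P i * P j * E = s • (P j * E))
    (hc : l.IsChain fun a b => ξ b - ξ a = s * (ξ a * ξ b)) :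
    ∃ z : S, E * (l.reverse.map fun i => 1 - ξ i • P i).prod = E * (1 - z • (l.map P).sum) ∧
      (l.map fun i => 1 - ξ i • P i).prod * E = (1 - z • (l.map P).sum) * E := by
  refine ⟨(l.map ξ).headD 0, ?_⟩
  induction l with
  | nil => simp
  | cons a l ih =>
    obtain ⟨ih1, ih2⟩ := ih (List.nodup_cons.1 hl).2 hc.tail
    have ha : ∀ i ∈ l, i ≠ a := fun i hi e => (List.nodup_cons.1 hl).1 (e ▸ hi)
    have s1 : ∀ l : List ι, (∀ i ∈ l, i ≠ a) →
        E * ((l.map P).sum * P a) = s • (E * (l.map P).sum) := by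
      intro l
      induction l with
      | nil => simp
      | cons b l ih2 =>
        intro ha
        rw [List.map_cons, List.sum_cons, add_mul, mul_add, mul_add, smul_add,
          hP _ _ (ha b List.mem_cons_self), ih2 fun i hi => ha i (List.mem_cons_of_mem _ hi)]
    have s2 : ∀ l : List ι, (∀ i ∈ l, i ≠ a) →
        P a * (l.map P).sum * E = s • ((l.map P).sum * E) := by
      intro l
      induction l with
      | nil => simp
      | cons b l ih2 =>
        intro ha
        rw [List.map_cons, List.sum_cons, mul_add, add_mul, add_mul, smul_add,
          hP' _ _ (ha b List.mem_cons_self).symm,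
          ih2 fun i hi => ha i (List.mem_cons_of_mem _ hi)]
    replace s1 := s1 l ha
    replace s2 := s2 l ha
    rw [List.reverse_cons, List.map_append, List.prod_append, ← mul_assoc, ih1]
    simp only [List.map_cons, List.map_nil, List.prod_cons, List.prod_nil, mul_one,
      List.sum_cons, List.headD_cons]
    rw [mul_assoc (1 - ξ a • P a), ih2]
    set J := (l.map P).sum with hJ
    set z := (l.map ξ).headD 0 with hz
    have hzJ : z • J - (ξ a * z * s) • J = ξ a • J := by
      cases l with
      | nil => simp [hJ]
      | cons b l =>
        rw [List.isChain_cons_cons] at hc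
        have e : z = ξ a + s * (ξ a * z) := sub_eq_iff_eq_add'.1 hc.1
        rw [← sub_smul]
        congr 1
        linear_combination e
    have t1 : E * (J * P a) = (s : S) • (E * J) := by rw [s1, Int.cast_smul_eq_zsmul]
    have t2 : P a * J * E = (s : S) • (J * E) := by rw [s2, Int.cast_smul_eq_zsmul]
    have e1 := congrArg (E * ·) hzJ
    have e2 := congrArg (· * E) hzJ
    simp only [mul_sub, sub_mul, mul_smul_comm, smul_mul_assoc] at e1 e2
    constructor
    · simp only [mul_sub, sub_mul, mul_one, one_mul, mul_smul_comm, smul_mul_assoc, mul_assoc, t1,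
        mul_add, smul_add, smul_sub]
      rw [← e1]
      module
    · simp only [mul_sub, sub_mul, mul_one, one_mul, mul_smul_comm, smul_mul_assoc, ← mul_assoc,
        t2, add_mul, smul_add, smul_sub]
      rw [← e2]
      module

end Abstract

/-! ### Symmetrizers -/

section Symmetrizer

variable {N n : ℕ} {A : Type*} [Ring A]

theorem mul_permMat_of_swap {χ : Equiv.Perm (Fin n) →* ℤˣ}
    {Z : Mat[N, n] A}
    (h : ∀ i j, i ≠ j → Z * permMat (Equiv.swap i j) = ((χ (Equiv.swap i j) : ℤˣ) : ℤ) • Z)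
    (τ : Equiv.Perm (Fin n)) : Z * permMat τ = ((χ τ : ℤˣ) : ℤ) • Z := by
  induction τ using Equiv.Perm.swap_induction_on with
  | one => simp [permMat_one]
  | swap_mul f x y hxy ih =>
    rw [← permMat_mul, ← mul_assoc, h x y hxy, smul_mul_assoc, ih, smul_smul, map_mul,
      Units.val_mul]

/-- The symmetry under the transpositions of neighbours in a list implies that under all
transpositions of its elements. -/
theorem mul_swap_of_chain {s : ℤ} (hs : s * s = 1) {l : List (Fin n)} (hl : l.Nodup)
    {Z : Mat[N, n] A}
    (hc : l.IsChain fun i j => i ≠ j ∧ Z * permMat (Equiv.swap i j) = s • Z) :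
    ∀ i ∈ l, ∀ j ∈ l, i ≠ j → Z * permMat (Equiv.swap i j) = s • Z := by
  let r : Fin n → Fin n → Prop := fun i j => i ≠ j → Z * permMat (Equiv.swap i j) = s • Z
  have htr : ∀ i j k, r i j → r j k → r i k := by
    intro i j k h1 h2 hik
    by_cases hij : i = j
    · subst hij; exact h2 hik
    by_cases hjk : j = k
    · subst hjk; exact h1 hij
    have e : Equiv.swap i k = Equiv.swap j k * (Equiv.swap i j * Equiv.swap j k) := by
      rw [← mul_assoc, Equiv.swap_mul_swap_mul_swap hij hik, Equiv.swap_comm]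
    rw [e, ← permMat_mul, ← permMat_mul, ← mul_assoc, h2 hjk, smul_mul_assoc, ← mul_assoc, h1 hij,
      smul_mul_assoc, h2 hjk, smul_smul, hs, one_smul]
  have : Trans r r r := ⟨fun {i j k} => htr i j k⟩
  have hp : l.Pairwise r := by
    rw [← List.isChain_iff_pairwise]
    exact hc.imp fun i j h _ => h.2
  have : Std.Symm r := ⟨fun i j h hij => by rw [Equiv.swap_comm]; exact h hij.symm⟩
  intro i hi j hj hij
  exact hp.forall hi hj hij hij

variable [Algebra Scal A]

/-- The projection of `(ℂ^N)^{⊗ n}` onto the isotypic component of a character `χ` of the symmetric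
group. -/
def isoProj (N n : ℕ) (χ : Equiv.Perm (Fin n) →* ℤˣ) (A : Type*) [Ring A] [Algebra Scal A] :
    Mat[N, n] A :=
  PowerSeries.C (1 / (n.factorial : ℂ)) •
    ∑ σ : Equiv.Perm (Fin n), ((χ σ : ℤˣ) : ℤ) • permMat σ

theorem symm_eq_isoProj : symm (N := N) n A = isoProj N n 1 A := by
  simp [symm, isoProj]

theorem antisymm_eq_isoProj : antisymm (N := N) n A = isoProj N n Equiv.Perm.sign A := rfl

theorem isoProj_map {B : Type*} [Ring B] [Algebra Scal B] (χ : Equiv.Perm (Fin n) →* ℤˣ)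
    (φ : A →ₐ[Scal] B) : (isoProj N n χ A).map φ = isoProj N n χ B := by
  have : ∀ M : Mat[N, n] A, M.map φ = φ.mapMatrix M := fun _ => rfl
  rw [this, isoProj, isoProj, map_smul, map_sum]
  congr 1
  refine Finset.sum_congr rfl fun σ _ => ?_
  rw [map_zsmul, ← this]
  congr 1
  exact permMat_map (φ : A →+* B) σ

theorem isoProj_mul_permMat (χ : Equiv.Perm (Fin n) →* ℤˣ) (τ : Equiv.Perm (Fin n)) :
    isoProj N n χ A * permMat τ = ((χ τ : ℤˣ) : ℤ) • isoProj N n χ A := by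
  rw [isoProj, smul_mul_assoc, smul_comm ((χ τ : ℤˣ) : ℤ), Finset.sum_mul]
  congr 1
  rw [Finset.smul_sum]
  refine Fintype.sum_equiv (Equiv.mulRight τ) _ _ fun σ => ?_
  rw [smul_mul_assoc, permMat_mul, Equiv.coe_mulRight, smul_smul, map_mul, Units.val_mul,
    mul_left_comm, ← Units.val_mul, Int.units_mul_self, Units.val_one, mul_one]

theorem permMat_mul_isoProj (χ : Equiv.Perm (Fin n) →* ℤˣ) (τ : Equiv.Perm (Fin n)) :
    permMat τ * isoProj N n χ A = ((χ τ : ℤˣ) : ℤ) • isoProj N n χ A := by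
  rw [isoProj, mul_smul_comm, smul_comm ((χ τ : ℤˣ) : ℤ), Finset.mul_sum]
  congr 1
  rw [Finset.smul_sum]
  refine Fintype.sum_equiv (Equiv.mulLeft τ) _ _ fun σ => ?_
  rw [mul_smul_comm, permMat_mul, Equiv.coe_mulLeft, smul_smul, map_mul, Units.val_mul,
    ← mul_assoc, ← Units.val_mul, Int.units_mul_self, Units.val_one, one_mul]

theorem mul_isoProj_of_forall (χ : Equiv.Perm (Fin n) →* ℤˣ)
    {Z : Mat[N, n] A}
    (h : ∀ τ, Z * permMat τ = ((χ τ : ℤˣ) : ℤ) • Z) : Z * isoProj N n χ A = Z := by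
  rw [isoProj, mul_smul_comm, Finset.mul_sum]
  have : ∀ σ : Equiv.Perm (Fin n), Z * ((χ σ : ℤˣ) : ℤ) • permMat σ = Z := fun σ => by
    rw [mul_smul_comm, h, smul_smul, ← Units.val_mul, Int.units_mul_self, Units.val_one, one_smul]
  rw [Finset.sum_congr rfl fun σ _ => this σ, Finset.sum_const, Finset.card_univ,
    Fintype.card_perm, Fintype.card_fin, ← Nat.cast_smul_eq_nsmul Scal, smul_smul]
  have e : (PowerSeries.C (1 / (n.factorial : ℂ)) * (n.factorial : Scal)) = 1 := by
    rw [← map_natCast PowerSeries.C, ← map_mul, one_div,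
      inv_mul_cancel₀ (by exact_mod_cast n.factorial_ne_zero), map_one]
  rw [e, one_smul]

theorem isoProj_sq (χ : Equiv.Perm (Fin n) →* ℤˣ) :
    isoProj N n χ A * isoProj N n χ A = isoProj N n χ A :=
  mul_isoProj_of_forall χ (isoProj_mul_permMat χ)

theorem commute_isoProj_of_forall (χ : Equiv.Perm (Fin n) →* ℤˣ)
    {Z : Mat[N, n] A} (h : ∀ τ, Commute (permMat τ) Z) :
    Commute (isoProj N n χ A) Z := by
  rw [Commute, SemiconjBy, isoProj, smul_mul_assoc, mul_smul_comm, Finset.sum_mul, Finset.mul_sum]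
  congr 1
  refine Finset.sum_congr rfl fun σ _ => ?_
  rw [smul_mul_assoc, mul_smul_comm, (h σ).eq]

theorem isoProj_apply_commute (χ : Equiv.Perm (Fin n) →* ℤˣ) (a b : Fin n → Fin N) (x : A) :
    Commute (isoProj N n χ A a b) x := by
  rw [isoProj, Matrix.smul_apply, Matrix.sum_apply]
  rw [Commute, SemiconjBy, smul_mul_assoc, mul_smul_comm, Finset.sum_mul, Finset.mul_sum]
  congr 1
  refine Finset.sum_congr rfl fun σ _ => ?_
  rw [Matrix.smul_apply, smul_mul_assoc, mul_smul_comm, permMat, Matrix.of_apply]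
  split_ifs <;> simp

variable {s : ℤ}

/-- If neighbouring matrices `X i` and `X j` satisfy the exchange relation with `1 + s P i j`, then
their product maps the image of a (anti-)symmetric `Z` to (anti-)symmetric tensors: on the image of
`Z` the factor `1 + s P i j` is multiplication by `2`. -/
theorem chain_mul_swap {P : Fin n → Fin n → Mat[N, n] A}
    (hPd : ∀ i j, P i j = permMat (Equiv.swap i j)) (hs : s * s = 1)
    {X : Fin n → Mat[N] A} (l : List (Fin n)) (hl : l.Nodup)
    (hc : l.IsChain fun i j => (1 + s • P i j) * (leg i (X i) * leg j (X j)) =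
      (leg j (X j) * leg i (X i)) * (1 + s • P i j)) :
    ∀ Z : Mat[N, n] A,
      (∀ i ∈ l, ∀ j ∈ l, i ≠ j → Z * P i j = s • Z) →
      l.IsChain fun i j => i ≠ j ∧ Z * (l.map fun k => leg k (X k)).prod * P i j =
        s • (Z * (l.map fun k => leg k (X k)).prod) := by
  induction l with
  | nil => intro _ _; exact List.IsChain.nil
  | cons a l ih =>
    intro Z hZ
    have hal := (List.nodup_cons.1 hl).1
    have hZ' : ∀ i ∈ l, ∀ j ∈ l, i ≠ j → Z * leg a (X a) * P i j = s • (Z * leg a (X a)) := by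
      intro i hi j hj hij
      rw [mul_assoc, hPd, ← (permMat_swap_comm_leg (k := a) (i := i) (j := j) (fun e => hal (e ▸ hi))
        (fun e => hal (e ▸ hj)) (X a)).eq, ← mul_assoc, ← hPd,
        hZ i (List.mem_cons_of_mem _ hi) j (List.mem_cons_of_mem _ hj) hij, smul_mul_assoc]
    have key := ih (List.nodup_cons.1 hl).2 hc.tail _ hZ'
    simp only [List.map_cons, List.prod_cons, ← mul_assoc]
    cases l with
    | nil => exact List.IsChain.singleton _
    | cons b l =>
      refine List.IsChain.cons_cons ⟨fun e => hal (e ▸ List.mem_cons_self), ?_⟩ key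
      rw [List.isChain_cons_cons] at hc
      have hab : a ≠ b := fun e => hal (e ▸ List.mem_cons_self)
      have hsq : P a b * P a b = 1 := by rw [hPd, permMat_swap_sq]
      set P0 := P a b with hP0
      have e0 : (1 + s • P0) * P0 = s • (1 + s • P0) := by
        rw [add_mul, smul_mul_assoc, hsq, smul_add, smul_smul, hs, one_smul, one_mul, add_comm]
      have e1 : (2 : ℤ) • Z = Z * (1 + s • P0) := by
        rw [mul_add, mul_one, mul_smul_comm, hZ a (by simp) b (by simp) hab, smul_smul, hs,
          one_smul, two_smul]
      have e2 : (2 : ℤ) • (Z * leg a (X a) * leg b (X b)) =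
          Z * (leg b (X b) * leg a (X a)) * (1 + s • P0) := by
        rw [mul_assoc, ← smul_mul_assoc, e1, mul_assoc, hc.1]
        simp only [mul_assoc]
      have e3 : (2 : ℤ) • (Z * leg a (X a) * leg b (X b) * P0) =
          (2 : ℤ) • (s • (Z * leg a (X a) * leg b (X b))) := by
        rw [← smul_mul_assoc, e2, mul_assoc, e0, mul_smul_comm, ← e2, smul_comm]
      have e4 : Z * leg a (X a) * leg b (X b) * P0 = s • (Z * leg a (X a) * leg b (X b)) := by
        have := congrArg ((PowerSeries.C (1 / 2 : ℂ) : Scal) • ·) e3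
        simp only [← Int.cast_smul_eq_zsmul Scal 2, smul_smul] at this
        have h2 : (PowerSeries.C (1 / 2 : ℂ) : Scal) * ((2 : ℤ) : Scal) = 1 := by
          rw [← map_intCast (PowerSeries.C (R := ℂ)), ← map_mul]; norm_num
        simpa only [h2, one_smul] using this
      have hcomm : Commute P0 ((l.map fun k => leg k (X k)).prod) := by
        refine Commute.list_prod_right _ _ fun x hx => ?_
        obtain ⟨k, hk, rfl⟩ := List.mem_map.1 hx
        rw [hP0, hPd]
        refine permMat_swap_comm_leg ?_ ?_ _
        · rintro rfl; exact hal (List.mem_cons_of_mem _ hk)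
        · rintro rfl
          exact (List.nodup_cons.1 (List.nodup_cons.1 hl).2).1 hk
      simp only [List.map_cons, List.prod_cons, ← mul_assoc]
      rw [mul_assoc _ _ P0, ← hcomm.eq, ← mul_assoc, e4, smul_mul_assoc]

end Symmetrizer

/-! ### Evaluation of power series -/

section Evaluation

open PowerSeries

variable {B C : Type*} [Ring B] [Ring C]

/-- A central power series whose powers tend to `0` coefficientwise, so that it can be substituted
into power series. -/
structure TopNil (σ : C⟦X⟧) : Prop where
  comm : ∀ x, Commute σ x
  nil : ∀ a, ∃ K, ∀ r, K ≤ r → ∀ b, b ≤ a → ∀ x, coeff b (x * σ ^ r) = 0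

/-- An exponent beyond which the powers of `σ` do not contribute to the coefficients up to `a`. -/
def TopNil.bound {σ : C⟦X⟧} (h : TopNil σ) (a : ℕ) : ℕ := (h.nil a).choose

theorem TopNil.bound_spec {σ : C⟦X⟧} (h : TopNil σ) {a r : ℕ} (hr : h.bound a ≤ r) {b : ℕ}
    (hb : b ≤ a) (x : C⟦X⟧) : coeff b (x * σ ^ r) = 0 :=
  (h.nil a).choose_spec r hr b hb x

theorem sum_range_coeff_eq {σ : C⟦X⟧} (φ : B →+* C⟦X⟧) (f : B⟦X⟧)
    {a K L : ℕ} (hK : ∀ r, K ≤ r → ∀ x, coeff a (x * σ ^ r) = 0)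
    (hL : ∀ r, L ≤ r → ∀ x, coeff a (x * σ ^ r) = 0) :
    ∑ r ∈ Finset.range K, coeff a (φ (coeff r f) * σ ^ r) =
      ∑ r ∈ Finset.range L, coeff a (φ (coeff r f) * σ ^ r) := by
  have key : ∀ K L : ℕ, K ≤ L → (∀ r, K ≤ r → ∀ x, coeff a (x * σ ^ r) = 0) →
      ∑ r ∈ Finset.range K, coeff a (φ (coeff r f) * σ ^ r) =
      ∑ r ∈ Finset.range L, coeff a (φ (coeff r f) * σ ^ r) := by
    intro K L h hK
    refine Finset.sum_subset (Finset.range_subset_range.2 h) fun r _ hr => ?_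
    exact hK r (by simpa using hr) _
  rcases le_total K L with h | h
  · exact key K L h hK
  · exact (key L K h hL).symm

/-- The coefficient of the substitution `∑ φ(f_r) σ^r`. -/
def evalFun (φ : B →+* C⟦X⟧) {σ : C⟦X⟧} (h : TopNil σ) (f : B⟦X⟧) :
    C⟦X⟧ :=
  mk fun a => ∑ r ∈ Finset.range (h.bound a), coeff a (φ (coeff r f) * σ ^ r)

theorem coeff_evalFun (φ : B →+* C⟦X⟧) {σ : C⟦X⟧} (h : TopNil σ)
    (f : B⟦X⟧) {a K : ℕ} (hK : ∀ r, K ≤ r → ∀ x, coeff a (x * σ ^ r) = 0) :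
    coeff a (evalFun φ h f) = ∑ r ∈ Finset.range K, coeff a (φ (coeff r f) * σ ^ r) := by
  rw [evalFun, coeff_mk]
  exact sum_range_coeff_eq φ f (fun r hr x => h.bound_spec hr le_rfl x) hK

theorem evalFun_mul (φ : B →+* C⟦X⟧) {σ : C⟦X⟧} (h : TopNil σ)
    (f g : B⟦X⟧) : evalFun φ h (f * g) = evalFun φ h f * evalFun φ h g := by
  ext a
  set K := h.bound a with hK
  have hb : ∀ b ≤ a, ∀ r, K ≤ r → ∀ x, coeff b (x * σ ^ r) = 0 :=
    fun b hb r hr x => h.bound_spec hr hb x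
  have e1 : ∀ f : B⟦X⟧, ∀ b ≤ a, coeff b (evalFun φ h f) =
      coeff b (∑ r ∈ Finset.range K, φ (coeff r f) * σ ^ r) := fun f b hb' => by
    rw [coeff_evalFun φ h f (hb b hb'), map_sum]
  have e2 : coeff a (evalFun φ h f * evalFun φ h g) =
      coeff a ((∑ r ∈ Finset.range K, φ (coeff r f) * σ ^ r) *
        ∑ r ∈ Finset.range K, φ (coeff r g) * σ ^ r) := by
    rw [coeff_mul, coeff_mul]
    refine Finset.sum_congr rfl fun p hp => ?_
    have := Finset.HasAntidiagonal.mem_antidiagonal.1 hp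
    rw [e1 f p.1 (by omega), e1 g p.2 (by omega)]
  have e3 : ∀ i j : ℕ, φ (coeff i f) * σ ^ i * (φ (coeff j g) * σ ^ j) =
      φ (coeff i f * coeff j g) * σ ^ (i + j) := fun i j => by
    rw [map_mul, pow_add, mul_assoc, ← mul_assoc (σ ^ i), ((h.comm _).pow_left i).eq]
    simp only [mul_assoc]
  have e5 : ∀ r, coeff a (φ (coeff r (f * g)) * σ ^ r) =
      ∑ p ∈ Finset.HasAntidiagonal.antidiagonal r,
        coeff a (φ (coeff p.1 f * coeff p.2 g) * σ ^ r) := fun r => by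
    rw [coeff_mul r f g, map_sum, Finset.sum_mul, map_sum]
  rw [e2, Finset.sum_mul_sum, coeff_evalFun φ h _ (hb a le_rfl), ← Finset.sum_product', map_sum,
    Finset.sum_congr rfl fun r _ => e5 r,
    Finset.sum_congr rfl fun p _ => congrArg (coeff a) (e3 p.1 p.2)]
  have e4 : ∑ p ∈ Finset.range K ×ˢ Finset.range K,
      coeff a (φ (coeff p.1 f * coeff p.2 g) * σ ^ (p.1 + p.2)) =
      ∑ p ∈ (Finset.range K ×ˢ Finset.range K).filter (fun p => p.1 + p.2 < K),
      coeff a (φ (coeff p.1 f * coeff p.2 g) * σ ^ (p.1 + p.2)) := by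
    rw [Finset.sum_filter]
    refine Finset.sum_congr rfl fun p _ => ?_
    split_ifs with hp
    · rfl
    · exact hb a le_rfl _ (not_lt.1 hp) _
  rw [e4]
  refine Eq.trans ?_ (Finset.sum_fiberwise_of_maps_to (t := Finset.range K)
    (g := fun p : ℕ × ℕ => p.1 + p.2)
    (fun p hp => Finset.mem_range.2 (Finset.mem_filter.1 hp).2) _)
  refine Finset.sum_congr rfl fun r hr => ?_
  have hr' := Finset.mem_range.1 hr
  refine Finset.sum_congr ?_ fun p hp => ?_
  · ext p
    simp only [Finset.HasAntidiagonal.mem_antidiagonal, Finset.mem_filter, Finset.mem_product, Finset.mem_range]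
    omega
  · rw [(Finset.mem_filter.1 hp).2]

/-- The substitution of `σ` for the variable, with `φ` applied to the coefficients. -/
def evalHom (φ : B →+* C⟦X⟧) {σ : C⟦X⟧} (h : TopNil σ) :
    B⟦X⟧ →+* C⟦X⟧ where
  toFun := evalFun φ h
  map_mul' := evalFun_mul φ h
  map_zero' := by ext a; simp [evalFun]
  map_add' f g := by
    ext a
    simp [evalFun, add_mul, Finset.sum_add_distrib]
  map_one' := by
    ext a
    rw [coeff_evalFun φ h 1 (K := h.bound a + 1)
      (fun r hr x => h.bound_spec (by omega) le_rfl x), Finset.sum_range_succ', Finset.sum_eq_zero]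
    · simp
    · intro r _
      simp [coeff_one]

theorem coeff_evalHom (φ : B →+* C⟦X⟧) {σ : C⟦X⟧} (h : TopNil σ)
    (f : B⟦X⟧) {a K : ℕ} (hK : ∀ r, K ≤ r → ∀ x, coeff a (x * σ ^ r) = 0) :
    coeff a (evalHom φ h f) = ∑ r ∈ Finset.range K, coeff a (φ (coeff r f) * σ ^ r) :=
  coeff_evalFun φ h f hK

theorem evalHom_C (φ : B →+* C⟦X⟧) {σ : C⟦X⟧} (h : TopNil σ) (b : B) :
    evalHom φ h (PowerSeries.C b) = φ b := by
  ext a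
  rw [coeff_evalHom φ h _ (K := h.bound a + 1)
    (fun r hr x => h.bound_spec (by omega) le_rfl x), Finset.sum_range_succ', Finset.sum_eq_zero]
  · simp
  · intro r _
    simp [coeff_C]

theorem evalHom_X (φ : B →+* C⟦X⟧) {σ : C⟦X⟧} (h : TopNil σ) :
    evalHom φ h X = σ := by
  ext a
  rw [coeff_evalHom φ h _ (K := h.bound a + 2)
    (fun r hr x => h.bound_spec (by omega) le_rfl x), Finset.sum_range_succ',
    Finset.sum_range_succ', Finset.sum_eq_zero]
  · simp [coeff_X]
  · intro r _
    simp [coeff_X]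

/-- A ring homomorphism of power series rings is determined by its values on constants and on the
variable, if the latter is topologically nilpotent. -/
theorem eq_evalHom (Φ : B⟦X⟧ →+* C⟦X⟧) (φ : B →+* C⟦X⟧)
    {σ : C⟦X⟧} (h : TopNil σ) (hC : ∀ b, Φ (PowerSeries.C b) = φ b) (hX : Φ X = σ) :
    Φ = evalHom φ h := by
  refine RingHom.ext fun f => ?_
  ext a
  obtain ⟨K, hK⟩ := h.nil a
  rw [coeff_evalHom φ h f fun r hr x => hK r hr a le_rfl x]
  have e : ∀ K : ℕ, ∃ g, f = ∑ r ∈ Finset.range K, PowerSeries.C (coeff r f) * X ^ r + g * X ^ K := by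
    intro K
    refine ⟨mk fun i => coeff (i + K) f, ?_⟩
    ext i
    rw [map_add, map_sum, coeff_mul_X_pow']
    simp only [coeff_C_mul, coeff_X_pow]
    split_ifs with hi
    · rw [Finset.sum_eq_zero, coeff_mk, zero_add, Nat.sub_add_cancel hi]
      intro r hr
      rw [if_neg (by have := Finset.mem_range.1 hr; omega), mul_zero]
    · rw [Finset.sum_eq_single i]
      · simp
      · intro r _ hr; rw [if_neg (Ne.symm hr), mul_zero]
      · intro hi'; exact absurd (Finset.mem_range.2 (by omega)) hi'
  obtain ⟨g, hg⟩ := e K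
  conv_lhs => rw [hg]
  rw [map_add, map_sum, map_mul, map_pow, hX, map_add, hK K le_rfl a le_rfl, add_zero, map_sum]
  refine Finset.sum_congr rfl fun r _ => ?_
  rw [map_mul, map_pow, hC, hX]

theorem ringHom_ext_of_topNil {Φ Ψ : B⟦X⟧ →+* C⟦X⟧} (h : TopNil (Φ X))
    (hC : ∀ b, Φ (PowerSeries.C b) = Ψ (PowerSeries.C b)) (hX : Φ X = Ψ X) : Φ = Ψ := by
  rw [eq_evalHom Φ (Φ.comp PowerSeries.C) h (fun _ => rfl) rfl,
    eq_evalHom Ψ (Φ.comp PowerSeries.C) h (fun b => (hC b).symm) hX.symm]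

theorem commute_of_coeff {f : C⟦X⟧} (h : ∀ a x, Commute (coeff a f) x)
    (g : C⟦X⟧) : Commute f g := by
  ext a
  rw [coeff_mul, coeff_mul, ← Finset.Nat.sum_antidiagonal_swap]
  exact Finset.sum_congr rfl fun p _ => (h _ _).eq

/-! ### Fractional linear and affine substitutions -/

/-- The power series `(ε x / (1 + ε κ x)) ^ r`. With `x = u⁻¹` this is `(ε u + κ)^{-r}`. -/
def moebPow (ε : ℤ) (κ : C) (r : ℕ) : C⟦X⟧ :=
  mk fun a => if r ≤ a then (ε ^ a * Ring.choose (-(r : ℤ)) (a - r)) • κ ^ (a - r) else 0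

theorem moebPow_zero (ε : ℤ) (κ : C) : moebPow ε κ 0 = 1 := by
  ext a
  rw [moebPow, coeff_mk, coeff_one, if_pos (Nat.zero_le a)]
  rcases Nat.eq_zero_or_pos a with h | h
  · subst h; simp
  · rw [if_neg h.ne', Nat.cast_zero, neg_zero, Nat.sub_zero, Ring.choose_zero_pos ℤ h]
    simp

theorem moebPow_succ_mul (ε : ℤ) (κ : C) (r : ℕ) :
    moebPow ε κ (r + 1) * (1 + PowerSeries.C (ε • κ) * X) =
      ε • (X * moebPow ε κ r) := by
  ext a
  rw [mul_add, mul_one, ← mul_assoc, map_add]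
  cases a with
  | zero => simp [moebPow]
  | succ a =>
    rw [coeff_succ_mul_X, coeff_mul_C, map_zsmul, coeff_succ_X_mul]
    simp only [moebPow, coeff_mk]
    by_cases h : r ≤ a
    · obtain ⟨d, rfl⟩ := Nat.exists_eq_add_of_le h
      rw [if_pos (by omega), if_pos h, show r + d + 1 - (r + 1) = d by omega,
        show r + d - r = d by omega]
      cases d with
      | zero =>
        rw [if_neg (by omega)]
        simp [pow_succ', mul_smul]
      | succ d =>
        rw [if_pos (by omega), show r + (d + 1) - (r + 1) = d by omega]
        have e : Ring.choose (-(r : ℤ)) (d + 1) =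
            Ring.choose (-((r + 1 : ℕ) : ℤ)) d + Ring.choose (-((r + 1 : ℕ) : ℤ)) (d + 1) := by
          rw [← Ring.choose_succ_succ]
          congr 1
          push_cast; ring
        rw [e, smul_mul_smul_comm, ← pow_succ, ← mul_smul, ← add_smul]
        congr 1
        ring
    · rw [if_neg (by omega), if_neg (by omega), if_neg h]
      simp

theorem moebPow_comm (ε : ℤ) {κ : C} (hκ : ∀ x, Commute κ x) (r : ℕ) (f : C⟦X⟧) :
    Commute (moebPow ε κ r) f := by
  refine commute_of_coeff (fun a x => ?_) f
  rw [moebPow, coeff_mk]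
  split_ifs
  · exact ((hκ x).pow_left _).smul_left _
  · exact Commute.zero_left _

theorem moebPow_eq (ε : ℤ) {κ : C} (hκ : ∀ x, Commute κ x) (r : ℕ) :
    moebPow ε κ r = moebPow ε κ 1 ^ r := by
  induction r with
  | zero => rw [moebPow_zero, pow_zero]
  | succ r ih =>
    have hu : IsUnit (1 + PowerSeries.C (ε • κ) * (X : C⟦X⟧)) := by
      rw [isUnit_iff_constantCoeff]
      simp
    refine hu.mul_left_injective ?_
    change moebPow ε κ (r + 1) * _ = moebPow ε κ 1 ^ (r + 1) * _
    have h1 := moebPow_succ_mul ε κ 0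
    rw [moebPow_zero, mul_one] at h1
    rw [moebPow_succ_mul, pow_succ, mul_assoc, h1, ih, mul_smul_comm]
    congr 1
    exact commute_X_pow _ 1 |>.eq |> fun h => by simpa using h.symm

theorem coeff_mul_moebPow_eq_zero (ε : ℤ) {κ : C} (hκ : ∀ x, Commute κ x) {a r : ℕ} (h : a < r)
    (f : C⟦X⟧) : coeff a (f * moebPow ε κ 1 ^ r) = 0 := by
  rw [← moebPow_eq ε hκ, coeff_mul]
  refine Finset.sum_eq_zero fun p hp => ?_
  have := Finset.HasAntidiagonal.mem_antidiagonal.1 hp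
  rw [moebPow, coeff_mk, if_neg (by omega), mul_zero]

theorem topNil_moebPow (ε : ℤ) {κ : C} (hκ : ∀ x, Commute κ x) : TopNil (moebPow ε κ 1) where
  comm := moebPow_comm ε hκ 1
  nil a := ⟨a + 1, fun r hr b hb f => coeff_mul_moebPow_eq_zero ε hκ (by omega) f⟩

/-- The substitution `u ↦ ε u + κ` in power series in `u⁻¹`. -/
def moebHom (ε : ℤ) (κ : C) (hκ : ∀ x, Commute κ x) : C⟦X⟧ →+* C⟦X⟧ :=
  evalHom PowerSeries.C (topNil_moebPow ε hκ)

theorem coeff_moebHom (ε : ℤ) (κ : C) (hκ : ∀ x, Commute κ x) (f : C⟦X⟧) (a : ℕ) :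
    coeff a (moebHom ε κ hκ f) = ∑ r ∈ Finset.range (a + 1),
      (ε ^ a * Ring.choose (-(r : ℤ)) (a - r)) • (κ ^ (a - r) * coeff r f) := by
  rw [moebHom, coeff_evalHom _ _ f (K := a + 1)
    (fun r hr x => coeff_mul_moebPow_eq_zero ε hκ (by omega) x)]
  refine Finset.sum_congr rfl fun r hr => ?_
  have := Finset.mem_range.1 hr
  rw [← moebPow_eq ε hκ, coeff_C_mul, moebPow, coeff_mk, if_pos (by omega), mul_smul_comm,
    ((hκ _).pow_left _).eq]

theorem moebHom_C (ε : ℤ) (κ : C) (hκ : ∀ x, Commute κ x) (b : C) :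
    moebHom ε κ hκ (PowerSeries.C b) = PowerSeries.C b := evalHom_C _ _ b

theorem moebHom_X (ε : ℤ) (κ : C) (hκ : ∀ x, Commute κ x) :
    moebHom ε κ hκ X * (1 + PowerSeries.C (ε • κ) * X) = ε • X := by
  rw [moebHom, evalHom_X]
  have := moebPow_succ_mul ε κ 0
  rwa [moebPow_zero, mul_one] at this

/-- The series `ε u + κ`. -/
def affX (ε : ℤ) (κ : C) : C⟦X⟧ := ε • X + PowerSeries.C κ

theorem affX_comm (ε : ℤ) {κ : C} (hκ : ∀ x, Commute κ x) (f : C⟦X⟧) :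
    Commute (affX ε κ) f := by
  refine commute_of_coeff (fun a x => ?_) f
  rw [affX, map_add, map_zsmul, coeff_X, coeff_C]
  refine Commute.add_left (Commute.smul_left ?_ _) ?_
  · split_ifs
    · exact Commute.one_left _
    · exact Commute.zero_left _
  · split_ifs
    · exact hκ x
    · exact Commute.zero_left _

theorem coeff_affX_pow (ε : ℤ) {κ : C} (hκ : ∀ x, Commute κ x) (r a : ℕ) :
    coeff a (affX ε κ ^ r) = (ε ^ a * (r.choose a : ℤ)) • κ ^ (r - a) := by
  have hc : Commute (ε • (X : C⟦X⟧)) (PowerSeries.C κ) :=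
    (Commute.symm <| commute_of_coeff (fun a x => by
      rw [coeff_C]; split_ifs; exacts [hκ x, Commute.zero_left _]) _)
  rw [affX, hc.add_pow, map_sum, Finset.sum_eq_single a]
  · rw [smul_pow, smul_mul_assoc, smul_mul_assoc, map_zsmul, ← map_pow, ← nsmul_eq_mul', map_nsmul,
      coeff_mul_C, coeff_X_pow_self, one_mul, mul_smul, natCast_zsmul]
  · intro b _ hb
    rw [smul_pow, smul_mul_assoc, smul_mul_assoc, map_zsmul, ← map_pow, ← nsmul_eq_mul', map_nsmul,
      coeff_mul_C, coeff_X_pow, if_neg (Ne.symm hb), zero_mul, smul_zero, smul_zero]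
  · intro ha
    rw [Nat.choose_eq_zero_of_lt (by simpa using ha), Nat.cast_zero, mul_zero, map_zero]

theorem coeff_mul_affX_pow_eq_zero (ε : ℤ) {κ : C} (hκ : ∀ x, Commute κ x) {m : ℕ}
    (hm : κ ^ m = 0) {a r : ℕ} (h : a + m ≤ r) (f : C⟦X⟧) :
    coeff a (f * affX ε κ ^ r) = 0 := by
  rw [coeff_mul]
  refine Finset.sum_eq_zero fun p hp => ?_
  have := Finset.HasAntidiagonal.mem_antidiagonal.1 hp
  rw [coeff_affX_pow ε hκ, pow_eq_zero_of_le (by omega) hm, smul_zero, mul_zero]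

theorem topNil_affX (ε : ℤ) {κ : C} (hκ : ∀ x, Commute κ x) {m : ℕ} (hm : κ ^ m = 0) :
    TopNil (affX ε κ) where
  comm := affX_comm ε hκ
  nil a := ⟨a + m, fun r hr b hb f => coeff_mul_affX_pow_eq_zero ε hκ hm (by omega) f⟩

/-- The substitution `u ↦ ε u + κ`, for nilpotent `κ`, in power series in `u`. -/
def affHom (ε : ℤ) (κ : C) (hκ : ∀ x, Commute κ x) {m : ℕ} (hm : κ ^ m = 0) :
    C⟦X⟧ →+* C⟦X⟧ :=
  evalHom PowerSeries.C (topNil_affX ε hκ hm)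

theorem coeff_affHom (ε : ℤ) (κ : C) (hκ : ∀ x, Commute κ x) {m : ℕ} (hm : κ ^ m = 0)
    (f : C⟦X⟧) (a : ℕ) :
    coeff a (affHom ε κ hκ hm f) = ∑ s ∈ Finset.range m,
      (ε ^ a * ((a + s).choose a : ℤ)) • (κ ^ s * coeff (a + s) f) := by
  rw [affHom, coeff_evalHom _ _ f (K := a + m)
    (fun r hr x => coeff_mul_affX_pow_eq_zero ε hκ hm (by omega) x), Finset.sum_range_add,
    Finset.sum_eq_zero, zero_add]
  · refine Finset.sum_congr rfl fun s _ => ?_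
    rw [coeff_C_mul, coeff_affX_pow ε hκ, mul_smul_comm, Nat.add_sub_cancel_left,
      ((hκ _).pow_left _).eq]
  · intro r hr
    rw [coeff_C_mul, coeff_affX_pow ε hκ, Nat.choose_eq_zero_of_lt (Finset.mem_range.1 hr)]
    simp

theorem affHom_C (ε : ℤ) (κ : C) (hκ : ∀ x, Commute κ x) {m : ℕ} (hm : κ ^ m = 0) (b : C) :
    affHom ε κ hκ hm (PowerSeries.C b) = PowerSeries.C b := evalHom_C _ _ b

theorem affHom_X (ε : ℤ) (κ : C) (hκ : ∀ x, Commute κ x) {m : ℕ} (hm : κ ^ m = 0) :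
    affHom ε κ hκ hm X = ε • X + PowerSeries.C κ := evalHom_X _ _

/-! ### Exchanging the variables -/

/-- The exchange of the two variables of a power series with power series coefficients. -/
def swapVar : C⟦X⟧⟦X⟧ →+* C⟦X⟧⟦X⟧ where
  toFun f := mk fun a => mk fun b => coeff a (coeff b f)
  map_zero' := by ext; simp
  map_one' := by
    ext a b
    simp only [coeff_mk, coeff_one, apply_ite (coeff a), apply_ite (coeff b), map_zero, coeff_one]
    split_ifs <;> rfl
  map_add' f g := by ext; simp
  map_mul' f g := by
    ext a b
    simp only [coeff_mk, coeff_mul, map_sum]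
    rw [Finset.sum_comm]

theorem coeff_swapVar (f : C⟦X⟧⟦X⟧) (a b : ℕ) :
    coeff b (coeff a (swapVar f)) = coeff a (coeff b f) := by
  simp [swapVar]

theorem swapVar_C (f : C⟦X⟧) : swapVar (PowerSeries.C f) = map PowerSeries.C f := by
  ext a b
  rw [coeff_swapVar, coeff_map, coeff_C, coeff_C]
  split_ifs <;> simp

theorem swapVar_map_C (f : C⟦X⟧) : swapVar (map PowerSeries.C f) = PowerSeries.C f := by
  ext a b
  rw [coeff_swapVar, coeff_map, coeff_C, coeff_C]
  split_ifs <;> simp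

end Evaluation

/-! ### The normalizing series -/

section Normalizing

open PowerSeries

/-- A series in `u⁻¹` which is invariant under `u ↦ u + N` is constant. -/
theorem coeff_shift_invariant {N : ℕ} (hN : N ≠ 0) {f : ℂ⟦X⟧}
    (hf : moebHom 1 (N : ℂ) (fun _ => Commute.all _ _) f = f) : f = PowerSeries.C (coeff 0 f) := by
  have key : ∀ k : ℕ, coeff (k + 1) f = 0 := by
    intro k
    induction k using Nat.strong_induction_on with
    | _ k ih =>
      have h1 := congrArg (coeff (k + 2)) hf
      rw [coeff_moebHom, Finset.sum_range_succ, Finset.sum_range_succ, Finset.sum_eq_zero] at h1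
      · rw [show k + 2 - (k + 1) = 1 by omega, Nat.sub_self, Ring.choose_one_right,
          Ring.choose_zero_right] at h1
        simp only [one_pow, one_mul, pow_one, pow_zero, one_smul, zero_add, zsmul_eq_mul] at h1
        -- If `f` is constant up to `u ^ (-k)`, then the shift changes the coefficient of `u ^ (-k
        -- - 2)` by `-(k + 1) N f_{k+1}`.
        have h2 : ((k : ℂ) + 1) * N ≠ 0 :=
          mul_ne_zero (by exact_mod_cast Nat.succ_ne_zero k) (by exact_mod_cast hN)
        have h3 : ((k : ℂ) + 1) * N * coeff (k + 1) f = 0 := by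
          push_cast at h1
          linear_combination -h1
        exact (mul_eq_zero.1 h3).resolve_left h2
      · intro r hr
        have hr' := Finset.mem_range.1 hr
        cases r with
        | zero =>
          rw [Nat.cast_zero, neg_zero, Ring.choose_zero_pos ℤ (by omega)]
          simp
        | succ r => rw [ih r (by omega), mul_zero, smul_zero]
  ext k
  cases k with
  | zero => simp
  | succ k => rw [key, coeff_C, if_neg (by omega)]

/-- The series `g`, in the variable `u⁻¹`. -/
def gSer (N : ℕ) : ℂ⟦X⟧ := mk (gCoeff N)

/-- The defining equation `g(u + N) = g(u) (1 - u⁻²)`. -/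
theorem moebHom_gSer {N : ℕ} (hN : N ≠ 0) :
    moebHom 1 (N : ℂ) (fun _ => Commute.all _ _) (gSer N) = gSer N * (1 - X ^ 2) := by
  ext m
  rw [coeff_moebHom, mul_sub, mul_one, map_sub, coeff_mul_X_pow']
  simp only [gSer, coeff_mk]
  rw [← gCoeff_spec N hN m]
  refine Finset.sum_congr rfl fun r _ => ?_
  rw [one_pow, one_mul, zsmul_eq_mul, mul_assoc]

/-- `g(u) g(-u) (1 - u⁻²) = 1`: by the defining equation the left hand side is invariant under `u ↦
u + N`, hence constant. -/
theorem gSer_unitarity {N : ℕ} (hN : N ≠ 0) :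
    gSer N * rescale (-1) (gSer N) * (1 - X ^ 2) = 1 := by
  set hc : ∀ x : ℂ, Commute (N : ℂ) x := fun _ => Commute.all _ _
  set θ := moebHom 1 (N : ℂ) hc with hθ
  set ρ : ℂ⟦X⟧ →+* ℂ⟦X⟧ := rescale (-1) with hρ
  have hX : θ X * (1 + PowerSeries.C (N : ℂ) * X) = X := by
    have := moebHom_X 1 (N : ℂ) hc
    simpa using this
  have hρX : ρ X = -X := by
    rw [hρ, rescale_X]; simp
  have hC : ∀ b, θ (PowerSeries.C b) = PowerSeries.C b := fun b => moebHom_C 1 _ hc b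
  have hρC : ∀ b, ρ (PowerSeries.C b) = PowerSeries.C b := fun b => by
    ext k
    rw [hρ, coeff_rescale, coeff_C]
    split_ifs with h
    · subst h; simp
    · simp
  have h1 : θ (ρ (θ X)) * (1 - PowerSeries.C (N : ℂ) * θ X) = -θ X := by
    have := congrArg (fun f => θ (ρ f)) hX
    simp only [map_mul, map_add, map_one, hC, hρC, hρX, map_neg] at this
    linear_combination this
  have h2 : θ (ρ (θ X)) = -X := by
    linear_combination (1 + PowerSeries.C (N : ℂ) * X) * h1 +
      (-1 + θ (ρ (θ X)) * PowerSeries.C (N : ℂ)) * hX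
  have hneg : TopNil (-X : ℂ⟦X⟧) := by
    have := topNil_affX (-1) (κ := (0 : ℂ)) (fun _ => Commute.all _ _) (m := 1) (by simp)
    have e : affX (-1) (0 : ℂ) = -X := by simp [affX]
    rwa [e] at this
  -- The shift `θ` and the reflection `ρ : u ↦ -u` satisfy `θ ρ θ = ρ`.
  have h3 : (θ.comp ρ).comp θ = ρ := by
    refine ringHom_ext_of_topNil (by simpa [h2] using hneg) (fun b => ?_) ?_
    · simp [hC, hρC]
    · simp [h2, hρX]
  have h4 := moebHom_gSer hN
  rw [← hθ] at h4
  have h5 : ρ (gSer N) = θ (ρ (gSer N)) * (1 - θ X ^ 2) := by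
    conv_lhs => rw [← h3]
    simp only [RingHom.comp_apply]
    rw [h4]
    simp only [map_mul, map_sub, map_one, map_pow, hρX, map_neg]
    ring
  have h6 : θ (gSer N * ρ (gSer N) * (1 - X ^ 2)) = gSer N * ρ (gSer N) * (1 - X ^ 2) := by
    simp only [map_mul, map_sub, map_one, map_pow]
    rw [mul_assoc, ← h5, h4]
    ring
  rw [coeff_shift_invariant hN h6]
  have e0 : constantCoeff (ρ (gSer N)) = 1 := by
    rw [← coeff_zero_eq_constantCoeff_apply, hρ, coeff_rescale]
    simp [gSer, gCoeff]
  have e1 : constantCoeff (gSer N) = 1 := by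
    rw [← coeff_zero_eq_constantCoeff_apply]
    simp [gSer, gCoeff]
  rw [coeff_zero_eq_constantCoeff_apply, map_mul (constantCoeff (R := ℂ)),
    map_mul (constantCoeff (R := ℂ)), e0, e1]
  simp

/-- The value `g(ξ⁻¹)` for `ξ` with `ξ ^ m = 0`; it does not depend on `m`. -/
def gEval (N m : ℕ) {R : Type*} [Ring R] [Algebra Scal R] (ξ : R) : R :=
  ∑ k ∈ Finset.range m, (PowerSeries.C (gCoeff N k) : Scal) • ξ ^ k

variable {R : Type*} [Ring R] [Algebra Scal R] {N m : ℕ}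

theorem gEval_map {R' : Type*} [Ring R'] [Algebra Scal R'] (Φ : R →+* R')
    (hΦ : ∀ s : Scal, Φ (algebraMap Scal R s) = algebraMap Scal R' s) (ξ : R) :
    Φ (gEval N m ξ) = gEval N m (Φ ξ) := by
  simp only [gEval, map_sum, Algebra.smul_def, map_mul, hΦ, map_pow]

theorem gEval_comm {ξ : R} (hξ : ∀ x, Commute ξ x) (x : R) : Commute (gEval N m ξ) x :=
  Commute.sum_left _ _ _ fun _ _ => ((hξ x).pow_left _).smul_left _

theorem topNil_C {R : Type*} [Ring R] {m : ℕ} {ξ : R} (hξ : ∀ x, Commute ξ x) (hm : ξ ^ m = 0) :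
    TopNil (PowerSeries.C ξ) where
  comm := commute_of_coeff fun a x => by
    rw [coeff_C]; split_ifs; exacts [hξ x, Commute.zero_left _]
  nil a := ⟨m, fun r hr b _ x => by
    rw [← map_pow, pow_eq_zero_of_le hr hm, map_zero, mul_zero, map_zero]⟩

/-- The substitution of `ξ` in power series over `ℂ`, with constants as values. -/
def nilHom {ξ : R} (hξ : ∀ x, Commute ξ x) (hm : ξ ^ m = 0) :
    ℂ⟦X⟧ →+* R⟦X⟧ :=
  evalHom ((PowerSeries.C.comp (algebraMap Scal R)).comp PowerSeries.C) (topNil_C hξ hm)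

theorem nilHom_apply {ξ : R} (hξ : ∀ x, Commute ξ x) (hm : ξ ^ m = 0) (f : ℂ⟦X⟧) :
    nilHom hξ hm f =
      PowerSeries.C (∑ k ∈ Finset.range m, (PowerSeries.C (coeff k f) : Scal) • ξ ^ k) := by
  ext a
  rw [nilHom, coeff_evalHom _ _ f (K := m) (fun r hr x => by
    rw [← map_pow, pow_eq_zero_of_le hr hm, map_zero, mul_zero, map_zero]), map_sum, map_sum]
  refine Finset.sum_congr rfl fun k _ => ?_
  rw [← map_pow, RingHom.comp_apply, RingHom.comp_apply, ← map_mul, Algebra.smul_def]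

theorem nilHom_gSer {ξ : R} (hξ : ∀ x, Commute ξ x) (hm : ξ ^ m = 0) :
    nilHom hξ hm (gSer N) = PowerSeries.C (gEval N m ξ) := by
  rw [nilHom_apply]
  simp [gSer, gEval]

theorem nilHom_X {ξ : R} (hξ : ∀ x, Commute ξ x) (hm : ξ ^ m = 0) :
    nilHom hξ hm X = PowerSeries.C ξ := evalHom_X _ _

/-- `g(u) g(-u) (1 - u⁻²) = 1`. -/
theorem gEval_unitarity (hN : N ≠ 0) {ξ : R} (hξ : ∀ x, Commute ξ x) (hm : ξ ^ m = 0) :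
    gEval N m ξ * gEval N m (-ξ) * (1 - ξ ^ 2) = 1 := by
  have h1 := congrArg (nilHom hξ hm) (gSer_unitarity hN)
  have h2 : nilHom hξ hm (rescale (-1) (gSer N)) = PowerSeries.C (gEval N m (-ξ)) := by
    rw [nilHom_apply, gEval]
    congr 1
    refine Finset.sum_congr rfl fun k _ => ?_
    rw [coeff_rescale, gSer, coeff_mk, neg_pow ξ, Algebra.smul_def, Algebra.smul_def, map_mul, map_mul,
      map_pow]
    simp only [map_neg, map_one, map_pow, one_pow, mul_one]
    rw [((Commute.neg_one_left (_ : R)).pow_left k).eq, mul_assoc,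
      ((Commute.neg_one_left (_ : R)).pow_left k).eq]
  simp only [map_mul, map_sub, map_one, map_pow, h2, nilHom_gSer, nilHom_X] at h1
  refine PowerSeries.C_injective ?_
  simpa using h1

/-- `g(u + N) = g(u) (1 - u⁻²)`. -/
theorem gEval_shift (hN : N ≠ 0) {ξ ξ' : R} (hξ : ∀ x, Commute ξ x) (hm : ξ ^ m = 0)
    (hξ' : ∀ x, Commute ξ' x) (hm' : ξ' ^ m = 0) (h : ξ' - ξ = (N : R) * (ξ * ξ')) :
    gEval N m ξ = gEval N m ξ' * (1 - ξ' ^ 2) := by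
  have e : (nilHom hξ' hm').comp (moebHom 1 (N : ℂ) (fun _ => Commute.all _ _)) = nilHom hξ hm := by
    have hCC : ∀ b, nilHom hξ' hm' (PowerSeries.C b) = nilHom hξ hm (PowerSeries.C b) := fun b => by
      rw [nilHom, nilHom, evalHom_C, evalHom_C]
    have hX : ((nilHom hξ' hm').comp (moebHom 1 (N : ℂ) (fun _ => Commute.all _ _))) X =
        nilHom hξ hm X := by
      have h1 := congrArg (nilHom hξ' hm') (moebHom_X 1 (N : ℂ) (fun _ => Commute.all _ _))
      simp only [one_smul, map_mul, map_add, map_one, map_natCast, nilHom_X] at h1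
      have hn : IsNilpotent ((N : R⟦X⟧) * PowerSeries.C ξ') :=
        ⟨m, by
          rw [(Nat.cast_commute N _).mul_pow, ← map_pow, hm', map_zero, mul_zero]⟩
      refine hn.isUnit_one_add.mul_left_injective ?_
      simp only [RingHom.comp_apply, nilHom_X]
      rw [h1, mul_add, mul_one, ← map_natCast (PowerSeries.C : R →+* _), ← map_mul, ← map_mul,
        ← map_add]
      congr 1
      rw [← mul_assoc, (hξ _).eq, mul_assoc, ← h, add_sub_cancel]
    refine ringHom_ext_of_topNil (by rw [hX, nilHom_X]; exact topNil_C hξ hm) (fun b => ?_) hX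
    rw [RingHom.comp_apply, moebHom_C, hCC]
  have h1 := congrArg (nilHom hξ' hm') (moebHom_gSer hN)
  rw [← RingHom.comp_apply, e] at h1
  simp only [map_mul, map_sub, map_one, map_pow, nilHom_gSer, nilHom_X] at h1
  refine PowerSeries.C_injective ?_
  simpa using h1

end Normalizing

/-! ### The normalized `R`-matrix with an auxiliary factor -/

section RBar

variable {N m : ℕ} {R : Type*} [Ring R] [Algebra Scal R]

/-- The normalized `R`-matrix `g(ξ⁻¹) (1 - ξ P)`, where one of the two factors is auxiliary. -/
def rb (N m : ℕ) {R : Type*} [Ring R] [Algebra Scal R] (ξ : R) :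
    Mat[N] (Mat[N] R) :=
  sc2 (gEval N m ξ) - sc2 (gEval N m ξ * ξ) * swapMat N R

theorem sc2_neg {R : Type*} [Ring R] (z : R) : (sc2 (-z) : Mat[N] _) = -sc2 z := by
  change Matrix.scalar _ (Matrix.scalar _ (-z)) = _
  rw [map_neg, map_neg]

theorem sc2_sub {R : Type*} [Ring R] (z w : R) :
    (sc2 (z - w) : Mat[N] _) = sc2 z - sc2 w := by
  change Matrix.scalar _ (Matrix.scalar _ (z - w)) = _
  rw [map_sub, map_sub]

theorem sc2_one {R : Type*} [Ring R] : (sc2 (1 : R) : Mat[N] _) = 1 := by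
  change Matrix.scalar _ (Matrix.scalar _ (1 : R)) = _
  rw [map_one, map_one]

theorem sc2_comm {R : Type*} [Ring R] {z : R} (hz : ∀ x, Commute z x)
    (M : Mat[N] (Mat[N] R)) : Commute (sc2 z) M :=
  Matrix.scalar_commute _ (fun M' => Matrix.scalar_commute _ hz M') M

/-- Unitarity of the normalized `R`-matrix. -/
theorem rb_mul_rb_neg (hN : N ≠ 0) {ξ : R} (hξ : ∀ x, Commute ξ x) (hm : ξ ^ m = 0) :
    rb N m ξ * rb N m (-ξ) = 1 := by
  have hξ' : ∀ x, Commute (-ξ) x := fun x => (hξ x).neg_left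
  have hg := gEval_comm (N := N) (m := m) hξ
  have hg' := gEval_comm (N := N) (m := m) hξ'
  have e1 : rb N m ξ = sc2 (gEval N m ξ) * (1 - sc2 ξ * swapMat N R) := by
    rw [rb, mul_sub, mul_one, ← mul_assoc, ← map_mul, ← map_mul]
  have e2 : rb N m (-ξ) = sc2 (gEval N m (-ξ)) * (1 + sc2 ξ * swapMat N R) := by
    rw [rb, mul_add, mul_one, ← mul_assoc, ← map_mul, ← map_mul]
    rw [mul_neg, sc2_neg, neg_mul, sub_neg_eq_add]
  have e3 : (1 - sc2 ξ * swapMat N R) * (1 + sc2 ξ * swapMat N R) = sc2 (1 - ξ ^ 2) := by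
    have : sc2 ξ * swapMat N R * (sc2 ξ * swapMat N R) = sc2 (ξ ^ 2) := by
      rw [mul_assoc, ← mul_assoc (swapMat N R), ← (sc2_comm hξ _).eq, mul_assoc, swapMat_sq,
        mul_one, ← map_mul, ← map_mul, sq]
    rw [sub_mul, one_mul, mul_add, mul_one, this]
    rw [sc2_sub, sc2_one]
    abel
  rw [e1, e2, mul_assoc, ← mul_assoc (1 - _), ← (sc2_comm hg' _).eq, mul_assoc, e3, ← mul_assoc,
    ← map_mul, ← map_mul, ← map_mul, ← map_mul, gEval_unitarity hN hξ hm, map_one, map_one]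

theorem rb_neg_mul_rb (hN : N ≠ 0) {ξ : R} (hξ : ∀ x, Commute ξ x) (hm : ξ ^ m = 0) :
    rb N m (-ξ) * rb N m ξ = 1 := by
  have := rb_mul_rb_neg (m := m) hN (fun x => (hξ x).neg_left) (ξ := -ξ)
    (by rw [neg_pow, hm, mul_zero])
  rwa [neg_neg] at this

/-- The relation `R̄(ξ) X₁ Y₂ = Y₂ X₁ R̄(ξ')`. -/
def BarRel (m : ℕ) (ξ ξ' : R) (X Y : Mat[N] R) : Prop :=
  MRel (gEval N m ξ) (gEval N m ξ * ξ) (gEval N m ξ') (gEval N m ξ' * ξ') X Y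

theorem BarRel.map {R' : Type*} [Ring R'] [Algebra Scal R'] (Φ : R →+* R')
    (hΦ : ∀ s : Scal, Φ (algebraMap Scal R s) = algebraMap Scal R' s)
    {ξ ξ' : R} {X Y : Mat[N] R} (h : BarRel m ξ ξ' X Y) :
    BarRel m (Φ ξ) (Φ ξ') (X.map Φ) (Y.map Φ) := by
  have := MRel.map Φ h
  simp only [map_mul, gEval_map Φ hΦ] at this
  exact this

theorem BarRel.aux {ξ ξ' : R} (hξ' : ∀ x, Commute ξ' x) {X Y : Mat[N] R}
    (h : BarRel m ξ ξ' X Y) :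
    rb N m ξ * (liftMat X * Matrix.scalar _ Y) = Matrix.scalar _ Y * liftMat X * rb N m ξ' := by
  have hc : ∀ x, Commute (gEval N m ξ' * ξ') x := fun x =>
    (gEval_comm hξ' x).mul_left (hξ' x)
  have := MRel.aux h
  rwa [← (sc2_comm hc _).eq] at this

theorem BarRel.aux_swap (hN : N ≠ 0) {ξ ξ' : R} (hξ : ∀ x, Commute ξ x) (hξ' : ∀ x, Commute ξ' x)
    (hm : ξ ^ m = 0) (hm' : ξ' ^ m = 0) {X Y : Mat[N] R}
    (h : BarRel m ξ ξ' X Y) :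
    rb N m (-ξ) * (liftMat Y * Matrix.scalar _ X) =
      Matrix.scalar _ X * liftMat Y * rb N m (-ξ') := by
  have hc : ∀ x, Commute (gEval N m ξ' * ξ') x := fun x =>
    (gEval_comm hξ' x).mul_left (hξ' x)
  have h1 := MRel.aux_swap h
  rw [← (sc2_comm hc _).eq] at h1
  change rb N m ξ * _ = _ * rb N m ξ' at h1
  have h2 : rb N m (-ξ) * (rb N m ξ * (Matrix.scalar _ X * liftMat Y)) * rb N m (-ξ') =
      rb N m (-ξ) * (liftMat Y * Matrix.scalar _ X * rb N m ξ') * rb N m (-ξ') := by rw [h1]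
  rw [← mul_assoc, rb_neg_mul_rb hN hξ hm, one_mul, mul_assoc (rb N m (-ξ)), mul_assoc _ (rb N m ξ'),
    rb_mul_rb_neg hN hξ' hm', mul_one] at h2
  exact h2.symm

/-- A relation with `μ (1 - ξ P)` on both sides, where `μ` is invertible and central, may be
multiplied by `μ⁻¹ g(ξ⁻¹)`. -/
theorem MRel.barRel {μ ξ : R} (hμ : ∀ x, Commute μ x) (hu : IsUnit μ) (hξ : ∀ x, Commute ξ x)
    {X Y : Mat[N] R} (h : MRel μ (μ * ξ) μ (μ * ξ) X Y) : BarRel m ξ ξ X Y := by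
  intro a b c d
  have hg := gEval_comm (N := N) (m := m) hξ
  have h1 : μ * (X a b * Y c d - ξ * (X c b * Y a d)) =
      μ * (Y c d * X a b - ξ * (Y c b * X a d)) := by
    have := h a b c d
    rw [← (hμ _).eq, ← (Commute.mul_left (hμ _) (hξ (Y c b * X a d))).eq] at this
    simpa only [mul_sub, mul_assoc] using this
  have h2 := hu.mul_left_cancel h1
  rw [mul_assoc (gEval N m ξ), ← (hg (Y c d * X a b)).eq,
    ← ((hg (Y c b * X a d)).mul_left (hξ (Y c b * X a d))).eq, mul_assoc (gEval N m ξ), ← mul_sub,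
    h2, mul_sub]

end RBar

/-! ### The defining relations as relations of series -/

section Universal

open PowerSeries

variable {N : ℕ} {D : Type} [Ring D] [Algebra Scal D]

/-- The matrix `T(u)`, with entries power series in `u⁻¹`. -/
def tMat (x : Gen N → D) : Mat[N] D⟦X⟧ :=
  Matrix.of fun i j => mk fun r => tOf x r i j

/-- The matrix `T⁺(u)`, with entries power series in `u`. -/
def tpMat (x : Gen N → D) : Mat[N] D⟦X⟧ :=
  Matrix.of fun i j => mk fun r => tpOf x r i j

/-- Images of the generators which satisfy the defining relations. -/
def Sat (c : ℂ) (x : Gen N → D) : Prop := ∀ y z, Rel x c y z → y = z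

theorem coeff_map_C_mul_C {D : Type*} [Ring D] (f g : D⟦X⟧) (r s : ℕ) :
    coeff s (coeff r (map PowerSeries.C f * PowerSeries.C g)) = coeff r f * coeff s g := by
  rw [coeff_mul_C, coeff_map, coeff_C_mul]

theorem coeff_C_mul_map_C {D : Type*} [Ring D] (f g : D⟦X⟧) (r s : ℕ) :
    coeff s (coeff r (PowerSeries.C g * map PowerSeries.C f)) = coeff s g * coeff r f := by
  rw [coeff_C_mul, coeff_map, coeff_mul_C]

theorem leg_zero_mul_leg_one_apply {A : Type*} [Ring A] (X Y : Mat[N] A)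
    (a b : Fin 2 → Fin N) :
    (leg 0 X * leg 1 Y : Matrix _ _ A) a b = X (a 0) (b 0) * Y (a 1) (b 1) := by
  rw [leg_mul_leg_apply (by decide), if_pos (by intro l; fin_cases l <;> simp)]

theorem leg_one_mul_leg_zero_apply {A : Type*} [Ring A] (X Y : Mat[N] A)
    (a b : Fin 2 → Fin N) :
    (leg 1 X * leg 0 Y : Matrix _ _ A) a b = X (a 1) (b 1) * Y (a 0) (b 0) := by
  rw [leg_mul_leg_apply (by decide), if_pos (by intro l; fin_cases l <;> simp)]

theorem C_X_mul {D : Type*} [Ring D] (f : D⟦X⟧⟦X⟧) :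
    PowerSeries.C X * f = f * PowerSeries.C X := by
  ext a b; rw [coeff_C_mul, coeff_mul_C, ((commute_X _).eq)]

/-- The relation between `T(u)` and `T(v)`, multiplied by `u⁻¹ v⁻¹`. The inner variable is `u⁻¹`,
the variable of the first matrix, and the outer one is `v⁻¹`. -/
theorem tMat_rel {c : ℂ} {x : Gen N → D} (hx : Sat c x) :
    MRel (X - PowerSeries.C X : D⟦X⟧⟦X⟧) (hh • (PowerSeries.C X * X))
      (X - PowerSeries.C X) (hh • (PowerSeries.C X * X))
      ((tMat x).map PowerSeries.C) ((tMat x).map (map PowerSeries.C)) := by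
  intro i j k l
  ext s r
  have e1 : ∀ f : D⟦X⟧⟦X⟧, (hh • (PowerSeries.C X * X)) * f =
      hh • (PowerSeries.C X * (X * f)) := fun f => by rw [smul_mul_assoc, mul_assoc]
  have e2 : ∀ f : D⟦X⟧⟦X⟧, f * (hh • (PowerSeries.C X * X)) =
      hh • (PowerSeries.C X * (X * f)) := fun f => by
    rw [mul_smul_comm, ← mul_assoc, ← C_X_mul, mul_assoc, (commute_X _).eq]
  have e3 : ∀ f : D⟦X⟧⟦X⟧, f * (X - PowerSeries.C X) =
      X * f - PowerSeries.C X * f := fun f => by rw [mul_sub, C_X_mul, (commute_X f).eq]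
  have hCX : ∀ (f : D⟦X⟧⟦X⟧) (s : ℕ),
      coeff s (PowerSeries.C X * f) = X * coeff s f := fun f s => coeff_C_mul _ _ _
  have hh' : ∀ (f : D⟦X⟧⟦X⟧) (s r : ℕ), coeff r (coeff s (hh • f)) =
      hh • coeff r (coeff s f) := fun f s r => rfl
  simp only [e1, e2, e3, sub_mul, map_sub, hh', Matrix.map_apply, hCX]
  cases s with
  | zero =>
    cases r with
    | zero => simp
    | succ r =>
      simp only [coeff_zero_X_mul, map_zero, mul_zero, smul_zero, coeff_succ_X_mul]
      rw [coeff_C_mul_map_C, coeff_map_C_mul_C]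
      simp [tMat, tOf, Matrix.one_apply]
  | succ s =>
    cases r with
    | zero =>
      simp only [coeff_zero_X_mul, map_zero, mul_zero, smul_zero, coeff_succ_X_mul]
      rw [coeff_C_mul_map_C, coeff_map_C_mul_C]
      simp [tMat, tOf, Matrix.one_apply]
    | succ r =>
      simp only [coeff_succ_X_mul, coeff_C_mul_map_C, coeff_map_C_mul_C]
      have h := hx _ _ (Rel.rtt r s ![i, k] ![j, l])
      rw [rttL, rttR, mul_assoc (permMat _)] at h
      simp only [Matrix.sub_apply, Matrix.smul_apply, permMat_mul_apply,
        mul_permMat_apply, leg_zero_mul_leg_one_apply, leg_one_mul_leg_zero_apply] at h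
      simp only [tMat, Matrix.of_apply, coeff_mk]
      simp only [Function.comp_apply, Equiv.symm_swap, Equiv.swap_apply_left,
        Equiv.swap_apply_right, Matrix.cons_val_zero, Matrix.cons_val_one] at h
      exact h

theorem coeff_X_mul_eq_prev {D : Type*} [Ring D] (f : D⟦X⟧) (r : ℕ) :
    coeff r (X * f) = prev (fun r => coeff r f) r := by
  cases r <;> simp [prev]

theorem prev_apply {D : Type*} [Ring D] (f : ℕ → Mat[N] D) (r : ℕ) (i j : Fin N) :
    prev f r i j = prev (fun r => f r i j) r := by
  cases r <;> simp [prev]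

/-- The relation between `T⁺(u)` and `T⁺(v)`. The inner variable is `u`, the variable of the first
matrix, and the outer one is `v`. -/
theorem tpMat_rel {c : ℂ} {x : Gen N → D} (hx : Sat c x) :
    MRel (PowerSeries.C X - X : D⟦X⟧⟦X⟧) (algebraMap Scal _ hh)
      (PowerSeries.C X - X) (algebraMap Scal _ hh)
      ((tpMat x).map PowerSeries.C) ((tpMat x).map (map PowerSeries.C)) := by
  intro i j k l
  ext s r
  have e3 : ∀ f : D⟦X⟧⟦X⟧, f * (PowerSeries.C X - X) =
      PowerSeries.C X * f - X * f := fun f => by rw [mul_sub, C_X_mul, (commute_X f).eq]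
  have hCX : ∀ (f : D⟦X⟧⟦X⟧) (s : ℕ),
      coeff s (PowerSeries.C X * f) = X * coeff s f := fun f s => coeff_C_mul _ _ _
  have hh' : ∀ (f : D⟦X⟧⟦X⟧) (s r : ℕ), coeff r (coeff s (hh • f)) =
      hh • coeff r (coeff s f) := fun f s r => rfl
  have h := hx _ _ (Rel.rttp r s ![i, k] ![j, l])
  rw [rttpL, rttpR, mul_assoc (permMat _)] at h
  simp only [Matrix.sub_apply, Matrix.smul_apply, permMat_mul_apply,
    mul_permMat_apply, leg_zero_mul_leg_one_apply, leg_one_mul_leg_zero_apply] at h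
  simp only [Function.comp_apply, Equiv.symm_swap, Equiv.swap_apply_left,
    Equiv.swap_apply_right, Matrix.cons_val_zero, Matrix.cons_val_one, prev_apply] at h
  have hP : ∀ f g : D⟦X⟧, coeff r (coeff s (X * (PowerSeries.C f *
      PowerSeries.map PowerSeries.C g))) = coeff r f * prev (fun s => coeff s g) s := fun f g => by
    cases s with
    | zero => simp [prev]
    | succ s => rw [coeff_succ_X_mul, coeff_C_mul_map_C, prev]
  have hP' : ∀ f g : D⟦X⟧, coeff r (coeff s (X *
      (PowerSeries.map PowerSeries.C g * PowerSeries.C f))) =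
      prev (fun s => coeff s g) s * coeff r f := fun f g => by
    cases s with
    | zero => simp [prev]
    | succ s => rw [coeff_succ_X_mul, coeff_map_C_mul_C, prev]
  have hQ : ∀ f g : D⟦X⟧, coeff r (coeff s (PowerSeries.C X * (PowerSeries.C f *
      PowerSeries.map PowerSeries.C g))) = prev (fun s => coeff s f) r * coeff s g := fun f g => by
    rw [← mul_assoc, ← map_mul, coeff_C_mul_map_C, coeff_X_mul_eq_prev]
  have hQ' : ∀ f g : D⟦X⟧, coeff r (coeff s (PowerSeries.C X *
      (PowerSeries.map PowerSeries.C g * PowerSeries.C f))) =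
      coeff s g * prev (fun s => coeff s f) r := fun f g => by
    rw [C_X_mul, mul_assoc, ← map_mul, coeff_map_C_mul_C, (commute_X f).eq, coeff_X_mul_eq_prev]
  rw [e3, ← Algebra.smul_def, ← Algebra.commutes, ← Algebra.smul_def]
  simp only [sub_mul, map_sub, hh', Matrix.map_apply, hP, hP', hQ, hQ', coeff_C_mul_map_C,
    coeff_map_C_mul_C]
  simp only [tpMat, Matrix.of_apply, coeff_mk]
  exact h

theorem coeff_coeff_smul (s : Scal) (f : D⟦X⟧⟦X⟧) (a b : ℕ) :
    coeff b (coeff a (s • f)) = s • coeff b (coeff a f) := rfl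

theorem coeff_coeff_mul {D : Type*} [Ring D] (f g : D⟦X⟧⟦X⟧) (r s : ℕ) :
    coeff s (coeff r (f * g)) = ∑ p ∈ Finset.range (r + 1), ∑ q ∈ Finset.range (s + 1),
      coeff q (coeff p f) * coeff (s - q) (coeff (r - p) g) := by
  rw [coeff_mul, Finset.Nat.sum_antidiagonal_eq_sum_range_succ (fun p p' => coeff p f * coeff p' g),
    map_sum]
  refine Finset.sum_congr rfl fun p _ => ?_
  rw [coeff_mul, Finset.Nat.sum_antidiagonal_eq_sum_range_succ
    (fun q q' => coeff q (coeff p f) * coeff q' (coeff (r - p) g))]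

theorem coeff_coeff_mul' {D : Type*} [Ring D] (f g : D⟦X⟧⟦X⟧) (r s : ℕ) :
    coeff s (coeff r (f * g)) = ∑ p ∈ Finset.range (r + 1), ∑ q ∈ Finset.range (s + 1),
      coeff (s - q) (coeff (r - p) f) * coeff q (coeff p g) := by
  rw [coeff_coeff_mul, ← Finset.sum_range_reflect]
  refine Finset.sum_congr rfl fun p hp => ?_
  rw [← Finset.sum_range_reflect]
  refine Finset.sum_congr rfl fun q hq => ?_
  have hp' := Finset.mem_range.1 hp
  have hq' := Finset.mem_range.1 hq
  rw [show r + 1 - 1 - p = r - p by omega, show r - (r - p) = p by omega,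
    show s + 1 - 1 - q = s - q by omega, show s - (s - q) = q by omega]

theorem sum_range_eq_of_eq_zero {M : Type*} [AddCommMonoid M] {f : ℕ → M} {K L : ℕ}
    (hK : ∀ k, K ≤ k → f k = 0) (hL : ∀ k, L ≤ k → f k = 0) :
    ∑ k ∈ Finset.range K, f k = ∑ k ∈ Finset.range L, f k := by
  have key : ∀ K L : ℕ, K ≤ L → (∀ k, K ≤ k → f k = 0) →
      ∑ k ∈ Finset.range K, f k = ∑ k ∈ Finset.range L, f k := fun K L h hK =>
    Finset.sum_subset (Finset.range_subset_range.2 h) fun r _ hr => hK r (by simpa using hr)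
  rcases le_total K L with h | h
  · exact key K L h hK
  · exact (key L K h hL).symm

/-! ### The mixed relation -/

section Mixed

variable {m : ℕ}

/-- The shift `γ h - v`. -/
def mixShift (D : Type*) [Ring D] [Algebra Scal D] (γ : ℂ) : D⟦X⟧ :=
  affX (-1) (algebraMap Scal D (PowerSeries.C γ * hh))

theorem mixShift_comm (γ : ℂ) (f : D⟦X⟧) : Commute (mixShift D γ) f :=
  affX_comm _ (fun x => Algebra.commutes _ x) f

/-- The series `h / (u - v + γ h)` in `u⁻¹`, with coefficients power series in `v`. -/
def mixXi (D : Type*) [Ring D] [Algebra Scal D] (γ : ℂ) : D⟦X⟧⟦X⟧ :=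
  hh • moebPow 1 (mixShift D γ) 1

theorem mixXi_pow (γ : ℂ) (k : ℕ) :
    mixXi D γ ^ k = hh ^ k • moebPow 1 (mixShift D γ) k := by
  rw [mixXi, smul_pow, ← moebPow_eq 1 (mixShift_comm γ)]

theorem mixXi_nil (hm : algebraMap Scal D hh ^ m = 0) (γ : ℂ) : (mixXi D γ) ^ m = 0 := by
  rw [mixXi_pow]
  ext a b
  rw [coeff_coeff_smul]
  rw [Algebra.smul_def, map_pow, hm, zero_mul, map_zero, map_zero]

theorem mixXi_mul (γ : ℂ) : mixXi D γ * (1 + PowerSeries.C (mixShift D γ) * X) = hh • X := by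
  have := moebPow_succ_mul 1 (mixShift D γ) 0
  rw [moebPow_zero, mul_one, one_smul, one_smul] at this
  rw [mixXi, smul_mul_assoc, this]

/-- The scalar factors in `rbarCoeff`. -/
def mixScal (γ : ℂ) (k p q : ℕ) : Scal :=
  hh ^ k * ((Ring.choose (-(k : ℤ)) (p - k) : ℤ) : Scal) *
      ((-1) ^ q * ((p - k).choose q : Scal) * (PowerSeries.C γ * hh) ^ (p - k - q))

theorem coeff_mixXi_pow (γ : ℂ) (k p q : ℕ) : coeff q (coeff p (mixXi D γ ^ k)) =
    if k ≤ p then algebraMap Scal D (mixScal γ k p q) else 0 := by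
  rw [mixXi_pow]
  rw [coeff_coeff_smul]
  rw [moebPow, coeff_mk]
  split_ifs
  · rw [map_zsmul (coeff q), mixShift, coeff_affX_pow _ (fun x => Algebra.commutes _ x), one_pow,
      one_mul, ← map_pow, ← map_zsmul, ← map_zsmul, Algebra.smul_def, ← map_mul, mixScal]
    congr 1
    simp only [zsmul_eq_mul]
    push_cast
    ring
  · rw [map_zero, smul_zero]

theorem sum_smul_coeff_mixXi_pow (hm : algebraMap Scal D hh ^ m = 0) (γ : ℂ) (g : ℕ → ℂ) {K : ℕ}
    (hK : m ≤ K) (p q : ℕ) :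
    coeff q (coeff p (∑ k ∈ Finset.range K, (PowerSeries.C (g k) : Scal) • mixXi D γ ^ k)) =
      ∑ k ∈ Finset.range (p + 1), algebraMap Scal D (mixScal γ k p q * PowerSeries.C (g k)) := by
  rw [map_sum, map_sum]
  simp only [coeff_coeff_smul]
  rw [sum_range_eq_of_eq_zero (L := p + 1)]
  · refine Finset.sum_congr rfl fun k hk => ?_
    rw [coeff_mixXi_pow, if_pos (by have := Finset.mem_range.1 hk; omega), mul_comm, map_mul,
      Algebra.smul_def]
  · intro k hk
    rw [pow_eq_zero_of_le (hK.trans hk) (mixXi_nil hm γ), map_zero, map_zero, smul_zero]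
  · intro k hk
    rw [coeff_mixXi_pow, if_neg (by omega), smul_zero]

theorem scalar_algebraMap {ι A : Type*} [Fintype ι] [DecidableEq ι] [Ring A] [Algebra Scal A]
    (s : Scal) : Matrix.scalar ι (algebraMap Scal A s) = s • (1 : Matrix ι ι A) := by
  ext i j
  rw [Matrix.scalar_apply, Matrix.smul_apply, Matrix.diagonal_apply, Matrix.one_apply]
  split_ifs
  · rw [Algebra.algebraMap_eq_smul_one]
  · rw [smul_zero]

theorem rbarCoeff_eq (γ : ℂ) (hm : algebraMap Scal D hh ^ m = 0) (p q : ℕ) :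
    rbarCoeff N D γ p q = Matrix.scalar _ (coeff q (coeff p (gEval N m (mixXi D γ)))) -
      Matrix.scalar _ (coeff q (coeff p (gEval N m (mixXi D γ) * mixXi D γ))) *
        permMat (Equiv.swap 0 1) := by
  have e : gEval N m (mixXi D γ) * mixXi D γ =
      ∑ k ∈ Finset.range (m + 1), (PowerSeries.C (prev (gCoeff N) k) : Scal) • mixXi D γ ^ k := by
    rw [Finset.sum_range_succ', gEval, Finset.sum_mul]
    simp only [prev, map_zero, zero_smul, add_zero, smul_mul_assoc, pow_succ]
  rw [e, gEval, sum_smul_coeff_mixXi_pow hm γ _ le_rfl, sum_smul_coeff_mixXi_pow hm γ _ (Nat.le_succ m),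
    map_sum, map_sum, Finset.sum_mul, ← Finset.sum_sub_distrib, rbarCoeff]
  refine Finset.sum_congr rfl fun k _ => ?_
  rw [scalar_algebraMap, scalar_algebraMap, smul_mul_assoc, one_mul, smul_sub, ← mul_smul,
    ← mul_smul, mixScal]

/-- The relation between `T(u)` and `T⁺(v)`. The outer variable is `u⁻¹`, the variable of the first
matrix, and the inner one is `v`. As `h` is nilpotent, `g` is evaluated at a polynomial in the
parameter `h / (u - v + c h / 2)`. -/
theorem tMat_tpMat_rel {c : ℂ} {x : Gen N → D} (hx : Sat c x)
    (hm : algebraMap Scal D hh ^ m = 0) :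
    BarRel m (mixXi D (c / 2)) (mixXi D (-(c / 2))) ((tMat x).map (map PowerSeries.C))
      ((tpMat x).map PowerSeries.C) := by
  intro i j k l
  ext r s
  have h := hx _ _ (Rel.rttm r s ![i, k] ![j, l])
  have hs : ∀ z : D, ∀ M : Matrix (Fin 2 → Fin N) (Fin 2 → Fin N) D, ∀ a b,
      (Matrix.scalar (Fin 2 → Fin N) z * M : Matrix _ _ D) a b = z * M a b := fun z M a b => by
    rw [Matrix.scalar_apply, Matrix.diagonal_mul]
  have hs' : ∀ z : D, (∀ y, Commute z y) → ∀ M : Matrix (Fin 2 → Fin N) (Fin 2 → Fin N) D, ∀ a b,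
      (M * Matrix.scalar (Fin 2 → Fin N) z : Matrix _ _ D) a b = M a b * z := fun z _ M a b => by
    rw [Matrix.scalar_apply, Matrix.mul_diagonal]
  have hs'' : ∀ z : D, ∀ M : Matrix (Fin 2 → Fin N) (Fin 2 → Fin N) D, ∀ a b,
      (M * (Matrix.scalar (Fin 2 → Fin N) z * permMat (Equiv.swap 0 1)) : Matrix _ _ D) a b =
        M a (b ∘ Equiv.swap 0 1) * z := fun z M a b => by
    rw [← mul_assoc, mul_permMat_apply, Matrix.scalar_apply, Matrix.mul_diagonal, Equiv.symm_swap]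
  rw [rttmL, rttmR, Matrix.sum_apply, Matrix.sum_apply] at h
  simp only [Matrix.sum_apply, rbarCoeff_eq _ hm, sub_mul, mul_sub, mul_assoc] at h
  simp only [← mul_assoc (leg _ _) _ (Matrix.scalar _ _), ← mul_assoc (leg _ _) (leg _ _),
    Matrix.sub_apply, hs, hs'', permMat_mul_apply] at h
  simp only [Matrix.scalar_apply, Matrix.mul_diagonal, leg_zero_mul_leg_one_apply,
    leg_one_mul_leg_zero_apply, Function.comp_apply, Equiv.swap_apply_left,
    Equiv.swap_apply_right, Matrix.cons_val_zero, Matrix.cons_val_one, Finset.sum_sub_distrib] at h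
  rw [map_sub, map_sub, map_sub, map_sub, coeff_coeff_mul, coeff_coeff_mul (gEval N m _ * _),
    coeff_coeff_mul', coeff_coeff_mul' (_ * _) (gEval N m _ * _)]
  simp only [Matrix.map_apply, coeff_map_C_mul_C, coeff_C_mul_map_C, tMat, tpMat, Matrix.of_apply,
    coeff_mk]
  exact h

end Mixed

end Universal

/-! ### Spectral parameters -/

section Zeta

variable {A : Type*} [Ring A] [Algebra Scal A]

/-- The multiple `α h` of `h`. -/
def kap (A : Type*) [Ring A] [Algebra Scal A] (α : ℂ) : A := algebraMap Scal A (PowerSeries.C α * hh)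

theorem kap_comm (α : ℂ) (x : A) : Commute (kap A α) x := Algebra.commutes _ x

theorem kap_pow {m : ℕ} (hm : algebraMap Scal A hh ^ m = 0) (α : ℂ) : kap A α ^ m = 0 := by
  rw [kap, map_mul, Commute.mul_pow (Algebra.commutes (R := Scal) (A := A) _ _), hm, mul_zero]

theorem kap_add (α β : ℂ) : kap A (α + β) = kap A α + kap A β := by
  rw [kap, map_add, add_mul, map_add, kap, kap]

theorem kap_neg (α : ℂ) : kap A (-α) = -kap A α := by
  rw [kap, map_neg, neg_mul, map_neg, kap]

theorem kap_sub (α β : ℂ) : kap A (α - β) = kap A α - kap A β := by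
  rw [sub_eq_add_neg, kap_add, kap_neg, sub_eq_add_neg]

theorem map_kap {B : Type*} [Ring B] [Algebra Scal B] (Φ : A →+* B)
    (hΦ : ∀ s : Scal, Φ (algebraMap Scal A s) = algebraMap Scal B s) (α : ℂ) :
    Φ (kap A α) = kap B α := hΦ _

/-- The element `(ε' u + β h) p - ε q`, which is `p (ε' u - ε v + β h)` if `v = q / p`. The pair
`(p, q)` is `(1, v)` for series in `v` and `(v⁻¹, 1)` for series in `v⁻¹`. -/
def den (ε' ε : ℤ) (β : ℂ) (u p q : A) : A := (ε' • u + kap A β) * p - ε • q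

/-- The element `h / (ε' u - ε v + β h)`, where `v = q / p`. -/
def zeta (ε' ε : ℤ) (β : ℂ) (u p q : A) : A := hh • (p * Ring.inverse (den ε' ε β u p q))

/-- Central elements `u, p, q` for which `ε' u - ε q / p + β h` can be inverted. -/
structure ZetaData (u p q : A) : Prop where
  hu : ∀ x, Commute u x
  hp : ∀ x, Commute p x
  hq : ∀ x, Commute q x
  unit : ∀ ε' ε : ℤ, ε' * ε' = 1 → ε * ε = 1 → ∀ β, IsUnit (den ε' ε β u p q)

variable {u p q : A} {ε' ε : ℤ}

theorem den_comm (h : ZetaData u p q) (β : ℂ) (x : A) : Commute (den ε' ε β u p q) x :=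
  ((((h.hu x).smul_left _).add_left (kap_comm β x)).mul_left (h.hp x)).sub_left
    ((h.hq x).smul_left _)

theorem ringInverse_comm {A : Type*} [Ring A] {a : A} (h : ∀ x, Commute a x) (x : A) : Commute (Ring.inverse a) x := by
  by_cases hu : IsUnit a
  · obtain ⟨a, rfl⟩ := hu
    rw [Ring.inverse_unit]
    exact (h x).units_inv_left
  · rw [Ring.inverse_non_unit _ hu]
    exact Commute.zero_left x

theorem zeta_comm (h : ZetaData u p q) (β : ℂ) (x : A) : Commute (zeta ε' ε β u p q) x :=
  ((h.hp x).mul_left (ringInverse_comm (den_comm h β) x)).smul_left _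

theorem zeta_nil {m : ℕ} (hm : algebraMap Scal A hh ^ m = 0) (β : ℂ) :
    zeta ε' ε β u p q ^ m = 0 := by
  rw [zeta, smul_pow, Algebra.smul_def, map_pow, hm, zero_mul]

theorem zeta_mul_den (h : ZetaData u p q) (h' : ε' * ε' = 1) (h'' : ε * ε = 1) (β : ℂ) :
    zeta ε' ε β u p q * den ε' ε β u p q = hh • p := by
  rw [zeta, smul_mul_assoc, mul_assoc, Ring.inverse_mul_cancel _ (h.unit ε' ε h' h'' β), mul_one]

theorem eq_zeta (h : ZetaData u p q) (h' : ε' * ε' = 1) (h'' : ε * ε = 1) {β : ℂ} {ξ : A}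
    (hξ : ξ * den ε' ε β u p q = hh • p) : ξ = zeta ε' ε β u p q := by
  refine (h.unit ε' ε h' h'' β).mul_right_cancel ?_
  rw [hξ, zeta_mul_den h h' h'']

theorem den_neg (β : ℂ) : den (-ε') (-ε) (-β) u p q = -den ε' ε β u p q := by
  rw [den, den, neg_smul, neg_smul, kap_neg, ← neg_add, neg_mul, neg_sub_neg, neg_sub]

theorem neg_zeta (h : ZetaData u p q) (h' : ε' * ε' = 1) (h'' : ε * ε = 1) (β : ℂ) :
    -zeta ε' ε β u p q = zeta (-ε') (-ε) (-β) u p q := by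
  refine eq_zeta h (by simpa) (by simpa) ?_
  rw [den_neg, neg_mul_neg, zeta_mul_den h h' h'']

/-- The equation `ζ'⁻¹ - ζ⁻¹ = β' - β` for the two parameters, without denominators. -/
theorem zeta_sub_zeta (h : ZetaData u p q) (h' : ε' * ε' = 1) (h'' : ε * ε = 1) (β β' : ℂ) :
    zeta ε' ε β u p q - zeta ε' ε β' u p q =
      (PowerSeries.C (β' - β) : Scal) • (zeta ε' ε β u p q * zeta ε' ε β' u p q) := by
  have e1 : den ε' ε β' u p q = den ε' ε β u p q + kap A (β' - β) * p := by
    rw [den, den, kap_sub]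
    simp only [add_mul, sub_mul]
    abel
  have h1 := zeta_mul_den h h' h'' β
  have h2 := zeta_mul_den h h' h'' β'
  have hu := h.unit ε' ε h' h'' β
  have hu' := h.unit ε' ε h' h'' β'
  have e3 : zeta ε' ε β u p q * (zeta ε' ε β' u p q * den ε' ε β' u p q) =
      zeta ε' ε β u p q * (hh • p) := by rw [h2]
  refine hu'.mul_right_cancel ?_
  rw [sub_mul, h2, smul_mul_assoc, mul_assoc, h2, e1, mul_add, h1, add_sub_cancel_left, kap,
    ← Algebra.smul_def, mul_smul, mul_smul_comm, mul_smul_comm]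

theorem zeta_map {B : Type*} [Ring B] [Algebra Scal B] (Φ : A →+* B)
    (hΦ : ∀ s : Scal, Φ (algebraMap Scal A s) = algebraMap Scal B s) (h : ZetaData u p q)
    (h' : ε' * ε' = 1) (h'' : ε * ε = 1) (β : ℂ) :
    Φ (zeta ε' ε β u p q) = zeta ε' ε β (Φ u) (Φ p) (Φ q) := by
  have hd : Φ (den ε' ε β u p q) = den ε' ε β (Φ u) (Φ p) (Φ q) := by
    simp only [den, map_sub, map_mul, map_add, map_zsmul, map_kap Φ hΦ]
  have hi : Φ (Ring.inverse (den ε' ε β u p q)) = Ring.inverse (den ε' ε β (Φ u) (Φ p) (Φ q)) := by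
    obtain ⟨a, ha⟩ := h.unit ε' ε h' h'' β
    rw [← hd, ← ha, Ring.inverse_unit]
    exact (Ring.inverse_unit (Units.map (Φ : A →* B) a)).symm
  rw [zeta, zeta, Algebra.smul_def, Algebra.smul_def, map_mul, hΦ, map_mul, hi]

end Zeta

section Nature

open PowerSeries

variable {C : Type*} [Ring C]

theorem moebHom_map_C (ε : ℤ) (κ : C) (hκ : ∀ x, Commute κ x)
    (hκ' : ∀ x, Commute (PowerSeries.C κ) x) (f : C⟦X⟧) :
    moebHom ε (PowerSeries.C κ) hκ' (map PowerSeries.C f) =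
      map PowerSeries.C (moebHom ε κ hκ f) := by
  ext a : 1
  simp only [coeff_moebHom, coeff_map, map_sum, map_zsmul, map_mul, map_pow]

theorem affHom_map_C (ε : ℤ) (κ : C) (hκ : ∀ x, Commute κ x)
    (hκ' : ∀ x, Commute (PowerSeries.C κ) x) {m : ℕ} (hm : κ ^ m = 0)
    (hm' : PowerSeries.C κ ^ m = 0) (f : C⟦X⟧) :
    affHom ε (PowerSeries.C κ) hκ' hm' (map PowerSeries.C f) =
      map PowerSeries.C (affHom ε κ hκ hm f) := by
  ext a : 1
  simp only [coeff_affHom, coeff_map, map_sum, map_zsmul, map_mul, map_pow]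

end Nature

/-! ### Exchange relations at shifted points -/

section Points

open PowerSeries

variable {N m : ℕ} {D : Type} [Ring D] [Algebra Scal D]

/-- The matrix `T(ε u + α h)`, with entries power series in `u⁻¹`. -/
def tAt (x : Gen N → D) (ε : ℤ) (α : ℂ) : Mat[N] D⟦X⟧ :=
  (tMat x).map (moebHom ε (kap D α) (kap_comm α))

/-- The matrix `T⁺(ε u + α h)`, with entries power series in `u`. -/
def tpAt (hm : algebraMap Scal D hh ^ m = 0) (x : Gen N → D) (ε : ℤ) (α : ℂ) :
    Mat[N] D⟦X⟧ :=
  (tpMat x).map (affHom ε (kap D α) (kap_comm α) (kap_pow hm α))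

variable {L : Type*} [Ring L] [Algebra Scal L]

/-- The substitution `φ` in the inner and `Ψ` in the outer variable, followed by an extension of
scalars. -/
def subst2 (ι : D⟦X⟧ →+* L) (φ : D⟦X⟧ →+* D⟦X⟧)
    (Ψ : D⟦X⟧⟦X⟧ →+* D⟦X⟧⟦X⟧) :
    D⟦X⟧⟦X⟧ →+* L⟦X⟧ :=
  (map ι).comp (Ψ.comp (map φ))

theorem algebraMap_series {B : Type*} [Ring B] [Algebra Scal B] (s : Scal) :
    algebraMap Scal B⟦X⟧ s = PowerSeries.C (algebraMap Scal B s) :=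
  PowerSeries.algebraMap_apply

theorem map_C_kap {B : Type*} [Ring B] [Algebra Scal B] (α : ℂ) :
    PowerSeries.C (kap B α) = kap B⟦X⟧ α := (algebraMap_series _).symm

/-- Substitutions `φ`, `Ψ` in the inner and in the outer variable, which do not change constants; `ψ`
is the substitution `Ψ` for coefficients in `D`. -/
structure SubstData {D : Type*} [Ring D] (φ : D⟦X⟧ →+* D⟦X⟧)
    (Ψ : D⟦X⟧⟦X⟧ →+* D⟦X⟧⟦X⟧)
    (ψ : D⟦X⟧ →+* D⟦X⟧) : Prop where
  hφ : ∀ d, φ (PowerSeries.C d) = PowerSeries.C d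
  hΨ : ∀ f, Ψ (PowerSeries.C f) = PowerSeries.C f
  hψ : ∀ f, Ψ (map PowerSeries.C f) = map PowerSeries.C (ψ f)

section

variable {ι : D⟦X⟧ →+* L} {φ ψ : D⟦X⟧ →+* D⟦X⟧}
    {Ψ : D⟦X⟧⟦X⟧ →+* D⟦X⟧⟦X⟧}

theorem subst2_C {D : Type} {L : Type*} [Ring D] [Ring L]
    {ι : D⟦X⟧ →+* L}
    {φ ψ : D⟦X⟧ →+* D⟦X⟧}
    {Ψ : D⟦X⟧⟦X⟧ →+* D⟦X⟧⟦X⟧} (h : SubstData φ Ψ ψ)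
    (f : D⟦X⟧) : subst2 ι φ Ψ (PowerSeries.C f) = PowerSeries.C (ι (φ f)) := by
  simp [subst2, map_C, h.hΨ]

theorem subst2_map_C {D : Type} {L : Type*} [Ring D] [Ring L]
    {ι : D⟦X⟧ →+* L}
    {φ ψ : D⟦X⟧ →+* D⟦X⟧}
    {Ψ : D⟦X⟧⟦X⟧ →+* D⟦X⟧⟦X⟧} (h : SubstData φ Ψ ψ) (f : D⟦X⟧) :
    subst2 ι φ Ψ (map PowerSeries.C f) = map (ι.comp PowerSeries.C) (ψ f) := by
  have e : map φ (map PowerSeries.C f) = map PowerSeries.C f := by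
    ext a : 1; simp [coeff_map, h.hφ]
  rw [subst2, RingHom.comp_apply, RingHom.comp_apply, e, h.hψ]
  ext a : 1
  simp [coeff_map]

theorem subst2_X {D : Type} {L : Type*} [Ring D] [Ring L]
    {ι : D⟦X⟧ →+* L}
    {φ ψ : D⟦X⟧ →+* D⟦X⟧}
    {Ψ : D⟦X⟧⟦X⟧ →+* D⟦X⟧⟦X⟧} (h : SubstData φ Ψ ψ) :
    subst2 ι φ Ψ X = map (ι.comp PowerSeries.C) (ψ X) := by
  rw [← subst2_map_C h, map_X]

theorem subst2_algebraMap (hι : ∀ s : Scal, ι (algebraMap Scal _ s) = algebraMap Scal L s)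
    (h : SubstData φ Ψ ψ) (s : Scal) :
    subst2 ι φ Ψ (algebraMap Scal _ s) = algebraMap Scal _ s := by
  rw [algebraMap_series, subst2_C h, algebraMap_series s, h.hφ, ← algebraMap_series, hι,
    ← algebraMap_series]

end

/-- An extension of scalars for power series in `u`, and the image of `u`. -/
structure PType (ι : D⟦X⟧ →+* L) (u : L) : Prop where
  hι : ∀ s : Scal, ι (algebraMap Scal _ s) = algebraMap Scal L s
  hu : ι X = u

/-- An extension of scalars for power series in `u⁻¹`, and the image of `u`. -/
structure QType (ι : D⟦X⟧ →+* L) (u : L) : Prop where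
  hι : ∀ s : Scal, ι (algebraMap Scal _ s) = algebraMap Scal L s
  hu : ι X * u = 1

variable {ι : D⟦X⟧ →+* L} {u : L} {x : Gen N → D} {c : ℂ}

/-- A matrix over power series in `u` or `u⁻¹` as a matrix with coefficients constant in `v`. -/
abbrev legMat (ι : D⟦X⟧ →+* L) (X : Mat[N] D⟦X⟧) :
    Mat[N] L⟦X⟧ := X.map fun f => PowerSeries.C (ι f)

/-- A matrix over power series in `v` or `v⁻¹` as a matrix with coefficients constant in `u`. -/
abbrev auxMat (ι : D⟦X⟧ →+* L) (X : Mat[N] D⟦X⟧) :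
    Mat[N] L⟦X⟧ := X.map (map (ι.comp PowerSeries.C))

/-- The exchange relation of a matrix `A` in the tensor factors with a matrix `t` in the auxiliary
factor. -/
def AuxRel (m : ℕ) (η ξ : L) (A t : Mat[N] L) : Prop :=
  rb N m η * (liftMat A * Matrix.scalar _ t) = Matrix.scalar _ t * liftMat A * rb N m ξ

theorem IsUnit_of_mul_central {R : Type*} [Ring R] {a b : R} (h : IsUnit (a * b))
    (hb : ∀ x, Commute b x) : IsUnit a := by
  obtain ⟨z, hz⟩ := h
  refine isUnit_iff_exists.2 ⟨b * ↑z⁻¹, ?_, ?_⟩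
  · rw [← mul_assoc, ← hz, Units.mul_inv]
  · rw [(hb _).eq, mul_assoc, (hb _).eq, ← hz, Units.inv_mul]

theorem algebraMap_series_pow {B : Type*} [Ring B] [Algebra Scal B]
    (hm : algebraMap Scal B hh ^ m = 0) : algebraMap Scal B⟦X⟧ hh ^ m = 0 := by
  rw [algebraMap_series, ← map_pow, hm, map_zero]

theorem algebraMap_pow_of_map {B : Type*} [Ring B] [Algebra Scal B] {B' : Type*} [Ring B']
    [Algebra Scal B'] (ι : B →+* B')
    (hι : ∀ s : Scal, ι (algebraMap Scal _ s) = algebraMap Scal B' s)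
    (hm : algebraMap Scal B hh ^ m = 0) : algebraMap Scal B' hh ^ m = 0 := by
  rw [← hι, ← map_pow, hm, map_zero]

section

variable {φ ψ : D⟦X⟧ →+* D⟦X⟧}
    {Ψ : D⟦X⟧⟦X⟧ →+* D⟦X⟧⟦X⟧} {ε' ε : ℤ} {α' α : ℂ}

/-- Both variables are substituted in the relation between `T⁺(u)` and `T⁺(v)`; it is then divided
by the difference of the points, which is invertible. -/
theorem auxRel_tp_tp_aux (hx : Sat c x) (hι : PType ι u)
    (hz : ZetaData (PowerSeries.C u) 1 (X : L⟦X⟧)) (h' : ε' * ε' = 1)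
    (h'' : ε * ε = 1) (h : SubstData φ Ψ ψ) (hφ : φ X = ε' • X + PowerSeries.C (kap D α'))
    (hψ : ψ X = ε • X + PowerSeries.C (kap D α)) :
    AuxRel m (zeta ε' ε (α' - α) (PowerSeries.C u) 1 X) (zeta ε' ε (α' - α) (PowerSeries.C u) 1 X)
      (legMat ι ((tpMat x).map φ)) (auxMat ι ((tpMat x).map ψ)) := by
  have h4 := MRel.map (subst2 ι φ Ψ) (tpMat_rel hx)
  have hk : ∀ α, ι (PowerSeries.C (kap D α)) = kap L α := fun α => by
    rw [map_C_kap, kap, hι.hι, kap]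
  have e1 : subst2 ι φ Ψ (PowerSeries.C X - X) = den ε' ε (α' - α) (PowerSeries.C u) 1 X := by
    rw [map_sub, subst2_C h, subst2_X h, hφ, hψ, den, kap_sub, ← map_C_kap, ← map_C_kap]
    simp only [map_add, map_zsmul, hk, hι.hu, map_X, map_C, RingHom.comp_apply, mul_one]
    abel
  have e2 : subst2 ι φ Ψ (algebraMap Scal _ hh) =
      den ε' ε (α' - α) (PowerSeries.C u) 1 X * zeta ε' ε (α' - α) (PowerSeries.C u) 1 X := by
    rw [(den_comm hz _ _).eq, zeta_mul_den hz h' h'', subst2_algebraMap hι.hι h,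
      Algebra.algebraMap_eq_smul_one]
  rw [e1, e2] at h4
  have h5 := MRel.barRel (m := m) (den_comm hz _) (hz.unit ε' ε h' h'' _) (zeta_comm hz _) h4
  have h6 := h5.aux (zeta_comm hz _)
  have e3 : ((tpMat x).map PowerSeries.C).map (subst2 ι φ Ψ) = legMat ι ((tpMat x).map φ) := by
    ext1 i j
    exact subst2_C h _
  have e4 : ((tpMat x).map (map PowerSeries.C)).map (subst2 ι φ Ψ) =
      auxMat ι ((tpMat x).map ψ) := by
    ext1 i j
    exact subst2_map_C h _
  rwa [e3, e4] at h6

theorem map_kap_C {ι : D⟦X⟧ →+* L}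
    (hι : ∀ s : Scal, ι (algebraMap Scal _ s) = algebraMap Scal L s) (α : ℂ) :
    ι (PowerSeries.C (kap D α)) = kap L α := by
  rw [map_C_kap, kap, hι, kap]

theorem commute_of_mul {R : Type*} [Ring R] {a b : R} (hb : ∀ x, Commute b x) (hu : IsUnit b)
    (hab : ∀ x, Commute (a * b) x) (x : R) : Commute a x := by
  refine hu.mul_right_cancel ?_
  rw [mul_assoc, ← (hb x).eq, ← mul_assoc, (hab x).eq, mul_assoc]

/-- The image of `u⁻¹` under the substitution in the inner variable is the inverse of `ε' u + α'
h`. -/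
theorem leg_point (hι : QType ι u) (h' : ε' * ε' = 1)
    (hφ : φ X * (1 + PowerSeries.C (ε' • kap D α') * X) = ε' • X) :
    ι (φ X) * (ε' • u + kap L α') = 1 := by
  have h1 := congrArg (fun f => ι f * u) hφ
  simp only [map_mul, map_add, map_one, map_zsmul] at h1
  rw [map_kap_C hι.hι, mul_assoc, add_mul, one_mul, mul_assoc, hι.hu, mul_one, smul_mul_assoc,
    hι.hu] at h1
  have h2 := congrArg (fun f => ε' • f) h1
  simp only [← mul_smul_comm, smul_add, ← mul_smul, h', one_smul] at h2
  exact h2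

/-- The image of `v⁻¹` under the substitution in the outer variable, multiplied by `v⁻¹ (ε v + α
h)`, is `v⁻¹`. -/
theorem aux_point (hι : ∀ s : Scal, ι (algebraMap Scal _ s) = algebraMap Scal L s)
    (h'' : ε * ε = 1) (h : SubstData φ Ψ ψ)
    (hψ : ψ X * (1 + PowerSeries.C (ε • kap D α) * X) = ε • X) :
    subst2 ι φ Ψ X * (ε • 1 + PowerSeries.C (kap L α) * X) = X := by
  have h1 := congrArg (map (ι.comp PowerSeries.C)) hψ
  rw [map_mul, ← subst2_X h] at h1
  simp only [map_add, map_mul, map_one, map_zsmul, map_C, map_X, RingHom.comp_apply,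
    map_kap_C hι] at h1
  have h2 := congrArg (fun f => ε • f) h1
  simp only [← mul_smul_comm, smul_add, ← mul_smul, h'', one_smul] at h2
  rw [smul_mul_smul_comm, h'', one_smul] at h2
  exact h2

theorem aux_unit (h'' : ε * ε = 1) (α : ℂ) :
    IsUnit (ε • 1 + PowerSeries.C (kap L α) * X : L⟦X⟧) := by
  rw [isUnit_iff_constantCoeff]
  have e : (constantCoeff : L⟦X⟧ →+* L) (ε • 1 + PowerSeries.C (kap L α) * X) = ε • 1 := by
    simp
  rw [e]
  refine isUnit_iff_exists.2 ⟨ε • 1, ?_, ?_⟩ <;>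
  rw [smul_mul_smul_comm, h'', one_smul, one_mul]

theorem aux_comm (α : ℂ) (f : L⟦X⟧) :
    Commute (ε • 1 + PowerSeries.C (kap L α) * X : L⟦X⟧) f :=
  ((Commute.one_left f).smul_left ε).add_left
    ((by rw [map_C_kap]; exact kap_comm α f : Commute (PowerSeries.C (kap L α)) f).mul_left
      (commute_X f).symm)

theorem leg_point_comm (hz : ∀ f, Commute (PowerSeries.C u : L⟦X⟧) f) (f : L⟦X⟧) :
    Commute (PowerSeries.C (ε' • u + kap L α')) f := by
  rw [map_add, map_zsmul, map_C_kap]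
  exact ((hz f).smul_left _).add_left (kap_comm _ f)

theorem leg_unit (hι : QType ι u) (hz : ∀ f, Commute (PowerSeries.C u : L⟦X⟧) f)
    (h' : ε' * ε' = 1) (hφ : φ X * (1 + PowerSeries.C (ε' • kap D α') * X) = ε' • X) :
    IsUnit (PowerSeries.C (ε' • u + kap L α')) := by
  have h1 := congrArg PowerSeries.C (leg_point hι h' hφ)
  rw [map_mul, map_one] at h1
  refine isUnit_iff_exists.2 ⟨_, ?_, h1⟩
  rw [(leg_point_comm hz _).eq, h1]

/-- Both variables are substituted in the relation between `T(u)` and `T(v)`. That relation has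
been multiplied by the inverses of the points; the product with the points themselves is the
denominator `den`, which is invertible. -/
theorem auxRel_t_t_aux (hx : Sat c x) (hι : QType ι u)
    (hz : ZetaData (PowerSeries.C u) (X : L⟦X⟧) 1) (h' : ε' * ε' = 1)
    (h'' : ε * ε = 1) (h : SubstData φ Ψ ψ)
    (hφ : φ X * (1 + PowerSeries.C (ε' • kap D α') * X) = ε' • X)
    (hψ : ψ X * (1 + PowerSeries.C (ε • kap D α) * X) = ε • X) :
    AuxRel m (zeta ε' ε (α' - α) (PowerSeries.C u) X 1) (zeta ε' ε (α' - α) (PowerSeries.C u) X 1)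
      (legMat ι ((tMat x).map φ)) (auxMat ι ((tMat x).map ψ)) := by
  have h4 := MRel.map (subst2 ι φ Ψ) (tMat_rel hx)
  have hw := congrArg PowerSeries.C (leg_point hι h' hφ)
  rw [map_mul, map_one, ← subst2_C (ι := ι) h] at hw
  have hq := aux_point hι.hι h'' h hψ
  have hwc := leg_point_comm (ε' := ε') (α' := α') hz.hu
  have hqc := aux_comm (L := L) (ε := ε) α
  have hwu := leg_unit hι hz.hu h' hφ
  have hqu := aux_unit (L := L) h'' α
  set w := PowerSeries.C (ε' • u + kap L α') with hwdef
  set q := (ε • 1 + PowerSeries.C (kap L α) * X : L⟦X⟧) with hqdef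
  set σi := subst2 ι φ Ψ (PowerSeries.C X)
  set σo := subst2 ι φ Ψ X
  have hi : ∀ f, Commute σi f := commute_of_mul hwc hwu (by rw [hw]; exact Commute.one_left)
  have ho : ∀ f, Commute σo f := commute_of_mul hqc hqu (by
    rw [hq]; exact fun f => (commute_X f).symm)
  have hd : den ε' ε (α' - α) (PowerSeries.C u) X 1 = X * w - q := by
    rw [hwdef, hqdef, den, kap_sub, ← map_C_kap, ← map_C_kap, map_add, map_zsmul]
    rw [(commute_X _).symm.eq]
    simp only [add_mul, sub_mul]
    abel
  have hμ : (σo - σi) * (w * q) = den ε' ε (α' - α) (PowerSeries.C u) X 1 := by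
    rw [hd, sub_mul, ← mul_assoc σi, hw, one_mul, (hwc q).eq, ← mul_assoc, hq]
  have hν : subst2 ι φ Ψ (hh • (PowerSeries.C X * X)) * (w * q) = hh • X := by
    rw [Algebra.smul_def, map_mul, subst2_algebraMap hι.hι h, map_mul, mul_assoc]
    change _ * (σi * σo * (w * q)) = _
    rw [← Algebra.smul_def, (hwc q).eq, mul_assoc, ← mul_assoc σo, hq, (commute_X w).symm.eq,
      ← mul_assoc, hw, one_mul]
  have hμc : ∀ f, Commute (σo - σi) f := fun f => (ho f).sub_left (hi f)
  have hν' : subst2 ι φ Ψ (hh • (PowerSeries.C X * X)) =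
      (σo - σi) * zeta ε' ε (α' - α) (PowerSeries.C u) X 1 := by
    refine (hwu.mul hqu).mul_right_cancel ?_
    rw [hν, mul_assoc, (zeta_comm hz _ _).eq, ← mul_assoc, hμ, (den_comm hz _ _).eq,
      zeta_mul_den hz h' h'']
  rw [map_sub, hν'] at h4
  have hμu : IsUnit (σo - σi) := IsUnit_of_mul_central (b := w * q)
    (by rw [hμ]; exact hz.unit _ _ h' h'' _) fun f => (hwc f).mul_left (hqc f)
  have h5 := MRel.barRel (m := m) hμc hμu (zeta_comm hz _) h4
  have h6 := h5.aux (zeta_comm hz _)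
  have e3 : ((tMat x).map PowerSeries.C).map (subst2 ι φ Ψ) = legMat ι ((tMat x).map φ) := by
    ext1 i j
    exact subst2_C h _
  have e4 : ((tMat x).map (map PowerSeries.C)).map (subst2 ι φ Ψ) =
      auxMat ι ((tMat x).map ψ) := by
    ext1 i j
    exact subst2_map_C h _
  rwa [e3, e4] at h6

/-- The relation between `T(u)` and `T⁺(v)`, where the matrix `T` is in the auxiliary factor. The
two factors are exchanged by means of the unitarity of the normalized `R`-matrix. -/
theorem auxRel_tp_t_aux (hN : N ≠ 0) (hx : Sat c x) (hm : algebraMap Scal D hh ^ m = 0)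
    (hι : PType ι u)
    (hz : ZetaData (PowerSeries.C u) (X : L⟦X⟧) 1) (h' : ε' * ε' = 1)
    (h'' : ε * ε = 1) (h : SubstData φ Ψ ψ) (hφ : φ X = ε' • X + PowerSeries.C (kap D α'))
    (hψ : ψ X * (1 + PowerSeries.C (ε • kap D α) * X) = ε • X) :
    AuxRel m (zeta ε' ε (α' - α - c / 2) (PowerSeries.C u) X 1)
      (zeta ε' ε (α' - α + c / 2) (PowerSeries.C u) X 1)
      (legMat ι ((tpMat x).map φ)) (auxMat ι ((tMat x).map ψ)) := by
  have h4 := BarRel.map (subst2 ι φ Ψ) (subst2_algebraMap hι.hι h) (tMat_tpMat_rel hx hm)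
  have hq := aux_point hι.hι h'' h hψ
  have e1 : ∀ γ, subst2 ι φ Ψ (mixXi D γ) = -zeta ε' ε (α' - α - γ) (PowerSeries.C u) X 1 := by
    intro γ
    rw [← neg_eq_iff_eq_neg]
    refine eq_zeta hz h' h'' ?_
    have h5 := congrArg (fun f => subst2 ι φ Ψ f * (ε • 1 + PowerSeries.C (kap L α) * X))
      (mixXi_mul (D := D) γ)
    have e2 : ι (φ (mixShift D γ)) = -(ε' • u + kap L α') + kap L γ := by
      change ι (φ ((-1 : ℤ) • X + PowerSeries.C (kap D γ))) = _
      rw [map_add, map_zsmul, hφ, h.hφ, map_add, map_zsmul, map_add, map_zsmul, hι.hu,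
        map_kap_C hι.hι, map_kap_C hι.hι, neg_one_zsmul]
    simp only [Algebra.smul_def hh] at h5
    simp only [map_mul, map_add, map_one, subst2_C h, e2, subst2_algebraMap hι.hι h] at h5
    rw [mul_assoc, mul_assoc, add_mul, mul_assoc, hq, one_mul, ← Algebra.smul_def] at h5
    rw [← h5, neg_mul, ← mul_neg]
    congr 1
    rw [den, kap_sub, kap_sub, ← map_C_kap, ← map_C_kap, ← map_C_kap, map_neg]
    simp only [map_add, map_zsmul, add_mul, sub_mul, neg_mul, neg_add]
    abel
  rw [e1, e1] at h4
  have hc : ∀ γ f, Commute (-zeta ε' ε γ (PowerSeries.C u) X 1 : L⟦X⟧) f :=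
    fun γ f => (zeta_comm hz γ f).neg_left
  have hmL := algebraMap_series_pow (algebraMap_pow_of_map ι hι.hι (algebraMap_series_pow hm))
  have hn : ∀ γ, (-zeta ε' ε γ (PowerSeries.C u) X 1 : L⟦X⟧) ^ m = 0 := fun γ => by
    rw [neg_pow, zeta_nil hmL, mul_zero]
  have h6 := h4.aux_swap hN (hc _) (hc _) (hn _) (hn _)
  rw [neg_neg, neg_neg, sub_neg_eq_add] at h6
  have e3 : ((tpMat x).map PowerSeries.C).map (subst2 ι φ Ψ) = legMat ι ((tpMat x).map φ) := by
    ext1 i j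
    exact subst2_C h _
  have e4 : ((tMat x).map (map PowerSeries.C)).map (subst2 ι φ Ψ) =
      auxMat ι ((tMat x).map ψ) := by
    ext1 i j
    exact subst2_map_C h _
  rwa [e3, e4] at h6

/-- The relation between `T(u)` and `T⁺(v)`, where the matrix `T⁺` is in the auxiliary factor. The
variables of the universal relation have to be exchanged, so that the variable of `T` becomes the
inner one. -/
theorem auxRel_t_tp_aux (hx : Sat c x) (hm : algebraMap Scal D hh ^ m = 0)
    (hι : QType ι u)
    (hz : ZetaData (PowerSeries.C u) 1 (X : L⟦X⟧)) (h' : ε' * ε' = 1)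
    (h'' : ε * ε = 1) (h : SubstData φ Ψ ψ)
    (hφ : φ X * (1 + PowerSeries.C (ε' • kap D α') * X) = ε' • X)
    (hψ : ψ X = ε • X + PowerSeries.C (kap D α)) :
    AuxRel m (zeta ε' ε (α' - α + c / 2) (PowerSeries.C u) 1 X)
      (zeta ε' ε (α' - α - c / 2) (PowerSeries.C u) 1 X)
      (legMat ι ((tMat x).map φ)) (auxMat ι ((tpMat x).map ψ)) := by
  have hsw : ∀ s : Scal, (swapVar : D⟦X⟧⟦X⟧ →+* _) (algebraMap Scal _ s) =
      algebraMap Scal _ s := fun s => by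
    rw [algebraMap_series, swapVar_C, algebraMap_series s, map_C]
  have hsX : (swapVar : D⟦X⟧⟦X⟧ →+* _) X = PowerSeries.C X := by
    rw [← map_X PowerSeries.C, swapVar_map_C]
  have hΦ : ∀ s : Scal, (subst2 ι φ Ψ).comp swapVar (algebraMap Scal _ s) =
      algebraMap Scal _ s := fun s => by
    rw [RingHom.comp_apply, hsw, subst2_algebraMap hι.hι h]
  have h4 := BarRel.map ((subst2 ι φ Ψ).comp swapVar) hΦ (tMat_tpMat_rel hx hm)
  have hw := congrArg PowerSeries.C (leg_point hι h' hφ)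
  rw [map_mul, map_one] at hw
  have e1 : ∀ γ, (subst2 ι φ Ψ).comp swapVar (mixXi D γ) =
      zeta ε' ε (α' - α + γ) (PowerSeries.C u) 1 X := by
    intro γ
    refine eq_zeta hz h' h'' ?_
    have h5 := congrArg (fun f => (subst2 ι φ Ψ).comp swapVar f * PowerSeries.C (ε' • u + kap L α'))
      (mixXi_mul (D := D) γ)
    have e2 : map (ι.comp PowerSeries.C) (ψ (mixShift D γ)) =
        -(ε • X + PowerSeries.C (kap L α)) + PowerSeries.C (kap L γ) := by
      change map (ι.comp PowerSeries.C) (ψ ((-1 : ℤ) • X + PowerSeries.C (kap D γ))) = _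
      have e2' : ψ (PowerSeries.C (kap D γ)) = PowerSeries.C (kap D γ) := by
        have := h.hψ (PowerSeries.C (kap D γ))
        rw [map_C, h.hΨ] at this
        ext a
        have h7 := congrArg (fun f => constantCoeff (coeff a f)) this
        simpa [coeff_C, apply_ite] using h7.symm
      rw [map_add, map_zsmul, hψ, e2', map_add, map_zsmul, map_add, map_zsmul, map_X, map_C, map_C,
        RingHom.comp_apply, RingHom.comp_apply, map_kap_C hι.hι, map_kap_C hι.hι, neg_one_zsmul]
    simp only [Algebra.smul_def hh] at h5
    simp only [RingHom.comp_apply, map_mul, map_add, map_one, swapVar_C, hsX, hsw, subst2_C h,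
      subst2_map_C h, subst2_algebraMap hι.hι h] at h5
    rw [map_add] at hw
    rw [e2, mul_assoc, mul_assoc (algebraMap _ _ _), add_mul, mul_assoc, hw,
      mul_one, mul_one, one_mul] at h5
    rw [← Algebra.algebraMap_eq_smul_one]
    rw [RingHom.comp_apply, ← h5]
    congr 1
    rw [den, kap_add, kap_sub, ← map_C_kap, ← map_C_kap, ← map_C_kap]
    simp only [map_add, map_zsmul, mul_one]
    abel
  rw [e1, e1] at h4
  have h6 := h4.aux (zeta_comm hz _)
  rw [← sub_eq_add_neg] at h6
  have e3 : (((tMat x).map (map PowerSeries.C)).map ((subst2 ι φ Ψ).comp swapVar)) =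
      legMat ι ((tMat x).map φ) := by
    ext1 i j
    change subst2 ι φ Ψ (swapVar (map PowerSeries.C _)) = _
    rw [swapVar_map_C]
    exact subst2_C h _
  have e4 : ((tpMat x).map PowerSeries.C).map ((subst2 ι φ Ψ).comp swapVar) =
      auxMat ι ((tpMat x).map ψ) := by
    ext1 i j
    change subst2 ι φ Ψ (swapVar (PowerSeries.C _)) = _
    rw [swapVar_C]
    exact subst2_map_C h _
  rwa [e3, e4] at h6

end

end Points

/-! ### Substitution of points in the defining relations -/

section Points

open PowerSeries

variable {N m : ℕ} {D : Type} [Ring D] [Algebra Scal D]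

theorem exists_substData_aff (hm : algebraMap Scal D hh ^ m = 0)
    {φ : D⟦X⟧ →+* D⟦X⟧}
    (hφ : ∀ d, φ (PowerSeries.C d) = PowerSeries.C d) (ε : ℤ) (α : ℂ) :
    ∃ Ψ, SubstData φ Ψ (affHom ε (kap D α) (kap_comm α) (kap_pow hm α)) := by
  have hc : ∀ x, Commute (PowerSeries.C (kap D α)) x := by rw [map_C_kap]; exact kap_comm α
  have hn : PowerSeries.C (kap D α) ^ m = 0 := by rw [← map_pow, kap_pow hm α, map_zero]
  exact ⟨affHom ε (PowerSeries.C (kap D α)) hc hn,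
    hφ, fun f => affHom_C ε _ hc hn f, fun f => affHom_map_C ε (kap D α) (kap_comm α) hc
      (kap_pow hm α) hn f⟩

theorem exists_substData_moeb {φ : D⟦X⟧ →+* D⟦X⟧}
    (hφ : ∀ d, φ (PowerSeries.C d) = PowerSeries.C d) (ε : ℤ) (α : ℂ) :
    ∃ Ψ, SubstData φ Ψ (moebHom ε (kap D α) (kap_comm α)) := by
  have hc : ∀ x, Commute (PowerSeries.C (kap D α)) x := by rw [map_C_kap]; exact kap_comm α
  exact ⟨moebHom ε (PowerSeries.C (kap D α)) hc, hφ, fun f => moebHom_C ε _ hc f,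
    fun f => moebHom_map_C ε (kap D α) (kap_comm α) hc f⟩

variable {L : Type*} [Ring L] [Algebra Scal L] {ι : D⟦X⟧ →+* L} {u : L} {x : Gen N → D}
  {c : ℂ} {ε' ε : ℤ}

/-- `T⁺(ε' u + α' h)` in a tensor factor and `T⁺(ε v + α h)` in the auxiliary one. -/
theorem auxRel_tp_tp (hx : Sat c x) (hm : algebraMap Scal D hh ^ m = 0) (hι : PType ι u)
    (hz : ZetaData (PowerSeries.C u) 1 (X : L⟦X⟧)) (h' : ε' * ε' = 1)
    (h'' : ε * ε = 1) (α' α : ℂ) :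
    AuxRel m (zeta ε' ε (α' - α) (PowerSeries.C u) 1 X) (zeta ε' ε (α' - α) (PowerSeries.C u) 1 X)
      (legMat ι (tpAt hm x ε' α')) (auxMat ι (tpAt hm x ε α)) :=
  auxRel_tp_tp_aux hx hι hz h' h'' (exists_substData_aff hm (affHom_C _ _ _ _) ε α).choose_spec
    (affHom_X _ _ _ _) (affHom_X _ _ _ _)

/-- `T(ε' u + α' h)` in a tensor factor and `T(ε v + α h)` in the auxiliary one. -/
theorem auxRel_t_t (hx : Sat c x) (hι : QType ι u)
    (hz : ZetaData (PowerSeries.C u) (X : L⟦X⟧) 1) (h' : ε' * ε' = 1)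
    (h'' : ε * ε = 1) (α' α : ℂ) :
    AuxRel m (zeta ε' ε (α' - α) (PowerSeries.C u) X 1) (zeta ε' ε (α' - α) (PowerSeries.C u) X 1)
      (legMat ι (tAt x ε' α')) (auxMat ι (tAt x ε α)) :=
  auxRel_t_t_aux hx hι hz h' h'' (exists_substData_moeb (moebHom_C _ _ _) ε α).choose_spec
    (moebHom_X _ _ _) (moebHom_X _ _ _)

/-- `T⁺(ε' u + α' h)` in a tensor factor and `T(ε v + α h)` in the auxiliary one. -/
theorem auxRel_tp_t (hN : N ≠ 0) (hx : Sat c x) (hm : algebraMap Scal D hh ^ m = 0)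
    (hι : PType ι u)
    (hz : ZetaData (PowerSeries.C u) (X : L⟦X⟧) 1) (h' : ε' * ε' = 1)
    (h'' : ε * ε = 1) (α' α : ℂ) :
    AuxRel m (zeta ε' ε (α' - α - c / 2) (PowerSeries.C u) X 1)
      (zeta ε' ε (α' - α + c / 2) (PowerSeries.C u) X 1)
      (legMat ι (tpAt hm x ε' α')) (auxMat ι (tAt x ε α)) :=
  auxRel_tp_t_aux hN hx hm hι hz h' h'' (exists_substData_moeb (affHom_C _ _ _ _) ε α).choose_spec
    (affHom_X _ _ _ _) (moebHom_X _ _ _)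

/-- `T(ε' u + α' h)` in a tensor factor and `T⁺(ε v + α h)` in the auxiliary one. -/
theorem auxRel_t_tp (hx : Sat c x) (hm : algebraMap Scal D hh ^ m = 0)
    (hι : QType ι u)
    (hz : ZetaData (PowerSeries.C u) 1 (X : L⟦X⟧)) (h' : ε' * ε' = 1)
    (h'' : ε * ε = 1) (α' α : ℂ) :
    AuxRel m (zeta ε' ε (α' - α + c / 2) (PowerSeries.C u) 1 X)
      (zeta ε' ε (α' - α - c / 2) (PowerSeries.C u) 1 X)
      (legMat ι (tAt x ε' α')) (auxMat ι (tpAt hm x ε α)) :=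
  auxRel_t_tp_aux hx hm hι hz h' h'' (exists_substData_aff hm (moebHom_C _ _ _) ε α).choose_spec
    (moebHom_X _ _ _) (affHom_X _ _ _ _)

end Points

/-! ### Fused `R`-matrices and exchange relations of products -/

section Fused

variable {N n m : ℕ} {A : Type*} [Ring A] [Algebra Scal A]

/-- A product of normalized `R`-matrices of the tensor factors with the auxiliary one. -/
def rprod (m : ℕ) (ξ : Fin n → A) (l : List (Fin n)) :
    Mat[N, n] (Mat[N] A) :=
  (l.map fun i => leg i (rb N m (ξ i))).prod

/-- The sum of the permutation operators of the tensor factors with the auxiliary one. -/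
def swapSum (N n : ℕ) (A : Type*) [Ring A] :
    Mat[N, n] (Mat[N] A) :=
  ∑ i, leg i (swapMat N A)

theorem permMat_comm_swapSum {A : Type*} [Ring A] (σ : Equiv.Perm (Fin n)) :
    Commute (permMat σ) (swapSum N n A) := by
  rw [Commute, SemiconjBy, swapSum, Finset.mul_sum, Finset.sum_mul]
  refine Fintype.sum_equiv σ _ _ fun i => ?_
  rw [permMat_mul_leg]

theorem rprod_append (ξ : Fin n → A) (l l' : List (Fin n)) :
    (rprod m ξ (l ++ l') : Matrix (Fin n → Fin N) _ _) = rprod m ξ l * rprod m ξ l' := by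
  rw [rprod, rprod, rprod, List.map_append, List.prod_append]

theorem rprod_inv (hN : N ≠ 0) {ξ : Fin n → A} (hξ : ∀ i x, Commute (ξ i) x)
    (hm : ∀ i, ξ i ^ m = 0) (l : List (Fin n)) :
    (rprod m ξ l : Matrix (Fin n → Fin N) _ _) * rprod m (fun i => -ξ i) l.reverse = 1 := by
  induction l with
  | nil => simp [rprod]
  | cons a l ih =>
    rw [List.reverse_cons, rprod_append]
    have e1 : (rprod m ξ (a :: l) : Matrix (Fin n → Fin N) _ _) = leg a (rb N m (ξ a)) * rprod m ξ l := by
      simp [rprod]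
    have e2 : (rprod m (fun i => -ξ i) [a] : Matrix (Fin n → Fin N) _ _) = leg a (rb N m (-ξ a)) := by
      simp [rprod]
    rw [e1, e2, mul_assoc, ← mul_assoc (rprod m ξ l), ih, one_mul, ← map_mul,
      rb_mul_rb_neg hN (hξ a) (hm a), map_one]

theorem rprod_inv' (hN : N ≠ 0) {ξ : Fin n → A} (hξ : ∀ i x, Commute (ξ i) x)
    (hm : ∀ i, ξ i ^ m = 0) (l : List (Fin n)) :
    (rprod m (fun i => -ξ i) l.reverse : Matrix (Fin n → Fin N) _ _) * rprod m ξ l = 1 := by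
  have := rprod_inv (N := N) (ξ := fun i => -ξ i) (m := m) hN (fun i x => (hξ i x).neg_left)
    (fun i => by rw [neg_pow, hm, mul_zero]) l.reverse
  simpa only [neg_neg, List.reverse_reverse] using this

theorem rb_apply_comm {ξ : A} (hξ : ∀ x, Commute ξ x) (a b c d : Fin N) (x : A) :
    Commute (rb N m ξ a b c d) x := by
  have hg := gEval_comm (N := N) (m := m) hξ
  have e : ∀ z : A, (∀ x, Commute z x) → ∀ a b c d,
      Commute ((sc2 z : Mat[N] _) a b c d) x := by
    intro z hz a b c d
    change Commute ((Matrix.diagonal fun _ => Matrix.diagonal fun _ => z :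
      Mat[N] (Mat[N] A)) a b c d) x
    rw [Matrix.diagonal_apply]
    split_ifs
    · rw [Matrix.diagonal_apply]
      split_ifs
      exacts [hz x, Commute.zero_left x]
    · exact Commute.zero_left x
  have e' : ∀ z : A, (∀ x, Commute z x) → 
      Commute ((sc2 z * swapMat N A : Mat[N] (Mat[N] A)) a b c d) x := by
    intro z hz
    rw [(sc2_comm hz _).eq, swapMat_mul_apply]
    exact e z hz _ _ _ _
  exact (e _ hg a b c d).sub_left (e' _ fun x => (hg x).mul_left (hξ x))

theorem rb_comm_scalar {ξ : A} (hξ : ∀ x, Commute ξ x) (a b : Fin N) (y : A) :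
    Commute (rb N m ξ a b) (Matrix.scalar (Fin N) y) := by
  refine Matrix.ext fun c d => ?_
  rw [Matrix.scalar_apply, Matrix.mul_diagonal, Matrix.diagonal_mul]
  exact (rb_apply_comm hξ a b c d y).eq

theorem leg_rb_comm_leg_lift {ξ : A} (hξ : ∀ x, Commute ξ x) {i j : Fin n} (h : i ≠ j)
    (Y : Mat[N] A) : Commute (leg i (rb N m ξ)) (leg j (liftMat Y)) :=
  leg_mul_leg_comm h _ _ fun a b _ _ => rb_comm_scalar hξ a b _

variable {χ : Equiv.Perm (Fin n) →* ℤˣ} {s : ℤ}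

/-- The fused form `γ (1 - z (P_1 + ⋯ + P_n))` of a product of `R`-matrices. -/
structure Fused {A : Type*} [Ring A] (N : ℕ) (χ : Equiv.Perm (Fin n) →* ℤˣ) (ρ : Mat[N, n]
    (Mat[N] A)) : Prop where
  exists_eq : ∃ γ z : Subring.center A, ρ = γ • (1 - z • swapSum N n A)

theorem Fused.comm {ρ : Mat[N, n] (Mat[N] A)}
    (h : Fused N χ ρ) : Commute (isoProj N n χ _) ρ := by
  obtain ⟨γ, z, rfl⟩ := h
  refine Commute.smul_right ?_ γ
  exact (Commute.one_right _).sub_right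
    ((commute_isoProj_of_forall χ permMat_comm_swapSum).smul_right z)

theorem Fused.comm' {A : Type*} [Ring A] {ρ ρ' : Mat[N, n] (Mat[N] A)}
    (h : Fused N χ ρ) (h' : Fused N χ ρ') : Commute ρ ρ' := by
  obtain ⟨γ, z, rfl⟩ := h
  obtain ⟨γ', z', rfl⟩ := h'
  have hJ : Commute (1 - z • swapSum N n A) (1 - z' • swapSum N n A) :=
    (Commute.one_left _).sub_left
      (((Commute.one_right _).sub_right ((Commute.refl _).smul_right z')).smul_left z)
  exact (hJ.smul_left γ).smul_right γ'

theorem rb_eq_smul {ξ : A} (hξ : ∀ x, Commute ξ x) :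
    ∃ γ z : Subring.center A, (z : A) = ξ ∧ (γ : A) = gEval N m ξ ∧
      rb N m ξ = γ • (1 - z • swapMat N A) := by
  have hc : ∀ z : A, (∀ x, Commute z x) → z ∈ Subring.center A := fun z hz =>
    Subring.mem_center_iff.2 fun g => (hz g).eq.symm
  have hs : ∀ z : Subring.center A, ∀ M : Mat[N] (Mat[N] A),
      z • M = sc2 (z : A) * M := fun z M => by
    ext a b c d
    change _ = (Matrix.diagonal (fun _ => Matrix.diagonal fun _ => (z : A)) * M :
      Mat[N] (Mat[N] A)) a b c d
    rw [Matrix.diagonal_mul, Matrix.diagonal_mul]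
    rfl
  refine ⟨⟨_, hc _ (gEval_comm (N := N) (m := m) hξ)⟩, ⟨_, hc _ hξ⟩, rfl, rfl, ?_⟩
  rw [hs, hs, rb, mul_sub, mul_one, ← mul_assoc, ← map_mul, ← map_mul]

theorem leg_smul {B S : Type*} [Ring B] [CommRing S] [Algebra S B] (i : Fin n) (z : S)
    (X : Mat[N] B) : leg i (z • X) = z • leg i X := by
  ext a b
  rw [leg_apply, Matrix.smul_apply, Matrix.smul_apply, leg_apply]
  split_ifs <;> simp

/-- In the presence of the projection `E`, a product of `R`-matrices at points in arithmetic
progression is a multiple of `1 - z (P_1 + ⋯ + P_n)`, where `P_i` is the permutation of the factor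
`i` with the auxiliary one. In particular, it commutes with `E`, and two such products commute. -/
theorem rprod_fused (hs : ∀ i j, i ≠ j → ((χ (Equiv.swap i j) : ℤˣ) : ℤ) = s) {ξ : Fin n → A}
    (hξ : ∀ i x, Commute (ξ i) x) {l : List (Fin n)} (hl : l.Nodup) (hall : ∀ i, i ∈ l)
    (hc : l.IsChain fun i j => ξ j - ξ i = s • (ξ i * ξ j)) :
    ∃ ρ, Fused N χ ρ ∧ isoProj N n χ _ * rprod m ξ l.reverse = isoProj N n χ _ * ρ ∧
      rprod m ξ l * isoProj N n χ _ = ρ * isoProj N n χ _ := by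
  choose γ z hz _ hrb using fun i => rb_eq_smul (N := N) (m := m) (hξ i)
  have hleg : ∀ i, leg i (rb N m (ξ i)) =
      γ i • (1 - z i • leg i (swapMat N A) : Mat[N, n] _) := fun i => by
    rw [hrb, leg_smul, map_sub, map_one, leg_smul]
  have hprod : ∀ l : List (Fin n), (rprod m ξ l : Matrix (Fin n → Fin N) _ _) =
      (l.map γ).prod • (l.map fun i => 1 - z i • leg i (swapMat N A)).prod := by
    intro l
    induction l with
    | nil => simp [rprod]
    | cons a l ih =>
      have e1 : (rprod m ξ (a :: l) : Matrix (Fin n → Fin N) _ _) =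
          leg a (rb N m (ξ a)) * rprod m ξ l := by simp [rprod]
      rw [e1, ih, hleg, List.map_cons, List.prod_cons, List.map_cons, List.prod_cons,
        smul_mul_smul_comm]
  have hE : ∀ i j : Fin n, i ≠ j → isoProj N n χ (Mat[N] A) *
      permMat (Equiv.swap i j) = s • isoProj N n χ _ := fun i j h => by
    rw [isoProj_mul_permMat, hs i j h]
  have hE' : ∀ i j : Fin n, i ≠ j → permMat (Equiv.swap i j) *
      isoProj N n χ (Mat[N] A) = s • isoProj N n χ _ := fun i j h => by
    rw [permMat_mul_isoProj, hs i j h]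
  obtain ⟨w, hw1, hw2⟩ := fusion_prod (S := Subring.center A) (E := isoProj N n χ _) (s := s)
    (P := fun i => leg i (swapMat N A)) (ξ := z) l hl
    (fun i j h => by rw [leg_swapMat_mul h, ← mul_assoc, hE i j h, smul_mul_assoc])
    (fun i j h => by rw [leg_swapMat_mul' h, mul_assoc, hE' i j h, mul_smul_comm])
    (hc.imp fun i j h => by
      apply Subtype.ext
      have : ((s : Subring.center A) * (z i * z j) : Subring.center A) = s • (z i * z j) := by
        rw [zsmul_eq_mul]
      rw [this]
      change (z j : A) - z i = s • ((z i : A) * z j)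
      rw [hz, hz, h])
  have hsum : (l.map fun i => leg i (swapMat N A)).sum = swapSum N n A := by
    rw [swapSum, ← List.sum_toFinset _ hl]
    congr 1
    ext i
    simp [hall i]
  rw [hsum] at hw1 hw2
  refine ⟨(l.map γ).prod • (1 - w • swapSum N n A), ⟨_, _, rfl⟩, ?_, ?_⟩
  · rw [hprod, mul_smul_comm, hw1, mul_smul_comm, List.map_reverse, List.prod_reverse]
  · rw [hprod, smul_mul_assoc, hw2, smul_mul_assoc]

end Fused

/-! ### Exchange relations of products -/

section MultiExchange

variable {N n m : ℕ} {A : Type*} [Ring A] [Algebra Scal A]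

/-- Central nilpotent parameters. -/
structure Par {A : Type*} [Ring A] (m : ℕ) (ξ : Fin n → A) : Prop where
  comm : ∀ i x, Commute (ξ i) x
  nil : ∀ i, ξ i ^ m = 0

theorem Par.neg {A : Type*} [Ring A] {ξ : Fin n → A} (h : Par m ξ) : Par m fun i => -ξ i :=
  ⟨fun i x => (h.comm i x).neg_left, fun i => by rw [neg_pow, h.nil, mul_zero]⟩

/-- The unit given by a product of `R`-matrices. -/
def rUnit (hN : N ≠ 0) {ξ : Fin n → A} (h : Par m ξ) (l : List (Fin n)) :
    (Mat[N, n] (Mat[N] A))ˣ :=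
  ⟨rprod m ξ l, rprod m (fun i => -ξ i) l.reverse, rprod_inv hN h.comm h.nil l,
    rprod_inv' hN h.comm h.nil l⟩

/-- Scalar matrices over the matrix ring, as an algebra homomorphism. -/
def scalarAlg (N : ℕ) (A : Type*) [Ring A] [Algebra Scal A] : A →ₐ[Scal] Mat[N] A :=
  { Matrix.scalar (Fin N) with
    commutes' := fun s => by
      change Matrix.scalar (Fin N) (algebraMap Scal A s) = _
      rw [scalar_algebraMap, Algebra.algebraMap_eq_smul_one] }

theorem liftMat_isoProj (χ : Equiv.Perm (Fin n) →* ℤˣ) :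
    (liftMat (isoProj N n χ A) : Matrix _ _ (Mat[N] A)) = isoProj N n χ _ :=
  isoProj_map χ (scalarAlg N A)

theorem liftMat_leg {A : Type*} [Ring A] (i : Fin n) (X : Mat[N] A) :
    (liftMat (leg i X) : Matrix _ _ (Mat[N] A)) = leg i (liftMat X) :=
  leg_map (Matrix.scalar (Fin N) : A →+* _) i X

theorem permMat_comm_scalar {B : Type*} [Ring B] (σ : Equiv.Perm (Fin n)) (t : B) :
    Commute (permMat σ : Matrix (Fin n → Fin N) _ B) (Matrix.scalar _ t) := by
  refine Matrix.ext fun a b => ?_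
  rw [permMat_mul_apply, mul_permMat_apply, Matrix.scalar_apply, Matrix.diagonal_apply,
    Matrix.diagonal_apply]
  congr 1
  refine propext ⟨?_, ?_⟩
  · rintro rfl
    funext i
    simp
  · intro h
    rw [h]
    funext i
    simp

/-- The exchange relation of `T_1(w_1) ⋯ T_n(w_n) (T_n(w_n') ⋯ T_1(w_1'))⁻¹` with `t t'⁻¹`, where
`t` and `t'` act on the auxiliary factor. The products of the `R`-matrices of the single factors
fuse, so that they fulfil the conditions of `exchange_of_relations`. -/
theorem multi_exchange (hN : N ≠ 0) {χ : Equiv.Perm (Fin n) →* ℤˣ} {s : ℤ}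
    (hs : ∀ i j, i ≠ j → ((χ (Equiv.swap i j) : ℤˣ) : ℤ) = s) {l : List (Fin n)} (hl : l.Nodup)
    (hall : ∀ i, i ∈ l) {P P' : Fin n → Mat[N] A}
    {t t' ti : Mat[N] A} (ht1 : t' * ti = 1) (ht2 : ti * t' = 1)
    {Ti : Mat[N, n] A}
    (hT1 : (l.reverse.map fun i => leg i (P' i)).prod * Ti = 1)
    (hT2 : Ti * (l.reverse.map fun i => leg i (P' i)).prod = 1)
    {η1 η2 η3 η4 ξ1 ξ2 : Fin n → A} (p1 : Par m η1) (p2 : Par m η2) (p3 : Par m η3)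
    (p4 : Par m η4) (q1 : Par m ξ1) (q2 : Par m ξ2)
    (r1 : ∀ i, AuxRel m (η1 i) (ξ1 i) (P i) t) (r2 : ∀ i, AuxRel m (η2 i) (ξ2 i) (P i) t')
    (r3 : ∀ i, AuxRel m (η3 i) (-ξ2 i) (P' i) t) (r4 : ∀ i, AuxRel m (η4 i) (-ξ1 i) (P' i) t')
    (c1 : l.IsChain fun i j => η1 i - η1 j = s • (η1 i * η1 j))
    (d1 : l.IsChain fun i j => ξ1 i - ξ1 j = s • (ξ1 i * ξ1 j))
    (d2 : l.IsChain fun i j => ξ2 i - ξ2 j = s • (ξ2 i * ξ2 j))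
    (hT : isoProj N n χ A * (l.map fun i => leg i (P i)).prod =
      isoProj N n χ A * (l.map fun i => leg i (P i)).prod * isoProj N n χ A) :
    liftMat (isoProj N n χ A * ((l.map fun i => leg i (P i)).prod * Ti)) *
      (rprod m (fun i => -η3 i) l * Matrix.scalar _ (t * ti) *
        rprod m η4 l.reverse) =
    liftMat (isoProj N n χ A) *
      (rprod m (fun i => -η1 i) l.reverse *
        Matrix.scalar _ (t * ti) * rprod m η2 l) *
      liftMat ((l.map fun i => leg i (P i)).prod * Ti) := by
  -- The exchange relations of the single factors are multiplied.
  have hR : ∀ {η ξ : Fin n → A} (_ : Par m η) (_ : Par m ξ) {P : Fin n → Mat[N] A}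
      {t : Mat[N] A} (_ : ∀ i, AuxRel m (η i) (ξ i) (P i) t) (l : List (Fin n))
      (_ : l.Nodup),
      rprod m η l * (liftMat (l.map fun i => leg i (P i)).prod * Matrix.scalar (Fin n → Fin N) t) =
      Matrix.scalar (Fin n → Fin N) t * liftMat (l.map fun i => leg i (P i)).prod *
        rprod m ξ l := by
    intro η ξ hη hξ P t r l hl
    have e : (liftMat (l.map fun i => leg i (P i)).prod :
        Mat[N, n] (Mat[N] A)) =
        (l.map fun i => leg i (liftMat (P i))).prod := by
      rw [map_list_prod, List.map_map]
      congr 1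
      exact List.map_congr_left fun i _ => liftMat_leg i _
    rw [e]
    refine list_prod_exchange hl (fun i _ => ?_)
      (fun i _ j _ h => leg_rb_comm_leg_lift (hη.comm i) h _)
      (fun i _ j _ h => leg_rb_comm_leg_lift (hξ.comm i) h _)
    rw [← leg_scalar i, ← map_mul, ← map_mul, ← map_mul, ← map_mul, r i]
  have hlr : l.reverse.Nodup := List.nodup_reverse.2 hl
  have hallr : ∀ i, i ∈ l.reverse := fun i => List.mem_reverse.2 (hall i)
  have hrev : ∀ {ξ : Fin n → A} (_ : Par m ξ), (l.IsChain fun i j => ξ i - ξ j = s • (ξ i * ξ j)) →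
      l.reverse.IsChain fun i j => ξ j - ξ i = s • (ξ i * ξ j) := by
    intro ξ hξ h
    rw [List.isChain_reverse]
    refine h.imp fun i j hij => ?_
    change ξ i - ξ j = s • (ξ j * ξ i)
    rw [hij, (hξ.comm i _).eq]
  obtain ⟨ρ1, f1, g1, -⟩ := rprod_fused (N := N) (m := m) hs p1.neg.comm hl hall
    (c1.imp fun i j h => by rw [neg_mul_neg, ← h]; abel)
  obtain ⟨σ1, f2, g2, -⟩ := rprod_fused (N := N) (m := m) hs q1.comm hlr hallr (hrev q1 d1)
  obtain ⟨σ2, f3, g3, -⟩ := rprod_fused (N := N) (m := m) hs q2.comm hlr hallr (hrev q2 d2)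
  rw [List.reverse_reverse] at g2 g3
  have hE2 := isoProj_sq (N := N) (A := Mat[N] A) χ
  have key := exchange_of_relations (R := Mat[N, n]
      (Mat[N] A))
    (E := liftMat (isoProj N n χ A)) (T := liftMat (l.map fun i => leg i (P i)).prod)
    (t := Matrix.scalar _ t) (X2 := rprod m η2 l)
    (T' := ⟨liftMat (l.reverse.map fun i => leg i (P' i)).prod, liftMat Ti,
      by rw [← map_mul, hT1, map_one], by rw [← map_mul, hT2, map_one]⟩)
    (t' := ⟨Matrix.scalar _ t', Matrix.scalar _ ti,
      by rw [← map_mul, ht1, map_one], by rw [← map_mul, ht2, map_one]⟩)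
    (X1 := rUnit hN p1 l) (X3 := rUnit hN p3 l.reverse) (X4 := rUnit hN p4 l.reverse)
    (Y1 := rUnit hN q1 l) (Y2 := rUnit hN q2 l)
    (hR p1 q1 r1 l hl) (hR p2 q2 r2 l hl)
    (hR p3 q2.neg r3 l.reverse hlr) (hR p4 q1.neg r4 l.reverse hlr) ?_ ?_ ?_ ?_
  · have e3 : (((rUnit hN p3 l.reverse)⁻¹ : (Mat[N, n]
        (Mat[N] A))ˣ) : Mat[N, n]
        (Mat[N] A)) = rprod m (fun i => -η3 i) l := by
      change rprod m _ l.reverse.reverse = _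
      rw [List.reverse_reverse]
    rw [e3] at key
    rw [map_mul, map_mul, map_mul]
    exact key
  · change _ * rprod m _ l.reverse = _ * rprod m _ l.reverse * _
    rw [liftMat_isoProj, g1, mul_assoc, ← f1.comm.eq, ← mul_assoc, hE2]
  · rw [liftMat_isoProj]
    exact commute_isoProj_of_forall χ fun τ => permMat_comm_scalar τ _
  · rw [← map_mul, ← map_mul, ← hT]
  · change _ * (rprod m _ l * rprod m _ l) = _ * (rprod m _ l * rprod m _ l)
    rw [liftMat_isoProj, ← mul_assoc, ← mul_assoc, g2, g3, f2.comm.eq, f3.comm.eq, mul_assoc, g3,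
      mul_assoc, g2, f3.comm.eq, ← mul_assoc, f2.comm.eq, ← mul_assoc, (f2.comm' f3).eq]

end MultiExchange

/-! ### Crossing symmetry -/

section Crossing

variable {N n m : ℕ} {A : Type*} [Ring A] [Algebra Scal A]

/-- Transposition in the tensor factors does not change the order of matrices which act on different
factors. -/
theorem transpose_leg_mul {B : Type*} [Ring B] {i : Fin n} {l : List (Fin n)} (hi : i ∉ l)
    (X : Mat[N] B) (Y : Fin n → Mat[N] B) :
    (leg i X * (l.map fun j => leg j (Y j)).prod).transpose =
      leg i X.transpose * (l.map fun j => leg j (Y j)).prod.transpose := by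
  have hz : ∀ l : List (Fin n), i ∉ l → ∀ a b : Fin n → Fin N, a i ≠ b i →
      ((l.map fun j => leg j (Y j)).prod : Matrix _ _ B) a b = 0 := by
    intro l
    induction l with
    | nil => 
      intro _ a b h
      rw [List.map_nil, List.prod_nil, Matrix.one_apply_ne fun e => h (by rw [e])]
    | cons j l ih =>
      intro hi a b h
      rw [List.mem_cons, not_or] at hi
      rw [List.map_cons, List.prod_cons, leg_mul_apply]
      refine Finset.sum_eq_zero fun x _ => ?_
      rw [ih hi.2 _ _ (by rwa [Function.update_of_ne hi.1]), mul_zero]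
  have hu : ∀ l : List (Fin n), i ∉ l → ∀ (a b : Fin n → Fin N) (x : Fin N), 
      ((l.map fun j => leg j (Y j)).prod : Matrix _ _ B) (Function.update a i x)
        (Function.update b i x) =
      ((l.map fun j => leg j (Y j)).prod : Matrix _ _ B) (Function.update a i (b i)) b := by
    intro l
    induction l with
    | nil =>
      intro _ a b x
      rw [List.map_nil, List.prod_nil, Matrix.one_apply, Matrix.one_apply]
      congr 1
      refine propext ⟨fun h => ?_, fun h => ?_⟩
      · have := congrArg (fun f => Function.update f i (b i)) h
        simpa using this
      · rw [← h]; simp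
    | cons j l ih =>
      intro hi a b x
      rw [List.mem_cons, not_or] at hi
      rw [List.map_cons, List.prod_cons, leg_mul_apply, leg_mul_apply]
      refine Finset.sum_congr rfl fun y _ => ?_
      rw [Function.update_of_ne (Ne.symm hi.1), Function.update_of_ne (Ne.symm hi.1),
        Function.update_comm hi.1, Function.update_comm hi.1, ih hi.2]
  ext1 a b
  rw [Matrix.transpose_apply, leg_mul_apply, leg_mul_apply,
    Finset.sum_eq_single (a i), Finset.sum_eq_single (b i)]
  · rw [Matrix.transpose_apply, Matrix.transpose_apply]
    congr 1
    have := hu l hi b a (b i)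
    rw [Function.update_eq_self] at this
    rw [this]
  · intro x _ hx
    rw [Matrix.transpose_apply, Matrix.transpose_apply, hz l hi, mul_zero]
    simpa using Ne.symm hx
  · simp
  · intro x _ hx
    rw [hz l hi, mul_zero]
    simpa using hx
  · simp

theorem transpose_legs {B : Type*} [Ring B] {l : List (Fin n)} (hl : l.Nodup)
    (Y : Fin n → Mat[N] B) :
    ((l.map fun j => leg j (Y j)).prod : Mat[N, n] B).transpose =
      (l.map fun j => leg j (Y j).transpose).prod := by
  induction l with
  | nil => simp
  | cons i l ih =>
    rw [List.map_cons, List.prod_cons, transpose_leg_mul (List.nodup_cons.1 hl).1,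
      ih (List.nodup_cons.1 hl).2, List.map_cons, List.prod_cons]

theorem sc2_transpose (z : A) :
    (sc2 z : Mat[N] (Mat[N] A)).transpose = sc2 z := by
  change (Matrix.diagonal fun _ => _).transpose = _
  rw [Matrix.diagonal_transpose]
  rfl

theorem sc2_mul_transpose (z : A) (M : Mat[N] (Mat[N] A)) :
    (sc2 z * M).transpose = sc2 z * M.transpose := by
  ext1 a b
  change ((Matrix.diagonal fun _ => Matrix.scalar _ z) * M :
      Mat[N] (Mat[N] A)) b a =
    ((Matrix.diagonal fun _ => Matrix.scalar _ z) * M.transpose :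
      Mat[N] (Mat[N] A)) a b
  rw [Matrix.diagonal_mul, Matrix.diagonal_mul, Matrix.transpose_apply]

/-- Crossing symmetry of the normalized `R`-matrix. -/
theorem rb_crossing (hN : N ≠ 0) {ξ ξ' : A} (hξ : ∀ x, Commute ξ x) (hm : ξ ^ m = 0)
    (hξ' : ∀ x, Commute ξ' x) (hm' : ξ' ^ m = 0) (h : ξ' - ξ = (N : A) * (ξ * ξ')) :
    (rb N m ξ).transpose * (rb N m (-ξ')).transpose = 1 := by
  set Q := (swapMat N A).transpose with hQ
  have hg' : ∀ x, Commute (gEval N m (-ξ')) x := gEval_comm fun x => (hξ' x).neg_left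
  have e1 : (rb N m ξ).transpose = sc2 (gEval N m ξ) * (1 - sc2 ξ * Q) := by
    rw [rb, Matrix.transpose_sub, sc2_transpose, sc2_mul_transpose, mul_sub, mul_one, ← mul_assoc,
      ← map_mul, ← map_mul]
  have e2 : (rb N m (-ξ')).transpose = sc2 (gEval N m (-ξ')) * (1 + sc2 ξ' * Q) := by
    rw [rb, Matrix.transpose_sub, sc2_transpose, sc2_mul_transpose, mul_add, mul_one, ← mul_assoc,
      ← map_mul, ← map_mul, mul_neg, sc2_neg, neg_mul, sub_neg_eq_add]
  have hc : ∀ z w : A, sc2 z * sc2 w = (sc2 (z * w) : Mat[N] _) := fun z w => by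
    rw [← map_mul, ← map_mul]
  have hNQ : Q * Q = sc2 (N : A) * Q := by
    rw [hQ, swapMat_transpose_sq, nsmul_eq_mul]
    congr 1
  have e3 : (1 - sc2 ξ * Q) * (1 + sc2 ξ' * Q) = 1 := by
    have h1 : sc2 ξ * Q * (sc2 ξ' * Q) = sc2 ξ' * Q - sc2 ξ * Q := by
      rw [mul_assoc, ← mul_assoc Q, ← (sc2_comm hξ' Q).eq, mul_assoc, hNQ, ← mul_assoc,
        ← mul_assoc, hc, hc, ← (Nat.cast_commute N (ξ * ξ')).eq, ← h, sc2_sub, sub_mul]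
    rw [sub_mul, one_mul, mul_add, mul_one, h1]
    abel
  rw [e1, e2, mul_assoc, ← mul_assoc (1 - _), ← (sc2_comm hg' _).eq, mul_assoc, e3, mul_one, hc,
    gEval_shift hN hξ hm hξ' hm' h, mul_assoc, ← (hg' _).eq, ← mul_assoc,
    gEval_unitarity hN hξ' hm', sc2_one]

/-- Crossing symmetry for products of `R`-matrices. -/
theorem transpose_rprod_mul (hN : N ≠ 0) {ξ ξ' : Fin n → A} (h : Par m ξ) (h' : Par m ξ')
    (hs : ∀ i, ξ' i - ξ i = (N : A) * (ξ i * ξ' i)) {l : List (Fin n)} (hl : l.Nodup) :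
    (rprod m ξ l : Matrix (Fin n → Fin N) _ _).transpose *
      (rprod m (fun i => -ξ' i) l.reverse).transpose = 1 := by
  rw [rprod, rprod, transpose_legs hl, transpose_legs (List.nodup_reverse.2 hl)]
  clear hl
  induction l with
  | nil => simp
  | cons a l ih =>
    rw [List.reverse_cons, List.map_append, List.prod_append, List.map_cons, List.prod_cons,
      mul_assoc, ← mul_assoc _ _ (List.prod (List.map _ [a])), ih, one_mul, List.map_cons,
      List.map_nil, List.prod_singleton, ← map_mul,
      rb_crossing hN (h.comm a) (h.nil a) (h'.comm a) (h'.nil a) (hs a), map_one]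

theorem rprod_apply_comm {ξ : Fin n → A} (h : Par m ξ) (l : List (Fin n)) (a b : Fin n → Fin N)
    (x : A) : Commute ((rprod m ξ l : Matrix _ _ (Mat[N] A)) a b)
      (Matrix.scalar (Fin N) x) := by
  induction l generalizing a with
  | nil =>
    rw [rprod, List.map_nil, List.prod_nil, Matrix.one_apply]
    split_ifs
    exacts [Commute.one_left _, Commute.zero_left _]
  | cons i l ih =>
    have e1 : (rprod m ξ (i :: l) : Matrix (Fin n → Fin N) _ _) =
        leg i (rb N m (ξ i)) * rprod m ξ l := by simp [rprod]
    rw [e1, leg_mul_apply]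
    exact Commute.sum_left _ _ _ fun y _ => (rb_comm_scalar (h.comm i) _ _ _).mul_left (ih _)

/-- The trace over the tensor factors is invariant under conjugation by `R`-matrices with crossed
parameters. -/
theorem trace_crossing (hN : N ≠ 0) {ξ ξ' : Fin n → A} (h : Par m ξ) (h' : Par m ξ')
    (hs : ∀ i, ξ' i - ξ i = (N : A) * (ξ i * ξ' i)) {l : List (Fin n)} (hl : l.Nodup)
    (Λ : Mat[N, n] A) :
    Matrix.trace (rprod m ξ l * liftMat Λ * rprod m (fun i => -ξ' i) l.reverse) =
      Matrix.scalar (Fin N) (Matrix.trace Λ) := by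
  have h1 := transpose_rprod_mul hN h h' hs hl
  -- The crossing relation, in matrix entries, contracts the indices over which the trace is taken.
  have h2 : ∀ y z, ∑ x, (rprod m ξ l : Matrix _ _ (Mat[N] A)) x y *
      rprod m (fun i => -ξ' i) l.reverse z x = if y = z then 1 else 0 := fun y z => by
    have := congrFun (congrFun h1 y) z
    rwa [Matrix.mul_apply, Matrix.one_apply] at this
  have h3 : Matrix.trace (rprod m ξ l * liftMat Λ * rprod m (fun i => -ξ' i) l.reverse) =
      ∑ y, ∑ z, Matrix.scalar (Fin N) (Λ y z) * ∑ x,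
        (rprod m ξ l : Matrix _ _ (Mat[N] A)) x y *
        rprod m (fun i => -ξ' i) l.reverse z x := by
    simp only [Matrix.trace, Matrix.diag, Matrix.mul_apply, Finset.sum_mul, Finset.mul_sum]
    rw [Finset.sum_comm' (s := Finset.univ) (t := fun _ => Finset.univ) (t' := Finset.univ)
      (s' := fun _ => Finset.univ) (by simp)]
    rw [Finset.sum_congr rfl fun z _ => Finset.sum_comm, Finset.sum_comm]
    refine Finset.sum_congr rfl fun y _ => Finset.sum_congr rfl fun z _ =>
      Finset.sum_congr rfl fun x _ => ?_
    have := (rprod_apply_comm h l x y (Λ y z)).eq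
    change _ * Matrix.scalar (Fin N) (Λ y z) * _ = _
    rw [this, mul_assoc]
  rw [h3]
  simp only [h2, mul_ite, mul_one, mul_zero, Finset.sum_ite_eq, Finset.mem_univ, if_true]
  rw [Matrix.trace, map_sum]
  rfl

end Crossing

/-! ### Commutation of traces -/

section TraceCommute

variable {N n m : ℕ} {A : Type*} [Ring A] [Algebra Scal A]

theorem trace_mul_isoProj {B : Type*} [Ring B] [Algebra Scal B] (χ : Equiv.Perm (Fin n) →* ℤˣ)
    (M : Mat[N, n] B) :
    Matrix.trace (isoProj N n χ B * M) = Matrix.trace (M * isoProj N n χ B) := by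
  simp only [Matrix.trace, Matrix.diag, Matrix.mul_apply]
  rw [Finset.sum_comm]
  exact Finset.sum_congr rfl fun a _ => Finset.sum_congr rfl fun b _ =>
    (isoProj_apply_commute χ b a _).eq

theorem isChain_reverse_par {A : Type*} [Ring A] {l : List (Fin n)} {ξ : Fin n → A} {s : ℤ}
    (hξ : ∀ i x, Commute (ξ i) x) (h : l.IsChain fun i j => ξ i - ξ j = s • (ξ i * ξ j)) :
    l.reverse.IsChain fun i j => ξ j - ξ i = s • (ξ i * ξ j) := by
  rw [List.isChain_reverse]
  refine h.imp fun i j hij => ?_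
  change ξ i - ξ j = s • (ξ j * ξ i)
  rw [hij, (hξ i _).eq]

/-- The fused product of `R`-matrices preserves the image of the projection. -/
theorem isoProj_mul_rprod {χ : Equiv.Perm (Fin n) →* ℤˣ} {s : ℤ}
    (hs : ∀ i j, i ≠ j → ((χ (Equiv.swap i j) : ℤˣ) : ℤ) = s) {ξ : Fin n → A}
    (hξ : ∀ i x, Commute (ξ i) x) {l : List (Fin n)} (hl : l.Nodup) (hall : ∀ i, i ∈ l)
    (hc : l.IsChain fun i j => ξ i - ξ j = s • (ξ i * ξ j)) :
    isoProj N n χ _ * rprod m ξ l = isoProj N n χ _ * rprod m ξ l * isoProj N n χ _ := by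
  obtain ⟨ρ, f, g, -⟩ := rprod_fused (N := N) (m := m) hs hξ (List.nodup_reverse.2 hl)
    (fun i => List.mem_reverse.2 (hall i)) (isChain_reverse_par hξ hc)
  rw [List.reverse_reverse] at g
  rw [g, mul_assoc, ← f.comm.eq, ← mul_assoc, isoProj_sq]

theorem isoProj_mul_rprod_neg {χ : Equiv.Perm (Fin n) →* ℤˣ} {s : ℤ}
    (hs : ∀ i j, i ≠ j → ((χ (Equiv.swap i j) : ℤˣ) : ℤ) = s) {ξ : Fin n → A}
    (hξ : ∀ i x, Commute (ξ i) x) {l : List (Fin n)} (hl : l.Nodup) (hall : ∀ i, i ∈ l)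
    (hc : l.IsChain fun i j => ξ i - ξ j = s • (ξ i * ξ j)) :
    isoProj N n χ _ * rprod m (fun i => -ξ i) l.reverse =
      isoProj N n χ _ * rprod m (fun i => -ξ i) l.reverse * isoProj N n χ _ := by
  refine isoProj_mul_rprod hs (fun i x => (hξ i x).neg_left) (List.nodup_reverse.2 hl)
    (fun i => List.mem_reverse.2 (hall i)) ?_
  refine (isChain_reverse_par hξ hc).imp fun i j hij => ?_
  rw [neg_mul_neg, ← hij]
  abel

/-- If `Λ` intertwines the conjugates of `B` by two families of `R`-matrices whose parameters are
related by crossing, then the trace of `Λ` commutes with `B`. -/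
theorem scalar_trace_comm (hN : N ≠ 0) {χ : Equiv.Perm (Fin n) →* ℤˣ} {s : ℤ}
    (hs : ∀ i j, i ≠ j → ((χ (Equiv.swap i j) : ℤˣ) : ℤ) = s) {l : List (Fin n)} (hl : l.Nodup)
    (hall : ∀ i, i ∈ l) {a b a' b' : Fin n → A} (pa : Par m a) (pb : Par m b) (pa' : Par m a')
    (pb' : Par m b') (ca : l.IsChain fun i j => a i - a j = s • (a i * a j))
    (cb : l.IsChain fun i j => b i - b j = s • (b i * b j))
    (ca' : l.IsChain fun i j => a' i - a' j = s • (a' i * a' j))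
    (cb' : l.IsChain fun i j => b' i - b' j = s • (b' i * b' j))
    (xa : ∀ i, a' i - a i = (N : A) * (a i * a' i)) (xb : ∀ i, b' i - b i = (N : A) * (b i * b' i))
    {B : Mat[N] A} {Λ : Mat[N, n] A}
    (hΛ : isoProj N n χ A * Λ = isoProj N n χ A * Λ * isoProj N n χ A)
    (h : liftMat (isoProj N n χ A) * (rprod m (fun i => -a i) l.reverse *
        Matrix.scalar _ B * rprod m b l) * liftMat Λ =
      liftMat (isoProj N n χ A * Λ) * (rprod m (fun i => -a' i) l.reverse *
        Matrix.scalar _ B * rprod m b' l)) :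
    B * Matrix.scalar _ (Matrix.trace (isoProj N n χ A * Λ)) =
      Matrix.scalar _ (Matrix.trace (isoProj N n χ A * Λ)) * B := by
  rw [map_mul, liftMat_isoProj] at h
  set E := isoProj N n χ (Mat[N] A) with hE
  have hE2 : E * E = E := isoProj_sq χ
  have hΛ' : E * liftMat Λ = E * liftMat Λ * E := by
    rw [hE, ← liftMat_isoProj, ← map_mul, ← map_mul, ← hΛ]
  have eB : Commute E (Matrix.scalar _ B) :=
    commute_isoProj_of_forall χ fun τ => permMat_comm_scalar τ _
  -- both traces reduce to the trace of `E Λ` by crossing symmetry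
  have tr : ∀ {x x' : Fin n → A}, Par m x → Par m x' →
      (l.IsChain fun i j => x i - x j = s • (x i * x j)) →
      (l.IsChain fun i j => x' i - x' j = s • (x' i * x' j)) →
      (∀ i, x' i - x i = (N : A) * (x i * x' i)) →
      Matrix.trace (E * (rprod m x l * liftMat Λ * rprod m (fun i => -x' i) l.reverse)) =
        Matrix.scalar (Fin N) (Matrix.trace (isoProj N n χ A * Λ)) := by
    intro x x' px px' cx cx' hx
    have e1 := isoProj_mul_rprod (N := N) (m := m) hs px.comm hl hall cx
    have e2 := isoProj_mul_rprod_neg (N := N) (m := m) hs px'.comm hl hall cx'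
    rw [← hE] at e1 e2
    set Y := rprod m x l with hY
    set Z := rprod m (fun i => -x' i) l.reverse with hZ
    have e3 : E * (Y * liftMat Λ * Z) = E * (Y * (E * liftMat Λ * (E * Z))) := by
      calc E * (Y * liftMat Λ * Z) = E * Y * (liftMat Λ * Z) := by simp only [mul_assoc]
        _ = E * Y * E * (liftMat Λ * Z) := by rw [← e1]
        _ = E * Y * (E * liftMat Λ * Z) := by simp only [mul_assoc]
        _ = E * Y * (E * liftMat Λ * E * Z) := by rw [← hΛ']
        _ = _ := by simp only [mul_assoc]
    have e4 : Y * (E * liftMat Λ * (E * Z)) * E = Y * (E * liftMat Λ) * Z := by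
      calc Y * (E * liftMat Λ * (E * Z)) * E = Y * (E * liftMat Λ) * (E * Z * E) := by
            simp only [mul_assoc]
        _ = Y * (E * liftMat Λ * E) * Z := by rw [← e2]; simp only [mul_assoc]
        _ = _ := by rw [← hΛ']
    rw [e3, trace_mul_isoProj, e4, hE, ← liftMat_isoProj, ← map_mul, hY, hZ,
      trace_crossing hN px px' hx hl]
  -- The `R`-matrices next to `B` on the outer sides are moved to the other side of the relation.
  have key : Matrix.scalar _ B * (E * (rprod m b l * liftMat Λ *
        rprod m (fun i => -b' i) l.reverse)) =
      E * (rprod m a l * liftMat Λ * rprod m (fun i => -a' i) l.reverse) * Matrix.scalar _ B := by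
    have e1 := isoProj_mul_rprod (N := N) (m := m) hs pa.comm hl hall ca
    have i1 := rprod_inv (N := N) hN pa.comm pa.nil l
    have i2 := rprod_inv (N := N) hN pb'.comm pb'.nil l
    rw [← hE] at e1
    have h' := congrArg (fun M => E * rprod m a l * M * rprod m (fun i => -b' i) l.reverse) h
    calc Matrix.scalar _ B * (E * (rprod m b l * liftMat Λ *
          rprod m (fun i => -b' i) l.reverse))
        = E * (rprod m a l * rprod m (fun i => -a i) l.reverse) * Matrix.scalar _ B *
          rprod m b l * liftMat Λ * rprod m (fun i => -b' i) l.reverse := by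
          rw [i1, mul_one, eB.eq]; simp only [mul_assoc]
      _ = E * rprod m a l * E * (rprod m (fun i => -a i) l.reverse * Matrix.scalar _ B *
          rprod m b l) * liftMat Λ * rprod m (fun i => -b' i) l.reverse := by
          rw [← e1]; simp only [mul_assoc]
      _ = E * rprod m a l * E * liftMat Λ * (rprod m (fun i => -a' i) l.reverse *
          Matrix.scalar _ B) * (rprod m b' l * rprod m (fun i => -b' i) l.reverse) := by
          simp only [mul_assoc] at h' ⊢
          exact h'
      _ = _ := by rw [i2, mul_one, ← e1]; simp only [mul_assoc]
  have h1 := congrArg Matrix.trace key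
  have e5 : ∀ M : Mat[N, n] (Mat[N] A),
      Matrix.trace (Matrix.scalar _ B * M) = B * Matrix.trace M := fun M => by
    simp only [Matrix.trace, Matrix.diag, Matrix.scalar_apply, Matrix.diagonal_mul, Finset.mul_sum]
  have e6 : ∀ M : Mat[N, n] (Mat[N] A),
      Matrix.trace (M * Matrix.scalar _ B) = Matrix.trace M * B := fun M => by
    simp only [Matrix.trace, Matrix.diag, Matrix.scalar_apply, Matrix.mul_diagonal, Finset.sum_mul]
  rw [e5, e6, tr pb pb' cb cb' xb, tr pa pa' ca ca' xa] at h1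
  exact h1

end TraceCommute

/-! ### Families of spectral parameters -/

section ZetaFamily

variable {N n m : ℕ} {A : Type*} [Ring A] [Algebra Scal A] {u p q : A}

/-- The parameters `h / (w_i - ε v + β h)`, where `w_i = u + s i h` and `v = q / p`. -/
def zfam (n : ℕ) (s : ℤ) (u p q : A) (ε : ℤ) (β : ℂ) (i : Fin n) : A :=
  zeta 1 ε (s * (i : ℕ) + β) u p q

theorem zfam_par (h : ZetaData u p q) (hm : algebraMap Scal A hh ^ m = 0) (s ε : ℤ) (β : ℂ) :
    Par m (zfam n s u p q ε β) :=
  ⟨fun _ => zeta_comm h _, fun _ => zeta_nil hm _⟩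

theorem neg_zeta_one (h : ZetaData u p q) {ε : ℤ} (h'' : ε * ε = 1) {β β' : ℂ} (hβ : β' = -β) :
    zeta (-1) (-ε) β' u p q = -zeta 1 ε β u p q := by
  rw [hβ, neg_zeta h (by norm_num) h'']

theorem isChain_finRange (n : ℕ) :
    (List.finRange n).IsChain fun i j : Fin n => ((j : ℕ) : ℂ) = (i : ℕ) + 1 := by
  rw [List.isChain_iff_getElem]
  intro i hi
  simp

theorem smul_C_intCast {B : Type*} [Ring B] [Algebra Scal B] (s : ℤ) (x : B) :
    (PowerSeries.C (s : ℂ) : Scal) • x = s • x := by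
  rw [map_intCast, Int.cast_smul_eq_zsmul]

/-- The points of the family are in arithmetic progression with difference `s h`, as fusion
requires. -/
theorem zfam_chain (h : ZetaData u p q) (s : ℤ) {ε : ℤ} (h'' : ε * ε = 1) (β : ℂ) :
    (List.finRange n).IsChain fun i j => zfam n s u p q ε β i - zfam n s u p q ε β j =
      s • (zfam n s u p q ε β i * zfam n s u p q ε β j) := by
  refine (isChain_finRange n).imp fun i j hij => ?_
  rw [zfam, zfam, zeta_sub_zeta h (by norm_num) h'', ← smul_C_intCast]
  congr 2
  rw [hij]
  ring_nf

theorem zfam_chain_rev (h : ZetaData u p q) (s : ℤ) {ε : ℤ} (h'' : ε * ε = 1) (β : ℂ) :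
    (List.finRange n).reverse.IsChain fun i j =>
      -zfam n s u p q ε β i - -zfam n s u p q ε β j =
      s • (-zfam n s u p q ε β i * -zfam n s u p q ε β j) := by
  refine (isChain_reverse_par (fun i => zeta_comm h _) (zfam_chain h s h'' β)).imp
    fun i j hij => ?_
  change _ = s • (zfam n s u p q ε β i * zfam n s u p q ε β j) at hij
  rw [neg_mul_neg, ← hij, zfam, zfam]
  abel

/-- The parameters are related by crossing if they differ by `N h`. -/
theorem zfam_crossing (h : ZetaData u p q) (s : ℤ) {ε : ℤ} (h'' : ε * ε = 1) {β β' : ℂ}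
    (hβ : β - β' = N) (i : Fin n) :
    zfam n s u p q ε β' i - zfam n s u p q ε β i =
      (N : A) * (zfam n s u p q ε β i * zfam n s u p q ε β' i) := by
  rw [zfam, zfam, zeta_sub_zeta h (by norm_num) h'', add_sub_add_left_eq_sub, hβ, map_natCast,
    Nat.cast_smul_eq_nsmul, nsmul_eq_mul, (zeta_comm h _ _).eq]

/-- The exchange relations of a family of matrices `X ε' α'`, at the points `ε' u + α' h`, with two
matrices `t`, `t'` in the auxiliary factor, at the points `v + b h` and `-v + b' h`. The arguments
of the `R`-matrices on the two sides are shifted by `δ h` and by `-δ h`; such a shift occurs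
between `T` and `T⁺`. -/
structure LegAux (m : ℕ) (u p q : A) (b b' δ : ℂ) (X : ℤ → ℂ → Mat[N] A)
    (t t' : Mat[N] A) : Prop where
  rel : ∀ ε' : ℤ, ε' * ε' = 1 → ∀ α, AuxRel m (zeta ε' 1 (α - b + δ) u p q)
    (zeta ε' 1 (α - b - δ) u p q) (X ε' α) t
  rel' : ∀ ε' : ℤ, ε' * ε' = 1 → ∀ α, AuxRel m (zeta ε' (-1) (α - b' + δ) u p q)
    (zeta ε' (-1) (α - b' - δ) u p q) (X ε' α) t'

theorem AuxRel.congr {η ξ η' ξ' : A} {X t : Mat[N] A} (h : AuxRel m η ξ X t)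
    (hη : η = η') (hξ : ξ = ξ') : AuxRel m η' ξ' X t := by
  subst hη hξ
  exact h

variable {χ : Equiv.Perm (Fin n) →* ℤˣ} {s : ℤ} {X : ℤ → ℂ → Mat[N] A}
    {t t' ti : Mat[N] A} {b b' δ : ℂ}
    {Ti : Mat[N, n] A}

/-- The exchange relation for points of the tensor factors at `w_i` and `-w_i`. -/
theorem exchange_increasing (hN : N ≠ 0) (hm : algebraMap Scal A hh ^ m = 0) (hz : ZetaData u p q)
    (hs : ∀ i j, i ≠ j → ((χ (Equiv.swap i j) : ℤˣ) : ℤ) = s) (h : LegAux m u p q b b' δ X t t')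
    (hδ : b + b' + 2 * δ = 0) (ht1 : t' * ti = 1) (ht2 : ti * t' = 1)
    (hT1 : ((List.finRange n).reverse.map fun i => leg i (X (-1) (-(s * (i : ℕ))))).prod * Ti = 1)
    (hT2 : Ti * ((List.finRange n).reverse.map fun i => leg i (X (-1) (-(s * (i : ℕ))))).prod = 1)
    (hT : isoProj N n χ A * ((List.finRange n).map fun i => leg i (X 1 (s * (i : ℕ)))).prod =
      isoProj N n χ A * ((List.finRange n).map fun i => leg i (X 1 (s * (i : ℕ)))).prod *
        isoProj N n χ A) :
    liftMat (isoProj N n χ A *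
        (((List.finRange n).map fun i => leg i (X 1 (s * (i : ℕ)))).prod * Ti)) *
      (rprod m (zfam n s u p q (-1) (b - δ)) (List.finRange n) * Matrix.scalar _ (t * ti) *
        rprod m (fun i => -zfam n s u p q 1 (b' - δ) i) (List.finRange n).reverse) =
    liftMat (isoProj N n χ A) *
      (rprod m (fun i => -zfam n s u p q 1 (-b + δ) i) (List.finRange n).reverse *
        Matrix.scalar _ (t * ti) * rprod m (zfam n s u p q (-1) (-b' + δ)) (List.finRange n)) *
      liftMat (((List.finRange n).map fun i => leg i (X 1 (s * (i : ℕ)))).prod * Ti) := by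
  have h1 : (1 : ℤ) * 1 = 1 := by norm_num
  have h2 : (-1 : ℤ) * -1 = 1 := by norm_num
  have key := multi_exchange (m := m) hN hs (List.nodup_finRange n) List.mem_finRange ht1 ht2 hT1 hT2
    (zfam_par hz hm s 1 (-b + δ)) (zfam_par hz hm s (-1) (-b' + δ))
    (zfam_par hz hm s (-1) (b - δ)).neg (zfam_par hz hm s 1 (b' - δ)).neg
    (zfam_par hz hm s 1 (-b - δ)) (zfam_par hz hm s (-1) (-b' - δ))
    (fun i => (h.rel 1 h1 (s * (i : ℕ))).congr (by rw [zfam]; congr 1; ring)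
      (by rw [zfam]; congr 1; ring))
    (fun i => (h.rel' 1 h1 (s * (i : ℕ))).congr (by rw [zfam]; congr 1; ring)
      (by rw [zfam]; congr 1; ring))
    (fun i => (h.rel (-1) h2 _).congr
      (by rw [zfam, ← neg_zeta_one hz h2 rfl, neg_neg]; congr 1; ring)
      (by rw [zfam, ← neg_zeta_one hz h2 rfl, neg_neg]; congr 1; linear_combination -hδ))
    (fun i => (h.rel' (-1) h2 _).congr
      (by rw [zfam, ← neg_zeta_one hz h1 rfl]; congr 1; ring)
      (by rw [zfam, ← neg_zeta_one hz h1 rfl]; congr 1; linear_combination -hδ))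
    (zfam_chain hz s h1 _) (zfam_chain hz s h1 _) (zfam_chain hz s h2 _) hT
  simpa only [neg_neg] using key

/-- The exchange relation for points of the tensor factors at `-w_i - c h / 2` and
`w_i + 3 c h / 2`. -/
theorem exchange_decreasing (hN : N ≠ 0) (hm : algebraMap Scal A hh ^ m = 0) (hz : ZetaData u p q)
    (hs : ∀ i j, i ≠ j → ((χ (Equiv.swap i j) : ℤˣ) : ℤ) = s) (h : LegAux m u p q b b' δ X t t')
    {c : ℂ} (hδ : b + b' + 2 * δ = c) (ht1 : t' * ti = 1) (ht2 : ti * t' = 1)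
    (hT1 : ((List.finRange n).map fun i => leg i (X 1 (s * (i : ℕ) + 3 * c / 2))).prod * Ti = 1)
    (hT2 : Ti * ((List.finRange n).map fun i => leg i (X 1 (s * (i : ℕ) + 3 * c / 2))).prod = 1)
    (hT : isoProj N n χ A *
        ((List.finRange n).reverse.map fun i => leg i (X (-1) (-(s * (i : ℕ)) - c / 2))).prod =
      isoProj N n χ A *
        ((List.finRange n).reverse.map fun i => leg i (X (-1) (-(s * (i : ℕ)) - c / 2))).prod *
        isoProj N n χ A) :
    liftMat (isoProj N n χ A * (((List.finRange n).reverse.map fun i =>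
        leg i (X (-1) (-(s * (i : ℕ)) - c / 2))).prod * Ti)) *
      (rprod m (fun i => -zfam n s u p q 1 (3 * c / 2 - b + δ) i) (List.finRange n).reverse *
        Matrix.scalar _ (t * ti) *
        rprod m (zfam n s u p q (-1) (3 * c / 2 - b' + δ)) (List.finRange n)) =
    liftMat (isoProj N n χ A) *
      (rprod m (zfam n s u p q (-1) (c / 2 + b - δ)) (List.finRange n) *
        Matrix.scalar _ (t * ti) *
        rprod m (fun i => -zfam n s u p q 1 (c / 2 + b' - δ) i) (List.finRange n).reverse) *
      liftMat (((List.finRange n).reverse.map fun i =>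
        leg i (X (-1) (-(s * (i : ℕ)) - c / 2))).prod * Ti) := by
  have h1 : (1 : ℤ) * 1 = 1 := by norm_num
  have h2 : (-1 : ℤ) * -1 = 1 := by norm_num
  have key := multi_exchange (m := m) (P' := fun i => X 1 (s * (i : ℕ) + 3 * c / 2)) hN hs
    (List.nodup_reverse.2 (List.nodup_finRange n))
    (fun i => List.mem_reverse.2 (List.mem_finRange i)) ht1 ht2
    (by rw [List.reverse_reverse]; exact hT1) (by rw [List.reverse_reverse]; exact hT2)
    (zfam_par hz hm s (-1) (c / 2 + b - δ)).neg (zfam_par hz hm s 1 (c / 2 + b' - δ)).neg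
    (zfam_par hz hm s 1 (3 * c / 2 - b + δ)) (zfam_par hz hm s (-1) (3 * c / 2 - b' + δ))
    (zfam_par hz hm s (-1) (c / 2 + b + δ)).neg (zfam_par hz hm s 1 (c / 2 + b' + δ)).neg
    (fun i => (h.rel (-1) h2 _).congr
      (by rw [zfam, ← neg_zeta_one hz h2 rfl, neg_neg]; congr 1; ring)
      (by rw [zfam, ← neg_zeta_one hz h2 rfl, neg_neg]; congr 1; ring))
    (fun i => (h.rel' (-1) h2 _).congr
      (by rw [zfam, ← neg_zeta_one hz h1 rfl]; congr 1; ring)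
      (by rw [zfam, ← neg_zeta_one hz h1 rfl]; congr 1; ring))
    (fun i => (h.rel 1 h1 (s * (i : ℕ) + 3 * c / 2)).congr (by rw [zfam]; congr 1; ring)
      (by rw [neg_neg, zfam]; congr 1; linear_combination -hδ))
    (fun i => (h.rel' 1 h1 (s * (i : ℕ) + 3 * c / 2)).congr (by rw [zfam]; congr 1; ring)
      (by rw [neg_neg, zfam]; congr 1; linear_combination -hδ))
    (zfam_chain_rev hz s h2 _) (zfam_chain_rev hz s h2 _) (zfam_chain_rev hz s h1 _) hT
  simpa only [neg_neg, List.reverse_reverse] using key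

end ZetaFamily

section MapR

variable {N n m : ℕ} {A B : Type*} [Ring A] [Algebra Scal A] [Ring B] [Algebra Scal B]

theorem sc2_map {A B : Type*} [Ring A] [Ring B] (Φ : A →+* B) (z : A) :
    (sc2 z : Mat[N] _).map (Φ.mapMatrix) = sc2 (Φ z) := by
  refine Matrix.ext fun a b => Matrix.ext fun c d => ?_
  rw [Matrix.map_apply, RingHom.mapMatrix_apply, Matrix.map_apply]
  simp only [Matrix.scalar_apply, Matrix.diagonal_apply]
  split_ifs <;> simp [Matrix.diagonal_apply]
  split_ifs <;> simp

theorem swapMat_map {A B : Type*} [Ring A] [Ring B] (Φ : A →+* B) :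
    (swapMat N A).map (Φ.mapMatrix) = swapMat N B := by
  refine Matrix.ext fun a b => Matrix.ext fun c d => ?_
  rw [Matrix.map_apply, RingHom.mapMatrix_apply, Matrix.map_apply, swapMat, swapMat,
    Matrix.of_apply, Matrix.of_apply, Matrix.single_apply, Matrix.single_apply]
  split_ifs <;> simp

theorem rb_map (Φ : A →+* B) (hΦ : ∀ s : Scal, Φ (algebraMap Scal A s) = algebraMap Scal B s)
    (ξ : A) : (rb N m ξ).map (Φ.mapMatrix) = rb N m (Φ ξ) := by
  have e : ∀ M : Mat[N] (Mat[N] A), M.map (Φ.mapMatrix) =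
      (Φ.mapMatrix : Mat[N] A →+* _).mapMatrix M := fun _ => rfl
  rw [rb, rb, e, map_sub, map_mul, ← e, ← e, ← e, sc2_map, sc2_map, swapMat_map, map_mul,
    gEval_map Φ hΦ]

theorem rprod_map (Φ : A →+* B) (hΦ : ∀ s : Scal, Φ (algebraMap Scal A s) = algebraMap Scal B s)
    (ξ : Fin n → A) (l : List (Fin n)) :
    (rprod m ξ l : Matrix _ _ (Mat[N] A)).map (Φ.mapMatrix) =
      rprod m (fun i => Φ (ξ i)) l := by
  have e : ∀ M : Mat[N, n] (Mat[N] A),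
      M.map (Φ.mapMatrix) = (Φ.mapMatrix : Mat[N] A →+* _).mapMatrix M :=
    fun _ => rfl
  rw [rprod, rprod, e, map_list_prod, List.map_map]
  congr 1
  refine List.map_congr_left fun i _ => ?_
  rw [Function.comp_apply, ← e, leg_map, rb_map Φ hΦ]

theorem zfam_map {u p q : A} (Φ : A →+* B)
    (hΦ : ∀ s : Scal, Φ (algebraMap Scal A s) = algebraMap Scal B s) (h : ZetaData u p q) (s : ℤ)
    {ε : ℤ} (h'' : ε * ε = 1) (β : ℂ) (i : Fin n) :
    Φ (zfam n s u p q ε β i) = zfam n s (Φ u) (Φ p) (Φ q) ε β i :=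
  zeta_map Φ hΦ h (by norm_num) h'' _

end MapR

/-! ### Maps of bimodules -/

section Bimodule

/-- An additive map `ψ : B → E` is a map of bimodules over `A`, which acts on `B` by `j` and on `E`
by `k`. -/
structure IsBiMap {A B E : Type*} [Ring A] [Ring B] [Ring E] (j : A →+* B) (k : A →+* E)
    (ψ : B →+ E) : Prop where
  left : ∀ a x, ψ (j a * x) = k a * ψ x
  right : ∀ x a, ψ (x * j a) = ψ x * k a

variable {A B E : Type*} [Ring A] [Ring B] [Ring E] {j : A →+* B} {k : A →+* E} {ψ : B →+ E}

theorem IsBiMap.mapMatrix (h : IsBiMap j k ψ) (I : Type*) [Fintype I] [DecidableEq I] :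
    IsBiMap (j.mapMatrix : Matrix I I A →+* Matrix I I B) k.mapMatrix ψ.mapMatrix where
  left a x := Matrix.ext fun r s => by
    simp [Matrix.mul_apply, h.left]
  right x a := Matrix.ext fun r s => by
    simp [Matrix.mul_apply, h.right]

/-- The coefficientwise extension of an additive map to power series. -/
def seriesMap (ψ : B →+ E) : B⟦X⟧ →+ E⟦X⟧ where
  toFun f := PowerSeries.mk fun r => ψ (PowerSeries.coeff r f)
  map_zero' := by ext r; simp
  map_add' f g := by ext r; simp

@[simp]
theorem coeff_seriesMap (ψ : B →+ E) (f : B⟦X⟧) (r : ℕ) :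
    PowerSeries.coeff r (seriesMap ψ f) = ψ (PowerSeries.coeff r f) :=
  PowerSeries.coeff_mk r fun r => ψ (PowerSeries.coeff r f)

theorem seriesMap_C (ψ : B →+ E) (x : B) :
    seriesMap ψ (PowerSeries.C x) = PowerSeries.C (ψ x) := by
  ext r
  rw [coeff_seriesMap, PowerSeries.coeff_C, PowerSeries.coeff_C]
  split_ifs <;> simp

theorem IsBiMap.seriesMap (h : IsBiMap j k ψ) :
    IsBiMap (PowerSeries.map j) (PowerSeries.map k) (seriesMap ψ) where
  left a x := by
    ext r
    simp [PowerSeries.coeff_mul, h.left]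
  right x a := by
    ext r
    simp [PowerSeries.coeff_mul, h.right]

variable [Algebra Scal A] [Algebra Scal B] [Algebra Scal E] {N n : ℕ}

theorem isoProj_ringHom_map (χ : Equiv.Perm (Fin n) →* ℤˣ)
    (hj : ∀ s : Scal, j (algebraMap Scal A s) = algebraMap Scal B s) :
    (isoProj N n χ A).map j = isoProj N n χ B :=
  isoProj_map χ ({ j with commutes' := hj } : A →ₐ[Scal] B)

theorem liftMat_map {B E : Type*} [Ring B] [Ring E] {ψ : B →+ E} {N : ℕ} {I : Type*} [Fintype I]
    [DecidableEq I] (M : Matrix I I B) :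
    (liftMat M : Matrix I I (Mat[N] B)).map ψ.mapMatrix = liftMat (M.map ψ) := by
  refine Matrix.ext fun a b => Matrix.ext fun c d => ?_
  simp only [Matrix.map_apply, RingHom.mapMatrix_apply, AddMonoidHom.mapMatrix_apply,
    Matrix.scalar_apply, Matrix.diagonal_apply]
  split_ifs <;> simp

theorem liftMat_isoProj_map (hj : ∀ s : Scal, j (algebraMap Scal A s) = algebraMap Scal B s)
    (χ : Equiv.Perm (Fin n) →* ℤˣ) :
    (j.mapMatrix : Mat[N] A →+* _).mapMatrix (liftMat (isoProj N n χ A)) =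
      liftMat (isoProj N n χ B) := by
  rw [← isoProj_ringHom_map χ hj]
  exact liftMat_map (ψ := j.toAddMonoidHom) _

theorem IsBiMap.isoProj_mul_map (h : IsBiMap j k ψ)
    (hj : ∀ s : Scal, j (algebraMap Scal A s) = algebraMap Scal B s)
    (hk : ∀ s : Scal, k (algebraMap Scal A s) = algebraMap Scal E s)
    (χ : Equiv.Perm (Fin n) →* ℤˣ) (F : Mat[N, n] B) :
    (isoProj N n χ B * F).map ψ = isoProj N n χ E * F.map ψ := by
  rw [← isoProj_ringHom_map χ hj, ← isoProj_ringHom_map χ hk]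
  exact (h.mapMatrix _).left (isoProj N n χ A) F

theorem IsBiMap.mul_isoProj_map (h : IsBiMap j k ψ)
    (hj : ∀ s : Scal, j (algebraMap Scal A s) = algebraMap Scal B s)
    (hk : ∀ s : Scal, k (algebraMap Scal A s) = algebraMap Scal E s)
    (χ : Equiv.Perm (Fin n) →* ℤˣ) (F : Mat[N, n] B) :
    (F * isoProj N n χ B).map ψ = F.map ψ * isoProj N n χ E := by
  rw [← isoProj_ringHom_map χ hj, ← isoProj_ringHom_map χ hk]
  exact (h.mapMatrix _).right F (isoProj N n χ A)

/-- A map of bimodules over `A` preserves an exchange relation whose `R`-matrices have coefficients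
in `A`, although it is not multiplicative. -/
theorem IsBiMap.exchange (h : IsBiMap j k ψ)
    (hj : ∀ s : Scal, j (algebraMap Scal A s) = algebraMap Scal B s)
    (hk : ∀ s : Scal, k (algebraMap Scal A s) = algebraMap Scal E s)
    (χ : Equiv.Perm (Fin n) →* ℤˣ) {F : Mat[N, n] B}
    {X Y : Mat[N, n] (Mat[N] A)}
    (hF : liftMat (isoProj N n χ B * F) * X.map j.mapMatrix =
      liftMat (isoProj N n χ B) * Y.map j.mapMatrix * liftMat F) :
    liftMat (isoProj N n χ E * F.map ψ) * X.map k.mapMatrix =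
      liftMat (isoProj N n χ E) * Y.map k.mapMatrix * liftMat (F.map ψ) := by
  have H := (h.mapMatrix (Fin N)).mapMatrix (Fin n → Fin N)
  have h1 := congrArg
    (ψ.mapMatrix : Mat[N] B →+ Mat[N] E).mapMatrix hF
  have e1 := H.right (liftMat (isoProj N n χ B * F)) X
  have e2 := H.left (liftMat (isoProj N n χ A) * Y) (liftMat F)
  have m1 := map_mul (j.mapMatrix : Mat[N] A →+* _).mapMatrix
    (liftMat (isoProj N n χ A)) Y
  have m2 := map_mul (k.mapMatrix : Mat[N] A →+* _).mapMatrix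
    (liftMat (isoProj N n χ A)) Y
  rw [liftMat_isoProj_map hj] at m1
  rw [liftMat_isoProj_map hk] at m2
  rw [m1, m2] at e2
  have h2 := e1.symm.trans (h1.trans e2)
  have e3 : ∀ M : Mat[N, n] B,
    (ψ.mapMatrix : Mat[N] B →+ Mat[N] E).mapMatrix (liftMat M) =
      liftMat (M.map ψ) := fun M => liftMat_map M
  rw [e3, e3, h.isoProj_mul_map hj hk] at h2
  exact h2

/-- Exchange relations for `F` and `K`, with values in two different rings, combine to an exchange
relation for the product of their images in a common ring. -/
theorem exchange_combine {C : Type*} [Ring C] [Algebra Scal C] {jQ : A →+* C} {ψQ : C →+ E}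
    (h : IsBiMap j k ψ) (hQ : IsBiMap jQ k ψQ)
    (hj : ∀ s : Scal, j (algebraMap Scal A s) = algebraMap Scal B s)
    (hjQ : ∀ s : Scal, jQ (algebraMap Scal A s) = algebraMap Scal C s)
    (hk : ∀ s : Scal, k (algebraMap Scal A s) = algebraMap Scal E s)
    (χ : Equiv.Perm (Fin n) →* ℤˣ) {F : Mat[N, n] B}
    {K : Mat[N, n] C}
    {X Y Z : Mat[N, n] (Mat[N] A)}
    (hF : liftMat (isoProj N n χ B * F) * X.map j.mapMatrix =
      liftMat (isoProj N n χ B) * Y.map j.mapMatrix * liftMat F)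
    (hK : liftMat (isoProj N n χ C * K) * Z.map jQ.mapMatrix =
      liftMat (isoProj N n χ C) * X.map jQ.mapMatrix * liftMat K)
    (eF : isoProj N n χ B * F = isoProj N n χ B * F * isoProj N n χ B)
    (eK : isoProj N n χ C * K = isoProj N n χ C * K * isoProj N n χ C) :
    isoProj N n χ E * (F.map ψ * K.map ψQ) =
      isoProj N n χ E * (F.map ψ * K.map ψQ) * isoProj N n χ E ∧
    liftMat (isoProj N n χ E) * Y.map k.mapMatrix * liftMat (F.map ψ * K.map ψQ) =
      liftMat (isoProj N n χ E * (F.map ψ * K.map ψQ)) * Z.map k.mapMatrix := by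
  have f1 := h.exchange hj hk χ hF
  have k1 := hQ.exchange hjQ hk χ hK
  have f2 := congrArg (fun M => M.map ψ) eF
  have k2 := congrArg (fun M => M.map ψQ) eK
  rw [h.mul_isoProj_map hj hk, h.isoProj_mul_map hj hk] at f2
  rw [hQ.mul_isoProj_map hjQ hk, hQ.isoProj_mul_map hjQ hk] at k2
  set f := F.map ψ
  set κ := K.map ψQ
  set e := isoProj N n χ E
  have ef : e * (f * κ) = e * f * (e * κ) := by
    rw [← mul_assoc, ← mul_assoc (e * f), ← f2]
  constructor
  · rw [ef, mul_assoc (e * f), ← k2]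
  · rw [ef, map_mul _ (e * f), mul_assoc _ (liftMat (e * κ)), k1, map_mul, ← mul_assoc, ← f1,
      ← mul_assoc, ← mul_assoc, ← map_mul, ← f2]

end Bimodule

/-! ### Operators on two-sided series -/

section Operators

variable (W : Type) [AddCommGroup W] [Module Scal W]

/-- The endomorphisms of a module over the scalars. -/
abbrev Op : Type := Module.End Scal W

/-- Formal two-sided series with coefficients in `W`, and Laurent polynomials with coefficients in
`W`. A product of a series in `u` and of a series in `u⁻¹` has no meaning in a ring of series, but
it has one as an operator: locally finite series in `u⁻¹` act on Laurent polynomials, and series in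
`u` map Laurent polynomials to formal two-sided series. -/
abbrev SeriesPair : Type := (ℤ → W) × (ℤ →₀ W)

variable {W}

/-- The multiplication by `d u ^ a`. -/
def monoOp (a : ℤ) (d : Op W) : Module.End Scal (SeriesPair W) :=
  LinearMap.prodMap (LinearMap.pi fun k => d ∘ₗ LinearMap.proj (k - a))
    (Finsupp.lsum Scal fun j => Finsupp.lsingle (j + a) ∘ₗ d)

theorem monoOp_fst (a : ℤ) (d : Op W) (v : SeriesPair W) (k : ℤ) :
    (monoOp a d v).1 k = d (v.1 (k - a)) := rfl

theorem monoOp_snd (a : ℤ) (d : Op W) (v : ℤ → W) (j : ℤ) (w : W) :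
    (monoOp a d (v, Finsupp.single j w)).2 = Finsupp.single (j + a) (d w) := by
  simp [monoOp]

/-- Endomorphisms of the pairs of series agree if they agree on generators. -/
theorem seriesPair_ext {S T : Module.End Scal (SeriesPair W)} (h1 : ∀ v, S (v, 0) = T (v, 0))
    (h2 : ∀ j w, S (0, Finsupp.single j w) = T (0, Finsupp.single j w)) : S = T := by
  refine LinearMap.prod_ext (LinearMap.ext h1) (Finsupp.lhom_ext h2)

theorem monoOp_mul (a b : ℤ) (d e : Op W) : monoOp a d * monoOp b e = monoOp (a + b) (d * e) := by
  refine seriesPair_ext (fun v => Prod.ext ?_ ?_) fun j w => Prod.ext ?_ ?_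
  · funext k
    simp [monoOp_fst, sub_sub]
  · simp [monoOp]
  · funext k
    simp [monoOp_fst]
  · simp [monoOp, add_assoc, add_comm a b]

theorem monoOp_one : monoOp 0 (1 : Op W) = 1 := by
  refine seriesPair_ext (fun v => Prod.ext ?_ ?_) fun j w => Prod.ext ?_ ?_
  · funext k
    simp [monoOp_fst]
  · simp [monoOp]
  · funext k
    simp [monoOp_fst]
  · simp [monoOp]

variable (W) in
/-- The operators on pairs of series which commute with the multiplication by `u`. -/
def UOp : Type :=
  Subalgebra.centralizer Scal ({monoOp 1 1} : Set (Module.End Scal (SeriesPair W)))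

instance : Ring (UOp W) :=
  Subalgebra.toRing (Subalgebra.centralizer Scal ({monoOp 1 1} : Set (Module.End Scal (SeriesPair W))))

instance : Algebra Scal (UOp W) :=
  Subalgebra.algebra (Subalgebra.centralizer Scal ({monoOp 1 1} : Set (Module.End Scal (SeriesPair W))))

theorem UOp.ext {S T : UOp W} (h : S.1 = T.1) : S = T := Subtype.ext h

theorem mem_uop {S : Module.End Scal (SeriesPair W)}
    (h : monoOp 1 1 * S = S * monoOp 1 1) :
    S ∈ Subalgebra.centralizer Scal ({monoOp 1 1} : Set (Module.End Scal (SeriesPair W))) := by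
  rw [Subalgebra.mem_centralizer_iff]
  rintro _ rfl
  exact h

/-- The multiplication by `d u ^ a`, as an operator which commutes with the multiplication by
`u`. -/
def monoU (a : ℤ) (d : Op W) : UOp W :=
  show Subalgebra.centralizer Scal ({monoOp 1 1} : Set (Module.End Scal (SeriesPair W))) from
  ⟨monoOp a d, mem_uop (by rw [monoOp_mul, monoOp_mul, one_mul, mul_one, add_comm])⟩

/-- A formal series in `u` as an operator from Laurent polynomials to formal series. -/
def convP (f : LaurentSeries (Op W)) : (ℤ →₀ W) →ₗ[Scal] (ℤ → W) :=
  Finsupp.lsum Scal fun j => LinearMap.pi fun k => f.coeff (k - j)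

theorem convP_single (f : LaurentSeries (Op W)) (j : ℤ) (w : W) (k : ℤ) :
    convP f (Finsupp.single j w) k = f.coeff (k - j) w := by
  simp [convP]

/-- The operator on pairs of series which is given by a series in `u`. -/
def psiOpP (f : LaurentSeries (Op W)) : Module.End Scal (SeriesPair W) :=
  LinearMap.inl Scal _ _ ∘ₗ convP f ∘ₗ LinearMap.snd Scal _ _

theorem psiOpP_inl (f : LaurentSeries (Op W)) (v : ℤ → W) : psiOpP f (v, 0) = 0 := by
  simp [psiOpP]

theorem psiOpP_fst (f : LaurentSeries (Op W)) (v : ℤ → W) (j : ℤ) (w : W) (k : ℤ) :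
    (psiOpP f (v, Finsupp.single j w)).1 k = f.coeff (k - j) w := convP_single f j w k

theorem psiOpP_snd (f : LaurentSeries (Op W)) (v : SeriesPair W) : (psiOpP f v).2 = 0 := rfl

theorem monoOp_mul_psiOpP (a : ℤ) (d : Op W) (f : LaurentSeries (Op W)) :
    monoOp a d * psiOpP f = psiOpP (HahnSeries.single a d * f) := by
  refine seriesPair_ext (fun v => ?_) fun j w => Prod.ext ?_ ?_
  · rw [Module.End.mul_apply, psiOpP_inl, psiOpP_inl, map_zero]
  · funext k
    rw [Module.End.mul_apply, monoOp_fst, psiOpP_fst, psiOpP_fst, HahnSeries.coeff_single_mul,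
      Module.End.mul_apply]
    congr 3
    ring
  · rw [Module.End.mul_apply, psiOpP_snd]
    simp [monoOp, psiOpP_snd]

theorem psiOpP_mul_monoOp (a : ℤ) (d : Op W) (f : LaurentSeries (Op W)) :
    psiOpP f * monoOp a d = psiOpP (f * HahnSeries.single a d) := by
  refine seriesPair_ext (fun v => ?_) fun j w => Prod.ext ?_ ?_
  · rw [Module.End.mul_apply, psiOpP_inl]
    have : monoOp a d (v, 0) = ((monoOp a d (v, 0)).1, 0) := Prod.ext rfl (by simp [monoOp])
    rw [this, psiOpP_inl]
  · funext k
    have : monoOp a d (0, Finsupp.single j w) =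
      ((monoOp a d (0, Finsupp.single j w)).1, Finsupp.single (j + a) (d w)) :=
      Prod.ext rfl (monoOp_snd a d _ j w)
    rw [Module.End.mul_apply, this, psiOpP_fst, psiOpP_fst, HahnSeries.coeff_mul_single,
      Module.End.mul_apply]
    congr 2
    ring
  · rfl

theorem psiOpP_zero : psiOpP (0 : LaurentSeries (Op W)) = 0 := by
  refine seriesPair_ext (fun v => psiOpP_inl _ _) fun j w => Prod.ext ?_ rfl
  funext k
  rw [psiOpP_fst]
  rfl

theorem psiOpP_add (f g : LaurentSeries (Op W)) : psiOpP (f + g) = psiOpP f + psiOpP g := by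
  refine seriesPair_ext (fun v => ?_) fun j w => Prod.ext ?_ ?_
  · rw [LinearMap.add_apply, psiOpP_inl, psiOpP_inl, psiOpP_inl, add_zero]
  · funext k
    rw [LinearMap.add_apply, Prod.fst_add, Pi.add_apply, psiOpP_fst, psiOpP_fst, psiOpP_fst]
    rfl
  · rw [LinearMap.add_apply, Prod.snd_add, psiOpP_snd, psiOpP_snd, psiOpP_snd, add_zero]

/-- The map of `psiOpP`, with values in the operators which commute with the multiplication by
`u`. -/
def psiP : LaurentSeries (Op W) →+ UOp W where
  toFun f := show Subalgebra.centralizer Scal ({monoOp 1 1} : Set (Module.End Scal (SeriesPair W))) from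
    ⟨psiOpP f, mem_uop (by
    rw [monoOp_mul_psiOpP, psiOpP_mul_monoOp]
    congr 1
    refine HahnSeries.ext ?_
    funext k
    rw [HahnSeries.coeff_single_mul, HahnSeries.coeff_mul_single, one_mul, mul_one])⟩
  map_zero' := UOp.ext psiOpP_zero
  map_add' f g := UOp.ext (psiOpP_add f g)

variable (W) in
/-- The formal series with coefficients in the operators on `W` which are locally finite: at every
vector of `W`, only finitely many coefficients do not vanish. -/
def locFin : Subalgebra Scal (LaurentSeries (Op W)) where
  carrier := {f | ∀ w, {l | f.coeff l w ≠ 0}.Finite}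
  add_mem' := by
    intro f g hf hg w
    refine ((hf w).union (hg w)).subset fun l hl => ?_
    by_contra h
    simp only [Set.mem_union, Set.mem_ofPred_eq, not_or, not_not] at h
    exact hl (by rw [HahnSeries.coeff_add, LinearMap.add_apply, h.1, h.2, add_zero])
  mul_mem' := by
    intro f g hf hg w
    have hfin : (⋃ j ∈ {l | g.coeff l w ≠ 0}, (fun i => i + j) ''
        {l | f.coeff l (g.coeff j w) ≠ 0}).Finite :=
      (hg w).biUnion fun j _ => (hf _).image _
    refine hfin.subset fun l hl => ?_
    rw [Set.mem_ofPred_eq, HahnSeries.coeff_mul, LinearMap.sum_apply] at hl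
    obtain ⟨ij, h1, h2⟩ := Finset.exists_ne_zero_of_sum_ne_zero hl
    rw [Finset.mem_antidiagonal] at h1
    rw [Module.End.mul_apply] at h2
    rw [Set.mem_iUnion₂]
    exact ⟨ij.2, fun h => h2 (by rw [h, map_zero]), ij.1, h2, h1.2.2⟩
  algebraMap_mem' s w := by
    refine (Set.finite_singleton (0 : ℤ)).subset fun l hl => ?_
    by_contra h
    refine hl ?_
    rw [HahnSeries.algebraMap_apply, HahnSeries.C_apply, HahnSeries.coeff_single_of_ne h]
    rfl

variable (W) in
/-- The algebra of locally finite series. -/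
def LocFin : Type := locFin W

instance : Ring (LocFin W) := Subalgebra.toRing (locFin W)

instance : Algebra Scal (LocFin W) := Subalgebra.algebra (locFin W)

theorem LocFin.ext {f g : LocFin W} (h : f.1 = g.1) : f = g := Subtype.ext h

variable (W) in
/-- The inclusion of the locally finite series. -/
def LocFin.val : LocFin W →+* LaurentSeries (Op W) := (locFin W).val.toRingHom

theorem single_mem_locFin (a : ℤ) (d : Op W) : HahnSeries.single a d ∈ locFin W := fun w => by
  refine (Set.finite_singleton a).subset fun l hl => ?_
  by_contra h
  exact hl (by rw [HahnSeries.coeff_single_of_ne h]; rfl)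

/-- The monomial `d u ^ a`, as a series in `u⁻¹`. -/
def monoQ (a : ℤ) (d : Op W) : LocFin W :=
  show locFin W from ⟨HahnSeries.single (-a) d, single_mem_locFin _ _⟩

/-- The action of a locally finite series on the monomial `w u ^ j`. -/
def convQ (κ : LocFin W) (j : ℤ) : W →ₗ[Scal] (ℤ →₀ W) where
  toFun w := Finsupp.ofSupportFinite (fun k => κ.1.coeff (j - k) w)
    (((κ.2 w).preimage (f := fun k => j - k) (fun _ _ _ _ h => by simpa using h)).subset fun _ h => h)
  map_add' w w' := Finsupp.ext fun k => map_add (κ.1.coeff (j - k)) w w'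
  map_smul' r w := Finsupp.ext fun k => map_smul (κ.1.coeff (j - k)) r w

theorem convQ_apply (κ : LocFin W) (j : ℤ) (w : W) (k : ℤ) :
    convQ κ j w k = κ.1.coeff (j - k) w := rfl

/-- The operator on pairs of series which is given by a locally finite series in `u⁻¹`. -/
def psiOpQ (κ : LocFin W) : Module.End Scal (SeriesPair W) :=
  LinearMap.inr Scal _ _ ∘ₗ Finsupp.lsum Scal (convQ κ) ∘ₗ LinearMap.snd Scal _ _

theorem psiOpQ_inl (κ : LocFin W) (v : ℤ → W) : psiOpQ κ (v, 0) = 0 := by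
  simp [psiOpQ]

theorem psiOpQ_single (κ : LocFin W) (v : ℤ → W) (j : ℤ) (w : W) :
    psiOpQ κ (v, Finsupp.single j w) = (0, convQ κ j w) := by
  simp [psiOpQ]

theorem monoOp_mul_psiOpQ (a : ℤ) (d : Op W) (κ : LocFin W) :
    monoOp a d * psiOpQ κ = psiOpQ (monoQ a d * κ) := by
  refine seriesPair_ext (fun v => ?_) fun j w => Prod.ext ?_ ?_
  · rw [Module.End.mul_apply, psiOpQ_inl, psiOpQ_inl, map_zero]
  · funext k
    rw [Module.End.mul_apply, psiOpQ_single, psiOpQ_single, monoOp_fst]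
    exact map_zero d
  · rw [Module.End.mul_apply, psiOpQ_single, psiOpQ_single]
    ext k
    have hs : ∀ (v : ℤ →₀ W), (monoOp a d (0, v)).2 k = d (v (k - a)) := fun v => by
      induction v using Finsupp.induction_linear with
      | zero => simp [monoOp]
      | add f g hf hg =>
        have : ((0 : ℤ → W), f + g) = (0, f) + (0, g) := by simp
        rw [this, map_add, Prod.snd_add, Finsupp.add_apply, hf, hg, Finsupp.add_apply, map_add]
      | single i w =>
        rw [monoOp_snd, Finsupp.single_apply, Finsupp.single_apply]
        by_cases h : i + a = k
        · rw [if_pos h, if_pos (by omega)]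
        · rw [if_neg h, if_neg (by omega), map_zero]
    rw [hs, convQ_apply, convQ_apply]
    change _ = (HahnSeries.single (-a) d * κ.1).coeff _ w
    rw [HahnSeries.coeff_single_mul, Module.End.mul_apply]
    congr 3
    ring

theorem psiOpQ_mul_monoOp (a : ℤ) (d : Op W) (κ : LocFin W) :
    psiOpQ κ * monoOp a d = psiOpQ (κ * monoQ a d) := by
  refine seriesPair_ext (fun v => ?_) fun j w => ?_
  · rw [Module.End.mul_apply, psiOpQ_inl]
    have : monoOp a d (v, 0) = ((monoOp a d (v, 0)).1, 0) := Prod.ext rfl (by simp [monoOp])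
    rw [this, psiOpQ_inl]
  · have : monoOp a d (0, Finsupp.single j w) =
      ((monoOp a d (0, Finsupp.single j w)).1, Finsupp.single (j + a) (d w)) :=
      Prod.ext rfl (monoOp_snd a d _ j w)
    rw [Module.End.mul_apply, this, psiOpQ_single, psiOpQ_single]
    congr 1
    ext k
    rw [convQ_apply, convQ_apply]
    change _ = (κ.1 * HahnSeries.single (-a) d).coeff _ w
    rw [HahnSeries.coeff_mul_single, Module.End.mul_apply]
    congr 2
    ring

theorem psiOpQ_zero : psiOpQ (0 : LocFin W) = 0 := by
  refine seriesPair_ext (fun v => psiOpQ_inl _ _) fun j w => ?_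
  rw [psiOpQ_single]
  refine Prod.ext rfl (Finsupp.ext fun k => ?_)
  rw [convQ_apply]
  rfl

theorem psiOpQ_add (f g : LocFin W) : psiOpQ (f + g) = psiOpQ f + psiOpQ g := by
  refine seriesPair_ext (fun v => ?_) fun j w => ?_
  · rw [LinearMap.add_apply, psiOpQ_inl, psiOpQ_inl, psiOpQ_inl, add_zero]
  · rw [LinearMap.add_apply, psiOpQ_single, psiOpQ_single, psiOpQ_single, Prod.mk_add_mk, add_zero]
    refine Prod.ext rfl (Finsupp.ext fun k => ?_)
    rw [Finsupp.add_apply, convQ_apply, convQ_apply, convQ_apply]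
    rfl

/-- The map of `psiOpQ`, with values in the operators which commute with the multiplication by
`u`. -/
def psiQ : LocFin W →+ UOp W where
  toFun f := show Subalgebra.centralizer Scal ({monoOp 1 1} : Set (Module.End Scal (SeriesPair W))) from
    ⟨psiOpQ f, mem_uop (by
    rw [monoOp_mul_psiOpQ, psiOpQ_mul_monoOp]
    congr 1
    refine LocFin.ext (HahnSeries.ext ?_)
    funext k
    change (HahnSeries.single (-1) 1 * f.1).coeff k = (f.1 * HahnSeries.single (-1) 1).coeff k
    rw [HahnSeries.coeff_single_mul, HahnSeries.coeff_mul_single, one_mul, mul_one])⟩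
  map_zero' := UOp.ext psiOpQ_zero
  map_add' f g := UOp.ext (psiOpQ_add f g)

/-- The product of a series in `u` and of a locally finite series in `u⁻¹`, applied to a vector. -/
theorem psiP_mul_psiQ_apply (f : LaurentSeries (Op W)) (κ : LocFin W) (w : W) (k : ℤ) :
    ((psiP f * psiQ κ : UOp W).1 (0, Finsupp.single 0 w)).1 k =
      (convQ κ 0 w).sum fun j w' => f.coeff (k - j) w' := by
  change (psiOpP f (psiOpQ κ (0, Finsupp.single 0 w))).1 k = _
  rw [psiOpQ_single]
  change convP f (convQ κ 0 w) k = _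
  rw [convP, Finsupp.lsum_apply, Finsupp.sum_apply']
  rfl

end Operators

/-! ### A common ring for the coefficients of `R`-matrices -/

section OpRing

variable (W : Type) [AddCommGroup W] [Module Scal W]

/-- Triples of a series in `u`, a locally finite series in `u⁻¹` and an operator which have the
same effect on series in `u` and on locally finite series in `u⁻¹`. This ring contains the Laurent
polynomials in `u` and the inverses of those which are invertible modulo `h`, and it acts on the
operators from both sides, so that it can be taken for the coefficients of the `R`-matrices between
the two parts of the trace. -/
def opRing : Subring (LaurentSeries (Op W) × LocFin W × UOp W) where
  carrier := {p | (∀ f, psiP (p.1 * f) = p.2.2 * psiP f) ∧ (∀ f, psiP (f * p.1) = psiP f * p.2.2) ∧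
    (∀ κ, psiQ (p.2.1 * κ) = p.2.2 * psiQ κ) ∧ ∀ κ, psiQ (κ * p.2.1) = psiQ κ * p.2.2}
  add_mem' := by
    rintro p q ⟨h1, h2, h3, h4⟩ ⟨k1, k2, k3, k4⟩
    refine ⟨fun f => ?_, fun f => ?_, fun f => ?_, fun f => ?_⟩
    · rw [Prod.fst_add, add_mul, map_add, h1, k1, Prod.snd_add, Prod.snd_add, add_mul]
    · rw [Prod.fst_add, mul_add, map_add, h2, k2, Prod.snd_add, Prod.snd_add, mul_add]
    · rw [Prod.snd_add, Prod.fst_add, add_mul, map_add, h3, k3, Prod.snd_add, add_mul]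
    · rw [Prod.snd_add, Prod.fst_add, mul_add, map_add, h4, k4, Prod.snd_add, mul_add]
  mul_mem' := by
    rintro p q ⟨h1, h2, h3, h4⟩ ⟨k1, k2, k3, k4⟩
    refine ⟨fun f => ?_, fun f => ?_, fun f => ?_, fun f => ?_⟩
    · rw [Prod.fst_mul, mul_assoc, h1, k1, Prod.snd_mul, Prod.snd_mul, mul_assoc]
    · rw [Prod.fst_mul, ← mul_assoc, k2, h2, Prod.snd_mul, Prod.snd_mul, mul_assoc]
    · rw [Prod.snd_mul, Prod.fst_mul, mul_assoc, h3, k3, Prod.snd_mul, mul_assoc]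
    · rw [Prod.snd_mul, Prod.fst_mul, ← mul_assoc, k4, h4, Prod.snd_mul, mul_assoc]
  zero_mem' := by simp
  one_mem' := by simp
  neg_mem' := by
    rintro p ⟨h1, h2, h3, h4⟩
    refine ⟨fun f => ?_, fun f => ?_, fun f => ?_, fun f => ?_⟩
    · rw [Prod.fst_neg, show -p.1 * f = -(p.1 * f) from neg_mul p.1 f,
        show psiP (-(p.1 * f)) = -psiP (p.1 * f) from map_neg psiP _, h1, Prod.snd_neg, Prod.snd_neg, neg_mul]
    · rw [Prod.fst_neg, show f * -p.1 = -(f * p.1) from mul_neg f p.1,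
        show psiP (-(f * p.1)) = -psiP (f * p.1) from map_neg psiP _, h2, Prod.snd_neg, Prod.snd_neg, mul_neg]
    · rw [Prod.snd_neg, Prod.fst_neg, neg_mul, map_neg, h3, Prod.snd_neg, neg_mul]
    · rw [Prod.snd_neg, Prod.fst_neg, mul_neg, map_neg, h4, Prod.snd_neg, mul_neg]

/-- The ring `opRing W`, as a type. -/
def OpRing : Type := opRing W

instance : Ring (OpRing W) := inferInstanceAs (Ring (opRing W))

variable {W}

theorem OpRing.ext {x y : OpRing W} (h1 : x.1.1 = y.1.1) (h2 : x.1.2.1.1 = y.1.2.1.1)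
    (h3 : x.1.2.2.1 = y.1.2.2.1) : x = y :=
  Subtype.ext (Prod.ext h1 (Prod.ext (LocFin.ext h2) (UOp.ext h3)))

/-- The monomial `d u ^ a`. -/
def monoR (a : ℤ) (d : Op W) : OpRing W :=
  show opRing W from ⟨(HahnSeries.single a d, monoQ a d, monoU a d),
    fun f => UOp.ext (monoOp_mul_psiOpP a d f).symm,
    fun f => UOp.ext (psiOpP_mul_monoOp a d f).symm,
    fun κ => UOp.ext (monoOp_mul_psiOpQ a d κ).symm,
    fun κ => UOp.ext (psiOpQ_mul_monoOp a d κ).symm⟩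

theorem monoR_mul (a b : ℤ) (d e : Op W) : monoR a d * monoR b e = monoR (a + b) (d * e) := by
  refine OpRing.ext ?_ ?_ ?_
  · exact HahnSeries.single_mul_single
  · refine HahnSeries.single_mul_single.trans ?_
    change _ = HahnSeries.single (-(a + b)) (d * e)
    rw [neg_add]
  · exact monoOp_mul a b d e

theorem monoR_one : monoR 0 (1 : Op W) = 1 :=
  OpRing.ext rfl (by
    change HahnSeries.single (-0) 1 = _
    rw [neg_zero]; rfl) monoOp_one

theorem monoOp_add (a : ℤ) (d e : Op W) : monoOp a (d + e) = monoOp a d + monoOp a e := by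
  refine seriesPair_ext (fun v => Prod.ext rfl ?_) fun j w => Prod.ext rfl ?_
  · simp [monoOp]
  · rw [LinearMap.add_apply, Prod.snd_add, monoOp_snd, monoOp_snd, monoOp_snd, LinearMap.add_apply,
      Finsupp.single_add]

theorem monoR_add (a : ℤ) (d e : Op W) : monoR a (d + e) = monoR a d + monoR a e :=
  OpRing.ext (map_add (HahnSeries.single.addMonoidHom a) d e)
    (map_add (HahnSeries.single.addMonoidHom (-a)) d e) (monoOp_add a d e)

/-- The operators on `W`, as constant Laurent polynomials. -/
def constR : Op W →+* OpRing W where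
  toFun := monoR 0
  map_one' := monoR_one
  map_mul' d e := by rw [monoR_mul, add_zero]
  map_zero' := by
    have := monoR_add 0 (0 : Op W) 0
    rw [add_zero] at this
    exact left_eq_add.1 this
  map_add' := monoR_add 0

theorem monoOp_zero_algebraMap (s : Scal) :
    monoOp 0 (algebraMap Scal (Op W) s) = algebraMap Scal (Module.End Scal (SeriesPair W)) s := by
  refine seriesPair_ext (fun v => Prod.ext ?_ ?_) fun j w => Prod.ext ?_ ?_
  · funext k
    rw [monoOp_fst, sub_zero]
    rfl
  · change (monoOp 0 _ _).2 = s • (0 : ℤ →₀ W)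
    simp [monoOp]
  · funext k
    change (monoOp 0 _ _).1 k = s • (0 : W)
    rw [monoOp_fst, smul_zero]
    exact smul_zero _
  · change (monoOp 0 _ _).2 = s • Finsupp.single j w
    rw [monoOp_snd, add_zero, Finsupp.smul_single]
    rfl

theorem constR_algebraMap_comm (s : Scal) (x : OpRing W) :
    constR (algebraMap Scal (Op W) s) * x = x * constR (algebraMap Scal (Op W) s) := by
  refine OpRing.ext ?_ ?_ ?_
  · exact Algebra.commutes (A := LaurentSeries (Op W)) s x.1.1
  · change HahnSeries.single (-0) _ * x.1.2.1.1 = x.1.2.1.1 * HahnSeries.single (-0) _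
    rw [neg_zero]
    exact Algebra.commutes (A := LaurentSeries (Op W)) s _
  · change monoOp 0 _ * x.1.2.2.1 = x.1.2.2.1 * monoOp 0 _
    rw [monoOp_zero_algebraMap]
    exact Algebra.commutes (A := Module.End Scal (SeriesPair W)) s _

instance : Algebra Scal (OpRing W) :=
  (constR.comp (algebraMap Scal (Op W))).toAlgebra' constR_algebraMap_comm

theorem constR_algebraMap (s : Scal) :
    constR (algebraMap Scal (Op W) s) = algebraMap Scal (OpRing W) s := rfl

variable (W) in
/-- The projection to the series in `u`. -/
def projP : OpRing W →+* LaurentSeries (Op W) := (RingHom.fst _ _).comp (opRing W).subtype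

variable (W) in
/-- The projection to the locally finite series in `u⁻¹`. -/
def projQ : OpRing W →+* LocFin W :=
  ((RingHom.fst _ _).comp (RingHom.snd _ _)).comp (opRing W).subtype

variable (W) in
/-- The projection to the operators on pairs of series. -/
def projU : OpRing W →+* UOp W :=
  ((RingHom.snd _ _).comp (RingHom.snd _ _)).comp (opRing W).subtype

theorem projP_algebraMap (s : Scal) :
    projP W (algebraMap Scal (OpRing W) s) = algebraMap Scal _ s := rfl

theorem projQ_algebraMap (s : Scal) :
    projQ W (algebraMap Scal (OpRing W) s) = algebraMap Scal _ s := LocFin.ext (by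
  change HahnSeries.single (-0) _ = _
  rw [neg_zero]
  rfl)

theorem projU_algebraMap (s : Scal) :
    projU W (algebraMap Scal (OpRing W) s) = algebraMap Scal _ s :=
  UOp.ext (monoOp_zero_algebraMap s)

/-- The operators given by series in `u` form a bimodule over `OpRing W`. -/
theorem isBiMap_psiP : IsBiMap (A := OpRing W) (B := LaurentSeries (Op W)) (E := UOp W) (projP W)
    (projU W) psiP := ⟨fun a => a.2.1, fun x a => a.2.2.1 x⟩

/-- The operators given by locally finite series in `u⁻¹` form a bimodule over `OpRing W`. -/
theorem isBiMap_psiQ : IsBiMap (A := OpRing W) (B := LocFin W) (E := UOp W) (projQ W) (projU W) psiQ :=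
  ⟨fun a => a.2.2.2.1, fun x a => a.2.2.2.2 x⟩

variable (W) in
/-- The variable `u`. -/
def uR : OpRing W := monoR 1 1

theorem uR_comm (x : OpRing W) : Commute (uR W) x := by
  refine OpRing.ext ?_ ?_ ?_
  · refine HahnSeries.ext ?_
    funext k
    change (HahnSeries.single 1 1 * x.1.1).coeff k = (x.1.1 * HahnSeries.single 1 1).coeff k
    rw [HahnSeries.coeff_single_mul, HahnSeries.coeff_mul_single, one_mul, mul_one]
  · refine HahnSeries.ext ?_
    funext k
    change (HahnSeries.single (-1) 1 * x.1.2.1.1).coeff k =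
      (x.1.2.1.1 * HahnSeries.single (-1) 1).coeff k
    rw [HahnSeries.coeff_single_mul, HahnSeries.coeff_mul_single, one_mul, mul_one]
  · exact (Subalgebra.mem_centralizer_iff Scal).1 x.1.2.2.2 _ rfl

theorem isUnit_uR : IsUnit (uR W) := by
  refine isUnit_iff_exists.2 ⟨monoR (-1) 1, ?_, ?_⟩ <;> rw [uR, monoR_mul] <;> simp [monoR_one]

variable {m : ℕ}

theorem opRing_pow (hm : algebraMap Scal (Op W) hh ^ m = 0) :
    algebraMap Scal (OpRing W) hh ^ m = 0 :=
  algebraMap_pow_of_map constR constR_algebraMap hm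

theorem C_comm_of_comm {R : Type*} [Ring R] {r : R} (h : ∀ x, Commute r x) (f : R⟦X⟧) :
    Commute (PowerSeries.C r) f := by
  ext a
  rw [PowerSeries.coeff_C_mul, PowerSeries.coeff_mul_C, (h _).eq]

/-- Power series in `u` as Laurent series. -/
def iotaP : (Op W)⟦X⟧ →+* LaurentSeries (Op W) := HahnSeries.ofPowerSeries ℤ (Op W)

theorem iotaP_algebraMap (s : Scal) :
    (iotaP (algebraMap Scal (Op W)⟦X⟧ s) : LaurentSeries (Op W)) =
      algebraMap Scal _ s := by
  rw [algebraMap_series, iotaP, HahnSeries.ofPowerSeries_C]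
  rfl

theorem pType_iota : PType (iotaP (W := W)) (projP W (uR W)) :=
  ⟨iotaP_algebraMap, HahnSeries.ofPowerSeries_X⟩

theorem qType_iota : QType (iotaP (W := W)) (LocFin.val W (projQ W (uR W))) :=
  ⟨iotaP_algebraMap, by
    rw [iotaP, HahnSeries.ofPowerSeries_X]
    change HahnSeries.single 1 1 * HahnSeries.single (-1) 1 = (1 : LaurentSeries (Op W))
    rw [HahnSeries.single_mul_single]
    simp⟩

theorem coeff_iotaP (f : (Op W)⟦X⟧) (k : ℤ) :
    (iotaP f).coeff k = if 0 ≤ k then PowerSeries.coeff k.toNat f else 0 := by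
  split_ifs with h
  · obtain ⟨a, rfl⟩ := Int.eq_ofNat_of_zero_le h
    exact HahnSeries.ofPowerSeries_apply_coeff f a
  · rw [iotaP, HahnSeries.ofPowerSeries_apply]
    refine HahnSeries.embDomain_of_notMem_range ?_
    rintro ⟨a, ha⟩
    exact h (by rw [← ha]; exact Int.natCast_nonneg a)

theorem mem_locFin_iotaP {f : (Op W)⟦X⟧}
    (h : ∀ w, {l | PowerSeries.coeff l f w ≠ 0}.Finite) : iotaP f ∈ locFin W := fun w => by
  refine ((h w).image ((↑) : ℕ → ℤ)).subset fun k hk => ?_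
  rw [Set.mem_ofPred_eq, coeff_iotaP] at hk
  split_ifs at hk with h0
  · exact ⟨k.toNat, hk, Int.toNat_of_nonneg h0⟩
  · exact absurd rfl hk

end OpRing

/-! ### Expansions of the spectral parameters -/

section ZetaDataSeries

variable {L : Type*} [Ring L] [Algebra Scal L] {u : L} {m : ℕ}

theorem isUnit_point_of_central (hm : algebraMap Scal L hh ^ m = 0) (hu : IsUnit u) {ε' : ℤ}
    (h' : ε' * ε' = 1) (β : ℂ) : IsUnit (ε' • u + kap L β) := by
  have h1 : IsUnit (ε' • u) := by
    obtain ⟨v, hv⟩ := hu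
    refine isUnit_iff_exists.2 ⟨ε' • ↑v⁻¹, ?_, ?_⟩ <;> rw [smul_mul_smul_comm, h', ← hv] <;> simp
  exact IsNilpotent.isUnit_add_left_of_commute ⟨m, kap_pow hm β⟩ h1 (kap_comm β _)

/-- The expansion in powers of `v`. -/
theorem zetaData_series (hm : algebraMap Scal L hh ^ m = 0) (hc : ∀ x, Commute u x)
    (hu : IsUnit u) : ZetaData (PowerSeries.C u) 1 PowerSeries.X where
  hu := C_comm_of_comm hc
  hp := Commute.one_left
  hq f := (PowerSeries.commute_X f).symm
  unit ε' ε h' h'' β := by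
    rw [PowerSeries.isUnit_iff_constantCoeff]
    have e : (PowerSeries.constantCoeff : L⟦X⟧ →+* _)
        (den ε' ε β (PowerSeries.C u) 1 PowerSeries.X) = ε' • u + kap L β := by
      rw [den, ← map_C_kap]
      simp
    rw [e]
    exact isUnit_point_of_central hm hu h' β

/-- The expansion in powers of `v⁻¹`. -/
theorem zetaData_series_inv (hc : ∀ x, Commute u x) :
    ZetaData (PowerSeries.C u) PowerSeries.X 1 where
  hu := C_comm_of_comm hc
  hp f := (PowerSeries.commute_X f).symm
  hq := Commute.one_left
  unit ε' ε h' h'' β := by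
    rw [PowerSeries.isUnit_iff_constantCoeff]
    have e : (PowerSeries.constantCoeff : L⟦X⟧ →+* _)
        (den ε' ε β (PowerSeries.C u) PowerSeries.X 1) = -(ε • 1) := by
      rw [den]
      simp
    rw [e, IsUnit.neg_iff]
    refine isUnit_iff_exists.2 ⟨ε • 1, ?_, ?_⟩ <;> rw [smul_mul_smul_comm, h'', one_smul, one_mul]

end ZetaDataSeries

/-! ### The coefficients of the trace as operators -/

section OperatorCommute

variable {W : Type} [AddCommGroup W] [Module Scal W] {N n m : ℕ}

theorem single_comm (a : ℤ) (f : LaurentSeries (Op W)) :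
    Commute (HahnSeries.single a 1 : LaurentSeries (Op W)) f := by
  refine HahnSeries.ext ?_
  funext k
  rw [HahnSeries.coeff_single_mul, HahnSeries.coeff_mul_single, one_mul, mul_one]

theorem projU_uR_comm (x : UOp W) : Commute (projU W (uR W)) x :=
  UOp.ext ((Subalgebra.mem_centralizer_iff Scal).1 x.2 _ rfl)

/-- A ring homomorphism on power series coefficients is compatible with the scalars. -/
theorem map_algebraMap_series {A B : Type*} [Ring A] [Ring B] [Algebra Scal A] [Algebra Scal B]
    {Φ : A →+* B} (h : ∀ s : Scal, Φ (algebraMap Scal A s) = algebraMap Scal B s) (s : Scal) :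
    PowerSeries.map Φ (algebraMap Scal _ s) = algebraMap Scal _ s := by
  rw [algebraMap_series, algebraMap_series, PowerSeries.map_C, h]

theorem map_sandwich {A B : Type*} [Ring A] [Ring B] [Algebra Scal A] [Algebra Scal B]
    {Φ : A →+* B} (h : ∀ s : Scal, Φ (algebraMap Scal A s) = algebraMap Scal B s)
    (ξ ξ' : Fin n → A) (l l' : List (Fin n)) (M : Mat[N] A) :
    (rprod m ξ l * Matrix.scalar _ M * rprod m ξ' l' :
        Mat[N, n] (Mat[N] A)).map Φ.mapMatrix =
      rprod m (fun i => Φ (ξ i)) l * Matrix.scalar _ (M.map Φ) * rprod m (fun i => Φ (ξ' i)) l' := by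
  have e : ∀ M : Mat[N, n] (Mat[N] A),
      M.map (Φ.mapMatrix) = (Φ.mapMatrix : Mat[N] A →+* _).mapMatrix M :=
    fun _ => rfl
  rw [e, map_mul, map_mul, ← e, ← e, ← e, rprod_map Φ h, rprod_map Φ h]
  congr 2
  refine Matrix.ext fun a b => ?_
  rw [Matrix.map_apply, Matrix.scalar_apply, Matrix.scalar_apply, Matrix.diagonal_apply,
    Matrix.diagonal_apply]
  split_ifs
  · rfl
  · exact map_zero _

/-- The contribution of the coefficients of `u ^ (k + l)` and of `u ^ (-l)` to the coefficient of
`u ^ k` in the trace of `E F K`. -/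
def traceOp (χ : Equiv.Perm (Fin n) →* ℤˣ)
    (F K : Mat[N, n] (Op W)⟦X⟧) (k : ℤ) (l : ℕ) : Op W :=
  if 0 ≤ k + l then
    Matrix.trace (isoProj N n χ (Op W) * F.map (PowerSeries.coeff (k + l).toNat) *
      K.map (PowerSeries.coeff l))
  else 0

/-- A sum over the coefficients of a locally finite series applied to `w` is finite. -/
theorem convQ_sum_eq {κ : LocFin W} {g : (Op W)⟦X⟧} (hκ : κ.1 = iotaP g) (w : W) {L : ℕ}
    (hL : ∀ l, L ≤ l → PowerSeries.coeff l g w = 0) (f : ℤ → Op W) :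
    ((convQ κ 0 w).sum fun j w' => f j w') =
      ∑ l ∈ Finset.range L, f (-l) (PowerSeries.coeff l g w) := by
  have h1 : ∀ j, convQ κ 0 w j = if 0 ≤ -j then PowerSeries.coeff (-j).toNat g w else 0 := by
    intro j
    rw [convQ_apply, hκ, coeff_iotaP, zero_sub]
    split_ifs <;> rfl
  have h2 : (convQ κ 0 w).support ⊆ (Finset.range L).image fun l : ℕ => -(l : ℤ) := by
    intro j hj
    rw [Finsupp.mem_support_iff, h1] at hj
    split_ifs at hj with h0
    · rw [Finset.mem_image]
      refine ⟨(-j).toNat, ?_, by omega⟩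
      rw [Finset.mem_range]
      by_contra h
      exact hj (hL _ (not_lt.1 h))
    · exact absurd rfl hj
  rw [Finsupp.sum_of_support_subset _ h2 _ fun j _ => map_zero _,
    Finset.sum_image fun a _ b _ h => by simpa using h]
  refine Finset.sum_congr rfl fun l _ => ?_
  rw [h1]
  simp

/-- The coefficient of `u ^ k` of an operator applied to the constant Laurent polynomial `w`. -/
def evalU (w : W) (k : ℤ) : UOp W →+ W where
  toFun z := (z.1 (0, Finsupp.single 0 w)).1 k
  map_zero' := rfl
  map_add' _ _ := rfl

theorem evalU_apply (w : W) (k : ℤ) (z : UOp W) :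
    evalU w k z = (z.1 (0, Finsupp.single 0 w)).1 k := rfl

/-- The coefficient of `u ^ k` of the trace, as an operator. -/
theorem trace_apply (χ : Equiv.Perm (Fin n) →* ℤˣ)
    (F K : Mat[N, n] (Op W)⟦X⟧)
    (κ : Mat[N, n] (LocFin W)) (hκ : ∀ a b, (κ a b).1 = iotaP (K a b))
    (w : W) {L : ℕ} (hL : ∀ l, L ≤ l → ∀ a b, PowerSeries.coeff l (K a b) w = 0) (k : ℤ) :
    evalU w k (Matrix.trace (isoProj N n χ (UOp W) * (F.map (fun f => psiP (iotaP f)) *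
      κ.map psiQ))) =
      ∑ l ∈ Finset.range L, traceOp χ F K k l w := by
  have e1 : isoProj N n χ (UOp W) * F.map (fun f => psiP (iotaP f)) =
      (isoProj N n χ (Op W)⟦X⟧ * F).map fun f => psiP (iotaP f) := by
    have h1 : (isoProj N n χ (Op W)⟦X⟧ * F).map iotaP =
        isoProj N n χ (LaurentSeries (Op W)) * F.map iotaP := by
      rw [← isoProj_ringHom_map χ (j := iotaP (W := W)) iotaP_algebraMap]
      exact map_mul (iotaP : (Op W)⟦X⟧ →+* LaurentSeries (Op W)).mapMatrix _ F
    have h2 := isBiMap_psiP.isoProj_mul_map projP_algebraMap projU_algebraMap χ (F.map iotaP)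
    rw [← h1, Matrix.map_map, Matrix.map_map] at h2
    exact h2.symm
  set G := isoProj N n χ (Op W)⟦X⟧ * F with hG
  have e2 : ∀ r, isoProj N n χ (Op W) * F.map (PowerSeries.coeff r) =
      G.map (PowerSeries.coeff r) := by
    intro r
    refine Matrix.ext fun a b => ?_
    rw [hG, Matrix.map_apply, Matrix.mul_apply, Matrix.mul_apply, map_sum]
    refine Finset.sum_congr rfl fun x _ => ?_
    have : isoProj N n χ (Op W)⟦X⟧ a x = PowerSeries.C (isoProj N n χ (Op W) a x) := by
      rw [← isoProj_ringHom_map χ (j := (PowerSeries.C : Op W →+* (Op W)⟦X⟧))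
        fun s => (algebraMap_series s).symm, Matrix.map_apply]
    rw [this, PowerSeries.coeff_C_mul, Matrix.map_apply]
  have e3 : evalU w k (Matrix.trace (isoProj N n χ (UOp W) * (F.map (fun f => psiP (iotaP f)) *
      κ.map psiQ))) = ∑ a, ∑ b, evalU w k (psiP (iotaP (G a b)) * psiQ (κ b a)) := by
    rw [← mul_assoc, e1, Matrix.trace, map_sum]
    refine Finset.sum_congr rfl fun a _ => ?_
    rw [Matrix.diag, Matrix.mul_apply, map_sum]
    rfl
  have e4 : ∀ a b, evalU w k (psiP (iotaP (G a b)) * psiQ (κ b a)) =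
      ∑ l ∈ Finset.range L, (if 0 ≤ k + l then PowerSeries.coeff (k + l).toNat (G a b) else 0)
        (PowerSeries.coeff l (K b a) w) := by
    intro a b
    rw [evalU_apply, psiP_mul_psiQ_apply, convQ_sum_eq (hκ b a) w (fun l hl => hL l hl b a)
      fun j => (iotaP (G a b)).coeff (k - j)]
    refine Finset.sum_congr rfl fun l _ => ?_
    rw [coeff_iotaP, sub_neg_eq_add]
  rw [e3, Finset.sum_congr rfl fun a _ => Finset.sum_congr rfl fun b _ => e4 a b]
  rw [Finset.sum_congr rfl fun a _ => Finset.sum_comm, Finset.sum_comm]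
  refine Finset.sum_congr rfl fun l _ => ?_
  rw [traceOp]
  split_ifs
  · rw [e2, Matrix.trace, LinearMap.sum_apply]
    refine Finset.sum_congr rfl fun a _ => ?_
    rw [Matrix.diag, Matrix.mul_apply, LinearMap.sum_apply]
    rfl
  · simp

end OperatorCommute

/-! ### Commutation with the coefficients of the trace -/

section OperatorCommute

variable {W : Type} [AddCommGroup W] [Module Scal W] {N n m : ℕ}

theorem legMat_prod {L D : Type*} [Ring L] [Ring D] (ι : D⟦X⟧ →+* L)
    (X : Fin n → Mat[N] D⟦X⟧) (l : List (Fin n)) :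
    ((l.map fun i => leg i ((X i).map fun f => PowerSeries.C (ι f))).prod :
      Mat[N, n] L⟦X⟧) =
      ((PowerSeries.C : L →+* L⟦X⟧).comp ι).mapMatrix
        (l.map fun i => leg i (X i)).prod := by
  rw [map_list_prod, List.map_map]
  congr 1
  refine List.map_congr_left fun i _ => ?_
  exact (leg_map ((PowerSeries.C : L →+* L⟦X⟧).comp ι) i (X i)).symm

theorem proj_mul_stable {R : Type*} [Ring R] {e a b : R} (ha : e * a = e * a * e)
    (hb : e * b = e * b * e) : e * (a * b) = e * (a * b) * e := by
  have h : e * (a * b) = e * a * (e * b) := by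
    rw [← mul_assoc, ha, mul_assoc (e * a), ← ha]
  rw [h, mul_assoc (e * a), ← hb]

/-- The conjugate of `M` by two products of `R`-matrices, with the parameters `h / (w_i + v + β h)`
to the left and `-h / (w_i - v + β' h)` to the right of `M`. -/
def sandA {A : Type*} [Ring A] [Algebra Scal A] (n m : ℕ) (s : ℤ) (u p q : A) (β β' : ℂ)
    (M : Mat[N] A) :
    Mat[N, n] (Mat[N] A) :=
  rprod m (zfam n s u p q (-1) β) (List.finRange n) * Matrix.scalar _ M *
    rprod m (fun i => -zfam n s u p q 1 β' i) (List.finRange n).reverse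

/-- The conjugate of `M` by two products of `R`-matrices, with the parameters `-h / (w_i - v + β
h)` to the left and `h / (w_i + v + β' h)` to the right of `M`. -/
def sandB {A : Type*} [Ring A] [Algebra Scal A] (n m : ℕ) (s : ℤ) (u p q : A) (β β' : ℂ)
    (M : Mat[N] A) :
    Mat[N, n] (Mat[N] A) :=
  rprod m (fun i => -zfam n s u p q 1 β i) (List.finRange n).reverse * Matrix.scalar _ M *
    rprod m (zfam n s u p q (-1) β') (List.finRange n)

section SandMap

variable {A B : Type*} [Ring A] [Algebra Scal A] [Ring B] [Algebra Scal B] {u p q : A}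

theorem sandA_map {Φ : A →+* B} (h : ∀ s : Scal, Φ (algebraMap Scal A s) = algebraMap Scal B s)
    (hz : ZetaData u p q) (s : ℤ) (β β' : ℂ) (M : Mat[N] A) :
    (sandA n m s u p q β β' M).map Φ.mapMatrix =
      sandA n m s (Φ u) (Φ p) (Φ q) β β' (M.map Φ) := by
  rw [sandA, map_sandwich h, sandA]
  congr 2
  · congr 1
    funext i
    exact zfam_map Φ h hz s (by norm_num) β i
  · funext i
    rw [map_neg, zfam_map Φ h hz s (by norm_num)]

theorem sandB_map {Φ : A →+* B} (h : ∀ s : Scal, Φ (algebraMap Scal A s) = algebraMap Scal B s)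
    (hz : ZetaData u p q) (s : ℤ) (β β' : ℂ) (M : Mat[N] A) :
    (sandB n m s u p q β β' M).map Φ.mapMatrix =
      sandB n m s (Φ u) (Φ p) (Φ q) β β' (M.map Φ) := by
  rw [sandB, map_sandwich h, sandB]
  congr 2
  · congr 1
    funext i
    rw [map_neg, zfam_map Φ h hz s (by norm_num)]
  · funext i
    exact zfam_map Φ h hz s (by norm_num) β' i

end SandMap

theorem evalU_mul_const (w : W) (k : ℤ) (d : Op W) (z : UOp W) :
    evalU w k (projU W (constR d) * z) = d (evalU w k z) := by
  change (monoOp 0 d (z.1 (0, Finsupp.single 0 w))).1 k = _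
  rw [monoOp_fst, sub_zero]
  rfl

theorem evalU_const_mul (w : W) (k : ℤ) (d : Op W) (z : UOp W) :
    evalU w k (z * projU W (constR d)) = evalU (d w) k z := by
  change (z.1 (monoOp 0 d (0, Finsupp.single 0 w))).1 k = _
  have : monoOp 0 d (0, Finsupp.single 0 w) = ((0 : ℤ → W), Finsupp.single 0 (d w)) :=
    Prod.ext (funext fun _ => map_zero d) (by rw [monoOp_snd, add_zero])
  rw [this]
  rfl

/-- The coefficients of a product `t t'⁻¹` commute with the coefficients of the trace of `E F K`, if
`t` and `t'` satisfy exchange relations with the factors of `F` and of `K`, where the levels are such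
that the resulting parameters are related by crossing. -/
theorem trace_coeff_comm (hN : N ≠ 0) (hm : algebraMap Scal (Op W) hh ^ m = 0)
    {χ : Equiv.Perm (Fin n) →* ℤˣ} {s : ℤ}
    (hs : ∀ i j, i ≠ j → ((χ (Equiv.swap i j) : ℤˣ) : ℤ) = s) {c : ℂ} (hc : 2 * c = -(N : ℂ))
    {S T : ℤ → ℂ → Mat[N] (Op W)⟦X⟧}
    {t t' ti : Mat[N] (Op W)⟦X⟧} (ht1 : t' * ti = 1) (ht2 : ti * t' = 1)
    {p q : (OpRing W)⟦X⟧} {pP qP : PowerSeries (LaurentSeries (Op W))}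
    {b b' δ : ℂ} (hδ : b + b' + 2 * δ = 0)
    (hp : PowerSeries.map (projP W) p = pP) (hq : PowerSeries.map (projP W) q = qP)
    (hp' : PowerSeries.map ((LocFin.val W).comp (projQ W)) p = pP)
    (hq' : PowerSeries.map ((LocFin.val W).comp (projQ W)) q = qP)
    (zR : ZetaData (PowerSeries.C (uR W)) p q)
    (zP : ZetaData (PowerSeries.C (projP W (uR W))) pP qP)
    (zQ : ZetaData (PowerSeries.C (LocFin.val W (projQ W (uR W)))) pP qP)
    (zU : ZetaData (PowerSeries.C (projU W (uR W))) (PowerSeries.map (projU W) p)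
      (PowerSeries.map (projU W) q))
    (LP : LegAux m (PowerSeries.C (projP W (uR W))) pP qP b b' δ
      (fun ε α => legMat iotaP (S ε α)) (auxMat iotaP t) (auxMat iotaP t'))
    (LQ : LegAux m (PowerSeries.C (LocFin.val W (projQ W (uR W)))) pP qP b b' (δ + c / 2)
      (fun ε α => legMat iotaP (T ε α)) (auxMat iotaP t) (auxMat iotaP t'))
    {Si Ti : Mat[N, n] (Op W)⟦X⟧}
    (hS1 : ((List.finRange n).reverse.map fun i => leg i (S (-1) (-(s * (i : ℕ))))).prod * Si = 1)
    (hS2 : Si * ((List.finRange n).reverse.map fun i => leg i (S (-1) (-(s * (i : ℕ))))).prod = 1)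
    (hT1 : ((List.finRange n).map fun i => leg i (T 1 (s * (i : ℕ) + 3 * c / 2))).prod * Ti = 1)
    (hT2 : Ti * ((List.finRange n).map fun i => leg i (T 1 (s * (i : ℕ) + 3 * c / 2))).prod = 1)
    {F K : Mat[N, n] (Op W)⟦X⟧}
    (hF : F = ((List.finRange n).map fun i => leg i (S 1 (s * (i : ℕ)))).prod * Si)
    (hK : K = ((List.finRange n).reverse.map fun i =>
      leg i (T (-1) (-(s * (i : ℕ)) - c / 2))).prod * Ti)
    (eS : isoProj N n χ _ * ((List.finRange n).map fun i => leg i (S 1 (s * (i : ℕ)))).prod =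
      isoProj N n χ _ * ((List.finRange n).map fun i => leg i (S 1 (s * (i : ℕ)))).prod *
        isoProj N n χ _)
    (eSi : isoProj N n χ _ * Si = isoProj N n χ _ * Si * isoProj N n χ _)
    (eT : isoProj N n χ _ *
        ((List.finRange n).reverse.map fun i => leg i (T (-1) (-(s * (i : ℕ)) - c / 2))).prod =
      isoProj N n χ _ *
        ((List.finRange n).reverse.map fun i => leg i (T (-1) (-(s * (i : ℕ)) - c / 2))).prod *
        isoProj N n χ _)
    (eTi : isoProj N n χ _ * Ti = isoProj N n χ _ * Ti * isoProj N n χ _)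
    (hfin : ∀ a b w, {l | PowerSeries.coeff l (K a b) w ≠ 0}.Finite)
    (r : ℕ) (i j : Fin N) (k : ℤ) (w : W) {L : ℕ}
    (hL : ∀ l, L ≤ l → ∀ a b, PowerSeries.coeff l (K a b) w = 0)
    (hL' : ∀ l, L ≤ l → ∀ a b,
      PowerSeries.coeff l (K a b) (PowerSeries.coeff r ((t * ti) i j) w) = 0) :
    PowerSeries.coeff r ((t * ti) i j) (∑ l ∈ Finset.range L, traceOp χ F K k l w) =
      ∑ l ∈ Finset.range L, traceOp χ F K k l (PowerSeries.coeff r ((t * ti) i j) w) := by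
  have h1 : (1 : ℤ) * 1 = 1 := by norm_num
  have h2 : (-1 : ℤ) * -1 = 1 := by norm_num
  have hm1 : algebraMap Scal (Op W)⟦X⟧ hh ^ m = 0 := algebraMap_series_pow hm
  have hmP : algebraMap Scal (PowerSeries (LaurentSeries (Op W))) hh ^ m = 0 :=
    algebraMap_series_pow (algebraMap_pow_of_map iotaP iotaP_algebraMap hm1)
  have hmU : algebraMap Scal (UOp W)⟦X⟧ hh ^ m = 0 :=
    algebraMap_series_pow (algebraMap_pow_of_map (projU W) projU_algebraMap (opRing_pow hm))
  -- the embedding of matrices over power series in `u` or `u⁻¹`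
  let ιP : (Op W)⟦X⟧ →+* PowerSeries (LaurentSeries (Op W)) :=
    (PowerSeries.C : LaurentSeries (Op W) →+* PowerSeries (LaurentSeries (Op W))).comp iotaP
  have hιP : ∀ s : Scal, ιP (algebraMap Scal _ s) = algebraMap Scal _ s := fun s => by
    change PowerSeries.C (iotaP _) = _
    rw [iotaP_algebraMap, algebraMap_series]
  have hEP : (isoProj N n χ (Op W)⟦X⟧).map ιP = isoProj N n χ _ :=
    isoProj_ringHom_map χ hιP
  have lift1 : ∀ {X Y : Mat[N, n] (Op W)⟦X⟧},
      X * Y = 1 → ιP.mapMatrix X * ιP.mapMatrix Y = 1 := fun h => by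
    rw [← map_mul, h, map_one]
  have lift2 : ∀ {X : Mat[N, n] (Op W)⟦X⟧},
      isoProj N n χ _ * X = isoProj N n χ _ * X * isoProj N n χ _ →
      isoProj N n χ _ * ιP.mapMatrix X = isoProj N n χ _ * ιP.mapMatrix X * isoProj N n χ _ := by
    intro X h
    rw [← hEP]
    change ιP.mapMatrix _ * _ = ιP.mapMatrix _ * _ * ιP.mapMatrix _
    rw [← map_mul, ← map_mul, ← h]
  have aux1 : ∀ {X Y : Mat[N] (Op W)⟦X⟧}, X * Y = 1 →
      auxMat (L := LaurentSeries (Op W)) iotaP X * auxMat iotaP Y = 1 := fun {X Y} h => by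
    have := map_mul (PowerSeries.map ((iotaP (W := W)).comp PowerSeries.C)).mapMatrix X Y
    rw [h, map_one] at this
    exact this.symm
  have eF : isoProj N n χ _ * F = isoProj N n χ _ * F * isoProj N n χ _ := by
    rw [hF]
    exact proj_mul_stable eS eSi
  have eK : isoProj N n χ _ * K = isoProj N n χ _ * K * isoProj N n χ _ := by
    rw [hK]
    exact proj_mul_stable eT eTi
  have RP := exchange_increasing hN hmP zP hs LP hδ (aux1 ht1) (aux1 ht2)
    (Ti := ιP.mapMatrix Si) (by rw [legMat_prod]; exact lift1 hS1)
    (by rw [legMat_prod]; exact lift1 hS2) (by rw [legMat_prod]; exact lift2 eS)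
  have RQ := exchange_decreasing hN hmP zQ hs LQ (c := c) (by linear_combination hδ) (aux1 ht1)
    (aux1 ht2) (Ti := ιP.mapMatrix Ti) (by rw [legMat_prod]; exact lift1 hT1)
    (by rw [legMat_prod]; exact lift1 hT2) (by rw [legMat_prod]; exact lift2 eT)
  rw [legMat_prod, ← map_mul ιP.mapMatrix, ← hF] at RP
  rw [legMat_prod, ← map_mul ιP.mapMatrix, ← hK] at RQ
  -- the product `t t'⁻¹` with coefficients in the ring `OpRing W`
  set MR : Mat[N] (OpRing W)⟦X⟧ := (t * ti).map (PowerSeries.map constR)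
    with hMR
  have hcP : (projP W).comp constR = (iotaP (W := W)).comp PowerSeries.C := RingHom.ext fun d =>
    (HahnSeries.ofPowerSeries_C d).symm
  have hcQ : ((LocFin.val W).comp (projQ W)).comp constR = (iotaP (W := W)).comp PowerSeries.C :=
    RingHom.ext fun d => by
      refine Eq.trans ?_ (HahnSeries.ofPowerSeries_C d).symm
      change HahnSeries.single (-0) d = HahnSeries.single 0 d
      rw [neg_zero]
  have hmap : ∀ {Φ : OpRing W →+* LaurentSeries (Op W)},
      Φ.comp constR = (iotaP (W := W)).comp PowerSeries.C →
      MR.map (PowerSeries.map Φ) = auxMat iotaP t * auxMat iotaP ti := fun {Φ} h => by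
    have e := map_mul (PowerSeries.map ((iotaP (W := W)).comp PowerSeries.C)).mapMatrix t ti
    refine Eq.trans ?_ e
    rw [hMR, ← h]
    ext a b : 2
    rw [Matrix.map_apply, Matrix.map_apply, RingHom.mapMatrix_apply, Matrix.map_apply]
    ext r
    simp
  have aP := map_algebraMap_series (projP_algebraMap (W := W))
  have aQ := map_algebraMap_series (projQ_algebraMap (W := W))
  have aV : ∀ s : Scal, PowerSeries.map ((LocFin.val W).comp (projQ W)) (algebraMap Scal _ s) =
      algebraMap Scal _ s := map_algebraMap_series fun s => by
    rw [RingHom.comp_apply, projQ_algebraMap]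
    rfl
  have aU := map_algebraMap_series (projU_algebraMap (W := W))
  -- The `R`-matrices of the relations for `F` and for `K` are images of `R`-matrices over `OpRing
  -- W`, where those between `F` and `K` agree.
  have RP' : liftMat (isoProj N n χ _ * ιP.mapMatrix F) *
      (sandA n m s (PowerSeries.C (uR W)) p q (b - δ) (b' - δ) MR).map
        (PowerSeries.map (projP W)).mapMatrix =
      liftMat (isoProj N n χ _) *
      (sandB n m s (PowerSeries.C (uR W)) p q (-b + δ) (-b' + δ) MR).map
        (PowerSeries.map (projP W)).mapMatrix * liftMat (ιP.mapMatrix F) := by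
    rw [sandA_map aP zR, sandB_map aP zR, hmap hcP, PowerSeries.map_C, hp, hq]
    exact RP
  have RQ' : liftMat (isoProj N n χ _ * ιP.mapMatrix K) *
      (sandB n m s (PowerSeries.C (uR W)) p q (-b + δ + 2 * c) (-b' + δ + 2 * c) MR).map
        (PowerSeries.map ((LocFin.val W).comp (projQ W))).mapMatrix =
      liftMat (isoProj N n χ _) *
      (sandA n m s (PowerSeries.C (uR W)) p q (b - δ) (b' - δ) MR).map
        (PowerSeries.map ((LocFin.val W).comp (projQ W))).mapMatrix *
      liftMat (ιP.mapMatrix K) := by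
    rw [sandA_map aV zR, sandB_map aV zR, hmap hcQ, PowerSeries.map_C, hp', hq']
    have e1 : -b + δ + 2 * c = 3 * c / 2 - b + (δ + c / 2) := by ring
    have e2 : -b' + δ + 2 * c = 3 * c / 2 - b' + (δ + c / 2) := by ring
    have e3 : b - δ = c / 2 + b - (δ + c / 2) := by ring
    have e4 : b' - δ = c / 2 + b' - (δ + c / 2) := by ring
    rw [e1, e2, e3, e4]
    exact RQ
  -- the relation for `K` holds already for locally finite series
  let κ : Mat[N, n] (LocFin W) := fun a b =>
    show locFin W from ⟨iotaP (K a b), mem_locFin_iotaP (hfin a b)⟩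
  let Kq : Mat[N, n] (LocFin W)⟦X⟧ :=
    κ.map PowerSeries.C
  have hKq : Kq.map (PowerSeries.map (LocFin.val W)) = ιP.mapMatrix K := by
    refine Matrix.ext fun a b => ?_
    exact PowerSeries.map_C (LocFin.val W) (κ a b)
  have hVinj : Function.Injective (PowerSeries.map (LocFin.val W)) := fun f g h => by
    ext r : 1
    have := congrArg (PowerSeries.coeff r) h
    rw [PowerSeries.coeff_map, PowerSeries.coeff_map] at this
    exact LocFin.ext this
  have aVal : ∀ s : Scal, PowerSeries.map (LocFin.val W) (algebraMap Scal _ s) =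
      algebraMap Scal _ s := map_algebraMap_series fun s => rfl
  have hEV : (isoProj N n χ (LocFin W)⟦X⟧).map (PowerSeries.map (LocFin.val W)) =
      isoProj N n χ _ := isoProj_ringHom_map χ aVal
  have injM : ∀ {X Y : Mat[N, n] (LocFin W)⟦X⟧},
      (PowerSeries.map (LocFin.val W)).mapMatrix X = (PowerSeries.map (LocFin.val W)).mapMatrix Y →
      X = Y := fun h => Matrix.map_injective hVinj h
  have eKq : isoProj N n χ _ * Kq = isoProj N n χ _ * Kq * isoProj N n χ _ := by
    apply injM
    rw [map_mul, map_mul, map_mul]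
    change Matrix.map _ _ * Matrix.map _ _ = Matrix.map _ _ * Matrix.map _ _ * Matrix.map _ _
    rw [hEV, hKq]
    exact lift2 eK
  have RK : liftMat (isoProj N n χ _ * Kq) *
      (sandB n m s (PowerSeries.C (uR W)) p q (-b + δ + 2 * c) (-b' + δ + 2 * c) MR).map
        (PowerSeries.map (projQ W)).mapMatrix =
      liftMat (isoProj N n χ _) *
      (sandA n m s (PowerSeries.C (uR W)) p q (b - δ) (b' - δ) MR).map
        (PowerSeries.map (projQ W)).mapMatrix * liftMat Kq := by
    refine Matrix.map_injective (f := (PowerSeries.map (LocFin.val W)).mapMatrix)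
      (Matrix.map_injective hVinj) ?_
    beta_reduce
    have hcomp : ∀ X : Mat[N, n]
        (Mat[N] (OpRing W)⟦X⟧),
        (X.map (PowerSeries.map (projQ W)).mapMatrix).map
          (PowerSeries.map (LocFin.val W)).mapMatrix =
        X.map (PowerSeries.map ((LocFin.val W).comp (projQ W))).mapMatrix := fun X => by
      refine Matrix.ext fun a b => Matrix.ext fun c d => ?_
      ext r
      simp [Matrix.map_apply]
    have hl : ∀ X : Mat[N, n] (LocFin W)⟦X⟧,
        (liftMat X : Matrix _ _ (Mat[N] _)).map
          (PowerSeries.map (LocFin.val W)).mapMatrix =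
        liftMat (X.map (PowerSeries.map (LocFin.val W))) := fun X =>
      liftMat_map (ψ := (PowerSeries.map (LocFin.val W)).toAddMonoidHom) X
    have hmul : ∀ X Y : Mat[N, n]
        (Mat[N] (LocFin W)⟦X⟧),
        (X * Y).map (PowerSeries.map (LocFin.val W)).mapMatrix =
        X.map (PowerSeries.map (LocFin.val W)).mapMatrix *
          Y.map (PowerSeries.map (LocFin.val W)).mapMatrix :=
      map_mul (PowerSeries.map (LocFin.val W)).mapMatrix.mapMatrix
    have hEK : (isoProj N n χ _ * Kq).map (PowerSeries.map (LocFin.val W)) =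
        isoProj N n χ _ * ιP.mapMatrix K := by
      rw [← hEV, ← hKq]
      exact map_mul (PowerSeries.map (LocFin.val W)).mapMatrix _ _
    rw [hmul, hmul, hmul, hcomp, hcomp, hl, hl, hl, hEK, hEV, hKq]
    exact RQ'
  -- Since `2 c = -N`, the parameters on the two sides of the relation for the product of `F` and
  -- `K` differ by `N h` and are related by crossing.
  obtain ⟨hΛ, key⟩ := exchange_combine isBiMap_psiP.seriesMap isBiMap_psiQ.seriesMap aP aQ aU χ
    RP' RK (lift2 eF) eKq
  rw [sandB_map aU zR, sandB_map aU zR, PowerSeries.map_C] at key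
  have fin := scalar_trace_comm hN hs (List.nodup_finRange n) List.mem_finRange
    (zfam_par zU hmU s 1 (-b + δ)) (zfam_par zU hmU s (-1) (-b' + δ))
    (zfam_par zU hmU s 1 (-b + δ + 2 * c)) (zfam_par zU hmU s (-1) (-b' + δ + 2 * c))
    (zfam_chain zU s h1 _) (zfam_chain zU s h2 _) (zfam_chain zU s h1 _) (zfam_chain zU s h2 _)
    (zfam_crossing zU s h1 (by linear_combination -hc))
    (zfam_crossing zU s h2 (by linear_combination -hc)) hΛ key
  -- the trace does not depend on `v`
  set z : UOp W := Matrix.trace (isoProj N n χ (UOp W) * (F.map (fun f => psiP (iotaP f)) *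
      κ.map psiQ)) with hz
  have hzC : Matrix.trace (isoProj N n χ (UOp W)⟦X⟧ *
      ((ιP.mapMatrix F).map (seriesMap psiP) * Kq.map (seriesMap psiQ))) = PowerSeries.C z := by
    have e1 : (ιP.mapMatrix F).map (seriesMap psiP) =
        (PowerSeries.C : UOp W →+* (UOp W)⟦X⟧).mapMatrix
          (F.map fun f => psiP (iotaP f)) := by
      refine Matrix.ext fun a b => ?_
      exact seriesMap_C (B := LaurentSeries (Op W)) psiP _
    have e2 : Kq.map (seriesMap psiQ) =
        (PowerSeries.C : UOp W →+* (UOp W)⟦X⟧).mapMatrix (κ.map psiQ) := by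
      refine Matrix.ext fun a b => ?_
      exact seriesMap_C psiQ _
    have e3 : isoProj N n χ (UOp W)⟦X⟧ =
        (PowerSeries.C : UOp W →+* (UOp W)⟦X⟧).mapMatrix (isoProj N n χ (UOp W)) :=
      (isoProj_ringHom_map χ fun s => (algebraMap_series s).symm).symm
    rw [e1, e2, e3, ← map_mul, ← map_mul, hz, Matrix.trace, Matrix.trace, map_sum]
    rfl
  rw [hzC] at fin
  have fin2 := congrArg (fun M : Mat[N] (UOp W)⟦X⟧ =>
    PowerSeries.coeff r (M i j)) fin
  simp only [Matrix.scalar_apply, Matrix.mul_diagonal, Matrix.diagonal_mul,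
    PowerSeries.coeff_C_mul, PowerSeries.coeff_mul_C] at fin2
  have hB : PowerSeries.coeff r ((MR.map (PowerSeries.map (projU W))) i j) =
      projU W (constR (PowerSeries.coeff r ((t * ti) i j))) := by
    rw [Matrix.map_apply, hMR, Matrix.map_apply, PowerSeries.coeff_map, PowerSeries.coeff_map]
  rw [hB] at fin2
  have fin3 := congrArg (evalU w k) fin2
  rw [evalU_mul_const, evalU_const_mul, hz, trace_apply χ F K κ (fun _ _ => rfl) w hL,
    trace_apply χ F K κ (fun _ _ => rfl) _ hL'] at fin3
  exact fin3

end OperatorCommute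

/-! ### Fused products of the generating matrices -/

section Fused

variable {N n : ℕ} {R : Type*} [Ring R] [Algebra Scal R]

/-- The family `T(ε u₀ + α ν)`, for `ε = ±1` and `α ∈ ℂ`, satisfies the relation
`(u - v - ν P) T₁(u) T₂(v) = T₂(v) T₁(u) (u - v - ν P)` at all pairs of its points. Here `u₀` and
`ν` are central, and `ν` can be cancelled. In the applications `(u₀, ν)` is `(u, h)`, or
`(1, h u⁻¹)` after division by `u`. -/
structure PointRel (u₀ ν : R) (T : ℤ → ℂ → Mat[N] R) : Prop where
  u_comm : ∀ x, Commute u₀ x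
  ν_comm : ∀ x, Commute ν x
  cancel : ∀ x, ν * x = 0 → x = 0
  rel : ∀ ε₁ ε₂ α₁ α₂, ε₁ * ε₁ = 1 → ε₂ * ε₂ = 1 →
    MRel ((ε₁ - ε₂) • u₀ + algebraMap Scal R (PowerSeries.C (α₁ - α₂)) * ν) ν
      ((ε₁ - ε₂) • u₀ + algebraMap Scal R (PowerSeries.C (α₁ - α₂)) * ν) ν (T ε₁ α₁) (T ε₂ α₂)

variable {u₀ ν : R} {T S : ℤ → ℂ → Mat[N] R}

theorem isChain_and {α : Type*} {r r' : α → α → Prop} {l : List α} (h : l.IsChain r)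
    (h' : l.IsChain r') : l.IsChain fun a b => r a b ∧ r' a b := by
  induction l with
  | nil => exact List.isChain_nil
  | cons a l ih =>
    cases l with
    | nil => exact List.isChain_singleton a
    | cons b l =>
      rw [List.isChain_cons_cons] at h h' ⊢
      exact ⟨⟨h.1, h'.1⟩, ih h.2 h'.2⟩

theorem scalar_commute {I : Type*} [Fintype I] [DecidableEq I] {z : R} (hz : ∀ x, Commute z x)
    (M : Matrix I I R) : Commute (Matrix.scalar I z) M :=
  Matrix.scalar_commute z hz M

theorem PointRel.central (h : PointRel u₀ ν T) (a : ℤ) (β : Scal) (x : R) :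
    Commute (a • u₀ + algebraMap Scal R β * ν) x :=
  (show Commute (a • u₀) x by
    rw [zsmul_eq_mul]; exact (Int.cast_commute a x).mul_left (h.u_comm x)).add_left ((show Commute _ x from Algebra.commutes β x).mul_left (h.ν_comm x))

/-- At two points which differ by `s h` the relation becomes one with `1 + s P`, since `ν` can be
cancelled. -/
theorem PointRel.fused (h : PointRel u₀ ν T) {s : ℤ} (hs : s * s = 1) {ε : ℤ} (hε : ε * ε = 1)
    {α β : ℂ} (hd : α - β = -s) {i j : Fin n} (hij : i ≠ j) :
    (1 + s • permMat (Equiv.swap i j)) * (leg i (T ε α) * leg j (T ε β)) =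
      (leg j (T ε β) * leg i (T ε α)) * (1 + s • permMat (Equiv.swap i j)) := by
  have h1 := (h.rel ε ε α β hε hε).legs hij
  have hμ : (ε - ε) • u₀ + algebraMap Scal R (PowerSeries.C (α - β)) * ν = (-s) • ν := by
    rw [sub_self, zero_smul, zero_add, hd, map_neg, map_neg, neg_mul, neg_smul]
    simp [zsmul_eq_mul]
  rw [hμ] at h1
  set Pm : Mat[N, n] R := permMat (Equiv.swap i j)
  set A := leg i (T ε α)
  set B := leg j (T ε β)
  have hc : ∀ M : Mat[N, n] R,
      Commute (Matrix.scalar _ ν) M := fun M => scalar_commute h.ν_comm M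
  have e1 : (Matrix.scalar (Fin n → Fin N) ((-s) • ν) : Matrix _ _ R) =
      (-s) • Matrix.scalar (Fin n → Fin N) ν := map_zsmul (Matrix.scalar (Fin n → Fin N)) _ _
  have e2 : (Matrix.scalar (Fin n → Fin N) ((-s) • ν) : Matrix _ _ R) -
      Matrix.scalar _ ν * Pm = (-s) • (Matrix.scalar _ ν * (1 + s • Pm)) := by
    rw [e1, mul_add, mul_one, smul_add, mul_smul_comm, smul_smul, neg_mul, hs]
    simp [sub_eq_add_neg]
  rw [← (hc Pm).eq, e2, smul_mul_assoc, mul_smul_comm] at h1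
  have h2 : Matrix.scalar _ ν * ((1 + s • Pm) * (A * B) - (B * A) * (1 + s • Pm)) = 0 := by
    have h3 := congrArg (fun M => (-s) • M) h1
    simp only [smul_smul, neg_mul_neg, hs, one_smul] at h3
    rw [mul_sub, ← mul_assoc, h3, ← mul_assoc, ← mul_assoc, (hc (B * A)).eq, sub_self]
  rw [← sub_eq_zero]
  ext a b
  refine h.cancel _ ?_
  have := congrFun (congrFun h2 a) b
  rwa [Matrix.scalar_apply, Matrix.diagonal_mul] at this

theorem PointRel.fused_inv (h : PointRel u₀ ν T)
    (hTS : ∀ ε α, T ε α * S ε α = 1) (hST : ∀ ε α, S ε α * T ε α = 1)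
    {s : ℤ} (hs : s * s = 1) {ε : ℤ} (hε : ε * ε = 1)
    {α β : ℂ} (hd : β - α = -s) {i j : Fin n} (hij : i ≠ j) :
    (1 + s • permMat (Equiv.swap i j)) * (leg i (S ε α) * leg j (S ε β)) =
      (leg j (S ε β) * leg i (S ε α)) * (1 + s • permMat (Equiv.swap i j)) := by
  have h1 := h.fused hs hε hd hij.symm
  rw [Equiv.swap_comm] at h1
  have hi1 : leg i (T ε α) * leg i (S ε α) = 1 := by rw [← map_mul, hTS, map_one]
  have hi2 : leg i (S ε α) * leg i (T ε α) = 1 := by rw [← map_mul, hST, map_one]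
  have hj1 : leg j (T ε β) * leg j (S ε β) = 1 := by rw [← map_mul, hTS, map_one]
  have hj2 : leg j (S ε β) * leg j (T ε β) = 1 := by rw [← map_mul, hST, map_one]
  set Q : Mat[N, n] R := 1 + s • permMat (Equiv.swap i j)
  set a := leg i (T ε α)
  set b := leg j (T ε β)
  set a' := leg i (S ε α)
  set b' := leg j (S ε β)
  calc Q * (a' * b') = (b' * (a' * a) * b) * Q * (a' * b') := by rw [hi2, mul_one, hj2, one_mul]
    _ = b' * a' * (a * b * Q) * (a' * b') := by noncomm_ring
    _ = b' * a' * Q * (b * (a * a') * b') := by rw [← h1]; noncomm_ring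
    _ = b' * a' * Q := by rw [hi1, mul_one, hj1, mul_one]

/-- If the points `α i` increase by `s` along the list, then the product of the `T(α i)` maps the
image of a symmetry projection to itself. -/
theorem PointRel.proj_mul_swap (h : PointRel u₀ ν T) {s : ℤ} (hs : s * s = 1) {ε : ℤ}
    (hε : ε * ε = 1) {α : Fin n → ℂ} {l : List (Fin n)} (hl : l.Nodup)
    (hc : l.IsChain fun i j => α i - α j = -s)
    {Z : Mat[N, n] R}
    (hZ : ∀ i ∈ l, ∀ j ∈ l, i ≠ j → Z * permMat (Equiv.swap i j) = s • Z) :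
    ∀ i ∈ l, ∀ j ∈ l, i ≠ j →
      Z * (l.map fun k => leg k (T ε (α k))).prod * permMat (Equiv.swap i j) =
        s • (Z * (l.map fun k => leg k (T ε (α k))).prod) := by
  refine mul_swap_of_chain hs hl ?_
  refine chain_mul_swap (fun _ _ => rfl) hs l hl ?_ Z hZ
  have hne : l.IsChain (· ≠ ·) := hl.isChain
  refine (isChain_and hne hc).imp ?_
  rintro i j ⟨hij, hd⟩
  exact h.fused hs hε hd hij

theorem PointRel.proj_mul_swap_inv (h : PointRel u₀ ν T)
    (hTS : ∀ ε α, T ε α * S ε α = 1) (hST : ∀ ε α, S ε α * T ε α = 1)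
    {s : ℤ} (hs : s * s = 1) {ε : ℤ}
    (hε : ε * ε = 1) {α : Fin n → ℂ} {l : List (Fin n)} (hl : l.Nodup)
    (hc : l.IsChain fun i j => α j - α i = -s)
    {Z : Mat[N, n] R}
    (hZ : ∀ i ∈ l, ∀ j ∈ l, i ≠ j → Z * permMat (Equiv.swap i j) = s • Z) :
    ∀ i ∈ l, ∀ j ∈ l, i ≠ j →
      Z * (l.map fun k => leg k (S ε (α k))).prod * permMat (Equiv.swap i j) =
        s • (Z * (l.map fun k => leg k (S ε (α k))).prod) := by
  refine mul_swap_of_chain hs hl ?_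
  refine chain_mul_swap (fun _ _ => rfl) hs l hl ?_ Z hZ
  have hne : l.IsChain (· ≠ ·) := hl.isChain
  refine (isChain_and hne hc).imp ?_
  rintro i j ⟨hij, hd⟩
  exact h.fused_inv hTS hST hs hε hd hij

/-- The exchange relation between an inverse matrix at one point and a matrix at another one. -/
theorem PointRel.inv_exchange (h : PointRel u₀ ν T)
    (hTS : ∀ ε α, T ε α * S ε α = 1) (hST : ∀ ε α, S ε α * T ε α = 1)
    {ε ε' : ℤ} (hε : ε * ε = 1) (hε' : ε' * ε' = 1) (α β : ℂ) {i k : Fin n} (hik : k ≠ i) :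
    let D : Mat[N, n] R :=
      Matrix.scalar _ ((ε - ε') • u₀ + algebraMap Scal R (PowerSeries.C (α - β)) * ν) -
        Matrix.scalar _ ν * permMat (Equiv.swap i k)
    leg i (S ε' β) * (D * leg k (T ε α)) = leg k (T ε α) * D * leg i (S ε' β) := by
  intro D
  have h1 := (h.rel ε ε' α β hε hε').legs hik
  rw [Equiv.swap_comm, ← (scalar_commute h.ν_comm (permMat (Equiv.swap i k))).eq] at h1
  have hi1 : leg i (T ε' β) * leg i (S ε' β) = 1 := by rw [← map_mul, hTS, map_one]
  have hi2 : leg i (S ε' β) * leg i (T ε' β) = 1 := by rw [← map_mul, hST, map_one]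
  change D * _ = _ * D at h1
  set a := leg k (T ε α)
  set b := leg i (T ε' β)
  set b' := leg i (S ε' β)
  calc b' * (D * a) = b' * (D * (a * b)) * b' := by
        rw [mul_assoc b' (D * _), mul_assoc D, mul_assoc a, hi1, mul_one]
    _ = (b' * b) * a * D * b' := by rw [h1]; noncomm_ring
    _ = a * D * b' := by rw [hi2, one_mul]

/-- If the entries of `T(α) T(c₀ - α)⁻¹` lie in a subring and the linear forms `2 ε u₀ + β ν` can
be cancelled in it, then the entries of the projection of `T₁(α₁) ⋯ T_n(α_n) (T_n(c₀ - α_n) ⋯ T₁(c₀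
- α₁))⁻¹` lie in it, for points `α_i` which increase by `s`. The reason is that the latter product
is obtained from the products `T_k(α_k) T_k(c₀ - α_k)⁻¹` and from factors `α_i + α_k - c₀ - ν
P_{ik}`, up to linear forms. -/
theorem PointRel.proj_fused_mem (h : PointRel u₀ ν T)
    (hTS : ∀ ε α, T ε α * S ε α = 1) (hST : ∀ ε α, S ε α * T ε α = 1)
    {s : ℤ} (hs : s * s = 1) {ε : ℤ} (hε : ε * ε = 1) {α : Fin n → ℂ} {c₀ : ℂ}
    (CA : Subalgebra Scal R) (hu : u₀ ∈ CA) (hν : ν ∈ CA)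
    (hdiv : ∀ (β : ℂ) (f : R),
      ((2 * ε) • u₀ + algebraMap Scal R (PowerSeries.C β) * ν) * f ∈ CA → f ∈ CA)
    (hmem : ∀ k i j, (T ε (α k) * S (-ε) (c₀ - α k)) i j ∈ CA)
    {Z : Mat[N, n] R} (hZm : ∀ a b, Z a b ∈ CA)
    (hZ : ∀ i j, i ≠ j → Z * permMat (Equiv.swap i j) = s • Z) (l : List (Fin n)) :
    l.Nodup → (l.IsChain fun i j => α i - α j = -s) →
    ∀ a b, (Z * ((l.map fun k => leg k (T ε (α k))).prod *
      (l.map fun k => leg k (S (-ε) (c₀ - α k))).prod)) a b ∈ CA := by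
  induction l using List.reverseRecOn with
  | nil => intro _ _ a b; simpa using hZm a b
  | append_singleton l k ih =>
    intro hl hc
    have hε' : -ε * -ε = 1 := by rw [neg_mul_neg, hε]
    have hkl : k ∉ l := by
      rw [List.nodup_append] at hl
      intro hk
      exact hl.2.2 k hk k (by simp) rfl
    have ih' := ih (List.nodup_append.1 hl).1 (List.isChain_append.1 hc).1
    set tp := (l.map fun k => leg k (T ε (α k))).prod with htp
    set sp := (l.map fun k => leg k (S (-ε) (c₀ - α k))).prod with hsp
    set tk := leg k (T ε (α k)) with htk
    set sk := leg k (S (-ε) (c₀ - α k)) with hsk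
    let μ : Fin n → R := fun i =>
      (ε - -ε) • u₀ + algebraMap Scal R (PowerSeries.C (α k - (c₀ - α i))) * ν
    let D : Fin n → Mat[N, n] R := fun i =>
      Matrix.scalar _ (μ i) - Matrix.scalar _ ν * permMat (Equiv.swap i k)
    have hμ : ∀ i x, Commute (μ i) x := fun i x => h.central _ _ x
    -- The new factor is moved past the inverses of the previous ones.
    have hex : sp * ((l.map D).prod * tk) = tk * (l.map D).prod * sp := by
      refine list_prod_exchange (List.nodup_append.1 hl).1 (fun i hi => ?_) ?_ ?_
      · exact h.inv_exchange hTS hST hε hε' (α k) (c₀ - α i)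
          (fun e => hkl (e ▸ hi))
      all_goals
        intro i hi j hj hij
        refine Commute.sub_right ?_ (Commute.mul_right ?_ ?_)
        · exact (scalar_commute (hμ j) _).symm
        · exact (scalar_commute h.ν_comm _).symm
        · exact (permMat_swap_comm_leg hij (fun e : i = k => hkl (e ▸ hi)) _).symm
    -- the projection turns the factors `D i` into scalars
    let q : Fin n → R := fun i =>
      (2 * ε) • u₀ + algebraMap Scal R (PowerSeries.C (α k - (c₀ - α i) - s)) * ν
    have hsw := h.proj_mul_swap hs hε hl hc (Z := Z) (fun i _ j _ => hZ i j)
    have hD : ∀ l' : List (Fin n), l' ⊆ l →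
        Z * (tp * tk) * (l'.map D).prod = Matrix.scalar _ (l'.map q).prod * (Z * (tp * tk)) := by
      intro l'
      induction l' with
      | nil => intro _; simp
      | cons i l' ih' =>
        intro hsub
        have hi : i ∈ l := hsub (by simp)
        have h1 := hsw i (by simp [hi]) k (by simp) (fun e => hkl (e ▸ hi))
        rw [List.map_append, List.prod_append, List.map_singleton, List.prod_singleton] at h1
        have h2 : Z * (tp * tk) * D i = Matrix.scalar _ (q i) * (Z * (tp * tk)) := by
          have hq : q i = μ i - s • ν := by
            simp only [q, μ]
            rw [map_sub PowerSeries.C _ (s : ℂ), map_sub, sub_mul, ← add_sub_assoc, sub_neg_eq_add,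
              ← two_mul]
            simp [zsmul_eq_mul]
          rw [mul_sub, ← mul_assoc _ (Matrix.scalar _ ν), ← (scalar_commute h.ν_comm _).eq,
            mul_assoc (Matrix.scalar _ ν), h1, hq, map_sub, sub_mul, (scalar_commute (hμ i) _).eq,
            map_zsmul, smul_mul_assoc, mul_smul_comm]
        rw [List.map_cons, List.prod_cons, ← mul_assoc, h2, mul_assoc,
          ih' (fun x hx => hsub (List.mem_cons_of_mem _ hx)), List.map_cons, List.prod_cons, map_mul,
          mul_assoc]
    have key : Z * (tp * sp) * ((l.map D).prod * (tk * sk)) =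
        Matrix.scalar _ (l.map q).prod * (Z * ((tp * tk) * (sp * sk))) := by
      calc Z * (tp * sp) * ((l.map D).prod * (tk * sk)) =
          Z * tp * (sp * ((l.map D).prod * tk)) * sk := by noncomm_ring
        _ = Z * (tp * tk) * (l.map D).prod * (sp * sk) := by rw [hex]; noncomm_ring
        _ = _ := by rw [hD l (fun _ h => h)]; noncomm_ring
    have hmul : ∀ {X Y : Mat[N, n] R}, (∀ a b, X a b ∈ CA) →
        (∀ a b, Y a b ∈ CA) → ∀ a b, (X * Y) a b ∈ CA := fun hX hY a b => by
      rw [Matrix.mul_apply]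
      exact sum_mem fun x _ => mul_mem (hX a x) (hY x b)
    have hDm : ∀ i a b, D i a b ∈ CA := by
      intro i a b
      have hμm : μ i ∈ CA := add_mem (zsmul_mem hu _) (mul_mem (Subalgebra.algebraMap_mem _ _) hν)
      have hsc : ∀ z ∈ CA, ∀ a b, Matrix.scalar (Fin n → Fin N) z a b ∈ CA := fun z hz a b => by
        rw [Matrix.scalar_apply, Matrix.diagonal_apply]
        split_ifs
        exacts [hz, zero_mem _]
      refine sub_mem (hsc _ hμm a b) (hmul (hsc _ hν) (fun a b => ?_) a b)
      rw [permMat, Matrix.of_apply]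
      split_ifs
      exacts [one_mem _, zero_mem _]
    have hDl : ∀ l' : List (Fin n), ∀ a b, (l'.map D).prod a b ∈ CA := by
      intro l'
      induction l' with
      | nil => intro a b; rw [List.map_nil, List.prod_nil, Matrix.one_apply]; split_ifs; exacts [one_mem _, zero_mem _]
      | cons i l' ih => rw [List.map_cons, List.prod_cons]; exact hmul (hDm i) ih
    have hkm : ∀ a b, (tk * sk) a b ∈ CA := by
      intro a b
      rw [htk, hsk, ← map_mul, leg_apply]
      split_ifs
      exacts [hmem k _ _, zero_mem _]
    intro a b
    have hm := hmul ih' (hmul (hDl l) hkm) a b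
    rw [key, Matrix.scalar_apply, Matrix.diagonal_mul] at hm
    rw [List.map_append, List.map_append, List.prod_append, List.prod_append]
    simp only [List.map_cons, List.map_nil, List.prod_singleton]
    have hcan : ∀ l' : List (Fin n), ∀ f, (l'.map q).prod * f ∈ CA → f ∈ CA := by
      intro l'
      induction l' with
      | nil => intro f hf; simpa using hf
      | cons i l' ih =>
        intro f hf
        rw [List.map_cons, List.prod_cons, mul_assoc] at hf
        exact ih f (hdiv _ _ hf)
    exact hcan l _ hm

end Fused

open UniformSpace (Completion)

/-! ### The double Yangian -/

section RelMap

variable {N : ℕ} {A B : Type} [Ring A] [Algebra Scal A] [Ring B] [Algebra Scal B]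

theorem mapMatrix_leg (φ : A →ₐ[Scal] B) {n : ℕ} (k : Fin n) (X : Mat[N] A) :
    φ.mapMatrix (leg k X) = leg k (φ.mapMatrix X) := leg_map (φ : A →+* B) k X

theorem mapMatrix_permMat (φ : A →ₐ[Scal] B) {n : ℕ} (σ : Equiv.Perm (Fin n)) :
    φ.mapMatrix (permMat σ : Mat[N, n] A) = permMat σ :=
  permMat_map (φ : A →+* B) σ

theorem mapMatrix_tOf (φ : A →ₐ[Scal] B) (x : Gen N → A) (r : ℕ) :
    φ.mapMatrix (tOf x r) = tOf (φ ∘ x) r := by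
  cases r with
  | zero => exact map_one φ.mapMatrix
  | succ r => ext i j; simp [tOf]

theorem mapMatrix_tpOf (φ : A →ₐ[Scal] B) (x : Gen N → A) (r : ℕ) :
    φ.mapMatrix (tpOf x r) = tpOf (φ ∘ x) r := by
  rw [tpOf, tpOf, map_sub, apply_ite φ.mapMatrix, map_one, map_zero]
  congr 1
  ext i j
  simp

theorem mapMatrix_prev_tpOf (φ : A →ₐ[Scal] B) (x : Gen N → A) (r : ℕ) :
    φ.mapMatrix (prev (tpOf x) r) = prev (tpOf (φ ∘ x)) r := by
  cases r with
  | zero => exact map_zero φ.mapMatrix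
  | succ r => exact mapMatrix_tpOf φ x r

theorem mapMatrix_rbarCoeff (φ : A →ₐ[Scal] B) (γ : ℂ) (p q : ℕ) :
    φ.mapMatrix (rbarCoeff N A γ p q) = rbarCoeff N B γ p q := by
  simp only [rbarCoeff, map_sum, map_smul, map_sub, map_one, mapMatrix_permMat]

/-- The defining relations for the images of some elements are the images of the relations. -/
theorem Rel.exists_of_comp (φ : A →ₐ[Scal] B) {x : Gen N → A} {c : ℂ} {y z : B}
    (h : Rel (φ ∘ x) c y z) : ∃ y' z', Rel x c y' z' ∧ φ y' = y ∧ φ z' = z := by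
  have key : ∀ {X Y : Matrix (Fin 2 → Fin N) (Fin 2 → Fin N) A}
      {X' Y' : Matrix (Fin 2 → Fin N) (Fin 2 → Fin N) B} {a b : Fin 2 → Fin N},
      Rel x c (X a b) (Y a b) → φ.mapMatrix X = X' → φ.mapMatrix Y = Y' →
      ∃ y' z', Rel x c y' z' ∧ φ y' = X' a b ∧ φ z' = Y' a b := by
    rintro X Y _ _ a b h rfl rfl
    exact ⟨_, _, h, rfl, rfl⟩
  cases h with
  | rtt r s a b =>
    refine key (Rel.rtt r s a b) ?_ ?_
    · simp only [rttL, map_sub, map_mul, map_smul, mapMatrix_leg, mapMatrix_permMat, mapMatrix_tOf]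
    · simp only [rttR, map_sub, map_mul, map_smul, mapMatrix_leg, mapMatrix_permMat, mapMatrix_tOf]
  | rttp r s a b =>
    refine key (Rel.rttp r s a b) ?_ ?_
    · simp only [rttpL, map_sub, map_mul, map_smul, mapMatrix_leg, mapMatrix_permMat,
        mapMatrix_tpOf, mapMatrix_prev_tpOf]
    · simp only [rttpR, map_sub, map_mul, map_smul, mapMatrix_leg, mapMatrix_permMat,
        mapMatrix_tpOf, mapMatrix_prev_tpOf]
  | rttm r s a b =>
    refine key (Rel.rttm r s a b) ?_ ?_
    · simp only [rttmL, map_sum, map_mul, mapMatrix_leg, mapMatrix_rbarCoeff, mapMatrix_tOf,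
        mapMatrix_tpOf]
    · simp only [rttmR, map_sum, map_mul, mapMatrix_leg, mapMatrix_rbarCoeff, mapMatrix_tOf,
        mapMatrix_tpOf]

theorem Sat.comp {c : ℂ} {x : Gen N → A} (h : Sat c x) (φ : A →ₐ[Scal] B) : Sat c (φ ∘ x) := by
  intro y z hr
  obtain ⟨y', z', hr', rfl, rfl⟩ := hr.exists_of_comp φ
  rw [h _ _ hr']

end RelMap

namespace DY

variable {N : ℕ} {c : ℂ}

theorem mk_surjective : Function.Surjective (mk N c) := Quotient.mk_surjective

theorem mk_eq_iff {a b : FreeAlgebra Scal (Gen N)} : mk N c a = mk N c b ↔ dyCon N c a b :=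
  RingCon.eq _

theorem eq_zero_of_smul {x : DY N c} (h : hh • x = 0) : x = 0 := by
  obtain ⟨a, rfl⟩ := mk_surjective x
  rw [← map_smul, ← map_zero (mk N c), mk_eq_iff] at h
  obtain ⟨n, hn⟩ := h
  rw [← map_zero (mk N c), mk_eq_iff]
  refine ⟨n + 1, ?_⟩
  rw [smul_zero] at hn ⊢
  rwa [pow_succ, mul_smul]

theorem sat_gen : Sat c (gen N c) := by
  intro y z h
  have h' : Rel (mk N c ∘ FreeAlgebra.ι Scal) c y z := h
  obtain ⟨y', z', hr, rfl, rfl⟩ := h'.exists_of_comp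
  rw [mk_eq_iff]
  exact ⟨0, by rw [pow_zero, one_smul, one_smul]; exact RingConGen.Rel.of _ _ hr⟩

theorem induction {p : DY N c → Prop} (hs : ∀ s : Scal, p (algebraMap Scal _ s))
    (hg : ∀ g, p (gen N c g)) (ha : ∀ x y, p x → p y → p (x + y))
    (hm : ∀ x y, p x → p y → p (x * y)) (x : DY N c) : p x := by
  obtain ⟨a, rfl⟩ := mk_surjective x
  induction a using FreeAlgebra.induction with
  | grade0 s => rw [AlgHom.commutes]; exact hs s
  | grade1 g => exact hg g
  | mul a b iha ihb => rw [map_mul]; exact hm _ _ iha ihb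
  | add a b iha ihb => rw [map_add]; exact ha _ _ iha ihb

/-- As the left ideal is saturated with respect to `h`, the factor `h` can be cancelled at the cost
of one power of `h`. -/
theorem mem_nbhd_of_smul {p m : ℕ} {x : DY N c} (h : hh • x ∈ nbhd N c p (m + 1)) :
    x ∈ nbhd N c p m := by
  rw [nbhd, Submodule.mem_sup] at h ⊢
  obtain ⟨y, ⟨n, hn⟩, z, hz, he⟩ := h
  obtain ⟨w, rfl⟩ := mem_hPow.1 hz
  refine ⟨x - hh ^ m • w, ⟨n + 1, ?_⟩, hh ^ m • w, mem_hPow.2 ⟨w, rfl⟩, sub_add_cancel _ _⟩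
  have : hh ^ (n + 1) • (x - hh ^ m • w) = hh ^ n • y := by
    rw [pow_succ, mul_smul, smul_sub hh, ← he, smul_smul, ← pow_succ', add_sub_cancel_right]
  rw [this]
  exact hn

theorem smul_mem_nbhd {p m k : ℕ} (hk : m ≤ k) (x : DY N c) : hh ^ k • x ∈ nbhd N c p m :=
  (le_sup_right : hPow N c m ≤ _) (hPow_anti hk (mem_hPow.2 ⟨x, rfl⟩))

end DY

/-! ### The generators `t_ij^{(r)}` act locally nilpotently -/

section Vanish

variable {N : ℕ} {c : ℂ}

theorem rbarCoeff_zero_zero {A : Type*} [Ring A] [Algebra Scal A] (γ : ℂ) :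
    rbarCoeff N A γ 0 0 = 1 := by
  simp [rbarCoeff, gCoeff, prev]

/-- The coefficient of `u ^ (-p) v ^ q` in the normalized `R`-matrix is divisible by `h ^ (p - q)`,
as the parameter `h / (u - v + γ h)` is homogeneous of degree `0` in `h, u, v`. -/
theorem rbarCoeff_eq_smul {A : Type*} [Ring A] [Algebra Scal A] (γ : ℂ) (p q : ℕ) :
    ∃ M, rbarCoeff N A γ p q = hh ^ (p - q) • M := by
  refine ⟨∑ k ∈ Finset.range (p + 1),
    (((Ring.choose (-(k : ℤ)) (p - k) : ℤ) : Scal) *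
      ((-1) ^ q * ((p - k).choose q : Scal) * (PowerSeries.C γ) ^ (p - k - q))) •
    (PowerSeries.C (gCoeff N k) • (1 : Matrix (Fin 2 → Fin N) (Fin 2 → Fin N) A)
      - PowerSeries.C (prev (gCoeff N) k) • permMat (Equiv.swap 0 1)), ?_⟩
  rw [rbarCoeff, Finset.smul_sum]
  refine Finset.sum_congr rfl fun k hk => ?_
  rw [← mul_smul]
  congr 1
  rw [Finset.mem_range] at hk
  rcases le_or_gt q (p - k) with hq | hq
  · have : p - q = k + (p - k - q) := by omega
    rw [this, pow_add, mul_pow]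
    ring
  · rw [Nat.choose_eq_zero_of_lt hq]
    simp

variable {I : Type*}

/-- All entries of the matrix map `y` to `[I_p] + h ^ m DY_c(gl_N)`. -/
def Van (p m : ℕ) (y : DY N c) (M : Matrix I I (DY N c)) : Prop :=
  ∀ a b, M a b * y ∈ DY.nbhd N c p m

variable {p m : ℕ} {y : DY N c}

theorem Van.sub {M M' : Matrix I I (DY N c)} (h : Van p m y M) (h' : Van p m y M') :
    Van p m y (M - M') := fun a b => by
  rw [Matrix.sub_apply, sub_mul]; exact sub_mem (h a b) (h' a b)

theorem Van.smul {M : Matrix I I (DY N c)} (h : Van p m y M) (s : Scal) :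
    Van p m y (s • M) := fun a b => by
  rw [Matrix.smul_apply, smul_mul_assoc]; exact Submodule.smul_mem _ _ (h a b)

theorem Van.sum {ι : Type*} {s : Finset ι} {M : ι → Matrix I I (DY N c)}
    (h : ∀ i ∈ s, Van p m y (M i)) : Van p m y (∑ i ∈ s, M i) := fun a b => by
  rw [Matrix.sum_apply, Finset.sum_mul]; exact sum_mem fun i hi => h i hi a b

theorem Van.mul_left [Fintype I] {M : Matrix I I (DY N c)} (h : Van p m y M) (A : Matrix I I (DY N c)) :
    Van p m y (A * M) := fun a b => by
  rw [Matrix.mul_apply, Finset.sum_mul]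
  exact sum_mem fun x _ => by rw [mul_assoc]; exact DY.mul_mem_nbhd _ (h x b)

theorem Van.pow_smul (M : Matrix I I (DY N c)) {k : ℕ} (hk : m ≤ k) :
    Van p m y (hh ^ k • M) := fun a b => by
  rw [Matrix.smul_apply, smul_mul_assoc]; exact DY.smul_mem_nbhd hk _

theorem Van.mul_permMat {M : Matrix (Fin 2 → Fin N) (Fin 2 → Fin N) (DY N c)}
    (h : Van p m y M) (σ : Equiv.Perm (Fin 2)) : Van p m y (M * permMat σ) := fun a b => by
  rw [mul_permMat_apply]; exact h _ _

theorem Van.mul_rbarCoeff {M : Matrix (Fin 2 → Fin N) (Fin 2 → Fin N) (DY N c)}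
    (h : Van p m y M) (γ : ℂ) (k l : ℕ) : Van p m y (M * rbarCoeff N _ γ k l) := by
  rw [rbarCoeff, Finset.mul_sum]
  refine Van.sum fun i _ => ?_
  rw [mul_smul_comm, mul_sub, mul_smul_comm, mul_smul_comm, mul_one]
  exact ((h.smul _).sub ((h.mul_permMat _).smul _)).smul _

/-- All `t_ij^{(r)}` with large `r` map `y` to `[I_p] + h ^ m DY_c(gl_N)`. -/
def Decays (y : DY N c) : Prop :=
  ∀ p m i j, ∃ r₀, ∀ r, r₀ ≤ r → DY.gen N c (Gen.pos i j r) * y ∈ DY.nbhd N c p m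

theorem Decays.van_leg {y : DY N c} (h : Decays y) (p m : ℕ) :
    ∃ r₀, ∀ r, r₀ ≤ r → Van p m y (leg (0 : Fin 2) (tOf (DY.gen N c) r)) := by
  choose f hf using h p m
  refine ⟨(Finset.univ.sup fun i => Finset.univ.sup fun j => f i j) + 1, fun r hr a b => ?_⟩
  obtain ⟨r, rfl⟩ : ∃ r', r = r' + 1 := ⟨r - 1, by omega⟩
  rw [leg_apply]
  split_ifs
  · have h1 : f (a 0) (b 0) ≤ r :=
      (Finset.le_sup (f := fun j => f (a 0) j) (Finset.mem_univ (b 0))).trans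
        ((Finset.le_sup (f := fun i => Finset.univ.sup fun j => f i j)
          (Finset.mem_univ (a 0))).trans (by omega))
    rw [tOf, Matrix.of_apply, smul_mul_assoc]
    exact Submodule.smul_mem _ _ (hf _ _ r h1)
  · rw [zero_mul]; exact zero_mem _

/-- Multiplication by `T(v)` preserves the decay: the relation between `T(u)` and `T(v)` expresses
the coefficient of `v ^ (-s - 1)` by that of `v ^ (-s)` and by terms in which `T(u)` acts first. -/
theorem Decays.van_tt {y : DY N c} (h : Decays y) (p m s : ℕ) :
    ∃ r₀, ∀ r, r₀ ≤ r → Van p m y (leg (0 : Fin 2) (tOf (DY.gen N c) r) *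
      leg 1 (tOf (DY.gen N c) s)) := by
  obtain ⟨r₀, h0⟩ := h.van_leg p m
  induction s with
  | zero => exact ⟨r₀, fun r hr => by rw [tOf, map_one, mul_one]; exact h0 r hr⟩
  | succ s ih =>
    obtain ⟨r₁, h1⟩ := ih
    refine ⟨max r₀ r₁, fun r hr => ?_⟩
    have hr0 : r₀ ≤ r := (le_max_left _ _).trans hr
    have hr1 : r₁ ≤ r := (le_max_right _ _).trans hr
    have e : rttL (DY.gen N c) r s = rttR (DY.gen N c) r s := by
      ext a b; exact DY.sat_gen _ _ (Rel.rtt r s a b)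
    rw [rttL, rttR, sub_sub, sub_eq_iff_eq_add] at e
    have e' : leg (0 : Fin 2) (tOf (DY.gen N c) r) * leg 1 (tOf (DY.gen N c) (s + 1)) =
        leg 0 (tOf (DY.gen N c) (r + 1)) * leg 1 (tOf (DY.gen N c) s) -
        hh • (permMat (Equiv.swap 0 1) *
          (leg 0 (tOf (DY.gen N c) r) * leg 1 (tOf (DY.gen N c) s))) -
        (leg 1 (tOf (DY.gen N c) s) * leg 0 (tOf (DY.gen N c) (r + 1)) -
        leg 1 (tOf (DY.gen N c) (s + 1)) * leg 0 (tOf (DY.gen N c) r) -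
        hh • (leg 1 (tOf (DY.gen N c) s) * leg 0 (tOf (DY.gen N c) r) *
          permMat (Equiv.swap 0 1))) := by
      rw [e, ← mul_assoc (permMat _)]; abel
    rw [e']
    refine ((h1 _ (by omega)).sub (((h1 r hr1).mul_left _).smul _)).sub
      ((((h0 _ (by omega)).mul_left _).sub ((h0 r hr0).mul_left _)).sub
        ((((h0 r hr0).mul_left _).mul_permMat _).smul _))

/-- Multiplication by `T⁺(v)` preserves the decay. The mixed relation expresses a combination of
the products of `T(u)` with the coefficient of `v ^ s` of `T⁺(v)` by those with smaller `s` and by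
terms in which `T(u)` acts first. -/
theorem Decays.van_ttp {y : DY N c} (h : Decays y) (p m s : ℕ) :
    ∃ r₀, ∀ r, r₀ ≤ r → Van p m y (leg (0 : Fin 2) (tOf (DY.gen N c) r) *
      leg 1 (tpOf (DY.gen N c) s)) := by
  obtain ⟨r₀, h0⟩ := h.van_leg p m
  induction s using Nat.strong_induction_on with
  | _ s ih =>
    have ih' : ∃ r₁, ∀ s' < s, ∀ r, r₁ ≤ r → Van p m y (leg (0 : Fin 2) (tOf (DY.gen N c) r) *
        leg 1 (tpOf (DY.gen N c) s')) := by
      choose! f hf using ih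
      refine ⟨(Finset.range s).sup f, fun s' hs' r hr => hf s' hs' r (le_trans ?_ hr)⟩
      exact Finset.le_sup (Finset.mem_range.2 hs')
    obtain ⟨r₁, h1⟩ := ih'
    -- the terms with the factor `T⁺_s`
    have key : ∀ r, r₀ + r₁ + m + s ≤ r → Van p m y (∑ k ∈ Finset.range (r + 1),
        rbarCoeff N _ (c / 2) k 0 * (leg (0 : Fin 2) (tOf (DY.gen N c) (r - k)) *
          leg 1 (tpOf (DY.gen N c) s))) := by
      intro r hr
      have e : rttmL (DY.gen N c) (c / 2) r s = rttmR (DY.gen N c) (-(c / 2)) r s := by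
        ext a b; exact DY.sat_gen _ _ (Rel.rttm r s a b)
      have hR : Van p m y (rttmR (DY.gen N c) (-(c / 2)) r s) := by
        refine Van.sum fun k hk => Van.sum fun q hq => ?_
        rw [Finset.mem_range] at hk hq
        rcases le_or_gt (m + q) k with hkq | hkq
        · obtain ⟨M, hM⟩ := rbarCoeff_eq_smul (N := N) (A := DY N c) (-(c / 2)) k q
          rw [hM, mul_smul_comm]
          exact Van.pow_smul _ (by omega)
        · exact ((h0 _ (by omega)).mul_left _).mul_rbarCoeff _ _ _
      rw [← e] at hR
      have hL : rttmL (DY.gen N c) (c / 2) r s = (∑ k ∈ Finset.range (r + 1),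
          rbarCoeff N _ (c / 2) k 0 * (leg (0 : Fin 2) (tOf (DY.gen N c) (r - k)) *
            leg 1 (tpOf (DY.gen N c) s))) +
          ∑ k ∈ Finset.range (r + 1), ∑ q ∈ Finset.range s,
            rbarCoeff N _ (c / 2) k (q + 1) * (leg (0 : Fin 2) (tOf (DY.gen N c) (r - k)) *
              leg 1 (tpOf (DY.gen N c) (s - (q + 1)))) := by
        rw [rttmL, ← Finset.sum_add_distrib]
        refine Finset.sum_congr rfl fun k _ => ?_
        rw [Finset.sum_range_succ', add_comm]
        simp only [mul_assoc, Nat.sub_zero]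
      have h2 : Van p m y (∑ k ∈ Finset.range (r + 1), ∑ q ∈ Finset.range s,
            rbarCoeff N _ (c / 2) k (q + 1) * (leg (0 : Fin 2) (tOf (DY.gen N c) (r - k)) *
              leg 1 (tpOf (DY.gen N c) (s - (q + 1))))) := by
        refine Van.sum fun k hk => Van.sum fun q hq => ?_
        rw [Finset.mem_range] at hk hq
        rcases le_or_gt (m + (q + 1)) k with hkq | hkq
        · obtain ⟨M, hM⟩ := rbarCoeff_eq_smul (N := N) (A := DY N c) (c / 2) k (q + 1)
          rw [hM, smul_mul_assoc]
          exact Van.pow_smul _ (by omega)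
        · exact (h1 _ (by omega) _ (by omega)).mul_left _
      have h3 := hR.sub h2
      rwa [hL, add_sub_cancel_right] at h3
    -- The other products with `T⁺_s` in this combination are divisible by `h`. They are removed by
    -- induction on the power of `h`, beginning with `h ^ m`, which belongs to the neighbourhood.
    have desc : ∀ j ≤ m, ∃ r₂, ∀ r, r₂ ≤ r → Van p m y (hh ^ (m - j) •
        (leg (0 : Fin 2) (tOf (DY.gen N c) r) * leg 1 (tpOf (DY.gen N c) s))) := by
      intro j
      induction j with
      | zero => exact fun _ => ⟨0, fun r _ => Van.pow_smul _ le_rfl⟩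
      | succ j ihj =>
        intro hj
        obtain ⟨r₂, h2⟩ := ihj (by omega)
        refine ⟨r₀ + r₁ + m + s + r₂, fun r hr => ?_⟩
        have h3 := (key r (by omega)).smul (hh ^ (m - (j + 1)))
        rw [Finset.sum_range_succ', rbarCoeff_zero_zero, one_mul, Nat.sub_zero, smul_add] at h3
        have h4 : Van p m y (hh ^ (m - (j + 1)) • ∑ k ∈ Finset.range r,
            rbarCoeff N _ (c / 2) (k + 1) 0 * (leg (0 : Fin 2) (tOf (DY.gen N c) (r - (k + 1))) *
              leg 1 (tpOf (DY.gen N c) s))) := by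
          rw [Finset.smul_sum]
          refine Van.sum fun k hk => ?_
          obtain ⟨M, hM⟩ := rbarCoeff_eq_smul (N := N) (A := DY N c) (c / 2) (k + 1) 0
          rw [hM, smul_mul_assoc, smul_smul, ← pow_add]
          rcases le_or_gt m (k + 1) with hk' | hk'
          · exact Van.pow_smul _ (by omega)
          · have e : m - (j + 1) + (k + 1 - 0) = k + (m - j) := by omega
            rw [e, pow_add, mul_smul, ← mul_smul_comm]
            exact ((h2 _ (by omega)).mul_left _).smul _
        have h5 := h3.sub h4
        rwa [add_sub_cancel_left] at h5
    obtain ⟨r₂, h2⟩ := desc m le_rfl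
    exact ⟨r₂, fun r hr => by simpa using h2 r hr⟩

/-- The generators are the coefficients of `T` and `T⁺` divided by `h`; this division is possible
by saturation. -/
theorem Decays.gen_mul {y : DY N c} (h : Decays y) (g : Gen N) : Decays (DY.gen N c g * y) := by
  intro p m i j
  have cancel : ∀ x : DY N c, hh • hh • x ∈ DY.nbhd N c p (m + 2) → x ∈ DY.nbhd N c p m :=
    fun x hx => DY.mem_nbhd_of_smul (DY.mem_nbhd_of_smul hx)
  cases g with
  | pos k l s =>
    obtain ⟨r₀, h0⟩ := h.van_tt p (m + 2) (s + 1)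
    refine ⟨r₀, fun r hr => cancel _ ?_⟩
    have := h0 (r + 1) (by omega) ![i, k] ![j, l]
    rw [leg_zero_mul_leg_one_apply] at this
    simpa [tOf, mul_assoc, smul_mul_assoc, mul_smul_comm] using this
  | neg k l s =>
    obtain ⟨r₀, h0⟩ := h.van_ttp p (m + 2) s
    obtain ⟨r₁, h1⟩ := h p (m + 2) i j
    refine ⟨max r₀ r₁, fun r hr => cancel _ ?_⟩
    have h2 := h0 (r + 1) (by omega) ![i, k] ![j, l]
    rw [leg_zero_mul_leg_one_apply] at h2
    have h3 := h1 r (by omega)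
    -- the constant term of `T⁺` has to be subtracted
    have e : hh • hh • (DY.gen N c (Gen.pos i j r) * (DY.gen N c (Gen.neg k l s) * y)) =
        ((if s = 0 then (1 : Mat[N] Scal) else 0) k l * hh) •
          (DY.gen N c (Gen.pos i j r) * y) -
        (tOf (DY.gen N c) (r + 1) i j * tpOf (DY.gen N c) s k l) * y := by
      have e1 : tpOf (DY.gen N c) s k l =
          algebraMap Scal _ ((if s = 0 then (1 : Mat[N] Scal) else 0) k l) -
            hh • DY.gen N c (Gen.neg k l s) := by
        rw [tpOf, Matrix.sub_apply, Matrix.of_apply]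
        congr 1
        by_cases hs : s = 0
        · simp [hs, Matrix.one_apply, apply_ite (algebraMap Scal (DY N c))]
        · simp [hs]
      rw [e1, tOf, Matrix.of_apply, mul_sub, sub_mul, ← Algebra.commutes, ← Algebra.smul_def,
        mul_smul, smul_mul_assoc, smul_mul_assoc]
      simp only [smul_mul_assoc, mul_smul_comm, mul_assoc, sub_sub_cancel]
    rw [e]
    exact sub_mem (Submodule.smul_mem _ _ h3) h2

theorem decays_one : Decays (1 : DY N c) := fun p m i j => ⟨p, fun r hr => by
  rw [mul_one]
  refine (le_sup_left : hSat _ ≤ _) ⟨0, ?_⟩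
  rw [pow_zero, one_smul]
  exact Ideal.subset_span ⟨i, j, r, by omega, rfl⟩⟩

/-- The generators `t_ij^{(r)}` act locally nilpotently: on every vector of the quotient by a
neighbourhood of zero, only finitely many of them do not vanish. -/
theorem decays (y : DY N c) : Decays y := by
  have key : ∀ x y : DY N c, Decays y → Decays (x * y) := by
    intro x
    refine DY.induction (p := fun x => ∀ y, Decays y → Decays (x * y)) ?_ ?_ ?_ ?_ x
    · intro s y hy p m i j
      obtain ⟨r₀, h⟩ := hy p m i j
      refine ⟨r₀, fun r hr => ?_⟩
      rw [← Algebra.smul_def, mul_smul_comm]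
      exact Submodule.smul_mem _ _ (h r hr)
    · exact fun g y hy => hy.gen_mul g
    · intro a b ha hb y hy p m i j
      obtain ⟨r₀, h0⟩ := ha y hy p m i j
      obtain ⟨r₁, h1⟩ := hb y hy p m i j
      refine ⟨max r₀ r₁, fun r hr => ?_⟩
      rw [add_mul, mul_add]
      exact add_mem (h0 r (by omega)) (h1 r (by omega))
    · intro a b ha hb y hy
      rw [mul_assoc]
      exact ha _ (hb y hy)
  have := key y 1 decays_one
  rwa [mul_one] at this

end Vanish

open UniformSpace (Completion)

/-! ### Discrete quotients of the double Yangian -/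

section Quot

variable {N : ℕ} {c : ℂ}

/-- The action of the double Yangian on its quotient by a left ideal. -/
def actOn (J : Submodule Scal (DY N c)) (hJ : ∀ a x, x ∈ J → a * x ∈ J) :
    DY N c →ₐ[Scal] Op (DY N c ⧸ J) where
  toFun a := J.mapQ J (LinearMap.mulLeft Scal a) fun x hx => hJ a x hx
  map_one' := by
    refine Submodule.linearMap_qext _ (LinearMap.ext fun x => ?_)
    simp
  map_mul' a b := by
    refine Submodule.linearMap_qext _ (LinearMap.ext fun x => ?_)
    exact congrArg J.mkQ (mul_assoc a b x)
  map_zero' := by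
    refine Submodule.linearMap_qext _ (LinearMap.ext fun x => ?_)
    simp
  map_add' a b := by
    refine Submodule.linearMap_qext _ (LinearMap.ext fun x => ?_)
    exact congrArg J.mkQ (add_mul a b x)
  commutes' s := by
    refine Submodule.linearMap_qext _ (LinearMap.ext fun x => ?_)
    exact congrArg J.mkQ (Algebra.smul_def s x).symm

theorem actOn_mk {J : Submodule Scal (DY N c)} (hJ : ∀ a x, x ∈ J → a * x ∈ J) (a x : DY N c) :
    actOn J hJ a (J.mkQ x) = J.mkQ (a * x) := rfl

variable {J : Submodule Scal (DY N c)} {m : ℕ}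

theorem actOn_hh_pow (hJ : ∀ a x, x ∈ J → a * x ∈ J) (hm : DY.hPow N c m ≤ J) :
    algebraMap Scal (Op (DY N c ⧸ J)) hh ^ m = 0 := by
  rw [← map_pow]
  refine Submodule.linearMap_qext _ (LinearMap.ext fun x => ?_)
  change hh ^ m • J.mkQ x = 0
  rw [← map_smul]
  exact (Submodule.Quotient.mk_eq_zero J).2 (hm (DY.mem_hPow.2 ⟨x, rfl⟩))

theorem actOn_eq_zero (hJ : ∀ a x, x ∈ J → a * x ∈ J) (hm : DY.hPow N c m ≤ J) {a : DY N c}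
    (ha : a ∈ DY.hPow N c m) : actOn J hJ a = 0 := by
  refine Submodule.linearMap_qext _ (LinearMap.ext fun x => ?_)
  exact (Submodule.Quotient.mk_eq_zero J).2 (hm (DY.hPow_mul_mem x ha))

theorem isOpen_hPow (m : ℕ) : {x : HDY N c | x ∈ DY.hPow N c m} ∈ nhds 0 :=
  (DY.hBasis N c).hasBasis_nhds_zero.mem_iff.2 ⟨m, trivial, fun _ h => h⟩

theorem continuous_of_hPow {G : Type*} [Ring G] [TopologicalSpace G] [DiscreteTopology G]
    (f : HDY N c →+* G) (h : ∀ a ∈ DY.hPow N c m, f a = 0) : Continuous f := by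
  have : ContinuousAdd G := ⟨continuous_of_discreteTopology⟩
  have : IsTopologicalAddGroup G := { continuous_neg := continuous_of_discreteTopology }
  refine continuous_of_continuousAt_zero f ?_
  rw [ContinuousAt, map_zero, nhds_discrete G, Filter.tendsto_pure]
  exact Filter.mem_of_superset (isOpen_hPow m) fun a ha => h a ha

/-- The action of the double Yangian on its quotient by a left ideal, as a map on the double Yangian
with its `h`-adic topology. -/
def actOnHom (J : Submodule Scal (DY N c)) (hJ : ∀ a x, x ∈ J → a * x ∈ J) :
    HDY N c →+* Op (DY N c ⧸ J) := (actOn J hJ : DY N c →+* Op (DY N c ⧸ J))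

/-- The action of the `h`-adic completion on a quotient which is annihilated by a power of `h`. -/
def hatAct (J : Submodule Scal (DY N c)) (hJ : ∀ a x, x ∈ J → a * x ∈ J)
    (hm : DY.hPow N c m ≤ J) : HatDY N c →+* Op (DY N c ⧸ J) :=
  letI : UniformSpace (Op (DY N c ⧸ J)) := ⊥
  haveI : DiscreteUniformity (Op (DY N c ⧸ J)) := ⟨rfl⟩
  haveI : IsTopologicalRing (Op (DY N c ⧸ J)) :=
    { continuous_add := continuous_of_discreteTopology
      continuous_mul := continuous_of_discreteTopology
      continuous_neg := continuous_of_discreteTopology }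
  haveI : IsUniformAddGroup (Op (DY N c ⧸ J)) :=
    ⟨DiscreteUniformity.uniformContinuous _ _⟩
  Completion.extensionHom (α := HDY N c) (actOnHom J hJ)
    (continuous_of_hPow (m := m) (actOnHom J hJ) fun _ ha => actOn_eq_zero hJ hm ha)

theorem hatAct_toHat (hJ : ∀ a x, x ∈ J → a * x ∈ J) (hm : DY.hPow N c m ≤ J) (a : DY N c) :
    hatAct J hJ hm (toHat N c a) = actOn J hJ a := by
  let : UniformSpace (Op (DY N c ⧸ J)) := ⊥
  have : DiscreteUniformity (Op (DY N c ⧸ J)) := ⟨rfl⟩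
  have : IsTopologicalRing (Op (DY N c ⧸ J)) :=
    { continuous_add := continuous_of_discreteTopology
      continuous_mul := continuous_of_discreteTopology
      continuous_neg := continuous_of_discreteTopology }
  have : IsUniformAddGroup (Op (DY N c ⧸ J)) :=
    ⟨DiscreteUniformity.uniformContinuous _ _⟩
  exact Completion.extensionHom_coe (α := HDY N c) (actOnHom J hJ)
    (continuous_of_hPow (m := m) (actOnHom J hJ) fun _ ha => actOn_eq_zero hJ hm ha) a

theorem isClopen_hatAct (hJ : ∀ a x, x ∈ J → a * x ∈ J) (hm : DY.hPow N c m ≤ J)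
    (S : Set (Op (DY N c ⧸ J))) : IsClopen {x | hatAct J hJ hm x ∈ S} := by
  let : UniformSpace (Op (DY N c ⧸ J)) := ⊥
  have : DiscreteUniformity (Op (DY N c ⧸ J)) := ⟨rfl⟩
  have hc : Continuous (hatAct J hJ hm) := Completion.continuous_extension
  exact (isClopen_discrete S).preimage hc

theorem hatAct_algebraMap (hJ : ∀ a x, x ∈ J → a * x ∈ J) (hm : DY.hPow N c m ≤ J) (s : Scal) :
    hatAct J hJ hm (algebraMap Scal _ s) = algebraMap Scal _ s := by
  rw [← (toHat N c).commutes s, hatAct_toHat, AlgHom.commutes]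

theorem hatAct_smul (hJ : ∀ a x, x ∈ J → a * x ∈ J) (hm : DY.hPow N c m ≤ J) (s : Scal)
    (x : HatDY N c) : hatAct J hJ hm (s • x) = s • hatAct J hJ hm x := by
  rw [Algebra.smul_def, map_mul, hatAct_algebraMap, ← Algebra.smul_def]

theorem hatAct_pow_smul (hJ : ∀ a x, x ∈ J → a * x ∈ J) (hm : DY.hPow N c m ≤ J)
    {k : ℕ} (hk : m ≤ k) (x : HatDY N c) : hatAct J hJ hm (hh ^ k • x) = 0 := by
  rw [hatAct_smul, Algebra.smul_def, map_pow, ← Nat.add_sub_cancel' hk, pow_add,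
    actOn_hh_pow hJ hm, zero_mul, zero_mul]

theorem hatAct_tsum (hJ : ∀ a x, x ∈ J → a * x ∈ J) (hm : DY.hPow N c m ≤ J)
    (f : ℕ → HatDY N c) :
    hatAct J hJ hm (∑' s, hh ^ s • f s) =
      ∑ s ∈ Finset.range m, hatAct J hJ hm (hh ^ s • f s) := by
  rw [← (summable_hpow_smul f).sum_add_tsum_nat_add m, map_add, map_sum]
  have e : ∑' s, hh ^ (s + m) • f (s + m) = hh ^ m • ∑' s, hh ^ s • f (s + m) := by
    rw [← (summable_hpow_smul fun s => f (s + m)).tsum_const_smul]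
    refine tsum_congr fun s => ?_
    rw [smul_smul, add_comm, pow_add]
  rw [e, hatAct_pow_smul hJ hm le_rfl, add_zero]

end Quot

/-! ### The `h`-adic completion -/

section Hat

variable {N : ℕ} {c : ℂ}

/-- The reduction of the `h`-adic completion modulo `h ^ m`. -/
def hatMod (N : ℕ) (c : ℂ) (m : ℕ) : HatDY N c →+* Op (DY N c ⧸ DY.hPow N c m) :=
  hatAct (DY.hPow N c m) (fun a _ h => DY.mul_mem_hPow a h) le_rfl

theorem hatMod_toHat_eq_zero {m : ℕ} {a : DY N c} :
    hatMod N c m (toHat N c a) = 0 ↔ a ∈ DY.hPow N c m := by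
  rw [hatMod, hatAct_toHat]
  refine ⟨fun h => ?_, fun h => actOn_eq_zero _ le_rfl h⟩
  have h1 := LinearMap.congr_fun h (Submodule.mkQ _ 1)
  rw [actOn_mk, mul_one] at h1
  exact (Submodule.Quotient.mk_eq_zero _).1 h1

/-- The `h`-adic completion is separated. -/
theorem eq_zero_of_hatMod {x : HatDY N c} (h : ∀ m, hatMod N c m x = 0) : x = 0 := by
  by_contra hx
  obtain ⟨V, ⟨hV, hVc⟩, hVU⟩ := (closed_nhds_basis (0 : HatDY N c)).mem_iff.1
    (isOpen_compl_singleton.mem_nhds (Ne.symm hx) : ({x}ᶜ : Set (HatDY N c)) ∈ nhds 0)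
  have h0 : (fun x : HDY N c => (x : HatDY N c)) ⁻¹' V ∈ nhds (0 : HDY N c) :=
    (Completion.continuous_coe _).continuousAt.preimage_mem_nhds (by
      rw [Completion.coe_zero]; exact hV)
  obtain ⟨m, -, hm⟩ := (DY.hBasis N c).hasBasis_nhds_zero.mem_iff.1 h0
  have key : hatMod N c m x = 0 → x ∈ V := by
    refine Completion.induction_on (p := fun x => hatMod N c m x = 0 → x ∈ V) x ?_ fun a ha => ?_
    · have e : {x : HatDY N c | hatMod N c m x = 0 → x ∈ V} =
          {x | hatMod N c m x ∈ ({0}ᶜ : Set _)} ∪ V := by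
        ext x
        simp only [Set.mem_ofPred_eq, Set.mem_union, Set.mem_compl_iff, Set.mem_singleton_iff]
        tauto
      rw [e]
      exact (isClopen_hatAct _ le_rfl _).isClosed.union hVc
    · exact hm (hatMod_toHat_eq_zero.1 ha)
  exact hVU (key (h m)) rfl

theorem hat_ext {x y : HatDY N c} (h : ∀ m, hatMod N c m x = hatMod N c m y) : x = y :=
  sub_eq_zero.1 (eq_zero_of_hatMod fun m => by rw [map_sub, h, sub_self])

theorem exists_hatMod_eq (x : HatDY N c) (m : ℕ) :
    ∃ a, hatMod N c m x = hatMod N c m (toHat N c a) := by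
  refine Completion.induction_on
    (p := fun x => ∃ a, hatMod N c m x = hatMod N c m (toHat N c a)) x ?_ fun a => ⟨a, rfl⟩
  have := (isClopen_hatAct (N := N) (c := c) (fun a x h => DY.mul_mem_hPow a h) (le_refl (DY.hPow N c m))
    (Set.range fun a => hatMod N c m (toHat N c a))).isClosed
  convert this using 1
  ext x
  simp only [Set.mem_ofPred_eq, Set.mem_range]
  exact exists_congr fun a => eq_comm

/-- An element of the `h`-adic completion is congruent modulo `h ^ m` to an element of the double
Yangian. -/
theorem exists_eq_toHat_add (x : HatDY N c) (m : ℕ) : ∃ a y, x = toHat N c a + hh ^ m • y := by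
  -- Approximations `a k` of `x` modulo `h ^ k` differ by multiples of `h ^ k`, and `y` is the sum
  -- of the quotients.
  choose a ha using exists_hatMod_eq x
  have hlow : ∀ k l, k ≤ l → ∀ z : DY N c, z ∈ DY.hPow N c l → hatMod N c k (toHat N c z) = 0 :=
    fun k l hkl z hz => hatMod_toHat_eq_zero.2 (DY.hPow_anti hkl hz)
  have hmono : ∀ k l, k ≤ l → hatMod N c k x = hatMod N c k (toHat N c (a l)) := by
    intro k l hkl
    have h1 : hatMod N c l (x - toHat N c (a l)) = 0 := by rw [map_sub, ha l, sub_self]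
    have h2 : ∀ z : HatDY N c, hatMod N c l z = 0 → hatMod N c k z = 0 := by
      intro z
      refine Completion.induction_on (p := fun z => hatMod N c l z = 0 → hatMod N c k z = 0) z ?_
        fun b hb => hlow k l hkl b (hatMod_toHat_eq_zero.1 hb)
      have e : {z : HatDY N c | hatMod N c l z = 0 → hatMod N c k z = 0} =
          {z | hatMod N c l z ∈ ({0}ᶜ : Set _)} ∪ {z | hatMod N c k z ∈ ({0} : Set _)} := by
        ext z
        simp only [Set.mem_ofPred_eq, Set.mem_union, Set.mem_compl_iff, Set.mem_singleton_iff]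
        tauto
      rw [e]
      exact (isClopen_hatAct _ le_rfl _).isClosed.union (isClopen_hatAct _ le_rfl _).isClosed
    have h3 := h2 _ h1
    rwa [map_sub, sub_eq_zero] at h3
  have hstep : ∀ j, ∃ d, a (m + j + 1) - a (m + j) = hh ^ (m + j) • d := by
    intro j
    have : a (m + j + 1) - a (m + j) ∈ DY.hPow N c (m + j) := by
      rw [← hatMod_toHat_eq_zero, map_sub, map_sub, ← ha, ← hmono _ _ (Nat.le_succ _), sub_self]
    obtain ⟨d, hd⟩ := DY.mem_hPow.1 this
    exact ⟨d, hd.symm⟩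
  choose d hd using hstep
  refine ⟨a m, ∑' j, hh ^ j • toHat N c (d j), hat_ext fun k => ?_⟩
  have htel : ∀ k, toHat N c (a (m + k)) =
      toHat N c (a m) + hh ^ m • ∑ j ∈ Finset.range k, hh ^ j • toHat N c (d j) := by
    intro k
    induction k with
    | zero => simp
    | succ k ih =>
      rw [Finset.sum_range_succ, smul_add, ← add_assoc (toHat N c (a m)), ← ih, smul_smul, ← pow_add,
        ← map_smul, ← hd, ← map_add, add_sub_cancel, add_assoc]
  rw [map_add, hatMod, hatAct_smul, hatAct_tsum]
  rw [← map_sum, ← hatAct_smul, ← map_add]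
  rw [← htel]
  exact hmono k _ (Nat.le_add_left _ _)

/-- The `h`-adic completion has no `h`-torsion. -/
theorem hat_eq_zero_of_smul {x : HatDY N c} (h : hh • x = 0) : x = 0 := by
  refine eq_zero_of_hatMod fun m => ?_
  obtain ⟨a, y, rfl⟩ := exists_eq_toHat_add x (m + 1)
  have h1 : hatMod N c (m + 1) (toHat N c (hh • a)) = 0 := by
    have h2 := congrArg (hatMod N c (m + 1)) h
    rw [smul_add, smul_smul, ← pow_succ', map_add, map_zero, hatMod,
      hatAct_pow_smul _ _ (Nat.le_succ _), add_zero] at h2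
    rw [map_smul]
    exact h2
  obtain ⟨b, hb⟩ := DY.mem_hPow.1 (hatMod_toHat_eq_zero.1 h1)
  have h3 : a = hh ^ m • b := by
    have : hh • (hh ^ m • b - a) = 0 := by rw [smul_sub, smul_smul, ← pow_succ', hb, sub_self]
    exact (sub_eq_zero.1 (DY.eq_zero_of_smul this)).symm
  rw [h3, map_add, map_smul, hatMod, hatAct_pow_smul _ _ le_rfl,
    hatAct_pow_smul _ _ (Nat.le_succ _), add_zero]

/-- The kernel of the reduction modulo `h ^ m` is generated by `h ^ m`. -/
theorem hatMod_eq_zero_iff {x : HatDY N c} {m : ℕ} :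
    hatMod N c m x = 0 ↔ ∃ y, x = hh ^ m • y := by
  refine ⟨fun h => ?_, ?_⟩
  · obtain ⟨a, y, rfl⟩ := exists_eq_toHat_add x m
    rw [map_add, hatMod, hatAct_pow_smul _ _ le_rfl, add_zero] at h
    obtain ⟨b, rfl⟩ := DY.mem_hPow.1 (hatMod_toHat_eq_zero.1 h)
    exact ⟨toHat N c b + y, by rw [map_smul, smul_add]⟩
  · rintro ⟨y, rfl⟩
    exact hatAct_pow_smul _ _ le_rfl _

end Hat

open PowerSeries

/-! ### Relations at the points of the universal series -/

section EvalTwo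

variable {N : ℕ} {D : Type} [Ring D]

/-- A relation between two commuting series in two variables may be evaluated at two points. -/
theorem mrel_evalTwo {μ ν μ' ν' : D⟦X⟧⟦X⟧}
    {Y Z : Mat[N] D⟦X⟧}
    (r : MRel μ ν μ' ν' (Y.map PowerSeries.C) (Z.map (map PowerSeries.C)))
    {φ ψ : D⟦X⟧ →+* D⟦X⟧} (h : TopNil (ψ X))
    (hφ : ∀ d, φ (PowerSeries.C d) = PowerSeries.C d)
    (hψ : ∀ d, ψ (PowerSeries.C d) = PowerSeries.C d) :
    MRel (evalHom φ h μ) (evalHom φ h ν) (evalHom φ h μ') (evalHom φ h ν') (Y.map φ) (Z.map ψ) := by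
  have e : (evalHom φ h).comp (map PowerSeries.C) = ψ := by
    refine ringHom_ext_of_topNil ?_ (fun d => ?_) ?_
    · rw [RingHom.comp_apply, map_X, evalHom_X]; exact h
    · rw [RingHom.comp_apply, map_C, evalHom_C, hφ, hψ]
    · rw [RingHom.comp_apply, map_X, evalHom_X]
  have h1 := r.map (evalHom φ h)
  rw [Matrix.map_map, Matrix.map_map] at h1
  convert h1 using 1
  · ext i j : 2
    simp [evalHom_C]
  · exact Matrix.ext fun i j => (RingHom.congr_fun e (Z i j)).symm

variable [Algebra Scal D] {m : ℕ} {x : Gen N → D} {c : ℂ}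

/-- The relation between the matrices `T⁺` at two points of the same variable `u`. -/
theorem tpAt_rel (hm : algebraMap Scal D hh ^ m = 0) (hx : Sat c x) (ε₁ ε₂ : ℤ) (α₁ α₂ : ℂ) :
    MRel ((ε₁ - ε₂) • (X : D⟦X⟧) +
        algebraMap Scal _ (PowerSeries.C (α₁ - α₂)) * algebraMap Scal _ hh) (algebraMap Scal _ hh)
      ((ε₁ - ε₂) • (X : D⟦X⟧) +
        algebraMap Scal _ (PowerSeries.C (α₁ - α₂)) * algebraMap Scal _ hh) (algebraMap Scal _ hh)
      (tpAt hm x ε₁ α₁) (tpAt hm x ε₂ α₂) := by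
  have hσ : TopNil (affHom ε₂ (kap D α₂) (kap_comm α₂) (kap_pow hm α₂) X) := by
    rw [affHom_X]; exact topNil_affX ε₂ (kap_comm α₂) (kap_pow hm α₂)
  have h := mrel_evalTwo (tpMat_rel hx) (φ := affHom ε₁ (kap D α₁) (kap_comm α₁) (kap_pow hm α₁)) hσ
    (affHom_C _ _ _ _) (affHom_C _ _ _ _)
  have e1 : evalHom (affHom ε₁ (kap D α₁) (kap_comm α₁) (kap_pow hm α₁)) hσ
      (PowerSeries.C X - X) = (ε₁ - ε₂) • (X : D⟦X⟧) +
        algebraMap Scal _ (PowerSeries.C (α₁ - α₂)) * algebraMap Scal _ hh := by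
    rw [map_sub, evalHom_C, evalHom_X, affHom_X, affHom_X, ← map_mul, algebraMap_series,
      map_sub PowerSeries.C α₁, sub_mul, map_sub, map_sub, sub_smul]
    simp only [kap]
    abel
  have e2 : evalHom (affHom ε₁ (kap D α₁) (kap_comm α₁) (kap_pow hm α₁)) hσ
      (algebraMap Scal _ hh) = algebraMap Scal _ hh := by
    rw [algebraMap_series, evalHom_C, algebraMap_series, affHom_C]
  rw [e1, e2] at h
  exact h

theorem moebHom_X_cancel (ε : ℤ) (hε : ε * ε = 1) (α : ℂ) {f : D⟦X⟧}
    (h : moebHom ε (kap D α) (kap_comm α) X * f = 0) : f = 0 := by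
  have hc : Commute (moebHom ε (kap D α) (kap_comm α) X)
      (1 + PowerSeries.C (ε • kap D α) * X) := by
    refine Commute.add_right (Commute.one_right _) (Commute.mul_right ?_ (commute_X _))
    refine (commute_of_coeff (fun a y => ?_) _).symm
    rw [coeff_C]
    split_ifs
    · exact (show Commute (ε • kap D α) y by
        rw [zsmul_eq_mul]; exact (Int.cast_commute ε y).mul_left (kap_comm α y))
    · exact Commute.zero_left _
  have h1 : (ε • X : D⟦X⟧) * f = 0 := by
    rw [← moebHom_X ε (kap D α) (kap_comm α), hc.eq, mul_assoc, h, mul_zero]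
  have h2 : X * f = 0 := by
    have := congrArg (fun g => ε • g) h1
    rwa [smul_mul_assoc, smul_zero, smul_smul, hε, one_smul] at this
  ext r
  have := congrArg (coeff (r + 1)) h2
  rwa [coeff_succ_X_mul, map_zero] at this

/-- The relation between the matrices `T` at two points of the same variable `u`, divided by `u`.
-/
theorem tAt_rel (hx : Sat c x) {ε₁ ε₂ : ℤ} (h₁ : ε₁ * ε₁ = 1) (h₂ : ε₂ * ε₂ = 1) (α₁ α₂ : ℂ) :
    MRel ((ε₁ - ε₂) • (1 : D⟦X⟧) +
        algebraMap Scal _ (PowerSeries.C (α₁ - α₂)) * (algebraMap Scal _ hh * X))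
      (algebraMap Scal _ hh * X)
      ((ε₁ - ε₂) • (1 : D⟦X⟧) +
        algebraMap Scal _ (PowerSeries.C (α₁ - α₂)) * (algebraMap Scal _ hh * X))
      (algebraMap Scal _ hh * X) (tAt x ε₁ α₁) (tAt x ε₂ α₂) := by
  set φ₁ := moebHom ε₁ (kap D α₁) (kap_comm α₁) with hφ₁
  set φ₂ := moebHom ε₂ (kap D α₂) (kap_comm α₂) with hφ₂
  have hnil : ∀ (ε : ℤ) (α : ℂ), TopNil (moebHom ε (kap D α) (kap_comm α) X) := fun ε α => by
    rw [moebHom, evalHom_X]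
    exact topNil_moebPow ε (kap_comm α)
  have h := mrel_evalTwo (tMat_rel hx) (φ := φ₁) (hnil ε₂ α₂) (moebHom_C _ _ _) (moebHom_C _ _ _)
  have e1 : evalHom φ₁ (hnil ε₂ α₂) (X - PowerSeries.C X) = φ₂ X - φ₁ X := by
    rw [map_sub, evalHom_C, evalHom_X]
  have e2 : evalHom φ₁ (hnil ε₂ α₂) (hh • (PowerSeries.C X * X)) =
      algebraMap Scal _ hh * (φ₁ X * φ₂ X) := by
    rw [Algebra.smul_def, map_mul, map_mul, evalHom_C, evalHom_X, algebraMap_series, evalHom_C,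
      algebraMap_series, hφ₁, moebHom_C]
  rw [e1, e2] at h
  replace h : MRel (φ₂ X - φ₁ X) (algebraMap Scal _ hh * (φ₁ X * φ₂ X)) (φ₂ X - φ₁ X)
    (algebraMap Scal _ hh * (φ₁ X * φ₂ X)) (tAt x ε₁ α₁) (tAt x ε₂ α₂) := h
  have hc₁ : ∀ f, Commute (φ₁ X) f := (hnil ε₁ α₁).comm
  have hc₂ : ∀ f, Commute (φ₂ X) f := (hnil ε₂ α₂).comm
  set ν : D⟦X⟧ := algebraMap Scal _ hh * X with hν
  have hνc : ∀ f, Commute ν f := fun f =>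
    (show Commute _ f from Algebra.commutes hh f).mul_left (commute_X f).symm
  set μ : D⟦X⟧ := (ε₁ - ε₂) • (1 : D⟦X⟧) +
    algebraMap Scal _ (PowerSeries.C (α₁ - α₂)) * ν with hμ
  have hμc : ∀ f, Commute μ f := fun f => by
    refine Commute.add_left ?_ ((show Commute _ f from Algebra.commutes _ f).mul_left (hνc f))
    rw [zsmul_eq_mul, mul_one]
    exact Int.cast_commute _ f
  -- `x (ε + α h X) = X` for the point `x = X / (ε + α h X)`
  have hpt : ∀ (ε : ℤ) (α : ℂ), ε * ε = 1 → moebHom ε (kap D α) (kap_comm α) X *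
      (ε • 1 + algebraMap Scal _ (PowerSeries.C α) * ν) = X := by
    intro ε α hε
    have h0 := congrArg (fun g => ε • g) (moebHom_X ε (kap D α) (kap_comm α))
    simp only [smul_smul, hε, one_smul] at h0
    have h1 : algebraMap Scal D⟦X⟧ (PowerSeries.C α) * ν =
        PowerSeries.C (kap D α) * X := by
      rw [hν, ← mul_assoc, ← map_mul, algebraMap_series, kap]
    rwa [← mul_smul_comm, smul_add, map_zsmul, smul_mul_assoc, smul_smul, hε, one_smul, ← h1] at h0
  have hd : (φ₁ X * φ₂ X) * μ = X * (φ₂ X - φ₁ X) := by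
    have p1 := hpt ε₁ α₁ h₁
    have p2 := hpt ε₂ α₂ h₂
    rw [← hφ₁] at p1
    rw [← hφ₂] at p2
    have hμ' : μ = (ε₁ • 1 + algebraMap Scal _ (PowerSeries.C α₁) * ν) -
        (ε₂ • 1 + algebraMap Scal _ (PowerSeries.C α₂) * ν) := by
      rw [hμ, map_sub, map_sub, sub_mul, sub_smul]
      abel
    rw [hμ', mul_sub, mul_assoc, mul_assoc, (hc₂ (ε₁ • 1 + _)).eq, ← mul_assoc, p1, p2, mul_sub,
      ((hc₁ X).eq)]
  have hνe : (φ₁ X * φ₂ X) * ν = X * (algebraMap Scal _ hh * (φ₁ X * φ₂ X)) := by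
    rw [(hνc _).symm.eq, hν, ← mul_assoc X, ((commute_X (algebraMap Scal _ hh)).eq)]
  intro a b d e
  have h3 := h a b d e
  have hμr : ∀ f, f * μ = μ * f := fun f => (hμc f).symm.eq
  have hνr : ∀ f, f * ν = ν * f := fun f => (hνc f).symm.eq
  have hmr : ∀ f, f * (φ₂ X - φ₁ X) = (φ₂ X - φ₁ X) * f := fun f =>
    ((hc₂ f).sub_left (hc₁ f)).symm.eq
  have hnr : ∀ f, f * (algebraMap Scal _ hh * (φ₁ X * φ₂ X)) =
      (algebraMap Scal _ hh * (φ₁ X * φ₂ X)) * f := fun f =>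
    ((show Commute _ f from Algebra.commutes hh f).mul_left ((hc₁ f).mul_left (hc₂ f))).symm.eq
  rw [hmr, hnr] at h3
  rw [hμr, hνr, ← sub_eq_zero]
  refine moebHom_X_cancel ε₂ h₂ α₂ (moebHom_X_cancel ε₁ h₁ α₁ ?_)
  rw [← hφ₁, ← hφ₂, ← mul_assoc, mul_sub, mul_sub, mul_sub, ← mul_assoc _ μ, ← mul_assoc _ μ,
    ← mul_assoc _ ν, ← mul_assoc _ ν, hd, hνe, mul_assoc X, mul_assoc X, mul_assoc X, mul_assoc X,
    ← mul_sub X, ← mul_sub X, ← mul_sub X]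
  rw [sub_eq_zero.2 h3, mul_zero]

end EvalTwo

open PowerSeries

/-! ### The generating matrices as matrices of series -/

section MatSer

variable {I : Type*} [Fintype I] [DecidableEq I] {A B : Type*} [Ring A] [Ring B]

/-- A series of matrices, viewed as a matrix of series. -/
def matSer : PowerSeries (Matrix I I A) →+* Matrix I I A⟦X⟧ where
  toFun F := Matrix.of fun i j => mk fun a => coeff a F i j
  map_one' := by
    ext i j a
    rw [Matrix.of_apply, coeff_mk, coeff_one, Matrix.one_apply, apply_ite (coeff a), coeff_one,
      map_zero]
    by_cases ha : a = 0
    · simp [ha, Matrix.one_apply]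
    · simp [ha]
  map_zero' := by ext i j a; simp
  map_add' F G := by ext i j a; simp
  map_mul' F G := by
    ext i j a
    rw [Matrix.of_apply, coeff_mk, coeff_mul, Matrix.sum_apply, Matrix.mul_apply, map_sum]
    simp only [Matrix.of_apply, coeff_mul, coeff_mk, Matrix.mul_apply]
    rw [Finset.sum_comm]

theorem coeff_matSer (F : PowerSeries (Matrix I I A)) (i j : I) (a : ℕ) :
    coeff a (matSer F i j) = coeff a F i j := by
  exact coeff_mk a fun a => coeff a F i j

theorem matSer_map_leg {N n : ℕ} (k : Fin n) (F : PowerSeries (Mat[N] A)) :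
    matSer (PowerSeries.map (leg k) F) = leg k (matSer F) := by
  ext a b r
  rw [coeff_matSer, coeff_map, leg_apply, leg_apply]
  split_ifs
  · rw [coeff_matSer]
  · rw [map_zero]

end MatSer

section GenMat

variable (N : ℕ) (c : ℂ)

/-- The matrix `T⁺(ε u + α h)` over the series with coefficients in the `h`-adic completion. -/
def hatT (ε : ℤ) (α : ℂ) : Mat[N] (HatDY N c)⟦X⟧ :=
  matSer (tpSeries N c ε α)

/-- The inverse of the matrix `T⁺(ε u + α h)`. -/
def hatS (ε : ℤ) (α : ℂ) : Mat[N] (HatDY N c)⟦X⟧ :=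
  matSer (Ring.inverse (tpSeries N c ε α))

/-- The matrix `T(ε u + α h)` over the series in `u⁻¹` with coefficients in the double Yangian. -/
def dyT (ε : ℤ) (α : ℂ) : Mat[N] (DY N c)⟦X⟧ :=
  matSer (tSeries N c ε α)

/-- The inverse of the matrix `T(ε u + α h)`. -/
def dyS (ε : ℤ) (α : ℂ) : Mat[N] (DY N c)⟦X⟧ :=
  matSer (Ring.inverse (tSeries N c ε α))

variable {N c}

theorem hatT_mul_hatS (ε : ℤ) (α : ℂ) : hatT N c ε α * hatS N c ε α = 1 := by
  rw [hatT, hatS, ← map_mul, Ring.mul_inverse_cancel _ (isUnit_tpSeries ε α), map_one]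

theorem hatS_mul_hatT (ε : ℤ) (α : ℂ) : hatS N c ε α * hatT N c ε α = 1 := by
  rw [hatT, hatS, ← map_mul, Ring.inverse_mul_cancel _ (isUnit_tpSeries ε α), map_one]

theorem dyT_mul_dyS (ε : ℤ) (α : ℂ) : dyT N c ε α * dyS N c ε α = 1 := by
  rw [dyT, dyS, ← map_mul, Ring.mul_inverse_cancel _ (isUnit_tSeries ε α), map_one]

theorem dyS_mul_dyT (ε : ℤ) (α : ℂ) : dyS N c ε α * dyT N c ε α = 1 := by
  rw [dyT, dyS, ← map_mul, Ring.inverse_mul_cancel _ (isUnit_tSeries ε α), map_one]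

theorem dyT_eq_tAt (ε : ℤ) (α : ℂ) : dyT N c ε α = tAt (DY.gen N c) ε α := by
  ext i j a
  rw [dyT, coeff_matSer, tSeries, coeff_mk, tAt, Matrix.map_apply, coeff_moebHom,
    Matrix.smul_apply, Matrix.sum_apply, Finset.smul_sum]
  refine Finset.sum_congr rfl fun r _ => ?_
  rw [Matrix.smul_apply, tMat, Matrix.of_apply, coeff_mk, kap, ← map_pow, ← Algebra.smul_def,
    ← Int.cast_smul_eq_zsmul Scal, smul_smul, smul_smul]
  congr 1
  push_cast
  ring

variable {J : Submodule Scal (DY N c)} {m : ℕ}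

/-- The images of the generators of the double Yangian in the operators on a quotient. -/
def genOp (J : Submodule Scal (DY N c)) (hJ : ∀ a x, x ∈ J → a * x ∈ J) :
    Gen N → Op (DY N c ⧸ J) := actOn J hJ ∘ DY.gen N c

theorem sat_genOp (hJ : ∀ a x, x ∈ J → a * x ∈ J) : Sat c (genOp J hJ) := DY.sat_gen.comp _

theorem dyT_map (hJ : ∀ a x, x ∈ J → a * x ∈ J) (ε : ℤ) (α : ℂ) :
    (dyT N c ε α).map (PowerSeries.map (actOn J hJ : DY N c →+* Op (DY N c ⧸ J))) = tAt (genOp J hJ) ε α := by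
  rw [dyT_eq_tAt]
  ext i j a : 2
  simp only [tAt, Matrix.map_apply, coeff_map, coeff_moebHom, map_sum, map_zsmul, map_mul, map_pow]
  refine Finset.sum_congr rfl fun r _ => ?_
  have e1 : (actOn J hJ : DY N c →+* Op (DY N c ⧸ J)) (kap (DY N c) α) = kap _ α := (actOn J hJ).commutes _
  have e2 : (actOn J hJ : DY N c →+* Op (DY N c ⧸ J)) (tOf (DY.gen N c) r i j) = tOf (genOp J hJ) r i j :=
    congrFun (congrFun (mapMatrix_tOf (actOn J hJ) (DY.gen N c) r) i) j
  rw [e1, tMat, tMat, Matrix.of_apply, Matrix.of_apply, coeff_mk, coeff_mk, e2]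

theorem hatT_map (hJ : ∀ a x, x ∈ J → a * x ∈ J) (hm : DY.hPow N c m ≤ J) (ε : ℤ) (α : ℂ) :
    (hatT N c ε α).map (PowerSeries.map (hatAct J hJ hm)) =
      tpAt (actOn_hh_pow hJ hm) (genOp J hJ) ε α := by
  ext i j a : 2
  rw [Matrix.map_apply, coeff_map, hatT, coeff_matSer, tpSeries, coeff_mk, Matrix.of_apply, tpAt,
    Matrix.map_apply, coeff_affHom]
  have e : ∀ s : ℕ, ((ε : Scal) ^ a * ((a + s).choose a : Scal) * (PowerSeries.C α * hh) ^ s) •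
      toHat N c (tpOf (DY.gen N c) (a + s) i j) =
      hh ^ s • (((ε : Scal) ^ a * ((a + s).choose a : Scal) * (PowerSeries.C α) ^ s) •
      toHat N c (tpOf (DY.gen N c) (a + s) i j)) := fun s => by
    rw [smul_smul, mul_pow]; congr 1; ring
  simp only [e]
  rw [hatAct_tsum]
  refine Finset.sum_congr rfl fun s _ => ?_
  have e2 : actOn J hJ (tpOf (DY.gen N c) (a + s) i j) = tpOf (genOp J hJ) (a + s) i j :=
    congrFun (congrFun (mapMatrix_tpOf (actOn J hJ) (DY.gen N c) (a + s)) i) j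
  rw [← e, hatAct_smul, hatAct_toHat, e2, tpMat, Matrix.of_apply, coeff_mk, kap, ← map_pow,
    ← Algebra.smul_def, ← Int.cast_smul_eq_zsmul Scal, smul_smul]
  congr 1
  push_cast
  ring

theorem hatSeries_ext {f g : (HatDY N c)⟦X⟧}
    (h : ∀ m, PowerSeries.map (hatMod N c m) f = PowerSeries.map (hatMod N c m) g) : f = g := by
  ext r
  refine hat_ext fun m => ?_
  have := congrArg (coeff r) (h m)
  rwa [coeff_map, coeff_map] at this

/-- The relations of `T⁺`. They are verified modulo every power of `h`, where the points can be
substituted. -/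
theorem pointRel_hat :
    PointRel (X : (HatDY N c)⟦X⟧) (algebraMap Scal _ hh) (hatT N c) where
  u_comm f := (commute_X f).symm
  ν_comm f := Algebra.commutes hh f
  cancel f h := by
    ext r
    have := congrArg (coeff r) h
    rw [algebraMap_series, coeff_C_mul, map_zero, ← Algebra.smul_def] at this
    rw [hat_eq_zero_of_smul this, map_zero]
  rel ε₁ ε₂ α₁ α₂ _ _ := by
    intro a b d e
    refine hatSeries_ext fun m => ?_
    have r := tpAt_rel (actOn_hh_pow (fun a _ h => DY.mul_mem_hPow a h) (le_refl (DY.hPow N c m)))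
      (sat_genOp (fun a _ h => DY.mul_mem_hPow a h)) ε₁ ε₂ α₁ α₂ a b d e
    rw [← hatT_map (fun a _ h => DY.mul_mem_hPow a h) (le_refl (DY.hPow N c m)),
      ← hatT_map (fun a _ h => DY.mul_mem_hPow a h) (le_refl (DY.hPow N c m))] at r
    have ha : ∀ s : Scal, PowerSeries.map (hatMod N c m) (algebraMap Scal _ s) =
        algebraMap Scal _ s := fun s => by
      rw [algebraMap_series, map_C, hatMod, hatAct_algebraMap, algebraMap_series]
    have hμ : PowerSeries.map (hatMod N c m) ((ε₁ - ε₂) • (X : (HatDY N c)⟦X⟧) +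
        algebraMap Scal _ (PowerSeries.C (α₁ - α₂)) * algebraMap Scal _ hh) =
        (ε₁ - ε₂) • X + algebraMap Scal _ (PowerSeries.C (α₁ - α₂)) * algebraMap Scal _ hh := by
      rw [map_add, map_zsmul, map_X, map_mul, ha, ha]
    have hmap : ∀ μ ν x₁ x₂ x₃ x₄ : (HatDY N c)⟦X⟧, PowerSeries.map (hatMod N c m)
        (μ * (x₁ * x₂) - ν * (x₃ * x₄)) = PowerSeries.map (hatMod N c m) μ *
          (PowerSeries.map (hatMod N c m) x₁ * PowerSeries.map (hatMod N c m) x₂) -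
        PowerSeries.map (hatMod N c m) ν *
          (PowerSeries.map (hatMod N c m) x₃ * PowerSeries.map (hatMod N c m) x₄) :=
      fun _ _ _ _ _ _ => by simp only [map_sub, map_mul]
    have hmap' : ∀ μ ν x₁ x₂ x₃ x₄ : (HatDY N c)⟦X⟧, PowerSeries.map (hatMod N c m)
        (x₁ * x₂ * μ - x₃ * x₄ * ν) = (PowerSeries.map (hatMod N c m) x₁ *
          PowerSeries.map (hatMod N c m) x₂) * PowerSeries.map (hatMod N c m) μ -
        (PowerSeries.map (hatMod N c m) x₃ * PowerSeries.map (hatMod N c m) x₄) *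
          PowerSeries.map (hatMod N c m) ν :=
      fun _ _ _ _ _ _ => by simp only [map_sub, map_mul]
    rw [hmap, hmap', hμ, ha]
    exact r

theorem pointRel_dy :
    PointRel (1 : (DY N c)⟦X⟧) (algebraMap Scal _ hh * X) (dyT N c) where
  u_comm f := Commute.one_left f
  ν_comm f := (show Commute _ f from Algebra.commutes hh f).mul_left (commute_X f).symm
  cancel f h := by
    ext r
    have := congrArg (coeff (r + 1)) h
    rw [mul_assoc, algebraMap_series, coeff_C_mul, map_zero, ← Algebra.smul_def,
      coeff_succ_X_mul] at this
    rw [DY.eq_zero_of_smul this, map_zero]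
  rel ε₁ ε₂ α₁ α₂ h₁ h₂ := by
    rw [dyT_eq_tAt, dyT_eq_tAt]
    exact tAt_rel DY.sat_gen h₁ h₂ α₁ α₂

/-! ### The two parts of the series -/

theorem list_prod_mul_inverse {R ι : Type*} [Ring R] {f g : ι → R} (h : ∀ i, f i * g i = 1)
    (l : List ι) : (l.reverse.map f).prod * (l.map g).prod = 1 := by
  induction l with
  | nil => simp
  | cons a l ih =>
    rw [List.reverse_cons, List.map_append, List.prod_append, List.map_cons, List.map_nil,
      List.prod_singleton, List.map_cons, List.prod_cons, mul_assoc, ← mul_assoc (f a), h, one_mul,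
      ih]

variable {n : ℕ}

theorem matSer_inverse_prod {A : Type*} [Ring A]
    {F : Fin n → PowerSeries (Mat[N] A)} (hF : ∀ i, IsUnit (F i))
    (l : List (Fin n)) :
    matSer (Ring.inverse (l.reverse.map fun k => PowerSeries.map (leg k) (F k)).prod) =
      (l.map fun k => leg k (matSer (Ring.inverse (F k)))).prod := by
  have e : ((l.map fun k => PowerSeries.map (leg k) (Ring.inverse (F k))).prod :
      PowerSeries (Mat[N, n] A)) =
      Ring.inverse (l.reverse.map fun k => PowerSeries.map (leg k) (F k)).prod := by
    have h1 := list_prod_mul_inverse (f := fun k => PowerSeries.map (leg k) (F k))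
      (g := fun k => (PowerSeries.map (leg k) (Ring.inverse (F k)) :
        PowerSeries (Mat[N, n] A)))
      (fun k => by rw [← map_mul, Ring.mul_inverse_cancel _ (hF k), map_one]) l
    have hu : IsUnit ((l.reverse.map fun k => PowerSeries.map (leg k) (F k)).prod :
        PowerSeries (Mat[N, n] A)) := by
      refine isUnit_listProd _ fun x hx => ?_
      obtain ⟨k, -, rfl⟩ := List.mem_map.1 hx
      exact (hF k).map _
    rw [← one_mul (List.prod _), ← Ring.inverse_mul_cancel _ hu, mul_assoc, h1, mul_one]
  rw [← e, map_list_prod, List.map_map]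
  congr 1
  exact List.map_congr_left fun k _ => matSer_map_leg k _

theorem matSer_prod {A : Type*} [Ring A]
    (F : Fin n → PowerSeries (Mat[N] A)) (l : List (Fin n)) :
    matSer (l.map fun k => PowerSeries.map (leg k) (F k)).prod =
      (l.map fun k => leg k (matSer (F k))).prod := by
  rw [map_list_prod, List.map_map]
  congr 1
  exact List.map_congr_left fun k _ => matSer_map_leg k _

/-- The series in `u` of the trace formula. -/
theorem matSer_plusPart (s : ℂ) : matSer (plusPart N c n s) =
    ((List.finRange n).map fun i => leg i (hatT N c 1 (s * (i : ℕ)))).prod *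
      ((List.finRange n).map fun i => leg i (hatS N c (-1) (-(s * (i : ℕ))))).prod := by
  rw [plusPart, map_mul, List.ofFn_eq_map, List.ofFn_eq_map, ← List.map_reverse,
    matSer_inverse_prod (fun i => isUnit_tpSeries _ _), matSer_prod]
  rfl

/-- The series in `u⁻¹` of the trace formula, at the level `c = -N / 2`, where `N / 4 = -c / 2` and
`-3 N / 4 = 3 c / 2`. -/
theorem matSer_minusPart (hc : 2 * c = -(N : ℂ)) (s : ℂ) : matSer (minusPart N c n s) =
    ((List.finRange n).reverse.map fun i => leg i (dyT N c (-1) (-(s * (i : ℕ)) - c / 2))).prod *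
      ((List.finRange n).reverse.map fun i =>
        leg i (dyS N c 1 (s * (i : ℕ) + 3 * c / 2))).prod := by
  have h := matSer_inverse_prod (N := N) (n := n)
    (F := fun i => tSeries N c 1 (s * (i : ℕ) - 3 * N / 4)) (fun i => isUnit_tSeries _ _)
    (List.finRange n).reverse
  rw [List.reverse_reverse] at h
  rw [minusPart, map_mul, List.ofFn_eq_map, List.ofFn_eq_map, ← List.map_reverse, h, matSer_prod]
  have e1 : ∀ i : Fin n, -(s * (i : ℕ)) + N / 4 = -(s * (i : ℕ)) - c / 2 := fun i => by
    linear_combination (1 / 4) * hc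
  have e2 : ∀ i : Fin n, s * (i : ℕ) - 3 * N / 4 = s * (i : ℕ) + 3 * c / 2 := fun i => by
    linear_combination (-3 / 4) * hc
  simp only [e1, e2]
  rfl

end GenMat

open PowerSeries

/-! ### The saturated closure of the reflection subalgebra -/

section Closure

variable (N : ℕ) (c : ℂ)

/-- The closure of `A_c(gl_N)` in the `h`-adic completion. -/
def aClosure (M : ℕ) : Subalgebra Scal (HatDY N c) where
  carrier := {v | ∀ m : ℕ, ∃ a ∈ aAlg N c M, ∃ y, v - a = hh ^ m • y}
  add_mem' := by
    intro v w hv hw m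
    obtain ⟨a, ha, y, hy⟩ := hv m
    obtain ⟨b, hb, z, hz⟩ := hw m
    exact ⟨a + b, add_mem ha hb, y + z, by rw [smul_add, ← hy, ← hz]; abel⟩
  mul_mem' := by
    intro v w hv hw m
    obtain ⟨a, ha, y, hy⟩ := hv m
    obtain ⟨b, hb, z, hz⟩ := hw m
    refine ⟨a * b, mul_mem ha hb, y * w + a * z, ?_⟩
    rw [smul_add, ← smul_mul_assoc, ← mul_smul_comm, ← hy, ← hz]
    noncomm_ring
  algebraMap_mem' s m := ⟨_, Subalgebra.algebraMap_mem _ s, 0, by rw [smul_zero, sub_self]⟩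

variable {N c} {M : ℕ}

theorem aAlg_le_aClosure : aAlg N c M ≤ aClosure N c M := fun v hv _ =>
  ⟨v, hv, 0, by rw [smul_zero, sub_self]⟩

theorem mem_aClosure_of_approx {v : HatDY N c}
    (h : ∀ m : ℕ, ∃ a ∈ aClosure N c M, ∃ y, v - a = hh ^ m • y) : v ∈ aClosure N c M := by
  intro m
  obtain ⟨a, ha, y, hy⟩ := h m
  obtain ⟨b, hb, z, hz⟩ := ha m
  exact ⟨b, hb, y + z, by rw [smul_add, ← hy, ← hz]; abel⟩

theorem mem_aClosure_of_hatMod {v : HatDY N c}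
    (h : ∀ m : ℕ, ∃ a ∈ aClosure N c M, hatMod N c m v = hatMod N c m a) :
    v ∈ aClosure N c M := by
  refine mem_aClosure_of_approx fun m => ?_
  obtain ⟨a, ha, e⟩ := h m
  exact ⟨a, ha, hatMod_eq_zero_iff.1 (by rw [map_sub, e, sub_self])⟩

theorem hatToTilde_mem_aTilde {v : HatDY N c} (h : v ∈ aClosure N c M) :
    hatToTilde N c v ∈ aTilde N c M := by
  choose a ha y hy using h
  have h1 : Filter.Tendsto (fun m => hatToTilde N c (v - hh ^ m • y m)) Filter.atTop
      (nhds (hatToTilde N c v)) := by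
    have hc : Continuous (hatToTilde N c) := UniformSpace.Completion.continuous_map
    have h2 := tendsto_hpow_smul y
    rw [Nat.cofinite_eq_atTop] at h2
    have h3 := (hc.tendsto _).comp (h2.const_sub v)
    rwa [sub_zero] at h3
  refine mem_closure_of_tendsto h1 (Filter.Eventually.of_forall fun m => ?_)
  refine ⟨a m, ha m, ?_⟩
  rw [← hy m, sub_sub_cancel]
  rfl

/-- The series with coefficients in an algebra over the double Yangian which belong to the closure of
`A_c(gl_N)`. -/
def aSeries {A : Type*} [Ring A] [Algebra Scal A] (φ : A →ₐ[Scal] HatDY N c) (M : ℕ) :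
    Subalgebra Scal A⟦X⟧ where
  carrier := {f | ∀ r, φ (coeff r f) ∈ aClosure N c M}
  add_mem' hf hg r := by rw [map_add, map_add]; exact add_mem (hf r) (hg r)
  mul_mem' hf hg r := by
    rw [coeff_mul, map_sum]
    exact sum_mem fun p _ => by rw [map_mul]; exact mul_mem (hf _) (hg _)
  algebraMap_mem' s r := by
    rw [algebraMap_series, coeff_C]
    split_ifs
    · rw [AlgHom.commutes]; exact Subalgebra.algebraMap_mem _ _
    · rw [map_zero]; exact zero_mem _

theorem X_mem_aSeries {A : Type*} [Ring A] [Algebra Scal A] (φ : A →ₐ[Scal] HatDY N c) :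
    X ∈ aSeries φ M := fun r => by
  rw [coeff_X]
  split_ifs
  · rw [map_one]; exact one_mem _
  · rw [map_zero]; exact zero_mem _

theorem algebraMap_two_smul {A : Type*} [AddCommGroup A] [Module Scal A] (x : A) :
    (PowerSeries.C (2⁻¹ : ℂ) : Scal) • (2 : ℤ) • x = x := by
  rw [← Int.cast_smul_eq_zsmul Scal, smul_smul]
  have : (PowerSeries.C (2⁻¹ : ℂ) : Scal) * ((2 : ℤ) : Scal) = 1 := by
    have e : ((2 : ℤ) : Scal) = PowerSeries.C (2 : ℂ) := by
      rw [Int.cast_ofNat, map_ofNat]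
    rw [e, ← map_mul]
    norm_num
  rw [this, one_smul]

/-- The linear forms `2 u + β h` can be cancelled in the series with coefficients in the closure of
`A_c(gl_N)`: the quotient is obtained from the expansion in powers of `h / u`. -/
theorem mem_aSeries_of_mul {β : ℂ} {f : (HatDY N c)⟦X⟧}
    (h : ((2 * 1 : ℤ) • (X : (HatDY N c)⟦X⟧) +
      algebraMap Scal _ (PowerSeries.C β) * algebraMap Scal _ hh) * f ∈
        aSeries (AlgHom.id Scal (HatDY N c)) M) :
    f ∈ aSeries (AlgHom.id Scal (HatDY N c)) M := by
  have hr : ∀ r, (2 : ℤ) • coeff r f + (PowerSeries.C β * hh) • coeff (r + 1) f ∈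
      aClosure N c M := fun r => by
    have := h (r + 1)
    rw [mul_one, add_mul, map_add, ← map_mul, algebraMap_series, coeff_C_mul, smul_mul_assoc,
      map_zsmul, coeff_succ_X_mul, ← Algebra.smul_def] at this
    exact this
  have hf : ∀ r, coeff r f = (PowerSeries.C (2⁻¹ : ℂ) : Scal) •
      ((2 : ℤ) • coeff r f + (PowerSeries.C β * hh) • coeff (r + 1) f) -
      hh • (PowerSeries.C (2⁻¹ : ℂ) * PowerSeries.C β : Scal) • coeff (r + 1) f := fun r => by
    rw [smul_add, algebraMap_two_smul, smul_smul, smul_smul, add_sub_assoc]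
    rw [show hh * (PowerSeries.C (2⁻¹ : ℂ) * PowerSeries.C β) =
      PowerSeries.C (2⁻¹ : ℂ) * (PowerSeries.C β * hh) by ring, sub_self, add_zero]
  intro r
  refine mem_aClosure_of_approx fun m => ?_
  change ∃ a ∈ aClosure N c M, ∃ y, coeff r f - a = hh ^ m • y
  induction m generalizing r with
  | zero => exact ⟨0, zero_mem _, coeff r f, by simp⟩
  | succ m ih =>
    obtain ⟨a, ha, y, hy⟩ := ih (r + 1)
    rw [sub_eq_iff_eq_add] at hy
    refine ⟨(PowerSeries.C (2⁻¹ : ℂ) : Scal) •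
      ((2 : ℤ) • coeff r f + (PowerSeries.C β * hh) • coeff (r + 1) f) -
      hh • (PowerSeries.C (2⁻¹ : ℂ) * PowerSeries.C β : Scal) • a,
      sub_mem (Subalgebra.smul_mem _ (hr r) _)
        (Subalgebra.smul_mem _ (Subalgebra.smul_mem _ ha _) _),
      -(PowerSeries.C (2⁻¹ : ℂ) * PowerSeries.C β : Scal) • y, ?_⟩
    conv_lhs => lhs; rw [hf r]
    rw [sub_sub_sub_cancel_left, ← smul_sub, ← smul_sub, hy, sub_add_cancel_right]
    simp only [smul_neg, neg_smul, smul_smul]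
    congr 2
    ring

/-- The corresponding statement for series in `u⁻¹`, where the linear form has been divided by `u`
and is invertible. -/
theorem mem_aSeries_of_mul' {A : Type*} [Ring A] [Algebra Scal A] (φ : A →ₐ[Scal] HatDY N c)
    {β : ℂ} {f : A⟦X⟧}
    (h : ((2 * -1 : ℤ) • (1 : A⟦X⟧) +
      algebraMap Scal _ (PowerSeries.C β) * (algebraMap Scal _ hh * X)) * f ∈ aSeries φ M) :
    f ∈ aSeries φ M := by
  have e : ((2 * -1 : ℤ) • (1 : A⟦X⟧) +
      algebraMap Scal _ (PowerSeries.C β) * (algebraMap Scal _ hh * X)) * f =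
      (PowerSeries.C β * hh) • (X * f) - (2 : ℤ) • f := by
    rw [add_mul, smul_mul_assoc, one_mul, ← mul_assoc, ← map_mul, mul_assoc, ← Algebra.smul_def]
    simp only [mul_neg, mul_one, neg_smul]
    abel
  rw [e] at h
  have half : ∀ r, (2 : ℤ) • φ (coeff r f) ∈ aClosure N c M → φ (coeff r f) ∈ aClosure N c M :=
    fun r hr => by
      rw [← algebraMap_two_smul (φ (coeff r f))]
      exact Subalgebra.smul_mem _ hr _
  have hcs : ∀ (s : Scal) (r : ℕ) (g : A⟦X⟧), coeff r (s • g) = s • coeff r g :=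
    fun s r g => by rw [Algebra.smul_def, algebraMap_series, coeff_C_mul, ← Algebra.smul_def]
  intro r
  induction r with
  | zero =>
    refine half 0 ?_
    have := h 0
    rw [map_sub, hcs, coeff_zero_X_mul, smul_zero, zero_sub, map_neg, map_zsmul, map_zsmul] at this
    simpa using neg_mem this
  | succ r ih =>
    refine half _ ?_
    have := h (r + 1)
    rw [map_sub, hcs, coeff_succ_X_mul, map_sub, map_smul, map_zsmul, map_zsmul] at this
    have h2 := sub_mem (Subalgebra.smul_mem _ ih (PowerSeries.C β * hh)) this
    rwa [sub_sub_cancel] at h2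

end Closure

open PowerSeries

/-! ### Shifts of the generating matrices -/

section Shift

variable {N m : ℕ} {D : Type} [Ring D] [Algebra Scal D]

theorem tMat_eq_one (h0 : algebraMap Scal D hh = 0) (x : Gen N → D) : tMat x = 1 := by
  refine Matrix.ext fun i j => PowerSeries.ext fun a => ?_
  rw [tMat, Matrix.of_apply, coeff_mk, Matrix.one_apply, apply_ite (coeff a), coeff_one, map_zero]
  cases a with
  | zero => rw [tOf, Matrix.one_apply, if_pos rfl]
  | succ a => rw [tOf, Matrix.of_apply, Algebra.smul_def, h0, zero_mul]; simp

theorem tpMat_eq_one (h0 : algebraMap Scal D hh = 0) (x : Gen N → D) : tpMat x = 1 := by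
  refine Matrix.ext fun i j => PowerSeries.ext fun a => ?_
  rw [tpMat, Matrix.of_apply, coeff_mk, Matrix.one_apply, apply_ite (coeff a), coeff_one, map_zero,
    tpOf, Matrix.sub_apply, Matrix.of_apply, Algebra.smul_def, h0, zero_mul, sub_zero]
  by_cases ha : a = 0
  · rw [if_pos ha, if_pos ha, Matrix.one_apply]
  · rw [if_neg ha, if_neg ha, Matrix.zero_apply, ite_self]

theorem kap_intCast_mul (ε : ℤ) (α : ℂ) : kap D (ε * α) = ε • kap D α := by
  have e : PowerSeries.C (ε * α) * hh = (ε : Scal) * (PowerSeries.C α * hh) := by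
    rw [map_mul, map_intCast, mul_assoc]
  rw [kap, e, kap, ← map_zsmul, zsmul_eq_mul]

theorem tpAt_map_affHom (hm : algebraMap Scal D hh ^ m = 0) (x : Gen N → D) (ε : ℤ) (α β : ℂ) :
    (tpAt hm x ε β).map (affHom 1 (kap D α) (kap_comm α) (kap_pow hm α)) =
      tpAt hm x ε (ε * α + β) := by
  have e : (affHom 1 (kap D α) (kap_comm α) (kap_pow hm α)).comp
      (affHom ε (kap D β) (kap_comm β) (kap_pow hm β)) =
      affHom ε (kap D (ε * α + β)) (kap_comm _) (kap_pow hm _) := by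
    have hX : ((affHom 1 (kap D α) (kap_comm α) (kap_pow hm α)).comp
        (affHom ε (kap D β) (kap_comm β) (kap_pow hm β))) X =
        affHom ε (kap D (ε * α + β)) (kap_comm _) (kap_pow hm _) X := by
      rw [RingHom.comp_apply, affHom_X, map_add, map_zsmul, affHom_X, affHom_C, affHom_X, one_smul,
        smul_add, add_assoc, ← map_zsmul, ← map_add]
      congr 2
      rw [kap_add, kap_intCast_mul]
    refine ringHom_ext_of_topNil ?_ (fun d => ?_) hX
    · rw [hX, affHom_X]
      exact topNil_affX ε (kap_comm _) (kap_pow hm _)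
    · rw [RingHom.comp_apply, affHom_C, affHom_C, affHom_C]
  refine Matrix.ext fun i j => ?_
  exact RingHom.congr_fun e (tpMat x i j)

theorem tAt_map_moebHom (x : Gen N → D) {ε ε' : ℤ} (hε : ε * ε = 1) (α β : ℂ) :
    (tAt x ε β).map (moebHom ε' (kap D α) (kap_comm α)) = tAt x (ε * ε') (ε * α + β) := by
  set φ := moebHom ε' (kap D α) (kap_comm α) with hφ
  have e : φ.comp (moebHom ε (kap D β) (kap_comm β)) =
      moebHom (ε * ε') (kap D (ε * α + β)) (kap_comm _) := by
    have hX : (φ.comp (moebHom ε (kap D β) (kap_comm β))) X =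
        moebHom (ε * ε') (kap D (ε * α + β)) (kap_comm _) X := by
      have h1 : φ X * (1 + PowerSeries.C (ε' • kap D α) * X) = ε' • X := moebHom_X ..
      have h2 := congrArg φ (moebHom_X ε (kap D β) (kap_comm β))
      rw [map_mul, map_add, map_one, map_mul, map_zsmul φ, hφ, moebHom_C, ← hφ] at h2
      have h3 := moebHom_X (ε * ε') (kap D (ε * α + β)) (kap_comm _)
      set q : D⟦X⟧ := 1 + PowerSeries.C ((ε * ε') • kap D (ε * α + β)) * X with hq
      have hu : IsUnit q := by
        rw [PowerSeries.isUnit_iff_constantCoeff, hq]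
        simp
      have h4 : (1 + PowerSeries.C (ε • kap D β) * φ X) *
          (1 + PowerSeries.C (ε' • kap D α) * X) = q := by
        have hk : (ε * ε') • kap D (ε * α + β) = ε' • kap D α + ε' • ε • kap D β := by
          rw [kap_add, kap_intCast_mul, smul_add, smul_smul, smul_smul, mul_comm ε ε', mul_assoc, hε, mul_one]
        rw [add_mul, one_mul, mul_assoc, h1, hq, hk, map_add, add_mul, add_assoc, mul_smul_comm,
          map_zsmul _ ε' (ε • kap D β), smul_mul_assoc]
      rw [RingHom.comp_apply]
      refine hu.mul_right_cancel ?_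
      rw [h3, ← h4, ← mul_assoc, h2, smul_mul_assoc, h1, smul_smul]
    refine ringHom_ext_of_topNil ?_ (fun d => ?_) hX
    · rw [hX, moebHom, evalHom_X]
      exact topNil_moebPow _ (kap_comm _)
    · rw [RingHom.comp_apply, moebHom_C, hφ, moebHom_C, moebHom_C]
  refine Matrix.ext fun i j => ?_
  exact RingHom.congr_fun e (tMat x i j)

theorem right_inverse_unique {R : Type*} [Ring R] {a b b' : R} (h : a * b = 1) (h' : b' * a = 1) :
    b = b' := by
  rw [← one_mul b, ← h', mul_assoc, h, mul_one]

end Shift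

/-! ### The generators of the reflection subalgebra -/

section GenMem

variable {N : ℕ} {c : ℂ} {M : ℕ}

theorem gMat_eq (hG : gMat N M ℂ = 1 ∨ gMat N M ℂ = -1) :
    ∃ g : ℤ, g * g = 1 ∧ ∀ (A : Type) [Ring A], gMat N M A = g • 1 := by
  rcases hG with hG | hG
  · refine ⟨1, by norm_num, fun A _ => ?_⟩
    rw [one_smul, gMat, ← Matrix.diagonal_one]
    congr 1
    funext i
    have := congrFun (congrFun hG i) i
    rw [gMat, Matrix.diagonal_apply_eq, Matrix.one_apply_eq] at this
    by_cases hi : (i : ℕ) < M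
    · rw [if_pos hi]
    · rw [if_neg hi] at this
      norm_num at this
  · refine ⟨-1, by norm_num, fun A _ => ?_⟩
    rw [neg_smul, one_smul, gMat, ← Matrix.diagonal_one, Matrix.diagonal_neg]
    congr 1
    funext i
    have := congrFun (congrFun hG i) i
    rw [gMat, Matrix.diagonal_apply_eq, Matrix.neg_apply, Matrix.one_apply_eq] at this
    by_cases hi : (i : ℕ) < M
    · rw [if_pos hi] at this
      norm_num at this
    · rw [if_neg hi]

/-- The matrix `T⁺(u) T⁺(-u)⁻¹`. -/
def hatB (N : ℕ) (c : ℂ) : Mat[N] (HatDY N c)⟦X⟧ :=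
  hatT N c 1 0 * hatS N c (-1) 0

/-- The matrix `T(u + hc) T(-u)⁻¹`. -/
def dyB (N : ℕ) (c : ℂ) : Mat[N] (DY N c)⟦X⟧ :=
  dyT N c 1 c * dyS N c (-1) 0

variable {g : ℤ}

theorem coeff_bpSeries (hG : gMat N M (HatDY N c) = g • 1) (r : ℕ) (i j : Fin N) :
    coeff r (bpSeries N c M) i j = g • coeff r (hatB N c i j) := by
  have e : bpSeries N c M = g • (tpSeries N c 1 0 * Ring.inverse (tpSeries N c (-1) 0)) := by
    rw [bpSeries, hG, map_zsmul, map_one, mul_smul_comm, mul_one, smul_mul_assoc]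
  rw [e, map_zsmul, Matrix.smul_apply, hatB, hatT, hatS, ← map_mul, coeff_matSer]

theorem coeff_bSeries (hG : gMat N M (DY N c) = g • 1) (r : ℕ) (i j : Fin N) :
    coeff r (bSeries N c M) i j = g • coeff r (dyB N c i j) := by
  have e : bSeries N c M = g • (tSeries N c 1 c * Ring.inverse (tSeries N c (-1) 0)) := by
    rw [bSeries, hG, map_zsmul, map_one, mul_smul_comm, mul_one, smul_mul_assoc]
  rw [e, map_zsmul, Matrix.smul_apply, dyB, dyT, dyS, ← map_mul, coeff_matSer]

theorem hh_eq_zero_mod_one : algebraMap Scal (Op (DY N c ⧸ DY.hPow N c 1)) hh = 0 := by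
  have := actOn_hh_pow (fun a _ h => DY.mul_mem_hPow a h) (le_refl (DY.hPow N c 1))
  rwa [pow_one] at this

theorem exists_coeff_eq {X : Mat[N] (HatDY N c)⟦X⟧}
    (h : X.map (PowerSeries.map (hatMod N c 1)) = 1) (r : ℕ) (i j : Fin N) :
    ∃ y, coeff r (X i j) =
      (if r = 0 then (1 : Mat[N] (HatDY N c)) i j else 0) - hh • y := by
  have h1 : hatMod N c 1 (coeff r (X i j) -
      (if r = 0 then (1 : Mat[N] (HatDY N c)) i j else 0)) = 0 := by
    have h2 := congrArg (coeff r) (congrFun (congrFun h i) j)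
    rw [Matrix.map_apply, coeff_map] at h2
    rw [map_sub, h2, Matrix.one_apply, Matrix.one_apply, apply_ite (coeff r), coeff_one, map_zero]
    by_cases hr : r = 0 <;> by_cases hij : i = j <;> simp [hr, hij]
  obtain ⟨y, hy⟩ := hatMod_eq_zero_iff.1 h1
  exact ⟨-y, by rw [smul_neg, sub_neg_eq_add, ← sub_eq_iff_eq_add', hy, pow_one]⟩

theorem mapMatrix_eq_one {A B : Type*} [Ring A] [Ring B] (φ : A →+* B)
    {T T' S' : Mat[N] A} (hS : T' * S' = 1) (hT : T.map φ = 1)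
    (hT' : T'.map φ = 1) : (T * S').map φ = 1 := by
  have e := map_mul φ.mapMatrix T' S'
  rw [hS, map_one] at e
  change 1 = T'.map φ * S'.map φ at e
  rw [hT', one_mul] at e
  change φ.mapMatrix (T * S') = 1
  rw [map_mul]
  change T.map φ * S'.map φ = 1
  rw [hT, ← e, one_mul]

theorem hatB_mod_one : (hatB N c).map (PowerSeries.map (hatMod N c 1)) = 1 := by
  have h : ∀ ε α, (hatT N c ε α).map (PowerSeries.map (hatMod N c 1)) = 1 := fun ε α => by
    rw [hatMod, hatT_map, tpAt, tpMat_eq_one hh_eq_zero_mod_one]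
    exact Matrix.map_one _ (map_zero _) (map_one _)
  exact mapMatrix_eq_one _ (hatT_mul_hatS (-1) 0) (h 1 0) (h (-1) 0)

theorem dyB_mod_one :
    ((dyB N c).map (PowerSeries.map (toHat N c : DY N c →+* HatDY N c))).map
      (PowerSeries.map (hatMod N c 1)) = 1 := by
  have h : ∀ ε α, ((dyT N c ε α).map (PowerSeries.map (toHat N c : DY N c →+* HatDY N c))).map
      (PowerSeries.map (hatMod N c 1)) = 1 := fun ε α => by
    have e : ((dyT N c ε α).map (PowerSeries.map (toHat N c : DY N c →+* HatDY N c))).map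
        (PowerSeries.map (hatMod N c 1)) = (dyT N c ε α).map (PowerSeries.map
          (actOn (DY.hPow N c 1) (fun a _ h => DY.mul_mem_hPow a h) :
            DY N c →+* Op (DY N c ⧸ DY.hPow N c 1))) := by
      refine Matrix.ext fun i j => PowerSeries.ext fun a => ?_
      simp only [Matrix.map_apply, coeff_map]
      exact hatAct_toHat _ _ _
    rw [e, dyT_map, tAt, tMat_eq_one hh_eq_zero_mod_one]
    exact Matrix.map_one _ (map_zero _) (map_one _)
  have := mapMatrix_eq_one ((PowerSeries.map (hatMod N c 1)).comp
    (PowerSeries.map (toHat N c : DY N c →+* HatDY N c))) (dyT_mul_dyS (-1) 0)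
    (T := dyT N c 1 c) (h 1 c) (h (-1) 0)
  exact this

/-- The coefficients of `T⁺(u) T⁺(-u)⁻¹`, which generate the reflection subalgebra up to a sign and
up to division by `h`. -/
theorem coeff_hatB_mem (hg : g * g = 1) (hG : gMat N M (HatDY N c) = g • 1) (r : ℕ) (i j : Fin N) :
    coeff r (hatB N c i j) ∈ aPrime N c M := by
  obtain ⟨y, hy⟩ := exists_coeff_eq (hatB_mod_one (N := N) (c := c)) r i j
  have hm : g • y ∈ aPrime N c M := by
    refine Algebra.subset_adjoin (Or.inl ⟨i, j, r, ?_⟩)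
    rw [coeff_bpSeries hG, hy, smul_sub, hG, smul_comm g hh y]
    split_ifs <;> simp
  have hy' : y ∈ aPrime N c M := by
    have := zsmul_mem hm g
    rwa [smul_smul, hg, one_smul] at this
  rw [hy]
  refine sub_mem ?_ (Subalgebra.smul_mem _ hy' _)
  rw [Matrix.one_apply]
  split_ifs
  exacts [one_mem _, zero_mem _, zero_mem _]

theorem coeff_dyB_mem (hg : g * g = 1) (hG : gMat N M (DY N c) = g • 1) (r : ℕ) (i j : Fin N) :
    toHat N c (coeff r (dyB N c i j)) ∈ aPrime N c M := by
  cases r with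
  | zero =>
    have h : ∀ ε α, (dyT N c ε α).map (constantCoeff (R := DY N c)) = 1 := fun ε α => by
      refine Matrix.ext fun i j => ?_
      rw [Matrix.map_apply, ← coeff_zero_eq_constantCoeff_apply, dyT, coeff_matSer]
      simp [tSeries, tOf]
    have h1 := mapMatrix_eq_one (constantCoeff (R := DY N c)) (dyT_mul_dyS (-1) 0)
      (T := dyT N c 1 c) (h 1 c) (h (-1) 0)
    have h2 := congrFun (congrFun h1 i) j
    rw [Matrix.map_apply, ← coeff_zero_eq_constantCoeff_apply] at h2
    change toHat N c (coeff 0 ((dyT N c 1 c * dyS N c (-1) 0) i j)) ∈ _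
    rw [h2, Matrix.one_apply]
    split_ifs
    · rw [map_one]; exact one_mem _
    · rw [map_zero]; exact zero_mem _
  | succ r =>
    obtain ⟨y, hy⟩ := exists_coeff_eq (dyB_mod_one (N := N) (c := c)) (r + 1) i j
    rw [Matrix.map_apply, coeff_map, if_neg (Nat.succ_ne_zero r), zero_sub] at hy
    change toHat N c _ = _ at hy
    have hm : -(g • y) ∈ aPrime N c M := by
      refine Algebra.subset_adjoin (Or.inr ⟨i, j, r, ?_⟩)
      rw [coeff_bSeries hG, map_zsmul, hy, smul_neg, smul_neg, smul_comm g hh y]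
    have hy' : y ∈ aPrime N c M := by
      have := zsmul_mem (neg_mem hm) g
      rwa [neg_neg, smul_smul, hg, one_smul] at this
    rw [hy]
    exact neg_mem (Subalgebra.smul_mem _ hy' _)

theorem aPrime_le_aClosure : aPrime N c M ≤ aClosure N c M := fun v hv =>
  aAlg_le_aClosure ⟨0, by rwa [pow_zero, one_smul]⟩

/-- The coefficients of the shifted matrices `T⁺(u + α h) T⁺(-u - α h)⁻¹`. -/
theorem hatT_mul_hatS_mem (hg : g * g = 1) (hG : gMat N M (HatDY N c) = g • 1) (α : ℂ)
    (i j : Fin N) :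
    (hatT N c 1 α * hatS N c (-1) (0 - α)) i j ∈ aSeries (AlgHom.id Scal (HatDY N c)) M := by
  intro r
  refine mem_aClosure_of_hatMod fun m => ?_
  have hJ : ∀ a x, x ∈ DY.hPow N c m → a * x ∈ DY.hPow N c m := fun a _ h => DY.mul_mem_hPow a h
  have hm := actOn_hh_pow hJ le_rfl
  let Φ : (HatDY N c)⟦X⟧ →+* PowerSeries (Op (DY N c ⧸ DY.hPow N c m)) :=
    PowerSeries.map (hatMod N c m)
  let A := affHom 1 (kap (Op (DY N c ⧸ DY.hPow N c m)) α) (kap_comm α) (kap_pow hm α)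
  have hT : ∀ (ε : ℤ) (β : ℂ), Φ.mapMatrix (hatT N c ε (ε * α + β)) =
      A.mapMatrix (Φ.mapMatrix (hatT N c ε β)) := fun ε β => by
    change (hatT N c ε (ε * α + β)).map (PowerSeries.map (hatMod N c m)) =
      ((hatT N c ε β).map (PowerSeries.map (hatMod N c m))).map A
    rw [hatMod, hatT_map, hatT_map, tpAt_map_affHom]
  have h1 := hT 1 0
  have h2 := hT (-1) 0
  rw [show ((1 : ℤ) : ℂ) * α + 0 = α by simp] at h1
  rw [show ((-1 : ℤ) : ℂ) * α + 0 = 0 - α by simp] at h2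
  have h3 : Φ.mapMatrix (hatS N c (-1) (0 - α)) = A.mapMatrix (Φ.mapMatrix (hatS N c (-1) 0)) := by
    refine right_inverse_unique (a := Φ.mapMatrix (hatT N c (-1) (0 - α))) ?_ ?_
    · rw [← map_mul, hatT_mul_hatS, map_one]
    · rw [h2, ← map_mul, ← map_mul, hatS_mul_hatT, map_one, map_one]
  have h4 : Φ.mapMatrix (hatT N c 1 α * hatS N c (-1) (0 - α)) =
      A.mapMatrix (Φ.mapMatrix (hatB N c)) := by
    rw [map_mul, h1, h3, ← map_mul, ← map_mul]
    rfl
  have h5 := congrArg (coeff r) (congrFun (congrFun h4 i) j)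
  change coeff r (PowerSeries.map (hatMod N c m) _) =
    coeff r (A (PowerSeries.map (hatMod N c m) (hatB N c i j))) at h5
  rw [coeff_map, coeff_affHom] at h5
  refine ⟨∑ s ∈ Finset.range m, (1 ^ r * ((r + s).choose r : ℤ)) •
    ((PowerSeries.C α * hh) ^ s • coeff (r + s) (hatB N c i j)), ?_, ?_⟩
  · exact sum_mem fun s _ => zsmul_mem (Subalgebra.smul_mem _
      (aPrime_le_aClosure (coeff_hatB_mem hg hG _ i j)) _) _
  · refine h5.trans ?_
    rw [map_sum]
    refine Finset.sum_congr rfl fun s _ => ?_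
    rw [map_zsmul, hatMod, hatAct_smul, Algebra.smul_def ((PowerSeries.C α * hh) ^ s), map_pow,
      coeff_map]
    rfl

/-- The coefficients of the shifted matrices `T(-u + α h) T(u + c h - α h)⁻¹`. -/
theorem dyT_mul_dyS_mem (hg : g * g = 1) (hG : gMat N M (DY N c) = g • 1) (α : ℂ) (i j : Fin N) :
    (dyT N c (-1) α * dyS N c 1 (c - α)) i j ∈ aSeries (toHat N c) M := by
  let A := moebHom (-1) (kap (DY N c) (α - c)) (kap_comm _)
  have hT : ∀ (ε : ℤ) (β : ℂ), ε * ε = 1 → dyT N c (ε * -1) (ε * (α - c) + β) =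
      A.mapMatrix (dyT N c ε β) := fun ε β hε => by
    rw [dyT_eq_tAt, dyT_eq_tAt, ← tAt_map_moebHom _ hε]
    rfl
  have h1 := hT 1 c (by norm_num)
  have h2 := hT (-1) 0 (by norm_num)
  rw [show ((1 : ℤ) : ℂ) * (α - c) + c = α by simp, one_mul] at h1
  rw [show ((-1 : ℤ) : ℂ) * (α - c) + 0 = c - α by simp, neg_mul_neg, one_mul] at h2
  have h3 : dyS N c 1 (c - α) = A.mapMatrix (dyS N c (-1) 0) := by
    refine right_inverse_unique (a := dyT N c 1 (c - α)) (dyT_mul_dyS _ _) ?_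
    rw [h2, ← map_mul, dyS_mul_dyT, map_one]
  have h4 : dyT N c (-1) α * dyS N c 1 (c - α) = A.mapMatrix (dyB N c) := by
    rw [h1, h3, ← map_mul]
    rfl
  intro r
  rw [h4]
  change toHat N c (coeff r (A (dyB N c i j))) ∈ _
  rw [coeff_moebHom, map_sum]
  refine sum_mem fun s _ => ?_
  rw [map_zsmul, kap, ← map_pow, ← Algebra.smul_def, map_smul]
  exact zsmul_mem (Subalgebra.smul_mem _ (aPrime_le_aClosure (coeff_dyB_mem hg hG _ i j)) _) _

end GenMem

/-! ### Projections of the two parts of the series -/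

section Parts

variable {N n : ℕ} {c : ℂ} {M : ℕ} {g : ℤ} {χ : Equiv.Perm (Fin n) →* ℤˣ} {s : ℤ}

theorem isoProj_apply_mem {A : Type*} [Ring A] [Algebra Scal A] (B : Subalgebra Scal A)
    (a b : Fin n → Fin N) : isoProj N n χ A a b ∈ B := by
  rw [isoProj, Matrix.smul_apply, Matrix.sum_apply]
  refine Subalgebra.smul_mem _ (sum_mem fun σ _ => ?_) _
  rw [Matrix.smul_apply, permMat, Matrix.of_apply]
  refine zsmul_mem ?_ _
  split_ifs
  exacts [one_mem _, zero_mem _]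

theorem isoProj_mul_swap {A : Type*} [Ring A] [Algebra Scal A]
    (hs : ∀ i j : Fin n, i ≠ j → ((χ (Equiv.swap i j) : ℤˣ) : ℤ) = s) (i j : Fin n) (hij : i ≠ j) :
    isoProj N n χ A * permMat (Equiv.swap i j) = s • isoProj N n χ A := by
  rw [isoProj_mul_permMat, hs i j hij]

theorem stable_of_swap {A : Type*} [Ring A] [Algebra Scal A]
    (hs : ∀ i j : Fin n, i ≠ j → ((χ (Equiv.swap i j) : ℤˣ) : ℤ) = s) {l : List (Fin n)}
    (hl : ∀ i, i ∈ l) {Z : Mat[N, n] A}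
    (h : ∀ i ∈ l, ∀ j ∈ l, i ≠ j → Z * permMat (Equiv.swap i j) = s • Z) :
    Z = Z * isoProj N n χ A :=
  (mul_isoProj_of_forall χ (mul_permMat_of_swap fun i j hij => by
    rw [h i (hl i) j (hl j) hij, hs i j hij])).symm

theorem chain_points (s : ℤ) (β : ℂ) : (List.finRange n).IsChain fun i j : Fin n =>
    (s * (i : ℕ) + β : ℂ) - (s * (j : ℕ) + β) = -s :=
  (isChain_finRange n).imp fun i j hij => by rw [hij]; ring

theorem chain_points_reverse (s : ℤ) (β : ℂ) : (List.finRange n).reverse.IsChain fun i j : Fin n =>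
    (-(s * (i : ℕ)) + β : ℂ) - (-(s * (j : ℕ)) + β) = -s := by
  rw [List.isChain_reverse]
  exact (isChain_finRange n).imp fun i j hij => by
    rw [hij]; ring

theorem hatT_stable (hs1 : s * s = 1)
    (hs : ∀ i j : Fin n, i ≠ j → ((χ (Equiv.swap i j) : ℤˣ) : ℤ) = s) :
    isoProj N n χ (HatDY N c)⟦X⟧ *
        ((List.finRange n).map fun i => leg i (hatT N c 1 (s * (i : ℕ)))).prod =
      isoProj N n χ _ * ((List.finRange n).map fun i => leg i (hatT N c 1 (s * (i : ℕ)))).prod *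
        isoProj N n χ _ :=
  stable_of_swap hs List.mem_finRange (pointRel_hat.proj_mul_swap hs1 (by norm_num)
    (List.nodup_finRange n) ((chain_points s 0).imp fun i j h => by simpa using h)
    fun i _ j _ => isoProj_mul_swap hs i j)

theorem hatS_stable (hs1 : s * s = 1)
    (hs : ∀ i j : Fin n, i ≠ j → ((χ (Equiv.swap i j) : ℤˣ) : ℤ) = s) :
    isoProj N n χ (HatDY N c)⟦X⟧ *
        ((List.finRange n).map fun i => leg i (hatS N c (-1) (-(s * (i : ℕ))))).prod =
      isoProj N n χ _ * ((List.finRange n).map fun i => leg i (hatS N c (-1) (-(s * (i : ℕ))))).prod *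
        isoProj N n χ _ :=
  stable_of_swap hs List.mem_finRange (pointRel_hat.proj_mul_swap_inv hatT_mul_hatS hatS_mul_hatT hs1
    (by norm_num) (List.nodup_finRange n) ((chain_points s 0).imp fun i j h => by
      rw [← h]; ring) fun i _ j _ => isoProj_mul_swap hs i j)

theorem dyT_stable (hs1 : s * s = 1)
    (hs : ∀ i j : Fin n, i ≠ j → ((χ (Equiv.swap i j) : ℤˣ) : ℤ) = s) :
    isoProj N n χ (DY N c)⟦X⟧ *
        ((List.finRange n).reverse.map fun i => leg i (dyT N c (-1) (-(s * (i : ℕ)) - c / 2))).prod =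
      isoProj N n χ _ *
        ((List.finRange n).reverse.map fun i => leg i (dyT N c (-1) (-(s * (i : ℕ)) - c / 2))).prod *
        isoProj N n χ _ :=
  stable_of_swap hs (fun i => List.mem_reverse.2 (List.mem_finRange i))
    (pointRel_dy.proj_mul_swap hs1 (by norm_num) (List.nodup_reverse.2 (List.nodup_finRange n))
      ((chain_points_reverse s (-(c / 2))).imp fun i j h => by rw [← h]; ring)
      fun i _ j _ => isoProj_mul_swap hs i j)

theorem dyS_stable (hs1 : s * s = 1)
    (hs : ∀ i j : Fin n, i ≠ j → ((χ (Equiv.swap i j) : ℤˣ) : ℤ) = s) :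
    isoProj N n χ (DY N c)⟦X⟧ *
        ((List.finRange n).reverse.map fun i => leg i (dyS N c 1 (s * (i : ℕ) + 3 * c / 2))).prod =
      isoProj N n χ _ *
        ((List.finRange n).reverse.map fun i => leg i (dyS N c 1 (s * (i : ℕ) + 3 * c / 2))).prod *
        isoProj N n χ _ :=
  stable_of_swap hs (fun i => List.mem_reverse.2 (List.mem_finRange i))
    (pointRel_dy.proj_mul_swap_inv dyT_mul_dyS dyS_mul_dyT hs1 (by norm_num)
      (List.nodup_reverse.2 (List.nodup_finRange n))
      ((chain_points_reverse s 0).imp fun i j h => by rw [← h]; ring)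
      fun i _ j _ => isoProj_mul_swap hs i j)

/-- The projection of the series in `u` has coefficients in the closure of the reflection algebra.
-/
theorem proj_plusPart_mem (hs1 : s * s = 1)
    (hs : ∀ i j : Fin n, i ≠ j → ((χ (Equiv.swap i j) : ℤˣ) : ℤ) = s)
    (hg : g * g = 1) (hG : gMat N M (HatDY N c) = g • 1) (a b : Fin n → Fin N) :
    (isoProj N n χ _ * matSer (plusPart N c n s) :
      Mat[N, n] (HatDY N c)⟦X⟧) a b ∈ aSeries (AlgHom.id Scal (HatDY N c)) M := by
  have h := pointRel_hat.proj_fused_mem (n := n) hatT_mul_hatS hatS_mul_hatT hs1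
    (ε := 1) (by norm_num) (α := fun i => (s * (i : ℕ) : ℂ)) (c₀ := 0)
    (aSeries (AlgHom.id Scal (HatDY N c)) M) (X_mem_aSeries _) (Subalgebra.algebraMap_mem _ _)
    (fun β f => mem_aSeries_of_mul) (fun k i j => hatT_mul_hatS_mem hg hG _ i j)
    (isoProj_apply_mem (χ := χ) _) (isoProj_mul_swap hs) (List.finRange n) (List.nodup_finRange n)
    ((chain_points s 0).imp fun i j h => by simpa using h) a b
  rw [matSer_plusPart]
  simpa only [zero_sub] using h

/-- The projection of the series in `u⁻¹` has coefficients in the closure of the reflection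
algebra. Here the points `-w_i - c / 2` and `w_i + 3 c / 2` add up to `c`. -/
theorem proj_minusPart_mem (hc : 2 * c = -(N : ℂ)) (hs1 : s * s = 1)
    (hs : ∀ i j : Fin n, i ≠ j → ((χ (Equiv.swap i j) : ℤˣ) : ℤ) = s)
    (hg : g * g = 1) (hG : gMat N M (DY N c) = g • 1) (a b : Fin n → Fin N) :
    (isoProj N n χ _ * matSer (minusPart N c n s) :
      Mat[N, n] (DY N c)⟦X⟧) a b ∈ aSeries (toHat N c) M := by
  have h := pointRel_dy.proj_fused_mem (n := n) dyT_mul_dyS dyS_mul_dyT hs1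
    (ε := -1) (by norm_num) (α := fun i => (-(s * (i : ℕ)) - c / 2 : ℂ)) (c₀ := c)
    (aSeries (toHat N c) M) (one_mem _)
    (mul_mem (Subalgebra.algebraMap_mem _ _) (X_mem_aSeries _))
    (fun β f => mem_aSeries_of_mul' (toHat N c)) (fun k i j => dyT_mul_dyS_mem hg hG _ i j)
    (isoProj_apply_mem (χ := χ) _) (isoProj_mul_swap hs) (List.finRange n).reverse
    (List.nodup_reverse.2 (List.nodup_finRange n))
    ((chain_points_reverse s (-(c / 2))).imp fun i j h => by rw [← h]; ring) a b
  rw [matSer_minusPart hc]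
  have e : ∀ i : Fin n, c - (-(s * (i : ℕ)) - c / 2) = s * (i : ℕ) + 3 * c / 2 := fun i => by ring
  simpa only [e, neg_neg] using h

end Parts

open PowerSeries

/-! ### Local finiteness of the products of the matrices `T(u)` -/

section LocalFinite

variable {N n m : ℕ}

theorem one_sub_tAt_pow {D : Type} [Ring D] [Algebra Scal D] (hm : algebraMap Scal D hh ^ m = 0)
    (x : Gen N → D) (ε : ℤ) (α : ℂ) : (1 - tAt x ε α) ^ m = 0 := by
  set φ := moebHom ε (kap D α) (kap_comm α) with hφ
  let Y : Mat[N] D⟦X⟧ :=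
    Matrix.of fun i j => mk fun r => prev (fun r => x (Gen.pos i j r)) r
  have h1 : tMat x = 1 + hh • Y := by
    refine Matrix.ext fun i j => PowerSeries.ext fun r => ?_
    rw [tMat, Matrix.of_apply, coeff_mk, Matrix.add_apply, Matrix.smul_apply, map_add,
      Matrix.one_apply, apply_ite (coeff r), coeff_one, map_zero, Algebra.smul_def,
      algebraMap_series, coeff_C_mul, ← Algebra.smul_def,
      show coeff r (Y i j) = prev (fun r => x (Gen.pos i j r)) r by simp [Y]]
    cases r with
    | zero => rw [tOf, prev, smul_zero, add_zero, Matrix.one_apply, if_pos rfl]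
    | succ r => simp [tOf, prev]
  have h2 : tAt x ε α = 1 + hh • Y.map φ := by
    rw [tAt, h1]
    refine Matrix.ext fun i j => ?_
    rw [Matrix.map_apply, Matrix.add_apply, Matrix.smul_apply, map_add, Algebra.smul_def, map_mul,
      algebraMap_series, moebHom_C, ← algebraMap_series, ← Algebra.smul_def, Matrix.add_apply,
      Matrix.smul_apply, Matrix.map_apply, Matrix.one_apply, apply_ite φ, map_one, map_zero]
  rw [h2, sub_add_cancel_left, ← smul_neg, smul_pow]
  refine Matrix.ext fun i j => ?_
  rw [Matrix.smul_apply, Algebra.smul_def, map_pow, algebraMap_series_pow hm, zero_mul,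
    Matrix.zero_apply]

section FinSer

variable (W : Type) [AddCommGroup W] [Module Scal W]

/-- The power series with coefficients in the operators on `W` which are locally finite. -/
def finSer : Subring (Op W)⟦X⟧ := (locFin W).toSubring.comap iotaP

variable {W}

theorem mem_finSer {f : (Op W)⟦X⟧} :
    f ∈ finSer W ↔ ∀ w, {l | coeff l f w ≠ 0}.Finite := by
  refine ⟨fun h w => ?_, fun h => mem_locFin_iotaP h⟩
  refine ((h w).preimage (f := ((↑) : ℕ → ℤ)) Nat.cast_injective.injOn).subset fun l hl => ?_
  change (iotaP f).coeff (l : ℤ) w ≠ 0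
  rw [coeff_iotaP, if_pos (Int.natCast_nonneg l), Int.toNat_natCast]
  exact hl

theorem leg_mem_matrix {A : Type*} [Ring A] (S : Subring A) {X : Mat[N] A}
    (h : X ∈ S.matrix) (k : Fin n) : leg k X ∈ (S.matrix : Subring (Mat[N, n] A)) := by
  intro a b
  rw [leg_apply]
  split_ifs
  exacts [h _ _, zero_mem _]

end FinSer

variable {c : ℂ}

theorem mul_mem_nbhd_left (p m : ℕ) (a x : DY N c) (h : x ∈ DY.nbhd N c p m) :
    a * x ∈ DY.nbhd N c p m := DY.mul_mem_nbhd a h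

theorem hPow_le_nbhd (p m : ℕ) : DY.hPow N c m ≤ DY.nbhd N c p m := le_sup_right

variable {p : ℕ}

theorem tAt_mem_finSer (ε : ℤ) (α : ℂ) :
    tAt (genOp (DY.nbhd N c p m) (mul_mem_nbhd_left p m)) ε α ∈ (finSer _).matrix := by
  intro i j
  refine mem_finSer.2 fun w => ?_
  obtain ⟨y, rfl⟩ := Submodule.mkQ_surjective _ w
  obtain ⟨r₀, hr₀⟩ := decays y p m i j
  refine (Set.finite_lt_nat (r₀ + m + 1)).subset fun a ha => ?_
  by_contra hlt
  rw [Set.mem_ofPred_eq, not_lt] at hlt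
  refine ha ?_
  rw [tAt, Matrix.map_apply, coeff_moebHom, LinearMap.sum_apply]
  refine Finset.sum_eq_zero fun r hr => ?_
  rw [LinearMap.smul_apply, Module.End.mul_apply]
  by_cases hra : r₀ + 1 ≤ r
  · obtain ⟨r, rfl⟩ := Nat.exists_eq_add_of_le' hra
    have h1 : tOf (genOp (DY.nbhd N c p m) (mul_mem_nbhd_left p m)) (r + (r₀ + 1)) i j
        ((DY.nbhd N c p m).mkQ y) = 0 := by
      change hh • (DY.nbhd N c p m).mkQ (DY.gen N c (Gen.pos i j (r + r₀)) * y) = 0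
      rw [Submodule.mkQ_apply, (Submodule.Quotient.mk_eq_zero _).2 (hr₀ _ (Nat.le_add_left _ _)),
        smul_zero]
    rw [tMat, Matrix.of_apply, coeff_mk, h1, map_zero, smul_zero]
  · have h2 : kap (Op (DY N c ⧸ DY.nbhd N c p m)) α ^ (a - r) = 0 :=
      pow_eq_zero_of_le (by omega)
        (kap_pow (actOn_hh_pow (mul_mem_nbhd_left p m) (hPow_le_nbhd p m)) α)
    rw [h2, LinearMap.zero_apply, smul_zero]

theorem dyS_map_mem_finSer (ε : ℤ) (α : ℂ) :
    (dyS N c ε α).map (PowerSeries.map (actOn (DY.nbhd N c p m) (mul_mem_nbhd_left p m) :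
      DY N c →+* Op (DY N c ⧸ DY.nbhd N c p m))) ∈ (finSer _).matrix := by
  set Φ : (DY N c)⟦X⟧ →+* PowerSeries (Op (DY N c ⧸ DY.nbhd N c p m)) :=
    PowerSeries.map (actOn (DY.nbhd N c p m) (mul_mem_nbhd_left p m) : DY N c →+* _)
  set T := tAt (genOp (DY.nbhd N c p m) (mul_mem_nbhd_left p m)) ε α with hT
  have h1 : T * Φ.mapMatrix (dyS N c ε α) = 1 := by
    rw [hT, ← dyT_map]
    change Φ.mapMatrix _ * _ = 1
    rw [← map_mul, dyT_mul_dyS, map_one]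
  -- the inverse of `T = 1 - (1 - T)` is a finite geometric sum
  have h2 : (∑ k ∈ Finset.range m, (1 - T) ^ k) * T = 1 := by
    have := geom_sum_mul_neg (1 - T) m
    rwa [sub_sub_cancel, hT, one_sub_tAt_pow (actOn_hh_pow (mul_mem_nbhd_left p m)
      (hPow_le_nbhd p m)), sub_zero, ← hT] at this
  have h3 := right_inverse_unique h1 h2
  change Φ.mapMatrix (dyS N c ε α) ∈ _
  rw [h3]
  exact sum_mem fun k _ => pow_mem (sub_mem (one_mem _) (tAt_mem_finSer ε α)) k

/-- The series in `u⁻¹` of the trace formula are locally finite on the quotients by the left ideals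
which define the topology. -/
theorem minusPart_map_mem_finSer (hc : 2 * c = -(N : ℂ)) (s : ℂ) (a b : Fin n → Fin N) :
    PowerSeries.map (actOn (DY.nbhd N c p m) (mul_mem_nbhd_left p m) :
      DY N c →+* Op (DY N c ⧸ DY.nbhd N c p m)) (matSer (minusPart N c n s) a b) ∈ finSer _ := by
  set Φ : (DY N c)⟦X⟧ →+* PowerSeries (Op (DY N c ⧸ DY.nbhd N c p m)) :=
    PowerSeries.map (actOn (DY.nbhd N c p m) (mul_mem_nbhd_left p m) : DY N c →+* _) with hΦ
  have h : Φ.mapMatrix (matSer (minusPart N c n s)) ∈ (finSer _).matrix := by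
    rw [matSer_minusPart hc, map_mul, map_list_prod, map_list_prod, List.map_map, List.map_map]
    refine mul_mem (list_prod_mem fun x hx => ?_) (list_prod_mem fun x hx => ?_)
    · obtain ⟨i, -, rfl⟩ := List.mem_map.1 hx
      change (leg i _).map Φ ∈ _
      rw [leg_map, dyT_map]
      exact leg_mem_matrix _ (tAt_mem_finSer _ _) i
    · obtain ⟨i, -, rfl⟩ := List.mem_map.1 hx
      change (leg i _).map Φ ∈ _
      rw [leg_map]
      exact leg_mem_matrix _ (dyS_map_mem_finSer _ _) i
  exact h a b

end LocalFinite

open UniformSpace (Completion)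

/-! ### The completed double Yangian -/

section Tilde

variable {N : ℕ} {c : ℂ}

/-- The map `a ↦ a x` from the double Yangian to its quotient by a neighbourhood of zero. -/
def evalHom₀ (x : DY N c) (p m : ℕ) : IDY N c →+ DY N c ⧸ DY.nbhd N c p m :=
  ((DY.nbhd N c p m).mkQ ∘ₗ LinearMap.mulRight Scal x).toAddMonoidHom

theorem continuous_evalHom₀ (x : DY N c) (p m : ℕ) [TopologicalSpace (DY N c ⧸ DY.nbhd N c p m)]
    [DiscreteTopology (DY N c ⧸ DY.nbhd N c p m)] : Continuous (evalHom₀ x p m) := by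
  have : ContinuousAdd (DY N c ⧸ DY.nbhd N c p m) := ⟨continuous_of_discreteTopology⟩
  have : IsTopologicalAddGroup (DY N c ⧸ DY.nbhd N c p m) :=
    { continuous_neg := continuous_of_discreteTopology }
  refine continuous_of_continuousAt_zero (evalHom₀ x p m) ?_
  rw [ContinuousAt, map_zero, nhds_discrete (DY N c ⧸ DY.nbhd N c p m), Filter.tendsto_pure]
  refine Filter.mem_of_superset ((DY.iBasis N c).hasBasis_nhds_zero.mem_of_mem
    (i := ({x}, p, m)) trivial) fun a ha => ?_
  exact (Submodule.Quotient.mk_eq_zero _).2 (ha x (Finset.mem_singleton_self x))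

/-- The action of the completed double Yangian on the class of `x` in the quotient by a neighbourhood
of zero. -/
def tildeEval (x : DY N c) (p m : ℕ) : TildeDY N c →+ DY N c ⧸ DY.nbhd N c p m :=
  letI : UniformSpace (DY N c ⧸ DY.nbhd N c p m) := ⊥
  haveI : DiscreteUniformity (DY N c ⧸ DY.nbhd N c p m) := ⟨rfl⟩
  haveI : IsUniformAddGroup (DY N c ⧸ DY.nbhd N c p m) :=
    ⟨DiscreteUniformity.uniformContinuous _ _⟩
  AddMonoidHom.extension (α := IDY N c) (evalHom₀ x p m) (continuous_evalHom₀ x p m)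

theorem tildeEval_toTilde (x : DY N c) (p m : ℕ) (a : DY N c) :
    tildeEval x p m (toTilde N c a) = (DY.nbhd N c p m).mkQ (a * x) := by
  let : UniformSpace (DY N c ⧸ DY.nbhd N c p m) := ⊥
  have : DiscreteUniformity (DY N c ⧸ DY.nbhd N c p m) := ⟨rfl⟩
  have : IsUniformAddGroup (DY N c ⧸ DY.nbhd N c p m) :=
    ⟨DiscreteUniformity.uniformContinuous _ _⟩
  exact AddMonoidHom.extension_coe (α := IDY N c) (evalHom₀ x p m) (continuous_evalHom₀ x p m) a

theorem isClopen_tildeEval (x : DY N c) (p m : ℕ) (S : Set (DY N c ⧸ DY.nbhd N c p m)) :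
    IsClopen {z | tildeEval x p m z ∈ S} := by
  let : UniformSpace (DY N c ⧸ DY.nbhd N c p m) := ⊥
  have : DiscreteUniformity (DY N c ⧸ DY.nbhd N c p m) := ⟨rfl⟩
  have hc : Continuous (tildeEval x p m) := Completion.continuous_extension
  exact (isClopen_discrete S).preimage hc

/-- A closed property holds on the completed double Yangian if it holds on the image of the double
Yangian. -/
theorem tilde_induction {P : TildeDY N c → Prop} (hP : IsClosed {z | P z})
    (h : ∀ a : DY N c, P (toTilde N c a)) (z : TildeDY N c) : P z :=
  Completion.induction_on z hP h

theorem hat_induction {P : HatDY N c → Prop} (hP : IsClosed {z | P z})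
    (h : ∀ a : DY N c, P (toHat N c a)) (z : HatDY N c) : P z :=
  Completion.induction_on z hP h

/-- Every neighbourhood of zero contains the common kernel of finitely many of the maps `tildeEval
x p m`. -/
theorem exists_tildeEval_of_nhds {V : Set (TildeDY N c)} (hV : V ∈ nhds 0) :
    ∃ (s : Finset (DY N c)) (p m : ℕ), ∀ z, (∀ x ∈ s, tildeEval x p m z = 0) → z ∈ V := by
  obtain ⟨U, ⟨hU, hUc⟩, hUV⟩ := (closed_nhds_basis (0 : TildeDY N c)).mem_iff.1 hV
  have h0 : (fun x : IDY N c => (x : TildeDY N c)) ⁻¹' U ∈ nhds (0 : IDY N c) :=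
    (Completion.continuous_coe _).continuousAt.preimage_mem_nhds (by
      rw [Completion.coe_zero]; exact hU)
  obtain ⟨⟨s, p, m⟩, -, hm⟩ := (DY.iBasis N c).hasBasis_nhds_zero.mem_iff.1 h0
  refine ⟨s, p, m, fun z hz => hUV ?_⟩
  revert hz
  refine tilde_induction (P := fun z => (∀ x ∈ s, tildeEval x p m z = 0) → z ∈ U) ?_
    (fun a ha => hm fun x hx => ?_) z
  · have e : {z : TildeDY N c | (∀ x ∈ s, tildeEval x p m z = 0) → z ∈ U} =
        (⋃ x ∈ s, {z | tildeEval x p m z ∈ ({0}ᶜ : Set _)}) ∪ U := by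
      ext z
      simp only [Set.mem_ofPred_eq, Set.mem_union, Set.mem_iUnion, Set.mem_compl_iff,
        Set.mem_singleton_iff, exists_prop]
      constructor
      · intro h
        by_cases hz : ∀ x ∈ s, tildeEval x p m z = 0
        · exact Or.inr (h hz)
        · push Not at hz
          exact Or.inl hz
      · rintro (⟨x, hx, h⟩ | h) h'
        · exact absurd (h' x hx) h
        · exact h
    rw [e]
    exact (isClosed_biUnion_finset fun x _ => (isClopen_tildeEval x p m _).isClosed).union hUc
  · have := ha x hx
    rw [tildeEval_toTilde] at this
    exact (Submodule.Quotient.mk_eq_zero _).1 this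

theorem eq_zero_of_tildeEval {z : TildeDY N c} (h : ∀ x p m, tildeEval x p m z = 0) : z = 0 := by
  by_contra hz
  obtain ⟨s, p, m, hs⟩ := exists_tildeEval_of_nhds
    (isOpen_compl_singleton.mem_nhds (Ne.symm hz) : ({z}ᶜ : Set (TildeDY N c)) ∈ nhds 0)
  exact hs z (fun x _ => h x p m) rfl

/-- The completed double Yangian has no `h`-torsion. -/
theorem tilde_eq_zero_of_smul {z : TildeDY N c} (h : hh • z = 0) : z = 0 := by
  refine eq_zero_of_tildeEval fun x p m => ?_
  have key : tildeEval x p (m + 1) (hh • z) = 0 → tildeEval x p m z = 0 := by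
    refine tilde_induction (P := fun z => tildeEval x p (m + 1) (hh • z) = 0 →
      tildeEval x p m z = 0) ?_ (fun a ha => ?_) z
    · have e : {z : TildeDY N c | tildeEval x p (m + 1) (hh • z) = 0 → tildeEval x p m z = 0} =
          (hh • ·) ⁻¹' {z | tildeEval x p (m + 1) z ∈ ({0}ᶜ : Set _)} ∪
            {z | tildeEval x p m z ∈ ({0} : Set _)} := by
        ext z
        simp only [Set.mem_ofPred_eq, Set.mem_union, Set.mem_preimage, Set.mem_compl_iff,
          Set.mem_singleton_iff]
        tauto
      rw [e]
      exact ((isClopen_tildeEval x p (m + 1) _).isClosed.preimage (continuous_const_smul _)).union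
        (isClopen_tildeEval x p m _).isClosed
    · rw [← map_smul, tildeEval_toTilde, smul_mul_assoc] at ha
      rw [tildeEval_toTilde]
      exact (Submodule.Quotient.mk_eq_zero _).2
        (DY.mem_nbhd_of_smul ((Submodule.Quotient.mk_eq_zero _).1 ha))
  exact key (by rw [h, map_zero])

theorem tilde_eq_zero_of_pow_smul {z : TildeDY N c} {n : ℕ} (h : hh ^ n • z = 0) : z = 0 := by
  induction n with
  | zero => simpa using h
  | succ n ih =>
    rw [pow_succ', mul_smul] at h
    exact ih (tilde_eq_zero_of_smul h)

/-- The action of the `h`-adic completion on the quotient by a neighbourhood of zero. -/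
def nbhdAct (N : ℕ) (c : ℂ) (p m : ℕ) : HatDY N c →+* Op (DY N c ⧸ DY.nbhd N c p m) :=
  hatAct (DY.nbhd N c p m) (mul_mem_nbhd_left p m) (hPow_le_nbhd p m)

theorem isClopen_nbhdAct (p m : ℕ) (S : Set (Op (DY N c ⧸ DY.nbhd N c p m))) :
    IsClopen {v | nbhdAct N c p m v ∈ S} := isClopen_hatAct _ _ S

theorem tildeEval_mul (x : DY N c) (p m : ℕ) (v : HatDY N c) (z : TildeDY N c) :
    tildeEval x p m (hatToTilde N c v * z) = nbhdAct N c p m v (tildeEval x p m z) := by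
  refine tilde_induction (P := fun z => tildeEval x p m (hatToTilde N c v * z) =
    nbhdAct N c p m v (tildeEval x p m z)) ?_ (fun y => ?_) z
  · let : UniformSpace (DY N c ⧸ DY.nbhd N c p m) := ⊥
    have : DiscreteUniformity (DY N c ⧸ DY.nbhd N c p m) := ⟨rfl⟩
    have hc : Continuous (tildeEval x p m) := Completion.continuous_extension
    exact isClosed_eq (hc.comp (continuous_const_mul _))
      ((continuous_of_discreteTopology (f := nbhdAct N c p m v)).comp hc)
  · refine hat_induction (P := fun v => tildeEval x p m (hatToTilde N c v * toTilde N c y) =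
      nbhdAct N c p m v (tildeEval x p m (toTilde N c y))) ?_ (fun a => ?_) v
    · let : UniformSpace (DY N c ⧸ DY.nbhd N c p m) := ⊥
      have : DiscreteUniformity (DY N c ⧸ DY.nbhd N c p m) := ⟨rfl⟩
      have hc : Continuous (tildeEval x p m) := Completion.continuous_extension
      have hτ : Continuous (hatToTilde N c) := Completion.continuous_map
      refine isClosed_eq (hc.comp (hτ.mul continuous_const)) ?_
      refine continuous_discrete_rng.2 fun w => ?_
      exact (isClopen_nbhdAct p m {f | f (tildeEval x p m (toTilde N c y)) = w}).isOpen
    · rw [hatToTilde_toHat, ← map_mul, tildeEval_toTilde, tildeEval_toTilde, nbhdAct, hatAct_toHat,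
        actOn_mk, mul_assoc]

theorem tildeEval_hatToTilde (x : DY N c) (p m : ℕ) (v : HatDY N c) :
    tildeEval x p m (hatToTilde N c v) = nbhdAct N c p m v ((DY.nbhd N c p m).mkQ x) := by
  have h := tildeEval_mul x p m v 1
  have h1 : tildeEval x p m 1 = (DY.nbhd N c p m).mkQ x := by
    rw [← map_one (toTilde N c), tildeEval_toTilde, one_mul]
  rwa [mul_one, h1] at h

/-- A series converges in the completed double Yangian if its image in each of the quotients by the
neighbourhoods of zero is finite. -/
theorem summable_of_tildeEval {f : ℕ → TildeDY N c}
    (h : ∀ x p m, {l | tildeEval x p m (f l) ≠ 0}.Finite) : Summable f := by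
  refine NonarchimedeanAddGroup.summable_of_tendsto_cofinite_zero fun V hV => ?_
  obtain ⟨s, p, m, hs⟩ := exists_tildeEval_of_nhds hV
  refine Filter.mem_map.2 (Filter.mem_cofinite.2 ?_)
  refine (s.finite_toSet.biUnion fun x _ => h x p m).subset fun l hl => ?_
  by_contra h'
  refine hl (hs _ fun x hx => ?_)
  by_contra h0
  exact h' (Set.mem_biUnion hx h0)

theorem exists_tildeEval_eq_sum {f : ℕ → TildeDY N c} {z : TildeDY N c} (h : HasSum f z)
    (x : DY N c) (p m : ℕ) :
    ∃ L₀, ∀ L, L₀ ≤ L → tildeEval x p m z = ∑ l ∈ Finset.range L, tildeEval x p m (f l) := by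
  have ho := (isClopen_tildeEval x p m {tildeEval x p m z}).isOpen.mem_nhds
    (show z ∈ {y | tildeEval x p m y ∈ ({tildeEval x p m z} : Set _)} from rfl)
  obtain ⟨L₀, hL⟩ := Filter.mem_atTop_sets.1 (h.tendsto_sum_nat ho)
  refine ⟨L₀, fun L hLL => ?_⟩
  rw [← map_sum]
  exact (hL L hLL).symm

end Tilde

/-! ### Commutation with the reflection subalgebra -/

section Centre

variable {N : ℕ} {c : ℂ} {M : ℕ} {g : ℤ}

/-- Since there is no torsion, powers of `h` can be cancelled in a commutation relation. -/
theorem commute_of_smul {v : HatDY N c} {z : TildeDY N c} {n : ℕ}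
    (h : hatToTilde N c (hh ^ n • v) * z = z * hatToTilde N c (hh ^ n • v)) :
    hatToTilde N c v * z = z * hatToTilde N c v := by
  rw [map_smul, smul_mul_assoc, mul_smul_comm, ← sub_eq_zero, ← smul_sub] at h
  exact sub_eq_zero.1 (tilde_eq_zero_of_pow_smul h)

/-- An element which commutes with the coefficients of the two generating matrices of the reflection
subalgebra commutes with the completed algebra. -/
theorem commute_aTilde (hG : ∀ (A : Type) [Ring A], gMat N M A = g • 1) {z : TildeDY N c}
    (hp : ∀ r i j, hatToTilde N c (PowerSeries.coeff r (hatB N c i j)) * z =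
      z * hatToTilde N c (PowerSeries.coeff r (hatB N c i j)))
    (hm : ∀ r i j, toTilde N c (PowerSeries.coeff r (dyB N c i j)) * z =
      z * toTilde N c (PowerSeries.coeff r (dyB N c i j)))
    {y : TildeDY N c} (hy : y ∈ aTilde N c M) : y * z = z * y := by
  let Z : Subalgebra Scal (TildeDY N c) := Subalgebra.centralizer Scal {z}
  have hZ : ∀ {y}, y ∈ Z ↔ y * z = z * y := fun {y} => by
    rw [Subalgebra.mem_centralizer_iff]
    simp [eq_comm]
  have h1 : aPrime N c M ≤ Z.comap (hatToTilde N c) := by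
    refine Algebra.adjoin_le ?_
    rintro b (⟨i, j, r, hb⟩ | ⟨i, j, r, hb⟩)
    · refine hZ.2 (commute_of_smul (n := 1) (hZ.1 ?_))
      rw [coeff_bpSeries (hG _)] at hb
      have e : hh ^ 1 • b = (if r = 0 then gMat N M (HatDY N c) i j else 0) -
          g • PowerSeries.coeff r (hatB N c i j) := by rw [hb, sub_sub_cancel, pow_one]
      rw [e, map_sub, map_zsmul]
      refine sub_mem ?_ (zsmul_mem (hZ.2 (hp r i j)) g)
      rw [hG, Matrix.smul_apply, Matrix.one_apply]
      split_ifs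
      · rw [map_zsmul, map_one]
        exact zsmul_mem (one_mem _) _
      · rw [smul_zero, map_zero]
        exact zero_mem _
      · rw [map_zero]
        exact zero_mem _
    · refine hZ.2 (commute_of_smul (n := 1) (hZ.1 ?_))
      rw [pow_one, ← hb, hatToTilde_toHat, coeff_bSeries (hG _), map_zsmul]
      exact zsmul_mem (hZ.2 (hm _ i j)) g
  have h2 : (aAlg N c M).map (hatToTilde N c) ≤ Z := by
    rintro _ ⟨v, ⟨n, hn⟩, rfl⟩
    exact hZ.2 (commute_of_smul (hZ.1 (h1 hn)))
  exact hZ.1 (Subalgebra.topologicalClosure_minimal h2 (Set.isClosed_centralizer _) hy)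

end Centre

open PowerSeries

/-! ### The terms of the trace -/

section TraceTerm

variable {N n : ℕ} {c : ℂ} {χ : Equiv.Perm (Fin n) →* ℤˣ}

theorem isoProj_series {A : Type*} [Ring A] [Algebra Scal A] :
    isoProj N n χ A⟦X⟧ = (isoProj N n χ A).map PowerSeries.C :=
  (isoProj_ringHom_map χ fun s => (algebraMap_series s).symm).symm

theorem map_coeff_isoProj_mul {A : Type*} [Ring A] [Algebra Scal A]
    (Y : Mat[N, n] A⟦X⟧) (r : ℕ) :
    (isoProj N n χ _ * Y).map (coeff r) = isoProj N n χ A * Y.map (coeff r) := by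
  refine Matrix.ext fun a b => ?_
  rw [isoProj_series, Matrix.map_apply, Matrix.mul_apply, Matrix.mul_apply, map_sum]
  simp only [Matrix.map_apply, coeff_C_mul]

theorem map_coeff_mul_isoProj {A : Type*} [Ring A] [Algebra Scal A]
    (Y : Mat[N, n] A⟦X⟧) (r : ℕ) :
    (Y * isoProj N n χ _).map (coeff r) = Y.map (coeff r) * isoProj N n χ A := by
  refine Matrix.ext fun a b => ?_
  rw [isoProj_series, Matrix.map_apply, Matrix.mul_apply, Matrix.mul_apply, map_sum]
  simp only [Matrix.map_apply, coeff_mul_C]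

theorem matSer_map_coeff {I A : Type*} [Fintype I] [DecidableEq I] [Ring A]
    (F : PowerSeries (Matrix I I A)) (r : ℕ) : (matSer F).map (coeff r) = coeff r F :=
  Matrix.ext fun a b => coeff_matSer F a b r

theorem map_trace_mul {I A B : Type*} [Fintype I] [DecidableEq I] [Ring A] [Ring B] (φ : A →+* B)
    (X Y Z : Matrix I I A) :
    φ (Matrix.trace (X * Y * Z)) = Matrix.trace (X.map φ * Y.map φ * Z.map φ) := by
  have h : (X * Y * Z).map φ = X.map φ * Y.map φ * Z.map φ := by
    rw [Matrix.map_mul, Matrix.map_mul]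
  rw [← h]
  exact AddMonoidHom.map_trace φ _

/-- The terms of the trace, as elements of the `h`-adic completion. -/
def hatTerm (N n : ℕ) (c : ℂ) (χ : Equiv.Perm (Fin n) →* ℤˣ) (s : ℂ) (k : ℤ) (l : ℕ) : HatDY N c :=
  if 0 ≤ k + l then
    Matrix.trace (isoProj N n χ (HatDY N c) * coeff (k + l).toNat (plusPart N c n s) *
      (coeff l (minusPart N c n s)).map (toHat N c))
  else 0

theorem hatToTilde_hatTerm (s : ℂ) (k : ℤ) (l : ℕ) :
    hatToTilde N c (hatTerm N n c χ s k l) = traceTerm N c n (isoProj N n χ _) s k l := by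
  rw [hatTerm, traceTerm]
  split_ifs
  · refine (map_trace_mul (hatToTilde N c : HatDY N c →+* TildeDY N c) _ _ _).trans ?_
    congr 2
    · congr 1
      exact isoProj_ringHom_map χ (hatToTilde N c).commutes
    · exact Matrix.ext fun a b => hatToTilde_toHat N c _
  · exact map_zero _

/-- The action of the series in `u` on the quotient by a neighbourhood of zero. -/
def plusOp (N n : ℕ) (c : ℂ) (p m : ℕ) (s : ℂ) : Mat[N, n]
    (PowerSeries (Op (DY N c ⧸ DY.nbhd N c p m))) :=
  (PowerSeries.map (nbhdAct N c p m)).mapMatrix (matSer (plusPart N c n s))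

/-- The action of the double Yangian on the quotient by a neighbourhood of zero. -/
def nbhdOp (N : ℕ) (c : ℂ) (p m : ℕ) : DY N c →+* Op (DY N c ⧸ DY.nbhd N c p m) :=
  (actOn (DY.nbhd N c p m) (mul_mem_nbhd_left p m) : DY N c →+* _)

/-- The action of the series in `u⁻¹` on the quotient by a neighbourhood of zero. -/
def minusOp (N n : ℕ) (c : ℂ) (p m : ℕ) (s : ℂ) : Mat[N, n]
    (PowerSeries (Op (DY N c ⧸ DY.nbhd N c p m))) :=
  (PowerSeries.map (nbhdOp N c p m)).mapMatrix (matSer (minusPart N c n s))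

theorem nbhdAct_hatTerm (p m : ℕ) (s : ℂ) (k : ℤ) (l : ℕ) :
    nbhdAct N c p m (hatTerm N n c χ s k l) =
      traceOp χ (plusOp N n c p m s) (minusOp N n c p m s) k l := by
  rw [hatTerm, traceOp]
  split_ifs
  · rw [map_trace_mul]
    congr 2
    · congr 1
      · exact isoProj_ringHom_map χ fun r => hatAct_algebraMap _ _ r
      · refine Matrix.ext fun a b => ?_
        rw [plusOp, RingHom.mapMatrix_apply, Matrix.map_apply, Matrix.map_apply, Matrix.map_apply,
          coeff_map, coeff_matSer]
    · refine Matrix.ext fun a b => ?_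
      rw [minusOp, RingHom.mapMatrix_apply, Matrix.map_apply, Matrix.map_apply, Matrix.map_apply,
        Matrix.map_apply, coeff_map, coeff_matSer]
      exact hatAct_toHat _ _ _
  · exact map_zero _

theorem finite_minusOp (hc : 2 * c = -(N : ℂ)) (p m : ℕ) (s : ℂ) (a b : Fin n → Fin N)
    (w : DY N c ⧸ DY.nbhd N c p m) : {l | coeff l (minusOp N n c p m s a b) w ≠ 0}.Finite :=
  mem_finSer.1 (minusPart_map_mem_finSer hc s a b) w

theorem exists_minusOp_eq_zero (hc : 2 * c = -(N : ℂ)) (p m : ℕ) (s : ℂ)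
    (w : DY N c ⧸ DY.nbhd N c p m) :
    ∃ L, ∀ l, L ≤ l → ∀ a b : Fin n → Fin N, coeff l (minusOp N n c p m s a b) w = 0 := by
  have h : (⋃ a, ⋃ b, {l | coeff l (minusOp N n c p m s a b) w ≠ 0}).Finite :=
    Set.finite_iUnion fun a => Set.finite_iUnion fun b => finite_minusOp hc p m s a b w
  obtain ⟨L, hL⟩ := h.bddAbove
  refine ⟨L + 1, fun l hl a b => ?_⟩
  by_contra h0
  have := hL (Set.mem_iUnion₂.2 ⟨a, b, h0⟩)
  omega

theorem traceOp_eq_zero {W : Type} [AddCommGroup W] [Module Scal W]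
    {F K : Mat[N, n] (Op W)⟦X⟧} {l : ℕ} {w : W}
    (h : ∀ a b, coeff l (K a b) w = 0) (k : ℤ) : traceOp χ F K k l w = 0 := by
  rw [traceOp]
  split_ifs
  · rw [Matrix.trace, LinearMap.sum_apply]
    refine Finset.sum_eq_zero fun a _ => ?_
    rw [Matrix.diag_apply, Matrix.mul_apply, LinearMap.sum_apply]
    refine Finset.sum_eq_zero fun b _ => ?_
    rw [Module.End.mul_apply, Matrix.map_apply, h, map_zero]
  · rfl

/-- The infinite sums which define the coefficients converge. -/
theorem summable_hatTerm (hc : 2 * c = -(N : ℂ)) (s : ℂ) (k : ℤ) :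
    Summable fun l => hatToTilde N c (hatTerm N n c χ s k l) := by
  refine summable_of_tildeEval fun x p m => ?_
  obtain ⟨L, hL⟩ := exists_minusOp_eq_zero (n := n) hc p m s ((DY.nbhd N c p m).mkQ x)
  refine (Set.finite_lt_nat L).subset fun l hl => ?_
  by_contra h
  refine hl ?_
  rw [tildeEval_hatToTilde, nbhdAct_hatTerm]
  exact traceOp_eq_zero (hL l (not_lt.1 h)) k

variable {M : ℕ} {s g : ℤ}

/-- The terms of the trace belong to the closure of the reflection subalgebra: as the projection `E`
satisfies `E F = E F E`, the trace of `E F K` is that of the product of `E F` and `E K`. -/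
theorem hatTerm_mem (hc : 2 * c = -(N : ℂ)) (hs1 : s * s = 1)
    (hs : ∀ i j : Fin n, i ≠ j → ((χ (Equiv.swap i j) : ℤˣ) : ℤ) = s)
    (hg : g * g = 1) (hG : ∀ (A : Type) [Ring A], gMat N M A = g • 1) (k : ℤ) (l : ℕ) :
    hatTerm N n c χ s k l ∈ aClosure N c M := by
  rw [hatTerm]
  split_ifs
  swap
  · exact zero_mem _
  set r := (k + l).toNat
  have hF : isoProj N n χ _ * matSer (plusPart N c n s) =
      isoProj N n χ _ * matSer (plusPart N c n s) * isoProj N n χ _ := by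
    rw [matSer_plusPart]
    exact proj_mul_stable (hatT_stable hs1 hs) (hatS_stable hs1 hs)
  have hF' : isoProj N n χ (HatDY N c) * coeff r (plusPart N c n s) =
      isoProj N n χ _ * coeff r (plusPart N c n s) * isoProj N n χ _ := by
    have h := congrArg (fun Y => Matrix.map Y (coeff r)) hF
    simp only [map_coeff_mul_isoProj, map_coeff_isoProj_mul, matSer_map_coeff] at h
    exact h
  rw [hF', mul_assoc (_ * _), Matrix.trace]
  refine sum_mem fun a _ => ?_
  rw [Matrix.diag_apply, Matrix.mul_apply]
  refine sum_mem fun b _ => mul_mem ?_ ?_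
  · have h := proj_plusPart_mem (n := n) (c := c) hs1 hs hg (hG _) a b r
    rw [← matSer_map_coeff, ← map_coeff_isoProj_mul]
    exact h
  · have h := proj_minusPart_mem (n := n) hc hs1 hs hg (hG _) b a l
    have e : isoProj N n χ (HatDY N c) * (coeff l (minusPart N c n s)).map (toHat N c) =
        ((isoProj N n χ (DY N c)⟦X⟧ * matSer (minusPart N c n s)).map
          (coeff l)).map (toHat N c) := by
      rw [map_coeff_isoProj_mul, matSer_map_coeff, ← isoProj_map χ (toHat N c), Matrix.map_mul]
    rw [e]
    exact h

end TraceTerm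

/-! ### Commutation with the generating matrices -/

section TraceComm

variable {N n : ℕ} {c : ℂ} {χ : Equiv.Perm (Fin n) →* ℤˣ} {s : ℤ} {p m : ℕ}

theorem nbhd_pow (p m : ℕ) : algebraMap Scal (Op (DY N c ⧸ DY.nbhd N c p m)) hh ^ m = 0 :=
  actOn_hh_pow (mul_mem_nbhd_left p m) (hPow_le_nbhd p m)

/-- The generators of the double Yangian as operators on the quotient by a neighbourhood of zero. -/
abbrev nbhdGen (N : ℕ) (c : ℂ) (p m : ℕ) : Gen N → Op (DY N c ⧸ DY.nbhd N c p m) :=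
  genOp (DY.nbhd N c p m) (mul_mem_nbhd_left p m)

theorem map_leg_list_prod {A B : Type*} [Ring A] [Ring B] (Φ : A →+* B)
    (X : Fin n → Mat[N] A) (l : List (Fin n)) :
    Φ.mapMatrix (l.map fun i => leg i (X i)).prod = (l.map fun i => leg i ((X i).map Φ)).prod := by
  rw [map_list_prod, List.map_map]
  congr 1
  exact List.map_congr_left fun i _ => leg_map Φ i (X i)

theorem leg_list_inverse {A : Type*} [Ring A] {X Y : Fin n → Mat[N] A}
    (h : ∀ i, X i * Y i = 1) (l : List (Fin n)) :
    ((l.reverse.map fun i => leg i (X i)).prod * (l.map fun i => leg i (Y i)).prod :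
      Mat[N, n] A) = 1 :=
  list_prod_mul_inverse (fun i => by rw [← map_mul, h, map_one]) l

theorem stable_map {A B : Type*} [Ring A] [Ring B] [Algebra Scal A] [Algebra Scal B] {Φ : A →+* B}
    (hΦ : ∀ s : Scal, Φ (algebraMap Scal A s) = algebraMap Scal B s)
    {X : Mat[N, n] A}
    (h : isoProj N n χ A * X = isoProj N n χ A * X * isoProj N n χ A) :
    isoProj N n χ B * Φ.mapMatrix X = isoProj N n χ B * Φ.mapMatrix X * isoProj N n χ B := by
  rw [← isoProj_ringHom_map χ hΦ]
  change Φ.mapMatrix _ * _ = Φ.mapMatrix _ * _ * Φ.mapMatrix _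
  rw [← map_mul, ← map_mul, ← h]

theorem map_hatT (ε : ℤ) (α : ℂ) :
    (hatT N c ε α).map (PowerSeries.map (nbhdAct N c p m)) =
      tpAt (nbhd_pow p m) (nbhdGen N c p m) ε α :=
  hatT_map _ _ ε α

theorem map_dyT (ε : ℤ) (α : ℂ) :
    (dyT N c ε α).map (PowerSeries.map (nbhdOp N c p m)) = tAt (nbhdGen N c p m) ε α :=
  dyT_map _ ε α

/-- The coefficients of `t t'⁻¹` commute with the partial sums of the trace, if `t` and `t'` satisfy
exchange relations with the matrices `T⁺` and `T`. -/
theorem traceOp_comm (hN : N ≠ 0) (hc : 2 * c = -(N : ℂ)) (hs1 : s * s = 1)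
    (hs : ∀ i j : Fin n, i ≠ j → ((χ (Equiv.swap i j) : ℤˣ) : ℤ) = s)
    {t t' ti : Mat[N] (PowerSeries (Op (DY N c ⧸ DY.nbhd N c p m)))}
    (ht1 : t' * ti = 1) (ht2 : ti * t' = 1)
    {P Q : PowerSeries (OpRing (DY N c ⧸ DY.nbhd N c p m))}
    {pP qP : PowerSeries (LaurentSeries (Op (DY N c ⧸ DY.nbhd N c p m)))} {b b' δ : ℂ}
    (hδ : b + b' + 2 * δ = 0) (hp : PowerSeries.map (projP _) P = pP)
    (hq : PowerSeries.map (projP _) Q = qP)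
    (hp' : PowerSeries.map ((LocFin.val _).comp (projQ _)) P = pP)
    (hq' : PowerSeries.map ((LocFin.val _).comp (projQ _)) Q = qP)
    (zR : ZetaData (PowerSeries.C (uR _)) P Q)
    (zP : ZetaData (PowerSeries.C (projP _ (uR _))) pP qP)
    (zQ : ZetaData (PowerSeries.C (LocFin.val _ (projQ _ (uR _)))) pP qP)
    (zU : ZetaData (PowerSeries.C (projU _ (uR _))) (PowerSeries.map (projU _) P)
      (PowerSeries.map (projU _) Q))
    (LP : LegAux m (PowerSeries.C (projP _ (uR _))) pP qP b b' δ
      (fun ε α => legMat iotaP (tpAt (nbhd_pow p m) (nbhdGen N c p m) ε α))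
      (auxMat iotaP t) (auxMat iotaP t'))
    (LQ : LegAux m (PowerSeries.C (LocFin.val _ (projQ _ (uR _)))) pP qP b b' (δ + c / 2)
      (fun ε α => legMat iotaP (tAt (nbhdGen N c p m) ε α)) (auxMat iotaP t) (auxMat iotaP t'))
    (r : ℕ) (i j : Fin N) (k : ℤ) (w : DY N c ⧸ DY.nbhd N c p m) {L : ℕ}
    (hL : ∀ l, L ≤ l → ∀ a b, coeff l (minusOp N n c p m s a b) w = 0)
    (hL' : ∀ l, L ≤ l → ∀ a b,
      coeff l (minusOp N n c p m s a b) (coeff r ((t * ti) i j) w) = 0) :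
    coeff r ((t * ti) i j) (∑ l ∈ Finset.range L,
        traceOp χ (plusOp N n c p m s) (minusOp N n c p m s) k l w) =
      ∑ l ∈ Finset.range L, traceOp χ (plusOp N n c p m s) (minusOp N n c p m s) k l
        (coeff r ((t * ti) i j) w) := by
  have hH : ∀ a : Scal, PowerSeries.map (nbhdAct N c p m) (algebraMap Scal _ a) =
      algebraMap Scal _ a := map_algebraMap_series fun a => hatAct_algebraMap _ _ a
  have hD : ∀ a : Scal, PowerSeries.map (nbhdOp N c p m) (algebraMap Scal _ a) =
      algebraMap Scal _ a := map_algebraMap_series (actOn _ (mul_mem_nbhd_left p m)).commutes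
  have eH := fun X l => map_leg_list_prod (N := N) (n := n) (PowerSeries.map (nbhdAct N c p m)) X l
  have eD := fun X l => map_leg_list_prod (N := N) (n := n) (PowerSeries.map (nbhdOp N c p m)) X l
  refine trace_coeff_comm hN (nbhd_pow p m) hs hc
    (S := fun ε α => tpAt (nbhd_pow p m) (nbhdGen N c p m) ε α)
    (T := fun ε α => tAt (nbhdGen N c p m) ε α) ht1 ht2 hδ hp hq hp' hq' zR zP zQ zU LP LQ
    (Si := (PowerSeries.map (nbhdAct N c p m)).mapMatrix
      ((List.finRange n).map fun i => leg i (hatS N c (-1) (-(s * (i : ℕ))))).prod)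
    (Ti := (PowerSeries.map (nbhdOp N c p m)).mapMatrix
      ((List.finRange n).reverse.map fun i => leg i (dyS N c 1 (s * (i : ℕ) + 3 * c / 2))).prod)
    ?_ ?_ ?_ ?_ ?_ ?_ ?_ ?_ ?_ ?_ (finite_minusOp hc p m s) r i j k w hL hL'
  · simp only [← map_hatT]
    rw [← eH, ← map_mul, leg_list_inverse (fun _ => hatT_mul_hatS _ _), map_one]
  · simp only [← map_hatT]
    rw [← eH, ← map_mul]
    have := leg_list_inverse (n := n) (fun i : Fin n => hatS_mul_hatT (N := N) (c := c) (-1)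
      (-(s * (i : ℕ)))) (List.finRange n).reverse
    rw [List.reverse_reverse] at this
    rw [this, map_one]
  · simp only [← map_dyT]
    rw [← eD, ← map_mul]
    have := leg_list_inverse (n := n) (fun i : Fin n => dyT_mul_dyS (N := N) (c := c) 1
      (s * (i : ℕ) + 3 * c / 2)) (List.finRange n).reverse
    rw [List.reverse_reverse] at this
    rw [this, map_one]
  · simp only [← map_dyT]
    rw [← eD, ← map_mul, leg_list_inverse (fun _ => dyS_mul_dyT _ _), map_one]
  · simp only [← map_hatT]
    rw [plusOp, matSer_plusPart, map_mul, eH]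
  · simp only [← map_dyT]
    rw [minusOp, matSer_minusPart hc, map_mul, eD]
  · simp only [← map_hatT]
    rw [← eH]
    exact stable_map hH (hatT_stable hs1 hs)
  · exact stable_map hH (hatS_stable hs1 hs)
  · simp only [← map_dyT]
    rw [← eD]
    exact stable_map hD (dyT_stable hs1 hs)
  · exact stable_map hD (dyS_stable hs1 hs)

theorem mul_eq_one_map {A B : Type*} [Ring A] [Ring B] (Φ : A →+* B)
    {X Y : Mat[N] A} (h : X * Y = 1) : X.map Φ * Y.map Φ = 1 := by
  rw [← Matrix.map_mul, h]
  exact Matrix.map_one _ (map_zero _) (map_one _)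

/-- The coefficients of `T⁺(u) T⁺(-u)⁻¹` commute with the partial sums of the trace. -/
theorem hatB_traceOp_comm (hN : N ≠ 0) (hc : 2 * c = -(N : ℂ)) (hs1 : s * s = 1)
    (hs : ∀ i j : Fin n, i ≠ j → ((χ (Equiv.swap i j) : ℤˣ) : ℤ) = s)
    (r : ℕ) (i j : Fin N) (k : ℤ) (w : DY N c ⧸ DY.nbhd N c p m) {L : ℕ}
    (hL : ∀ l, L ≤ l → ∀ a b, coeff l (minusOp N n c p m s a b) w = 0)
    (hL' : ∀ l, L ≤ l → ∀ a b, coeff l (minusOp N n c p m s a b)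
      (nbhdAct N c p m (coeff r (hatB N c i j)) w) = 0) :
    nbhdAct N c p m (coeff r (hatB N c i j)) (∑ l ∈ Finset.range L,
        traceOp χ (plusOp N n c p m s) (minusOp N n c p m s) k l w) =
      ∑ l ∈ Finset.range L, traceOp χ (plusOp N n c p m s) (minusOp N n c p m s) k l
        (nbhdAct N c p m (coeff r (hatB N c i j)) w) := by
  have hW : algebraMap Scal (Op (DY N c ⧸ DY.nbhd N c p m)) hh ^ m = 0 := nbhd_pow p m
  have hx : Sat c (nbhdGen N c p m) := sat_genOp _
  let V := DY N c ⧸ DY.nbhd N c p m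
  have hm1 : algebraMap Scal (LaurentSeries (Op V)) hh ^ m = 0 :=
    algebraMap_pow_of_map (B' := LaurentSeries (Op V)) iotaP iotaP_algebraMap
      (algebraMap_series_pow hW)
  have zP := zetaData_series (u := projP V (uR V)) hm1 (single_comm 1) (isUnit_uR.map (projP V))
  have zQ := zetaData_series (u := LocFin.val V (projQ V (uR V))) hm1 (single_comm (-1))
    (isUnit_uR.map ((LocFin.val V).comp (projQ V)))
  have e : (tpAt hW (nbhdGen N c p m) 1 0 *
      (hatS N c (-1) 0).map (PowerSeries.map (nbhdAct N c p m)) : Matrix _ _ _) =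
      (hatB N c).map (PowerSeries.map (nbhdAct N c p m)) := by
    rw [← map_hatT, ← Matrix.map_mul, hatB]
  have key : coeff r ((tpAt hW (nbhdGen N c p m) 1 0 *
      (hatS N c (-1) 0).map (PowerSeries.map (nbhdAct N c p m)) : Matrix _ _ _) i j) =
      nbhdAct N c p m (coeff r (hatB N c i j)) := by
    rw [e, Matrix.map_apply, coeff_map]
  rw [← key] at hL' ⊢
  refine traceOp_comm hN hc hs1 hs (t' := tpAt hW (nbhdGen N c p m) (-1) 0)
    (P := 1) (Q := X) (b := 0) (b' := 0) (δ := 0) ?_ ?_ (by ring) (map_one _) (map_X _)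
    (map_one _) (map_X _)
    (zetaData_series (opRing_pow hW) uR_comm isUnit_uR) zP zQ ?_ ?_ ?_ r i j k w hL hL'
  · rw [← map_hatT]
    exact mul_eq_one_map _ (hatT_mul_hatS _ _)
  · rw [← map_hatT]
    exact mul_eq_one_map _ (hatS_mul_hatT _ _)
  · rw [map_one, map_X]
    exact zetaData_series (algebraMap_pow_of_map (projU _) projU_algebraMap (opRing_pow hW))
      projU_uR_comm (isUnit_uR.map (projU _))
  · refine ⟨fun ε' h' α => ?_, fun ε' h' α => ?_⟩
    · refine (auxRel_tp_tp hx hW pType_iota zP h' (ε := 1) (by norm_num) α 0).congr ?_ ?_ <;>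
        congr 1 <;> ring
    · refine (auxRel_tp_tp hx hW pType_iota zP h' (ε := -1) (by norm_num) α 0).congr ?_ ?_ <;>
        congr 1 <;> ring
  · refine ⟨fun ε' h' α => ?_, fun ε' h' α => ?_⟩
    · refine (auxRel_t_tp hx hW qType_iota zQ h' (ε := 1) (by norm_num) α 0).congr ?_ ?_ <;>
        congr 1 <;> ring
    · refine (auxRel_t_tp hx hW qType_iota zQ h' (ε := -1) (by norm_num) α 0).congr ?_ ?_ <;>
        congr 1 <;> ring

/-- The coefficients of `T(u + hc) T(-u)⁻¹` commute with the partial sums of the trace. -/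
theorem dyB_traceOp_comm (hN : N ≠ 0) (hc : 2 * c = -(N : ℂ)) (hs1 : s * s = 1)
    (hs : ∀ i j : Fin n, i ≠ j → ((χ (Equiv.swap i j) : ℤˣ) : ℤ) = s)
    (r : ℕ) (i j : Fin N) (k : ℤ) (w : DY N c ⧸ DY.nbhd N c p m) {L : ℕ}
    (hL : ∀ l, L ≤ l → ∀ a b, coeff l (minusOp N n c p m s a b) w = 0)
    (hL' : ∀ l, L ≤ l → ∀ a b, coeff l (minusOp N n c p m s a b)
      (nbhdOp N c p m (coeff r (dyB N c i j)) w) = 0) :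
    nbhdOp N c p m (coeff r (dyB N c i j)) (∑ l ∈ Finset.range L,
        traceOp χ (plusOp N n c p m s) (minusOp N n c p m s) k l w) =
      ∑ l ∈ Finset.range L, traceOp χ (plusOp N n c p m s) (minusOp N n c p m s) k l
        (nbhdOp N c p m (coeff r (dyB N c i j)) w) := by
  have hW : algebraMap Scal (Op (DY N c ⧸ DY.nbhd N c p m)) hh ^ m = 0 := nbhd_pow p m
  have hx : Sat c (nbhdGen N c p m) := sat_genOp _
  let V := DY N c ⧸ DY.nbhd N c p m
  have zP := zetaData_series_inv (u := projP V (uR V)) (single_comm 1)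
  have zQ := zetaData_series_inv (u := LocFin.val V (projQ V (uR V))) (single_comm (-1))
  have e : (tAt (nbhdGen N c p m) 1 c *
      (dyS N c (-1) 0).map (PowerSeries.map (nbhdOp N c p m)) : Matrix _ _ _) =
      (dyB N c).map (PowerSeries.map (nbhdOp N c p m)) := by
    rw [← map_dyT, ← Matrix.map_mul, dyB]
  have key : coeff r ((tAt (nbhdGen N c p m) 1 c *
      (dyS N c (-1) 0).map (PowerSeries.map (nbhdOp N c p m)) : Matrix _ _ _) i j) =
      nbhdOp N c p m (coeff r (dyB N c i j)) := by
    rw [e, Matrix.map_apply, coeff_map]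
  rw [← key] at hL' ⊢
  refine traceOp_comm hN hc hs1 hs (t' := tAt (nbhdGen N c p m) (-1) 0)
    (P := X) (Q := 1) (b := c) (b' := 0) (δ := -c / 2) ?_ ?_ (by ring) (map_X _) (map_one _)
    (map_X _) (map_one _) (zetaData_series_inv uR_comm) zP zQ ?_ ?_ ?_ r i j k w hL hL'
  · rw [← map_dyT]
    exact mul_eq_one_map _ (dyT_mul_dyS _ _)
  · rw [← map_dyT]
    exact mul_eq_one_map _ (dyS_mul_dyT _ _)
  · rw [map_one, map_X]
    exact zetaData_series_inv projU_uR_comm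
  · refine ⟨fun ε' h' α => ?_, fun ε' h' α => ?_⟩
    · refine (auxRel_tp_t hN hx hW pType_iota zP h' (ε := 1) (by norm_num) α c).congr ?_ ?_ <;>
        congr 1 <;> ring
    · refine (auxRel_tp_t hN hx hW pType_iota zP h' (ε := -1) (by norm_num) α 0).congr ?_ ?_ <;>
        congr 1 <;> ring
  · refine ⟨fun ε' h' α => ?_, fun ε' h' α => ?_⟩
    · refine (auxRel_t_t hx qType_iota zQ h' (ε := 1) (by norm_num) α c).congr ?_ ?_ <;>
        congr 1 <;> ring
    · refine (auxRel_t_t hx qType_iota zQ h' (ε := -1) (by norm_num) α 0).congr ?_ ?_ <;>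
        congr 1 <;> ring

/-- An element `v` commutes with a convergent sum of elements `f l` if its action on every quotient by
a neighbourhood of zero commutes with the large partial sums. -/
theorem commute_of_partial_sums {f : ℕ → HatDY N c} {z : TildeDY N c}
    (h : HasSum (fun l => hatToTilde N c (f l)) z) {v : HatDY N c}
    (hv : ∀ (p m : ℕ) (w : DY N c ⧸ DY.nbhd N c p m), ∃ L₀, ∀ L, L₀ ≤ L →
      nbhdAct N c p m v (∑ l ∈ Finset.range L, nbhdAct N c p m (f l) w) =
        ∑ l ∈ Finset.range L, nbhdAct N c p m (f l) (nbhdAct N c p m v w)) :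
    hatToTilde N c v * z = z * hatToTilde N c v := by
  rw [← sub_eq_zero]
  refine eq_zero_of_tildeEval fun x p m => ?_
  rw [map_sub, sub_eq_zero]
  obtain ⟨L₁, h1⟩ := exists_tildeEval_eq_sum (h.mul_left (hatToTilde N c v)) x p m
  obtain ⟨L₂, h2⟩ := exists_tildeEval_eq_sum (h.mul_right (hatToTilde N c v)) x p m
  obtain ⟨L₀, h0⟩ := hv p m ((DY.nbhd N c p m).mkQ x)
  have key := h0 (L₀ + L₁ + L₂) (by omega)
  rw [h1 (L₀ + L₁ + L₂) (by omega), h2 (L₀ + L₁ + L₂) (by omega)]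
  simp only [tildeEval_mul, tildeEval_hatToTilde]
  rw [← map_sum]
  exact key

variable {M : ℕ} {g : ℤ}

/-- The coefficients of the trace belong to the centre of the completed reflection algebra. -/
theorem exists_hasSum_center (hN : N ≠ 0) (hc : 2 * c = -(N : ℂ)) (hs1 : s * s = 1)
    (hs : ∀ i j : Fin n, i ≠ j → ((χ (Equiv.swap i j) : ℤˣ) : ℤ) = s)
    (hg : g * g = 1) (hG : ∀ (A : Type) [Ring A], gMat N M A = g • 1) (k : ℤ) :
    ∃ z ∈ Subalgebra.center Scal (aTilde N c M),
      HasSum (traceTerm N c n (isoProj N n χ _) s k) (z : TildeDY N c) := by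
  have e : traceTerm N c n (isoProj N n χ _) s k =
      fun l => hatToTilde N c (hatTerm N n c χ s k l) :=
    funext fun l => (hatToTilde_hatTerm (s : ℂ) k l).symm
  obtain ⟨z, hz⟩ := summable_hatTerm (n := n) (χ := χ) hc (s : ℂ) k
  have hmem : z ∈ aTilde N c M := by
    refine (Subalgebra.isClosed_topologicalClosure _).mem_of_tendsto hz
      (Filter.Eventually.of_forall fun S => ?_)
    exact sum_mem fun l _ => hatToTilde_mem_aTilde (hatTerm_mem hc hs1 hs hg hG k l)
  have hp : ∀ r i j, hatToTilde N c (coeff r (hatB N c i j)) * z =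
      z * hatToTilde N c (coeff r (hatB N c i j)) := fun r i j => by
    refine commute_of_partial_sums hz fun p m w => ?_
    obtain ⟨L₁, h1⟩ := exists_minusOp_eq_zero (n := n) hc p m (s : ℂ) w
    obtain ⟨L₂, h2⟩ := exists_minusOp_eq_zero (n := n) hc p m (s : ℂ)
      (nbhdAct N c p m (coeff r (hatB N c i j)) w)
    refine ⟨L₁ + L₂, fun L hL => ?_⟩
    simp only [nbhdAct_hatTerm]
    exact hatB_traceOp_comm hN hc hs1 hs r i j k w (fun l hl => h1 l (by omega))
      (fun l hl => h2 l (by omega))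
  have hm : ∀ r i j, toTilde N c (coeff r (dyB N c i j)) * z =
      z * toTilde N c (coeff r (dyB N c i j)) := fun r i j => by
    rw [← hatToTilde_toHat]
    refine commute_of_partial_sums hz fun p m w => ?_
    have ea : nbhdAct N c p m (toHat N c (coeff r (dyB N c i j))) =
        nbhdOp N c p m (coeff r (dyB N c i j)) := hatAct_toHat _ _ _
    obtain ⟨L₁, h1⟩ := exists_minusOp_eq_zero (n := n) hc p m (s : ℂ) w
    obtain ⟨L₂, h2⟩ := exists_minusOp_eq_zero (n := n) hc p m (s : ℂ)
      (nbhdOp N c p m (coeff r (dyB N c i j)) w)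
    refine ⟨L₁ + L₂, fun L hL => ?_⟩
    simp only [nbhdAct_hatTerm, ea]
    exact dyB_traceOp_comm hN hc hs1 hs r i j k w (fun l hl => h1 l (by omega))
      (fun l hl => h2 l (by omega))
  refine ⟨⟨z, hmem⟩, Subalgebra.mem_center_iff.2 fun y => Subtype.ext ?_, ?_⟩
  · exact commute_aTilde hG hp hm y.2
  · rw [e]
    exact hz

end TraceComm

end Reflection

end

theorem corollary3p3 (N : ℕ) (hN : 2 ≤ N) (M : ℕ) (hM : M ≤ N)
    (hG : Reflection.gMat N M ℂ = 1 ∨ Reflection.gMat N M ℂ = -1) (n : ℕ) (k : ℤ) :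
    (∃ z ∈ Subalgebra.center Reflection.Scal (Reflection.aTilde N (-(N : ℂ) / 2) M),
      Reflection.IsCoeffRow N (-(N : ℂ) / 2) n k (z : Reflection.TildeDY N (-(N : ℂ) / 2))) ∧
    (∃ z ∈ Subalgebra.center Reflection.Scal (Reflection.aTilde N (-(N : ℂ) / 2) M),
      Reflection.IsCoeffCol N (-(N : ℂ) / 2) n k (z : Reflection.TildeDY N (-(N : ℂ) / 2))) := by
  have hc : 2 * (-(N : ℂ) / 2) = -(N : ℂ) := by ring
  have hN0 : N ≠ 0 := by omega
  obtain ⟨g, hg, hG⟩ := Reflection.gMat_eq hG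
  constructor
  · obtain ⟨z, hz, h⟩ := Reflection.exists_hasSum_center (n := n) (χ := 1) (s := 1) hN0 hc
      (by norm_num) (fun _ _ _ => by simp) hg hG k
    refine ⟨z, hz, ?_⟩
    rw [Reflection.IsCoeffRow, Reflection.symm_eq_isoProj]
    simpa only [Int.cast_one] using h
  · obtain ⟨z, hz, h⟩ := Reflection.exists_hasSum_center (n := n) (χ := Equiv.Perm.sign) (s := -1)
      hN0 hc (by norm_num) (fun i j hij => by simp [Equiv.Perm.sign_swap hij]) hg hG k
    refine ⟨z, hz, ?_⟩
    rw [Reflection.IsCoeffCol, Reflection.antisymm_eq_isoProj]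
    simpa only [Int.cast_neg, Int.cast_one] using h
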